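/- For $N\ge 1$ let $\mathbb{GT}_N$ be the set of integer $N$-tuples $\lambda_1\ge\dots\ge\lambda_N$, and for $\lambda\in\mathbb{GT}_N$ let $s_\lambda(x_1,\dots,x_N)$ be the Schur (Laurent) polynomial. For a probability measure $\tau$ on $\mathbb{GT}_N$ its Schur generating function is $$S_\tau(x_1,\dots,x_N)=\sum_{\lambda\in\mathbb{GT}_N}\tau(\lambda)\,\frac{s_\lambda(x_1,\dots,x_N)}{s_\lambda(1^N)},\qquad 1^N=(1,\dots,1),$$ and $\tau$ is called smooth if $\sum_\lambda\tau(\lambda)\,r^{|\lambda_1|+\dots+|\lambda_N|}<\infty$ for some $r>1$. For each $N=1,2,\dots$ let $\rho_N$ be a smooth probability measure on $\mathbb{GT}_N$, let $\lambda$ be $\rho_N$-distributed, and put $$p_k^N=\sum_{i=1}^N\Bigl(\frac{\lambda_i+N-i}{N}\Bigr)^k,\qquad k=1,2,\dots.$$ For $k_1,\dots,k_r\ge 1$ let $$\kappa_{k_1,\dots,k_r}=\sum_{\{U_1,\dots,U_t\}}(-1)^{t-1}(t-1)!\prod_{i=1}^t\mathbb E\Bigl[\prod_{j\in U_i}p^N_{k_j}\Bigr]$$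 be the joint cumulant, where the sum is over all partitions of $\{1,\dots,r\}$ into non-empty disjoint sets. The measures $\rho_N$ *satisfy a CLT* if there are real numbers $\mathfrak p(k)$, $\mathfrak{cov}(k,m)$, $k,m\ge1$, such that (A) $\lim_{N\to\infty}\frac1N\mathbb E[p_k^N]=\mathfrak p(k)$ for all $k\ge 1$; (B) $\lim_{N\to\infty}\bigl(\mathbb E[p_k^Np_m^N]-\mathbb E[p_k^N]\,\mathbb E[p_m^N]\bigr)=\mathfrak{cov}(k,m)$ for all $k,m\ge 1$; (C) $\lim_{N\to\infty}\kappa_{k_1,\dots,k_r}=0$ for all $r>2$ and all $k_1,\dots,k_r\ge1$. They are *CLT-appropriate* if there are real numbers $\mathbf c_k$, $\mathbf d_{k,m}$, $k,m\ge 1$, such that (1) $\lim_{N\to\infty}\frac1N\,\partial_{x_i}^k\ln S_{\rho_N}\big|_{1^N}=\mathbf c_k$ for all $i$ and all $k\ge1$; (2) $\lim_{N\to\infty}\partial_{x_i}^k\partial_{x_j}^m\ln S_{\rho_N}\big|_{1^N}=\mathbf d_{k,m}$ for all $i\ne j$ and all $k,m\ge1$; (3) $\lim_{N\to\infty}\partial_{x_{i_1}}\cdots\partial_{x_{i_s}}\ln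 S_{\rho_N}\big|_{1^N}=0$ for all indices $i_1,\dots,i_s$ of which at least three are distinct. **Theorem.** Smooth measures $\rho_N$ satisfy a CLT if and only if they are CLT-appropriate. In this case $\mathfrak p(k)$ and $\mathfrak{cov}(k,m)$ are given by $$\mathfrak p(k)=[z^{-1}]\,\frac{1}{(k+1)(1+z)}\,f(z)^{k+1},$$ $$\mathfrak{cov}(k,m)=[z^{-1}w^{-1}]\,f(z)^k f(w)^m\left(\Bigl(\sum_{a=0}^\infty\frac{z^a}{w^{1+a}}\Bigr)^2+\sum_{a,b=1}^\infty\frac{\mathbf d_{a,b}}{(a-1)!\,(b-1)!}\,z^{a-1}w^{b-1}\right)$$ for all $k,m\ge1$, where $$f(z)=(1+z)\Bigl(\frac1z+\sum_{a=1}^\infty\frac{\mathbf c_a z^{a-1}}{(a-1)!}\Bigr)$$ and $[z^{-1}]$, $[z^{-1}w^{-1}]$ denote coefficients in formal Laurent series. The right-hand sides are polynomials (with rational coefficients) in the numbers $\mathbf c_a$ and $\mathbf d_{a,b}$. -/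

import Mathlib

open Filter Topology

noncomputable section

/-- `GT N`: integer tuples `lam 0 ≥ lam 1 ≥ ⋯ ≥ lam (N-1)` (indices start at `0`). -/
abbrev GT (N : ℕ) : Type := {lam : Fin N → ℤ // Antitone lam}

/-- The Schur (Laurent) polynomial `s_lam(x₁,…,x_N)`, as the sum over Gelfand–Tsetlin patterns
with top row `lam`: one sums over the rows `mu` interlacing with `lam`
(`lam (i+1) ≤ mu i ≤ lam i`), and the last variable carries the exponent `|lam| - |mu|`. -/
def schurPoly : (N : ℕ) → (Fin N → ℤ) → (Fin N → ℂ) → ℂ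
  | 0, _, _ => 1
  | N + 1, lam, x =>
      ∑ mu ∈ Fintype.piFinset fun i : Fin N => Finset.Icc (lam i.succ) (lam i.castSucc),
        schurPoly N mu (fun i => x i.castSucc) * x (Fin.last N) ^ (∑ i, lam i - ∑ i, mu i)

/-- The Schur generating function of a probability measure on `GT N`. -/
def schurGen {N : ℕ} (τ : PMF (GT N)) (x : Fin N → ℂ) : ℂ :=
  ∑' lam : GT N, ((τ lam).toReal : ℂ) * (schurPoly N lam.1 x / schurPoly N lam.1 1)

/-- Smooth probability measures on `GT N`. -/
def IsSmooth {N : ℕ} (τ : PMF (GT N)) : Prop :=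
  ∃ r : ℝ, 1 < r ∧ Summable fun lam : GT N => (τ lam).toReal * r ^ (∑ i, (lam.1 i).natAbs)

/-- The expectation of a random variable on `GT N`. -/
def expect {N : ℕ} (τ : PMF (GT N)) (ξ : GT N → ℝ) : ℝ :=
  ∑' lam : GT N, (τ lam).toReal * ξ lam

/-- The random variable `p_k^N = ∑ᵢ ((lamᵢ + N - i) / N)^k`, the sum over `i = 1, …, N`
(with indices starting at `0`, `N - i` becomes `N - 1 - i`). -/
def powerSum (N : ℕ) (k : ℕ+) (lam : GT N) : ℝ :=
  ∑ i : Fin N, (((lam.1 i : ℝ) + N - 1 - (i : ℕ)) / N) ^ (k : ℕ)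

/-- The joint cumulant `κ_{k₁,…,k_r}` of a family of random variables on `GT N`, `r ≥ 1`. -/
def cumulant {N : ℕ} (τ : PMF (GT N)) (ξ : ℕ+ → GT N → ℝ) {r : ℕ} (k : Fin r → ℕ+) : ℝ :=
  ∑ π : Finpartition (Finset.univ : Finset (Fin r)),
    (-1) ^ (π.parts.card - 1) * ((π.parts.card - 1).factorial : ℝ) *
      ∏ U ∈ π.parts, expect τ fun lam => ∏ j ∈ U, ξ (k j) lam

/-- The measures `ρ N` satisfy a CLT with limiting means `p` and covariances `cov`. -/
structure SatisfiesCLTWith (ρ : (N : ℕ) → PMF (GT N)) (p : ℕ+ → ℝ) (cov : ℕ+ → ℕ+ → ℝ) :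
    Prop where
  mean : ∀ k : ℕ+,
    Tendsto (fun N : ℕ => (1 / (N : ℝ)) * expect (ρ N) (powerSum N k)) atTop (𝓝 (p k))
  covariance : ∀ k m : ℕ+,
    Tendsto (fun N : ℕ => expect (ρ N) (fun lam => powerSum N k lam * powerSum N m lam)
      - expect (ρ N) (powerSum N k) * expect (ρ N) (powerSum N m)) atTop (𝓝 (cov k m))
  higher : ∀ r : ℕ, 2 < r → ∀ k : Fin r → ℕ+,
    Tendsto (fun N : ℕ => cumulant (ρ N) (powerSum N) k) atTop (𝓝 0)

/-- The measures `ρ N` satisfy a CLT as `N → ∞`. -/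
def SatisfiesCLT (ρ : (N : ℕ) → PMF (GT N)) : Prop :=
  ∃ (p : ℕ+ → ℝ) (cov : ℕ+ → ℕ+ → ℝ), SatisfiesCLTWith ρ p cov

/-- The partial derivative `∂/∂xᵢ` of a function of `N` complex variables; the index `i : ℕ` is
fixed while `N` varies, and only `i < N` is meaningful (otherwise the value is `0`). -/
def partialD {N : ℕ} (i : ℕ) (f : (Fin N → ℂ) → ℂ) : (Fin N → ℂ) → ℂ :=
  fun x => lineDeriv ℂ f x (fun j : Fin N => if (j : ℕ) = i then 1 else 0)

/-- `∂/∂x_{i₁} ⋯ ∂/∂x_{i_s} ln S_τ` at `x₁ = ⋯ = x_N = 1`, for the list `[i₁, …, i_s]`.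
Near this point `S_τ` is close to `S_τ(1,…,1) = 1`, so `ln` is the principal branch. -/
def logDerivAtOne {N : ℕ} (τ : PMF (GT N)) (L : List ℕ) : ℂ :=
  L.foldr partialD (fun x => Complex.log (schurGen τ x)) 1

/-- The measures `ρ N` are CLT-appropriate with limiting derivatives `c` and `d`. -/
structure CLTAppropriateWith (ρ : (N : ℕ) → PMF (GT N)) (c : ℕ+ → ℝ) (d : ℕ+ → ℕ+ → ℝ) :
    Prop where
  one : ∀ (i : ℕ) (k : ℕ+),
    Tendsto (fun N : ℕ => (1 / (N : ℂ)) * logDerivAtOne (ρ N) (List.replicate k i))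
      atTop (𝓝 (c k : ℂ))
  two : ∀ i j : ℕ, i ≠ j → ∀ k m : ℕ+,
    Tendsto (fun N : ℕ => logDerivAtOne (ρ N) (List.replicate k i ++ List.replicate m j))
      atTop (𝓝 (d k m : ℂ))
  three : ∀ L : List ℕ, 3 ≤ L.toFinset.card →
    Tendsto (fun N : ℕ => logDerivAtOne (ρ N) L) atTop (𝓝 0)

/-- The measures `ρ N` are CLT-appropriate as `N → ∞`. -/
def CLTAppropriate (ρ : (N : ℕ) → PMF (GT N)) : Prop :=
  ∃ (c : ℕ+ → ℝ) (d : ℕ+ → ℕ+ → ℝ), CLTAppropriateWith ρ c d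

/-- The variable `z` of `K((z))`. -/
def zVar (K : Type*) [Field K] : LaurentSeries K := HahnSeries.single 1 1

/-- `(1 + z) (1/z + ∑_{a ≥ 1} c_a z^{a-1} / (a-1)!)` in `K((z))`. -/
def fSeries {K : Type*} [Field K] (c : ℕ+ → K) : LaurentSeries K :=
  (1 + zVar K) * ((zVar K)⁻¹ +
    HahnSeries.ofPowerSeries ℤ K
      (PowerSeries.mk fun a : ℕ => c a.succPNat / (a.factorial : K)))

/-- `[z⁻¹] (1 / ((k+1)(1+z))) f(z)^{k+1}`. -/
def limitMean (c : ℕ+ → ℝ) (k : ℕ+) : ℝ :=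
  ((((k : ℕ) + 1 : LaurentSeries ℝ) * (1 + zVar ℝ))⁻¹ * fSeries c ^ ((k : ℕ) + 1)).coeff (-1)

/-- `∑_{a ≥ 0} z^a / w^{1+a}` in `ℝ((w))((z))`, i.e. `1/(w-z)` expanded in the region `|z| < |w|`.
The outer Laurent variable is `z`, the inner one is `w`. -/
def geomSeries : LaurentSeries (LaurentSeries ℝ) :=
  HahnSeries.ofPowerSeries ℤ (LaurentSeries ℝ)
    (PowerSeries.mk fun a : ℕ => HahnSeries.single (-(1 + (a : ℤ))) (1 : ℝ))

/-- `∑_{a,b ≥ 1} d_{a,b} z^{a-1} w^{b-1} / ((a-1)! (b-1)!)` in `ℝ((w))((z))`. -/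
def dSeries (d : ℕ+ → ℕ+ → ℝ) : LaurentSeries (LaurentSeries ℝ) :=
  HahnSeries.ofPowerSeries ℤ (LaurentSeries ℝ)
    (PowerSeries.mk fun a : ℕ => HahnSeries.ofPowerSeries ℤ ℝ
      (PowerSeries.mk fun b : ℕ =>
        d a.succPNat b.succPNat / ((a.factorial : ℝ) * (b.factorial : ℝ))))

/-- `[z⁻¹ w⁻¹] f(z)^k f(w)^m ((∑_{a ≥ 0} z^a / w^{1+a})² + ∑_{a,b} d_{a,b} ⋯)`. -/
def limitCov (c : ℕ+ → ℝ) (d : ℕ+ → ℕ+ → ℝ) (k m : ℕ+) : ℝ :=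
  ((fSeries (fun a => (HahnSeries.C (c a) : LaurentSeries ℝ)) ^ (k : ℕ) *
      HahnSeries.C (fSeries c) ^ (m : ℕ) *
      (geomSeries ^ 2 + dSeries d)).coeff (-1)).coeff (-1)

end

/-! Put ε = 1/N and expand S(1+y₁,…,1+y_N) in powers of the y_j. The expansion is symmetric, so it
can be stored in a linear functional E on ℝ[β₁,β₂,…], normalized by E(1) = 1, for which S(1+y) =
E[∏_j exp(N ∑_m β_m y_j^m)] as formal series (`measFunctional`, `expFunctional_prod`). The β_m
behave like random variables, although no positivity of E is used, and ln S is their cumulant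
generating function. By the law of total cumulance a derivative of ln S at 1 is a sum over set
partitions of the differentiations into blocks of a single variable, a partition π contributing
N^|π| times a joint cumulant of the β_|B|, up to factorials (`IsSmooth.logDerivAtOne_list`). The
coarsest such partition dominates. Hence CLT-appropriateness means `VarCLT`: the means of the β_m
converge, N² times their covariances converge, and N^r times their cumulants of order r ≥ 3 tend to
0. The limits are c_m/m! and d_{k,m}/(k! m!).

The random side enters through the operators V⁻¹ ∑_i (1+y_i)^k ∂_i^k/k! V, with V the Vandermonde
product; their eigenvalues at Schur polynomials are ∑_i C(λ_i+N-i, k). Written in the β_m, the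
normalized operator becomes `vertex`: substitute β_m ↦ β_m + O(ε²), multiply by a kernel, extract a
residue. The eigenvalue relation `schurFunctional_vertex` is checked on determinants det(e_{m_j-i}),
with e_n the coefficients of exp(N ∑ β_m y^m). The Schur functional sends them, up to normalization,
to det C(λ_i+N-i, m_j) by Weyl's formula, and they determine a linear map on all products of N of
the e_n (`eq_zero_of_jacobiDet`). Joint moments of the normalized binomial sums are therefore E of
universal polynomials `univMoment`, obtained by applying vertex operators to 1.

The substitution is a ring homomorphism that moves every β_m by a multiple of ε², so the universal
cumulant of r binomial sums is divisible by ε^{2(r-1)} (`dvd_univCum`). Total cumulance and the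
delta method (`CumTendsto.delta`) then give the limits of the rescaled cumulants of the binomial
sums (`CumTendsto.binom`). The mean is a universal polynomial at the limiting means; the covariance
is the linearized covariance of the β_m plus the leading coefficient of the universal cumulant of
two sums, which produces the term (∑ z^a/w^{1+a})²; higher cumulants vanish.

For the converse give β_m the weight m. Binomial cumulants of total index n depend only on cumulants
of the β_m of weight at most n, those of weight n entering linearly. The limiting coefficient matrix
is invertible (`det_transferLimit_ne_zero`), so induction on n recovers `VarCLT`
(`cumTendsto_of_binomCum`). Power sums and binomial sums differ by a triangular change of basis
whose off-diagonal entries are powers of 1/N (`tendsto_kumM_triangular`). The stated formulas result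
from evaluating φ = 1/z + ∑ m β_m z^{m-1} at the limiting means, which turns (1+z)φ into f. -/

set_option linter.unusedSectionVars false

/-! ### Set partitions, joint cumulants and the law of total cumulance. -/

section Cumulants

variable {ι : Type*} [DecidableEq ι]

/-- The set partitions of a finite set. -/
def setParts (I : Finset ι) : Finset (Finset (Finset ι)) :=
  I.powerset.powerset.filter fun π =>
    ∅ ∉ π ∧ (∀ U ∈ π, ∀ V ∈ π, U ≠ V → Disjoint U V) ∧ π.biUnion id = I

theorem mem_setParts {I : Finset ι} {π : Finset (Finset ι)} :
    π ∈ setParts I ↔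
      ∅ ∉ π ∧ (∀ U ∈ π, ∀ V ∈ π, U ≠ V → Disjoint U V) ∧ π.biUnion id = I := by
  unfold setParts
  rw [Finset.mem_filter]
  refine ⟨fun h => h.2, fun h => ⟨?_, h⟩⟩
  rw [Finset.mem_powerset]
  intro U hU
  rw [Finset.mem_powerset, ← h.2.2]
  exact Finset.subset_biUnion_of_mem id hU

theorem subset_of_mem_setParts {I : Finset ι} {π : Finset (Finset ι)} (h : π ∈ setParts I)
    {U : Finset ι} (hU : U ∈ π) : U ⊆ I := by
  rw [← (mem_setParts.1 h).2.2]
  exact Finset.subset_biUnion_of_mem id hU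

theorem nonempty_of_mem_setParts {I : Finset ι} {π : Finset (Finset ι)} (h : π ∈ setParts I)
    {U : Finset ι} (hU : U ∈ π) : U.Nonempty := by
  rw [Finset.nonempty_iff_ne_empty]
  rintro rfl
  exact (mem_setParts.1 h).1 hU

theorem eq_of_mem_setParts {I : Finset ι} {π : Finset (Finset ι)} (h : π ∈ setParts I)
    {U V : Finset ι} (hU : U ∈ π) (hV : V ∈ π) {i : ι} (hiU : i ∈ U) (hiV : i ∈ V) : U = V := by
  by_contra hne
  exact (Finset.disjoint_left.1 ((mem_setParts.1 h).2.1 U hU V hV hne)) hiU hiV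

theorem exists_mem_setParts {I : Finset ι} {π : Finset (Finset ι)} (h : π ∈ setParts I)
    {i : ι} (hi : i ∈ I) : ∃ U ∈ π, i ∈ U := by
  rw [← (mem_setParts.1 h).2.2] at hi
  simpa using hi

theorem setParts_of_subset {I : Finset ι} {π D : Finset (Finset ι)} (h : π ∈ setParts I)
    (hD : D ⊆ π) : D ∈ setParts (D.biUnion id) := by
  rw [mem_setParts]
  exact ⟨fun h0 => (mem_setParts.1 h).1 (hD h0),
    fun U hU V hV => (mem_setParts.1 h).2.1 U (hD hU) V (hD hV), rfl⟩

theorem biUnion_sdiff_setParts {I : Finset ι} {π D : Finset (Finset ι)} (h : π ∈ setParts I)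
    (hD : D ⊆ π) : (π \ D).biUnion id = I \ D.biUnion id := by
  ext i
  simp only [Finset.mem_biUnion, Finset.mem_sdiff, id]
  constructor
  · rintro ⟨U, ⟨hU, hUD⟩, hi⟩
    refine ⟨subset_of_mem_setParts h hU hi, ?_⟩
    rintro ⟨V, hV, hiV⟩
    exact hUD (eq_of_mem_setParts h hU (hD hV) hi hiV ▸ hV)
  · rintro ⟨hi, hn⟩
    obtain ⟨U, hU, hiU⟩ := exists_mem_setParts h hi
    exact ⟨U, ⟨hU, fun hUD => hn ⟨U, hUD, hiU⟩⟩, hiU⟩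

theorem union_mem_setParts {I B : Finset ι} (hB : B ⊆ I) {π₁ π₂ : Finset (Finset ι)}
    (h₁ : π₁ ∈ setParts B) (h₂ : π₂ ∈ setParts (I \ B)) : π₁ ∪ π₂ ∈ setParts I := by
  have hd : ∀ U ∈ π₁, ∀ V ∈ π₂, Disjoint U V := fun U hU V hV =>
    Finset.disjoint_of_subset_left (subset_of_mem_setParts h₁ hU)
      (Finset.disjoint_of_subset_right (subset_of_mem_setParts h₂ hV) Finset.disjoint_sdiff)
  rw [mem_setParts]
  refine ⟨?_, ?_, ?_⟩
  · rw [Finset.mem_union]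
    exact fun h => h.elim (mem_setParts.1 h₁).1 (mem_setParts.1 h₂).1
  · intro U hU V hV hne
    rcases Finset.mem_union.1 hU with hU | hU <;> rcases Finset.mem_union.1 hV with hV | hV
    · exact (mem_setParts.1 h₁).2.1 U hU V hV hne
    · exact hd U hU V hV
    · exact (hd V hV U hU).symm
    · exact (mem_setParts.1 h₂).2.1 U hU V hV hne
  · rw [Finset.union_biUnion, (mem_setParts.1 h₁).2.2, (mem_setParts.1 h₂).2.2,
      Finset.union_sdiff_of_subset hB]

theorem disjoint_setParts {I B : Finset ι} {π₁ π₂ : Finset (Finset ι)}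
    (h₁ : π₁ ∈ setParts B) (h₂ : π₂ ∈ setParts (I \ B)) : Disjoint π₁ π₂ := by
  rw [Finset.disjoint_left]
  intro U hU hU'
  obtain ⟨i, hi⟩ := nonempty_of_mem_setParts h₁ hU
  exact (Finset.mem_sdiff.1 (subset_of_mem_setParts h₂ hU' hi)).2 (subset_of_mem_setParts h₁ hU hi)

/-- Splitting a set partition into two families of blocks amounts to splitting the underlying set
and partitioning both halves. -/
theorem sum_setParts_split {R : Type*} [AddCommMonoid R] (I : Finset ι)
    (F : Finset (Finset ι) → Finset (Finset ι) → R) :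
    ∑ π ∈ setParts I, ∑ D ∈ π.powerset, F D (π \ D) =
      ∑ B ∈ I.powerset, ∑ π₁ ∈ setParts B, ∑ π₂ ∈ setParts (I \ B), F π₁ π₂ := by
  simp_rw [Finset.sum_sigma']
  refine Finset.sum_bij' (fun x _ => ⟨x.2.biUnion id, x.2, x.1 \ x.2⟩)
    (fun y _ => ⟨y.2.1 ∪ y.2.2, y.2.1⟩) ?_ ?_ ?_ ?_ ?_
  · rintro ⟨π, D⟩ h
    simp only [Finset.mem_sigma, Finset.mem_powerset] at h ⊢
    refine ⟨?_, setParts_of_subset h.1 h.2, ?_⟩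
    · rw [← (mem_setParts.1 h.1).2.2]
      exact Finset.biUnion_subset_biUnion_of_subset_left id h.2
    · rw [← biUnion_sdiff_setParts h.1 h.2]
      exact setParts_of_subset h.1 Finset.sdiff_subset
  · rintro ⟨B, π₁, π₂⟩ h
    simp only [Finset.mem_sigma, Finset.mem_powerset] at h ⊢
    exact ⟨union_mem_setParts h.1 h.2.1 h.2.2, Finset.subset_union_left⟩
  · rintro ⟨π, D⟩ h
    simp only [Finset.mem_sigma, Finset.mem_powerset] at h ⊢
    simp [Finset.union_sdiff_of_subset h.2]
  · rintro ⟨B, π₁, π₂⟩ h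
    simp only [Finset.mem_sigma, Finset.mem_powerset] at h ⊢
    have := (mem_setParts.1 h.2.1).2.2
    subst this
    have hd := disjoint_setParts h.2.1 h.2.2
    simp [Finset.union_sdiff_cancel_left hd]
  · rintro ⟨π, D⟩ h
    rfl

theorem setParts_empty : setParts (∅ : Finset ι) = {∅} := by
  ext π
  rw [mem_setParts, Finset.mem_singleton]
  constructor
  · rintro ⟨h0, -, h⟩
    rw [Finset.eq_empty_iff_forall_notMem]
    intro U hU
    have : U = ∅ := Finset.subset_empty.1 (h ▸ Finset.subset_biUnion_of_mem id hU)
    exact h0 (this ▸ hU)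
  · rintro rfl
    simp

theorem singleton_mem_setParts {I : Finset ι} (hI : I.Nonempty) : {I} ∈ setParts I := by
  rw [mem_setParts]
  refine ⟨?_, ?_, by simp⟩
  · simpa using hI.ne_empty.symm
  · simp

theorem eq_singleton_of_mem_setParts {I : Finset ι} {π : Finset (Finset ι)} (h : π ∈ setParts I)
    (hI : I.Nonempty) (hc : π.card ≤ 1) : π = {I} := by
  obtain ⟨i, hi⟩ := hI
  obtain ⟨U, hU, hiU⟩ := exists_mem_setParts h hi
  have h1 : π.card = 1 := le_antisymm hc (Finset.card_pos.2 ⟨U, hU⟩)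
  obtain ⟨V, rfl⟩ := Finset.card_eq_one.1 h1
  have := (mem_setParts.1 h).2.2
  simp at this
  rw [this]

theorem card_pos_of_mem_setParts {I : Finset ι} {π : Finset (Finset ι)} (h : π ∈ setParts I)
    (hI : I.Nonempty) : 0 < π.card := by
  obtain ⟨i, hi⟩ := hI
  obtain ⟨U, hU, -⟩ := exists_mem_setParts h hi
  exact Finset.card_pos.2 ⟨U, hU⟩

theorem sum_card_of_mem_setParts {I : Finset ι} {π : Finset (Finset ι)} (h : π ∈ setParts I)
    {M : Type*} [AddCommMonoid M] (f : ι → M) : ∑ U ∈ π, ∑ i ∈ U, f i = ∑ i ∈ I, f i := by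
  rw [← (mem_setParts.1 h).2.2, Finset.sum_biUnion]
  · rfl
  · intro U hU V hV hne
    exact (mem_setParts.1 h).2.1 U hU V hV hne

variable {R : Type*} [CommRing R]

/-- The joint cumulant attached to the moments `M`, by Möbius inversion. -/
def cum (M : Finset ι → R) (I : Finset ι) : R :=
  ∑ π ∈ setParts I, (-1) ^ (π.card - 1) * ((π.card - 1).factorial : R) * ∏ U ∈ π, M U

theorem sum_setParts_card_le_one (M : Finset ι → R) (h0 : M ∅ = 1) (J : Finset ι) :
    ∑ π ∈ setParts J, (if π.card ≤ 1 then ∏ U ∈ π, M U else 0) = M J := by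
  rcases J.eq_empty_or_nonempty with rfl | hJ
  · simp [setParts_empty, h0]
  · rw [Finset.sum_eq_single_of_mem {J} (singleton_mem_setParts hJ)]
    · simp
    · intro π hπ hne
      rw [if_neg]
      exact fun hc => hne (eq_singleton_of_mem_setParts hπ hJ hc)

/-- Read M(I \ B) as a partition with at most one block and regroup by the resulting partition π of
I. If π has t blocks, it arises from itself and from deleting any one of the t-1 blocks that avoid
i, and (-1)^{t-1}(t-1)! + (t-1)(-1)^{t-2}(t-2)! vanishes unless t = 1. -/
theorem cum_rec (M : Finset ι → R) (h0 : M ∅ = 1) {I : Finset ι} {i : ι} (hi : i ∈ I) :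
    M I = ∑ B ∈ I.powerset with i ∈ B, cum M B * M (I \ B) := by
  set μ : ℕ → R := fun t => (-1) ^ (t - 1) * ((t - 1).factorial : R) with hμ
  have key := sum_setParts_split (R := R) I (fun D E =>
    (if i ∈ D.biUnion id then μ D.card * ∏ U ∈ D, M U else 0) *
      (if E.card ≤ 1 then ∏ U ∈ E, M U else 0))
  have hR : ∑ B ∈ I.powerset with i ∈ B, cum M B * M (I \ B) =
      ∑ B ∈ I.powerset, ∑ π₁ ∈ setParts B, ∑ π₂ ∈ setParts (I \ B),
      (if i ∈ π₁.biUnion id then μ π₁.card * ∏ U ∈ π₁, M U else 0) *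
      (if π₂.card ≤ 1 then ∏ U ∈ π₂, M U else 0) := by
    rw [Finset.sum_filter]
    refine Finset.sum_congr rfl fun B hB => ?_
    rw [← Finset.sum_mul_sum, sum_setParts_card_le_one M h0]
    split_ifs with hiB
    · congr 1
      refine Finset.sum_congr rfl fun π hπ => ?_
      rw [(mem_setParts.1 hπ).2.2, if_pos hiB]
    · symm
      convert zero_mul _
      refine Finset.sum_eq_zero fun π hπ => ?_
      rw [(mem_setParts.1 hπ).2.2, if_neg hiB]
  rw [hR, ← key, ← sum_setParts_card_le_one M h0 I]
  refine Finset.sum_congr rfl fun π hπ => ?_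
  obtain ⟨C, hC, hiC⟩ := exists_mem_setParts hπ hi
  have hmem : ∀ D ⊆ π, (i ∈ D.biUnion id ↔ C ∈ D) := by
    intro D hD
    simp only [Finset.mem_biUnion, id]
    exact ⟨fun ⟨V, hV, hiV⟩ => eq_of_mem_setParts hπ hC (hD hV) hiC hiV ▸ hV,
      fun h => ⟨C, h, hiC⟩⟩
  have hsub : insert π ((π.erase C).image fun E => π.erase E) ⊆ π.powerset := by
    intro D hD
    rw [Finset.mem_insert, Finset.mem_image] at hD
    rw [Finset.mem_powerset]
    rcases hD with rfl | ⟨E, -, rfl⟩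
    · exact subset_rfl
    · exact Finset.erase_subset _ _
  rw [← Finset.sum_subset hsub, Finset.sum_insert, Finset.sum_image]
  · rw [if_pos ((hmem π subset_rfl).2 hC)]
    have h1 : ∀ E ∈ π.erase C,
        (if i ∈ (π.erase E).biUnion id then μ (π.erase E).card * ∏ U ∈ π.erase E, M U else 0) *
        (if (π \ π.erase E).card ≤ 1 then ∏ U ∈ π \ π.erase E, M U else 0) =
        μ (π.card - 1) * ∏ U ∈ π, M U := by
      intro E hE
      have hEπ := Finset.mem_of_mem_erase hE
      have hs : π \ π.erase E = {E} := by
        rw [Finset.sdiff_erase_self hEπ]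
      rw [if_pos ((hmem _ (Finset.erase_subset _ _)).2
        (Finset.mem_erase.2 ⟨(Finset.ne_of_mem_erase hE).symm, hC⟩)), hs,
        Finset.card_erase_of_mem hEπ]
      simp only [Finset.card_singleton, le_refl, if_true, Finset.prod_singleton]
      rw [mul_assoc, Finset.prod_erase_mul _ _ hEπ]
    rw [Finset.sum_congr rfl h1, Finset.sum_const, Finset.card_erase_of_mem hC]
    have hpos : 0 < π.card := Finset.card_pos.2 ⟨C, hC⟩
    obtain ⟨t, ht⟩ : ∃ t, π.card = t + 1 := ⟨π.card - 1, by omega⟩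
    rw [ht]
    rcases t with _ | t
    · simp [hμ]
    · rw [if_neg (by omega)]
      simp only [hμ, Finset.sdiff_self, Finset.card_empty, zero_le, if_true, Finset.prod_empty,
        Nat.add_sub_cancel, nsmul_eq_mul, Nat.factorial_succ]
      push_cast
      ring
  · intro E hE F hF h
    by_contra hne
    have : E ∈ π.erase F := Finset.mem_erase.2 ⟨hne, Finset.mem_of_mem_erase hE⟩
    exact Finset.notMem_erase E π ((show π.erase E = π.erase F from h).symm ▸ this)
  · rw [Finset.mem_image]
    rintro ⟨E, hE, h⟩
    have := Finset.mem_of_mem_erase hE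
    rw [← h] at this
    exact Finset.notMem_erase E π this
  · intro D hD hD'
    rw [Finset.mem_powerset] at hD
    by_cases hCD : C ∈ D
    · rw [if_neg (fun hc : (π \ D).card ≤ 1 => ?_), mul_zero]
      apply hD'
      rw [Finset.mem_insert, Finset.mem_image]
      rcases Nat.le_one_iff_eq_zero_or_eq_one.1 hc with hc | hc
      · left
        rw [Finset.card_eq_zero, Finset.sdiff_eq_empty_iff_subset] at hc
        exact subset_antisymm hD hc
      · right
        obtain ⟨E, hE⟩ := Finset.card_eq_one.1 hc
        have hEm : E ∈ π \ D := hE ▸ Finset.mem_singleton_self E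
        refine ⟨E, Finset.mem_erase.2 ⟨?_, (Finset.mem_sdiff.1 hEm).1⟩, ?_⟩
        · rintro rfl
          exact (Finset.mem_sdiff.1 hEm).2 hCD
        · rw [← Finset.sdiff_singleton_eq_erase, ← hE, Finset.sdiff_sdiff_eq_self hD]
    · rw [if_neg (fun h => hCD ((hmem D hD).1 h)), zero_mul]

/-- The term B = I of the recursion is K I itself because M ∅ = 1, so the recursion solves for K by
induction. The pivot may depend on I. -/
theorem cum_unique (M K : Finset ι → R) (h0 : M ∅ = 1)
    (h : ∀ I : Finset ι, I.Nonempty → ∃ i ∈ I,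
      M I = ∑ B ∈ I.powerset with i ∈ B, K B * M (I \ B)) :
    ∀ I : Finset ι, I.Nonempty → K I = cum M I := by
  intro I
  induction I using Finset.strongInduction with
  | H I ih =>
    intro hI
    obtain ⟨i, hi, hK⟩ := h I hI
    have hC := cum_rec M h0 hi
    have hmem : I ∈ I.powerset.filter (i ∈ ·) := by simp [hi]
    rw [← Finset.add_sum_erase _ _ hmem] at hK hC
    have : ∑ B ∈ (I.powerset.filter (i ∈ ·)).erase I, K B * M (I \ B) =
        ∑ B ∈ (I.powerset.filter (i ∈ ·)).erase I, cum M B * M (I \ B) := by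
      refine Finset.sum_congr rfl fun B hB => ?_
      simp only [Finset.mem_erase, Finset.mem_filter, Finset.mem_powerset] at hB
      rw [ih B (Finset.ssubset_iff_subset_ne.2 ⟨hB.2.1, hB.1⟩) ⟨i, hB.2.2⟩]
    rw [this] at hK
    simp only [Finset.sdiff_self, h0, mul_one] at hK hC
    have := hK.symm.trans hC
    exact add_right_cancel this

/-- Moments in terms of a family `X` of cumulants. -/
def expMoment (X : Finset ι → R) (I : Finset ι) : R :=
  ∑ π ∈ setParts I, ∏ U ∈ π, X U

@[simp] theorem expMoment_empty (X : Finset ι → R) : expMoment X ∅ = 1 := by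
  simp [expMoment, setParts_empty]

theorem expMoment_rec (X : Finset ι → R) {I : Finset ι} {i : ι} (hi : i ∈ I) :
    expMoment X I = ∑ B ∈ I.powerset with i ∈ B, X B * expMoment X (I \ B) := by
  have key := sum_setParts_split (R := R) I (fun D E =>
    (if i ∈ D.biUnion id ∧ D.card ≤ 1 then ∏ U ∈ D, X U else 0) * ∏ U ∈ E, X U)
  have hR : ∑ B ∈ I.powerset with i ∈ B, X B * expMoment X (I \ B) =
      ∑ B ∈ I.powerset, ∑ π₁ ∈ setParts B, ∑ π₂ ∈ setParts (I \ B),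
      (if i ∈ π₁.biUnion id ∧ π₁.card ≤ 1 then ∏ U ∈ π₁, X U else 0) * ∏ U ∈ π₂, X U := by
    rw [Finset.sum_filter]
    refine Finset.sum_congr rfl fun B hB => ?_
    rw [← Finset.sum_mul_sum]
    split_ifs with hiB
    · congr 1
      rw [Finset.sum_eq_single_of_mem {B} (singleton_mem_setParts ⟨i, hiB⟩)]
      · simp [hiB]
      · intro π hπ hne
        rw [if_neg]
        exact fun hc => hne (eq_singleton_of_mem_setParts hπ ⟨i, hiB⟩ hc.2)
    · symm
      convert zero_mul _
      refine Finset.sum_eq_zero fun π hπ => ?_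
      rw [(mem_setParts.1 hπ).2.2, if_neg (fun h => hiB h.1)]
  rw [hR, ← key]
  refine Finset.sum_congr rfl fun π hπ => ?_
  obtain ⟨C, hC, hiC⟩ := exists_mem_setParts hπ hi
  rw [Finset.sum_eq_single_of_mem {C} (by simpa using hC)]
  · simp only [Finset.singleton_biUnion, id, hiC, Finset.card_singleton, le_refl, and_self, if_true,
      Finset.prod_singleton]
    rw [Finset.sdiff_singleton_eq_erase, Finset.mul_prod_erase _ _ hC]
  · intro D hD hne
    rw [Finset.mem_powerset] at hD
    rw [if_neg, zero_mul]
    rintro ⟨h1, h2⟩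
    apply hne
    simp only [Finset.mem_biUnion, id] at h1
    obtain ⟨V, hV, hiV⟩ := h1
    have : V = C := eq_of_mem_setParts hπ (hD hV) hC hiV hiC
    subst this
    exact (Finset.eq_singleton_iff_unique_mem.2 ⟨hV, fun W hW =>
      (Finset.card_le_one.1 h2) W hW V hV⟩)

theorem expMoment_cum (M : Finset ι → R) (h0 : M ∅ = 1) (I : Finset ι) :
    expMoment (cum M) I = M I := by
  induction I using Finset.strongInduction with
  | H I ih =>
    rcases I.eq_empty_or_nonempty with rfl | ⟨i, hi⟩
    · simp [h0]
    · rw [expMoment_rec _ hi, cum_rec M h0 hi]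
      refine Finset.sum_congr rfl fun B hB => ?_
      simp only [Finset.mem_filter, Finset.mem_powerset] at hB
      rw [ih (I \ B) (Finset.sdiff_ssubset hB.1 ⟨i, hB.2⟩)]

/-- Expanding the product over the blocks lets every block choose X or Y; the two families of chosen
blocks partition complementary subsets. -/
theorem expMoment_add (X Y : Finset ι → R) (I : Finset ι) :
    expMoment (X + Y) I = ∑ B ∈ I.powerset, expMoment X B * expMoment Y (I \ B) := by
  have key := sum_setParts_split (R := R) I (fun D E => (∏ U ∈ D, X U) * ∏ U ∈ E, Y U)
  simp_rw [expMoment, Finset.sum_mul_sum]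
  rw [← key]
  refine Finset.sum_congr rfl fun π hπ => ?_
  simp_rw [Pi.add_apply]
  rw [Finset.prod_add]

/-- The law of total cumulance. -/
theorem cum_total {A : Type*} [CommRing A] (E : A →+ R) (hE : E 1 = 1) (X : Finset ι → A)
    {I : Finset ι} (hI : I.Nonempty) :
    cum (fun U => E (expMoment X U)) I =
      ∑ π ∈ setParts I, cum (fun D : Finset (Finset ι) => E (∏ C ∈ D, X C)) π := by
  symm
  -- The right-hand side satisfies the recursion that characterizes cumulants: for each partition π
  -- of I, `cum_rec` is applied to the set of blocks of π, with pivot the block that contains i.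
  refine cum_unique (fun U => E (expMoment X U))
    (fun I => ∑ π ∈ setParts I, cum (fun D : Finset (Finset ι) => E (∏ C ∈ D, X C)) π)
    (by simp [hE]) ?_ I hI
  intro I hI
  obtain ⟨i, hi⟩ := hI
  refine ⟨i, hi, ?_⟩
  have key := sum_setParts_split (R := R) I (fun D E' =>
    (if i ∈ D.biUnion id then cum (fun D : Finset (Finset ι) => E (∏ C ∈ D, X C)) D else 0) *
      E (∏ U ∈ E', X U))
  have hR : ∑ B ∈ I.powerset with i ∈ B,
      (∑ π ∈ setParts B, cum (fun D : Finset (Finset ι) => E (∏ C ∈ D, X C)) π) *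
        E (expMoment X (I \ B)) =
      ∑ B ∈ I.powerset, ∑ π₁ ∈ setParts B, ∑ π₂ ∈ setParts (I \ B),
      (if i ∈ π₁.biUnion id then cum (fun D : Finset (Finset ι) => E (∏ C ∈ D, X C)) π₁ else 0) *
      E (∏ U ∈ π₂, X U) := by
    rw [Finset.sum_filter]
    refine Finset.sum_congr rfl fun B hB => ?_
    rw [← Finset.sum_mul_sum]
    split_ifs with hiB
    · simp only [expMoment, map_sum]
      congr 1
      refine Finset.sum_congr rfl fun π hπ => ?_
      rw [(mem_setParts.1 hπ).2.2, if_pos hiB]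
    · symm
      convert zero_mul _
      refine Finset.sum_eq_zero fun π hπ => ?_
      rw [(mem_setParts.1 hπ).2.2, if_neg hiB]
  rw [hR, ← key]
  simp only [expMoment, map_sum]
  refine Finset.sum_congr rfl fun π hπ => ?_
  obtain ⟨C, hC, hiC⟩ := exists_mem_setParts hπ hi
  have := cum_rec (fun D : Finset (Finset ι) => E (∏ C ∈ D, X C)) (by simp [hE]) hC
  rw [this, Finset.sum_filter]
  refine Finset.sum_congr rfl fun D hD => ?_
  rw [Finset.mem_powerset] at hD
  have hmem : (i ∈ D.biUnion id ↔ C ∈ D) := by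
    simp only [Finset.mem_biUnion, id]
    exact ⟨fun ⟨V, hV, hiV⟩ => eq_of_mem_setParts hπ hC (hD hV) hiC hiV ▸ hV,
      fun h => ⟨C, h, hiC⟩⟩
  by_cases h : C ∈ D
  · rw [if_pos h, if_pos (hmem.2 h)]
  · rw [if_neg h, if_neg (fun h' => h (hmem.1 h')), zero_mul]

end Cumulants

/-- Equal multisets of values have equinumerous fibres over each value, and bijections of the fibres
glue together. -/
theorem exists_equiv_of_map_eq {ι κ α : Type*} {I : Finset ι} {I' : Finset κ} {x : ι → α} {y : κ → α}
    (h : I.val.map x = I'.val.map y) : ∃ e : I ≃ I', ∀ i : I, y (e i) = x i := by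
  classical
  have hfib : ∀ a : α, Nonempty ({i : I // x i = a} ≃ {i : I' // y i = a}) := by
    intro a
    rw [← Fintype.card_eq]
    have := congrArg (Multiset.count a) h
    rw [Multiset.count_map, Multiset.count_map] at this
    have h1 : Fintype.card {i : I // x i = a} = (I.val.filter fun i => a = x i).card := by
      rw [Fintype.card_subtype, Finset.univ_eq_attach, ← Finset.card_map (Function.Embedding.subtype _)]
      rw [← Finset.filter_val, ← Finset.card]
      congr 1
      ext i
      simp [eq_comm, and_comm]
    have h2 : Fintype.card {i : I' // y i = a} = (I'.val.filter fun i => a = y i).card := by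
      rw [Fintype.card_subtype, Finset.univ_eq_attach, ← Finset.card_map (Function.Embedding.subtype _)]
      rw [← Finset.filter_val, ← Finset.card]
      congr 1
      ext i
      simp [eq_comm, and_comm]
    rw [h1, h2, this]
  refine ⟨(Equiv.sigmaFiberEquiv (fun i : I => x i)).symm.trans
    ((Equiv.sigmaCongrRight fun a => (hfib a).some).trans
      (Equiv.sigmaFiberEquiv (fun i : I' => y i))), fun i => ?_⟩
  exact ((hfib (x i)).some ⟨i, rfl⟩).2

/-! ### Calculus of joint cumulants: multilinearity, products, differentiation. -/

section CumulantCalculus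

variable {ι κ : Type*} [DecidableEq ι] [DecidableEq κ] {R : Type*} [CommRing R]

theorem cum_congr {M M' : Finset ι → R} {I : Finset ι} (h : ∀ U ⊆ I, M U = M' U) :
    cum M I = cum M' I := by
  refine Finset.sum_congr rfl fun π hπ => ?_
  rw [Finset.prod_congr rfl fun U hU => h U (subset_of_mem_setParts hπ hU)]

/-- The variant needed when the candidate formula for the cumulants is available only inside a fixed
index set, as in `kum_update_mul`. -/
theorem cum_unique_of_subset (M K : Finset ι → R) (h0 : M ∅ = 1) (I₀ : Finset ι)
    (h : ∀ I ⊆ I₀, I.Nonempty → ∃ i ∈ I,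
      M I = ∑ B ∈ I.powerset with i ∈ B, K B * M (I \ B)) :
    ∀ I ⊆ I₀, I.Nonempty → K I = cum M I := by
  intro I
  induction I using Finset.strongInduction with
  | H I ih =>
    intro hI₀ hI
    obtain ⟨i, hi, hK⟩ := h I hI₀ hI
    have hC := cum_rec M h0 hi
    have hmem : I ∈ I.powerset.filter (i ∈ ·) := by simp [hi]
    rw [← Finset.add_sum_erase _ _ hmem] at hK hC
    have : ∑ B ∈ (I.powerset.filter (i ∈ ·)).erase I, K B * M (I \ B) =
        ∑ B ∈ (I.powerset.filter (i ∈ ·)).erase I, cum M B * M (I \ B) := by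
      refine Finset.sum_congr rfl fun B hB => ?_
      simp only [Finset.mem_erase, Finset.mem_filter, Finset.mem_powerset] at hB
      rw [ih B (Finset.ssubset_iff_subset_ne.2 ⟨hB.2.1, hB.1⟩) (hB.2.1.trans hI₀) ⟨i, hB.2.2⟩]
    rw [this] at hK
    simp only [Finset.sdiff_self, h0, mul_one] at hK hC
    exact add_right_cancel (hK.symm.trans hC)

theorem sum_powerset_filter_mem {S : Type*} [AddCommMonoid S] {I : Finset ι} {i : ι} (hi : i ∈ I)
    (f : Finset ι → S) :
    ∑ B ∈ I.powerset with i ∈ B, f B = ∑ B ∈ (I.erase i).powerset, f (insert i B) := by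
  refine Finset.sum_bij' (fun B _ => B.erase i) (fun B _ => insert i B) ?_ ?_ ?_ ?_ ?_
  · intro B hB
    simp only [Finset.mem_filter, Finset.mem_powerset] at hB ⊢
    exact Finset.erase_subset_erase i hB.1
  · intro B hB
    simp only [Finset.mem_filter, Finset.mem_powerset] at hB ⊢
    refine ⟨?_, Finset.mem_insert_self i B⟩
    rw [Finset.insert_subset_iff]
    exact ⟨hi, hB.trans (Finset.erase_subset i I)⟩
  · intro B hB
    simp only [Finset.mem_filter] at hB
    exact Finset.insert_erase hB.2
  · intro B hB
    simp only [Finset.mem_powerset] at hB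
    exact Finset.erase_insert fun h => Finset.notMem_erase i I (hB h)
  · intro B hB
    simp only [Finset.mem_filter] at hB
    rw [Finset.insert_erase hB.2]

/-- The recursion for cumulants, solved for the top one. -/
theorem cum_eq_sub (M : Finset ι → R) (h0 : M ∅ = 1) {I : Finset ι} {i : ι} (hi : i ∈ I) :
    cum M I = M I - ∑ B ∈ (I.powerset.filter (i ∈ ·)).erase I, cum M B * M (I \ B) := by
  have hmem : I ∈ I.powerset.filter (i ∈ ·) := by simp [hi]
  have hC := cum_rec M h0 hi
  rw [← Finset.add_sum_erase _ _ hmem] at hC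
  simp only [Finset.sdiff_self, h0, mul_one] at hC
  rw [hC, add_sub_cancel_right]

/-- In the recursion only the top moment involves the full index set, and it enters with coefficient
one. -/
theorem cum_sub_cum {M M' : Finset ι → R} (h0 : M ∅ = 1) {I : Finset ι} (hI : I.Nonempty)
    (h : ∀ U ⊂ I, M U = M' U) : cum M I - cum M' I = M I - M' I := by
  obtain ⟨i, hi⟩ := hI
  have h0' : M' ∅ = 1 := by
    rw [← h ∅ (Finset.ssubset_iff_subset_ne.2 ⟨Finset.empty_subset _, fun hh => by
      rw [← hh] at hi; simp at hi⟩), h0]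
  rw [cum_eq_sub M h0 hi, cum_eq_sub M' h0' hi]
  have : ∑ B ∈ (I.powerset.filter (i ∈ ·)).erase I, cum M B * M (I \ B) =
      ∑ B ∈ (I.powerset.filter (i ∈ ·)).erase I, cum M' B * M' (I \ B) := by
    refine Finset.sum_congr rfl fun B hB => ?_
    simp only [Finset.mem_erase, Finset.mem_filter, Finset.mem_powerset] at hB
    have hss : B ⊂ I := Finset.ssubset_iff_subset_ne.2 ⟨hB.2.1, hB.1⟩
    rw [cum_congr fun U hU => h U (Finset.ssubset_of_subset_of_ssubset hU hss),
      h (I \ B) (Finset.sdiff_ssubset hB.2.1 ⟨i, hB.2.2⟩)]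
  rw [this]
  ring

@[simp] theorem cum_singleton (M : Finset ι → R) (h0 : M ∅ = 1) (i : ι) :
    cum M {i} = M {i} := by
  rw [cum_eq_sub M h0 (Finset.mem_singleton_self i)]
  rw [Finset.sum_eq_zero, sub_zero]
  intro B hB
  simp only [Finset.mem_erase, Finset.mem_filter, Finset.mem_powerset] at hB
  exact absurd (subset_antisymm hB.2.1 (Finset.singleton_subset_iff.2 hB.2.2)) hB.1

theorem cum_map (f : ι ↪ κ) (M : Finset κ → R) (h0 : M ∅ = 1) {I : Finset ι} (hI : I.Nonempty) :
    cum (fun U => M (U.map f)) I = cum M (I.map f) := by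
  symm
  refine cum_unique (fun U => M (U.map f)) (fun U => cum M (U.map f)) (by simpa using h0) ?_ I hI
  rintro I ⟨i, hi⟩
  refine ⟨i, hi, ?_⟩
  have hfi : f i ∈ I.map f := Finset.mem_map_of_mem f hi
  have := cum_rec M h0 hfi
  rw [sum_powerset_filter_mem hfi] at this
  rw [sum_powerset_filter_mem hi]
  simp only [this, ← Finset.map_erase]
  symm
  refine Finset.sum_bij (fun B _ => B.map f) ?_ ?_ ?_ ?_
  · intro B hB
    rw [Finset.mem_powerset] at hB ⊢
    exact Finset.map_subset_map.2 hB
  · intro B _ C _ h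
    exact Finset.map_injective f h
  · intro B hB
    rw [Finset.mem_powerset] at hB
    obtain ⟨C, hC, rfl⟩ := Finset.subset_map_iff.1 hB
    exact ⟨C, by simpa using hC, rfl⟩
  · intro B hB
    rw [Finset.map_insert]
    congr 2
    rw [← Finset.map_insert, Finset.map_sdiff]

variable {A : Type*} [CommRing A] [Algebra ℝ A] (E : A →ₗ[ℝ] ℝ)

/-- Joint cumulants of elements of a commutative algebra with respect to a linear functional. -/
def kum (x : ι → A) (I : Finset ι) : ℝ := cum (fun U => E (∏ j ∈ U, x j)) I

variable {E}

theorem kum_congr {x y : ι → A} {I : Finset ι} (h : ∀ i ∈ I, x i = y i) :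
    kum E x I = kum E y I :=
  cum_congr fun U hU => by rw [Finset.prod_congr rfl fun i hi => h i (hU hi)]

theorem kum_rec (hE : E 1 = 1) (x : ι → A) {I : Finset ι} {i : ι} (hi : i ∈ I) :
    E (∏ j ∈ I, x j) =
      ∑ B ∈ (I.erase i).powerset, kum E x (insert i B) * E (∏ j ∈ (I.erase i) \ B, x j) := by
  have := cum_rec (fun U => E (∏ j ∈ U, x j)) (by simpa using hE) hi
  rw [sum_powerset_filter_mem hi] at this
  rw [this]
  refine Finset.sum_congr rfl fun B hB => ?_
  rw [Finset.mem_powerset] at hB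
  have hiB : i ∉ B := fun h => Finset.notMem_erase i I (hB h)
  rw [show I \ insert i B = I.erase i \ B by
    rw [Finset.sdiff_insert, Finset.erase_sdiff_comm]]
  rfl

theorem kum_singleton (hE : E 1 = 1) (x : ι → A) (i : ι) : kum E x {i} = E (x i) := by
  simp [kum, hE]

/-- Induction through the recursion with pivot i: the moment is linear in slot i, and so are the
cumulants of the smaller sets containing i, hence also the remaining top cumulant. -/
theorem kum_update_linear (hE : E 1 = 1) (x : ι → A) (c : ℝ) (a b : A) (i : ι) :
    ∀ I : Finset ι, i ∈ I →
    kum E (Function.update x i (c • a + b)) I =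
      c * kum E (Function.update x i a) I + kum E (Function.update x i b) I := by
  intro I
  induction I using Finset.strongInduction with
  | H I ih =>
    intro hi
    have hrec : ∀ y : A, E (y * ∏ j ∈ I.erase i, x j) =
        kum E (Function.update x i y) I + ∑ B ∈ (I.erase i).powerset.erase (I.erase i),
          kum E (Function.update x i y) (insert i B) * E (∏ j ∈ (I.erase i) \ B, x j) := by
      intro y
      have h := kum_rec hE (Function.update x i y) hi
      rw [← Finset.mul_prod_erase _ _ hi, Function.update_self,
        Finset.prod_congr rfl (fun j hj => Function.update_of_ne (Finset.ne_of_mem_erase hj) y x)]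
        at h
      rw [h, ← Finset.add_sum_erase _ _ (Finset.mem_powerset_self (I.erase i)),
        Finset.insert_erase hi, Finset.sdiff_self]
      simp only [Finset.prod_empty, hE, mul_one]
      congr 1
      refine Finset.sum_congr rfl fun B _ => ?_
      congr 2
      refine Finset.prod_congr rfl fun j hj => Function.update_of_ne ?_ y x
      exact Finset.ne_of_mem_erase (Finset.mem_sdiff.1 hj).1
    have h1 := hrec (c • a + b)
    have h2 := hrec a
    have h3 := hrec b
    have hlin : E ((c • a + b) * ∏ j ∈ I.erase i, x j) =
        c * E (a * ∏ j ∈ I.erase i, x j) + E (b * ∏ j ∈ I.erase i, x j) := by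
      rw [add_mul, map_add, smul_mul_assoc, map_smul, smul_eq_mul]
    have hsum : ∑ B ∈ (I.erase i).powerset.erase (I.erase i),
          kum E (Function.update x i (c • a + b)) (insert i B) * E (∏ j ∈ (I.erase i) \ B, x j) =
        c * (∑ B ∈ (I.erase i).powerset.erase (I.erase i),
          kum E (Function.update x i a) (insert i B) * E (∏ j ∈ (I.erase i) \ B, x j)) +
        ∑ B ∈ (I.erase i).powerset.erase (I.erase i),
          kum E (Function.update x i b) (insert i B) * E (∏ j ∈ (I.erase i) \ B, x j) := by
      rw [Finset.mul_sum, ← Finset.sum_add_distrib]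
      refine Finset.sum_congr rfl fun B hB => ?_
      simp only [Finset.mem_erase, Finset.mem_powerset] at hB
      rw [ih (insert i B) ?_ (Finset.mem_insert_self i B)]
      · ring
      · have hBs : B ⊂ I.erase i := Finset.ssubset_iff_subset_ne.2 ⟨hB.2, hB.1⟩
        obtain ⟨j, hj, hjB⟩ := Finset.exists_of_ssubset hBs
        refine Finset.ssubset_iff_subset_ne.2 ⟨?_, fun h => ?_⟩
        · rw [Finset.insert_subset_iff]
          exact ⟨hi, hB.2.trans (Finset.erase_subset i I)⟩
        · have : j ∈ insert i B := h ▸ Finset.mem_of_mem_erase hj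
          rcases Finset.mem_insert.1 this with rfl | h'
          · exact Finset.notMem_erase _ _ hj
          · exact hjB h'
    rw [hlin, h2, h3, hsum] at h1
    linarith

theorem kum_update_add (hE : E 1 = 1) (x : ι → A) (a b : A) {i : ι} {I : Finset ι} (hi : i ∈ I) :
    kum E (Function.update x i (a + b)) I =
      kum E (Function.update x i a) I + kum E (Function.update x i b) I := by
  have := kum_update_linear hE x 1 a b i I hi
  rwa [one_smul, one_mul] at this

theorem kum_update_zero (hE : E 1 = 1) (x : ι → A) {i : ι} {I : Finset ι} (hi : i ∈ I) :
    kum E (Function.update x i 0) I = 0 := by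
  have := kum_update_add hE x 0 0 hi
  rw [add_zero] at this
  linarith

theorem kum_update_smul (hE : E 1 = 1) (x : ι → A) (c : ℝ) (a : A) {i : ι} {I : Finset ι}
    (hi : i ∈ I) :
    kum E (Function.update x i (c • a)) I = c * kum E (Function.update x i a) I := by
  have := kum_update_linear hE x c a 0 i I hi
  rwa [add_zero, kum_update_zero hE x hi, add_zero] at this

theorem kum_update_sum (hE : E 1 = 1) (x : ι → A) {σ : Type*} (s : Finset σ) (a : σ → A) {i : ι}
    {I : Finset ι} (hi : i ∈ I) :
    kum E (Function.update x i (∑ j ∈ s, a j)) I =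
      ∑ j ∈ s, kum E (Function.update x i (a j)) I := by
  classical
  induction s using Finset.induction_on with
  | empty => simp [kum_update_zero hE x hi]
  | insert j s hj ih => rw [Finset.sum_insert hj, Finset.sum_insert hj, kum_update_add hE x _ _ hi, ih]

/-- The joint cumulant as a multilinear map. -/
noncomputable def kumMultilinear [Fintype ι] (hE : E 1 = 1) : MultilinearMap ℝ (fun _ : ι => A) ℝ where
  toFun x := kum E x Finset.univ
  map_update_add' x i a b := by
    convert kum_update_add hE x a b (Finset.mem_univ i)
  map_update_smul' x i c a := by
    rw [smul_eq_mul]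
    convert kum_update_smul hE x c a (Finset.mem_univ i)

theorem kum_smul (x : ι → A) (c : ι → ℝ) (I : Finset ι) :
    kum E (fun i => c i • x i) I = (∏ i ∈ I, c i) * kum E x I := by
  unfold kum cum
  rw [Finset.mul_sum]
  refine Finset.sum_congr rfl fun π hπ => ?_
  have : ∏ U ∈ π, E (∏ j ∈ U, c j • x j) = (∏ i ∈ I, c i) * ∏ U ∈ π, E (∏ j ∈ U, x j) := by
    rw [← (mem_setParts.1 hπ).2.2, Finset.prod_biUnion, ← Finset.prod_mul_distrib]
    · refine Finset.prod_congr rfl fun U _ => ?_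
      rw [Finset.prod_smul, map_smul, smul_eq_mul, id]
    · intro U hU V hV hne
      exact (mem_setParts.1 hπ).2.1 U hU V hV hne
  rw [this]
  ring

/-- A joint cumulant of at least two elements vanishes if one of them is a scalar. -/
theorem kum_scalar (hE : E 1 = 1) (x : ι → A) {i : ι} (c : ℝ) (hx : x i = algebraMap ℝ A c) :
    ∀ I : Finset ι, i ∈ I → 1 < I.card → kum E x I = 0 := by
  intro I
  induction I using Finset.strongInduction with
  | H I ih =>
    intro hi hcard
    have h := kum_rec hE x hi
    have hne : (∅ : Finset ι) ≠ I.erase i := by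
      intro hh
      have := Finset.card_erase_of_mem hi
      rw [← hh] at this
      simp at this
      omega
    rw [← Finset.add_sum_erase _ _ (Finset.mem_powerset_self (I.erase i)),
      ← Finset.add_sum_erase _ _ (show ∅ ∈ (I.erase i).powerset.erase (I.erase i) by
        simp [hne]), Finset.insert_erase hi, Finset.sdiff_self, insert_empty_eq,
      kum_singleton hE, Finset.sdiff_empty, Finset.sum_eq_zero] at h
    · rw [← Finset.mul_prod_erase _ _ hi, hx, ← Algebra.smul_def, map_smul, Algebra.algebraMap_eq_smul_one,
        map_smul, hE] at h
      simp [hE] at h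
      exact h
    · intro B hB
      simp only [Finset.mem_erase, Finset.mem_powerset] at hB
      have hiB : i ∉ B := fun h => Finset.notMem_erase i I (hB.2.2 h)
      rw [ih (insert i B) ?_ (Finset.mem_insert_self i B), zero_mul]
      · rw [Finset.card_insert_of_notMem hiB]
        have := Finset.card_pos.2 (Finset.nonempty_iff_ne_empty.2 hB.1)
        omega
      · have hBs : B ⊂ I.erase i := Finset.ssubset_iff_subset_ne.2 ⟨hB.2.2, hB.2.1⟩
        obtain ⟨j, hj, hjB⟩ := Finset.exists_of_ssubset hBs
        refine Finset.ssubset_iff_subset_ne.2 ⟨?_, fun h => ?_⟩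
        · rw [Finset.insert_subset_iff]
          exact ⟨hi, hB.2.2.trans (Finset.erase_subset i I)⟩
        · have : j ∈ insert i B := h ▸ Finset.mem_of_mem_erase hj
          rcases Finset.mem_insert.1 this with rfl | h'
          · exact Finset.notMem_erase _ _ hj
          · exact hjB h'

/-- Joint cumulants of a family in which one entry is a product. -/
theorem kum_update_mul (hE : E 1 = 1) (x : ι → A) {i j : ι} {I : Finset ι} (hi : i ∈ I)
    (hj : j ∉ I) :
    kum E (Function.update x i (x i * x j)) I = kum E x (insert j I) +
      ∑ B ∈ (I.erase i).powerset,
        kum E x (insert i B) * kum E x (insert j ((I.erase i) \ B)) := by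
  set y := Function.update x i (x i * x j) with hy
  symm
  have hyU : ∀ U : Finset ι, i ∉ U → ∏ l ∈ U, y l = ∏ l ∈ U, x l := fun U hU =>
    Finset.prod_congr rfl fun l hl => Function.update_of_ne (fun h : l = i => hU (h ▸ hl)) _ _
  -- The candidate for the cumulants of y. On a set U containing i the moment of y is that of x over
  -- `insert j U`; its recursion at i is split by whether the chosen block contains j, and when it
  -- does not, the remaining moment is expanded once more at j.
  set K : Finset ι → ℝ := fun U => if i ∈ U then kum E x (insert j U) +
      ∑ B ∈ (U.erase i).powerset, kum E x (insert i B) * kum E x (insert j ((U.erase i) \ B))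
    else kum E x U with hK
  have key := cum_unique_of_subset (fun U => E (∏ l ∈ U, y l)) K (by simpa using hE) I ?_ I
    subset_rfl ⟨i, hi⟩
  · rw [← show _ = kum E y I from key]
    simp only [hK, if_pos hi]
  intro U hU hUne
  by_cases hiU : i ∈ U
  · refine ⟨i, hiU, ?_⟩
    have hjU : j ∉ U := fun h => hj (hU h)
    have hij : i ≠ j := fun h => hjU (h ▸ hiU)
    have hjUe : j ∉ U.erase i := fun h => hjU (Finset.mem_of_mem_erase h)
    have h1 : ∏ l ∈ U, y l = ∏ l ∈ insert j U, x l := by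
      rw [← Finset.mul_prod_erase _ _ hiU, hyU _ (Finset.notMem_erase i U), hy,
        Function.update_self, Finset.prod_insert hjU, ← Finset.mul_prod_erase U x hiU]
      ring
    rw [sum_powerset_filter_mem hiU, h1, kum_rec hE x (Finset.mem_insert_of_mem hiU),
      Finset.erase_insert_of_ne hij.symm, Finset.sum_powerset_insert hjUe]
    have hterm : ∀ B ∈ (U.erase i).powerset,
        K (insert i B) * E (∏ l ∈ U \ insert i B, y l) =
        kum E x (insert i (insert j B)) * E (∏ l ∈ (U.erase i) \ B, x l) +
        ∑ C ∈ B.powerset, kum E x (insert i C) * kum E x (insert j (B \ C)) *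
          E (∏ l ∈ (U.erase i) \ B, x l) := by
      intro B hB
      rw [Finset.mem_powerset] at hB
      have hiB : i ∉ B := fun h => Finset.notMem_erase i U (hB h)
      have hs : U \ insert i B = U.erase i \ B := by
        rw [Finset.sdiff_insert, Finset.erase_sdiff_comm]
      rw [hs, hyU _ (fun h => Finset.notMem_erase i U (Finset.mem_sdiff.1 h).1), hK]
      simp only [Finset.mem_insert_self, if_true, Finset.erase_insert hiB]
      rw [add_mul, Finset.sum_mul, Finset.insert_comm]
    rw [Finset.sum_congr rfl hterm, Finset.sum_add_distrib, add_comm]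
    congr 1
    · refine Finset.sum_congr rfl fun B hB => ?_
      rw [Finset.mem_powerset] at hB
      congr 3
      ext l
      simp only [Finset.mem_sdiff, Finset.mem_insert]
      constructor
      · rintro ⟨h | h, h'⟩
        · exact absurd (Or.inl h) h'
        · exact ⟨h, fun hb => h' (Or.inr hb)⟩
      · rintro ⟨h, h'⟩
        refine ⟨Or.inr h, ?_⟩
        rintro (rfl | h'')
        · exact hjUe h
        · exact h' h''
    · have h2 : ∀ C ∈ (U.erase i).powerset, kum E x (insert i C) *
          E (∏ l ∈ insert j (U.erase i) \ C, x l) =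
          ∑ D ∈ ((U.erase i) \ C).powerset, kum E x (insert i C) * kum E x (insert j D) *
            E (∏ l ∈ (U.erase i \ C) \ D, x l) := by
        intro C hC
        rw [Finset.mem_powerset] at hC
        have hjC : j ∉ C := fun h => hjUe (hC h)
        rw [Finset.insert_sdiff_of_notMem _ hjC, kum_rec hE x (Finset.mem_insert_self j _),
          Finset.erase_insert (fun h => hjUe (Finset.mem_sdiff.1 h).1), Finset.mul_sum]
        refine Finset.sum_congr rfl fun D _ => ?_
        ring
      rw [Finset.sum_congr rfl h2, Finset.sum_sigma', Finset.sum_sigma']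
      refine Finset.sum_bij' (fun p _ => ⟨p.1 ∪ p.2, p.1⟩) (fun p _ => ⟨p.2, p.1 \ p.2⟩)
        ?_ ?_ ?_ ?_ ?_
      · rintro ⟨C, D⟩ h
        simp only [Finset.mem_sigma, Finset.mem_powerset] at h ⊢
        exact ⟨Finset.union_subset h.1 (h.2.trans Finset.sdiff_subset), Finset.subset_union_left⟩
      · rintro ⟨B, C⟩ h
        simp only [Finset.mem_sigma, Finset.mem_powerset] at h ⊢
        exact ⟨h.2.trans h.1, Finset.sdiff_subset_sdiff h.1 subset_rfl⟩
      · rintro ⟨C, D⟩ h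
        simp only [Finset.mem_sigma, Finset.mem_powerset] at h ⊢
        have hd : Disjoint C D := Finset.disjoint_of_subset_right h.2 Finset.disjoint_sdiff
        simp [Finset.union_sdiff_cancel_left hd]
      · rintro ⟨B, C⟩ h
        simp only [Finset.mem_sigma, Finset.mem_powerset] at h ⊢
        simp [Finset.union_sdiff_of_subset h.2]
      · rintro ⟨C, D⟩ h
        simp only [Finset.mem_sigma, Finset.mem_powerset] at h ⊢
        have hd : Disjoint C D := Finset.disjoint_of_subset_right h.2 Finset.disjoint_sdiff
        rw [Finset.union_sdiff_cancel_left hd, sdiff_sdiff_left]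
        rfl
  · obtain ⟨l, hl⟩ := hUne
    refine ⟨l, hl, ?_⟩
    have := cum_rec (fun U => E (∏ l ∈ U, x l)) (by simpa using hE) hl
    simp only [hyU U hiU, this]
    refine Finset.sum_congr rfl fun B hB => ?_
    simp only [Finset.mem_filter, Finset.mem_powerset] at hB
    rw [hyU _ (fun h => hiU (Finset.mem_sdiff.1 h).1), hK]
    simp only [if_neg (fun h => hiU (hB.1 h))]
    rfl

theorem kum_attach (hE : E 1 = 1) (x : ι → A) {I : Finset ι} (hI : I.Nonempty) :
    kum E (fun i : I => x i) Finset.univ = kum E x I := by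
  have : Nonempty I := hI.to_subtype
  have := cum_map (Function.Embedding.subtype (· ∈ I)) (fun U => E (∏ j ∈ U, x j))
    (by simpa using hE) (I := (Finset.univ : Finset I)) Finset.univ_nonempty
  simp only [Finset.prod_map, Finset.univ_eq_attach, Finset.attach_map_val,
    Function.Embedding.subtype_apply] at this
  rw [Finset.univ_eq_attach]
  exact this

/-- Joint cumulants depend only on the multiset of the entries. -/
theorem kum_eq_of_map_eq (hE : E 1 = 1) {I : Finset ι} {I' : Finset κ} {x : ι → A} {y : κ → A}
    (h : I.val.map x = I'.val.map y) (hI : I.Nonempty) : kum E x I = kum E y I' := by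
  have hI' : I'.Nonempty := by
    rw [← Finset.card_pos] at hI ⊢
    have := congrArg Multiset.card h
    simp only [Multiset.card_map, Finset.card_val] at this
    omega
  obtain ⟨e, he⟩ := exists_equiv_of_map_eq h
  have : Nonempty I := hI.to_subtype
  rw [← kum_attach hE x hI, ← kum_attach hE y hI']
  have := cum_map e.toEmbedding (fun U => E (∏ j ∈ U, y j)) (by simpa using hE)
    (I := (Finset.univ : Finset I)) Finset.univ_nonempty
  simp only [Finset.prod_map, Finset.map_univ_equiv, Equiv.coe_toEmbedding, he] at this
  exact this

variable (E) in
/-- The joint cumulant of a multiset of elements. -/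
noncomputable def kumM (s : Multiset A) : ℝ := kum E (fun j : ℕ => s.toList.getD j 0) (Finset.range (Multiset.card s))

theorem kum_eq_kumM (hE : E 1 = 1) (x : ι → A) {I : Finset ι} (hI : I.Nonempty) :
    kum E x I = kumM E (I.val.map x) := by
  refine kum_eq_of_map_eq hE ?_ hI
  generalize I.val.map x = s
  conv_lhs => rw [← Multiset.coe_toList s]
  rw [Finset.range_val, ← Multiset.coe_range, Multiset.map_coe]
  congr 1
  rw [← Multiset.length_toList]
  apply List.ext_getElem
  · simp
  · intro n h1 h2
    rw [List.getElem_map, List.getElem_range, List.getD_eq_getElem]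

/-- If the moments satisfy `M' U = M (U ∪ p) - M U * M p`, then differentiation appends `p` to
the cumulants. -/
theorem hasDerivAt_cum {M : ℂ → Finset ι → ℂ} {x : ℂ} {p : ι} (h0 : ∀ᶠ y in 𝓝 x, M y ∅ = 1)
    {I₀ : Finset ι} (hp : p ∉ I₀)
    (hM : ∀ U ⊆ I₀, HasDerivAt (fun y => M y U) (M x (insert p U) - M x U * M x {p}) x) :
    ∀ I ⊆ I₀, I.Nonempty → HasDerivAt (fun y => cum (M y) I) (cum (M x) (insert p I)) x := by
  intro I
  induction I using Finset.strongInduction with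
  | H I ih =>
    rintro hI₀ ⟨i, hi⟩
    have hpI : p ∉ I := fun h => hp (hI₀ h)
    have hip : i ≠ p := fun h => hpI (h ▸ hi)
    have hx0 : M x ∅ = 1 := h0.self_of_nhds
    set s := (I.powerset.filter (i ∈ ·)).erase I with hs
    have hd : HasDerivAt (fun y => M y I - ∑ B ∈ s, cum (M y) B * M y (I \ B))
        (M x (insert p I) - M x I * M x {p} - ∑ B ∈ s, (cum (M x) (insert p B) * M x (I \ B) +
          cum (M x) B * (M x (insert p (I \ B)) - M x (I \ B) * M x {p}))) x := by
      refine (hM I hI₀).sub (HasDerivAt.fun_sum fun B hB => ?_)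
      simp only [hs, Finset.mem_erase, Finset.mem_filter, Finset.mem_powerset] at hB
      exact (ih B (Finset.ssubset_iff_subset_ne.2 ⟨hB.2.1, hB.1⟩) (hB.2.1.trans hI₀)
        ⟨i, hB.2.2⟩).mul (hM _ (Finset.sdiff_subset.trans hI₀))
    have hmem : I ∈ I.powerset.filter (i ∈ ·) := by simp [hi]
    -- The recursions for `insert p I` and for I, both with pivot i, are compared; the products with
    -- M x {p} recombine to M x I * M x {p} and cancel.
    have hval : M x (insert p I) - M x I * M x {p} -
        ∑ B ∈ s, (cum (M x) (insert p B) * M x (I \ B) +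
          cum (M x) B * (M x (insert p (I \ B)) - M x (I \ B) * M x {p})) =
        cum (M x) (insert p I) := by
      have h1 := cum_rec (M x) hx0 (Finset.mem_insert_of_mem (b := p) hi)
      have h2 := cum_rec (M x) hx0 hi
      have hsplit : ∑ B ∈ (insert p I).powerset with i ∈ B, cum (M x) B * M x (insert p I \ B) =
          ∑ B ∈ I.powerset with i ∈ B, (cum (M x) (insert p B) * M x (I \ B) +
            cum (M x) B * M x (insert p (I \ B))) := by
        rw [sum_powerset_filter_mem (Finset.mem_insert_of_mem hi), sum_powerset_filter_mem hi,
          Finset.erase_insert_of_ne hip.symm,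
          Finset.sum_powerset_insert (fun h => hpI (Finset.mem_of_mem_erase h)), add_comm,
          ← Finset.sum_add_distrib]
        refine Finset.sum_congr rfl fun B hB => ?_
        rw [Finset.mem_powerset] at hB
        have hpB : p ∉ B := fun h => hpI (Finset.mem_of_mem_erase (hB h))
        have hpB' : p ∉ insert i B := by
          rw [Finset.mem_insert]; exact fun h => h.elim (fun h => hip h.symm) hpB
        rw [Finset.insert_sdiff_of_notMem _ hpB', Finset.insert_comm i p B]
        congr 3
        ext l
        simp only [Finset.mem_sdiff, Finset.mem_insert]
        constructor
        · rintro ⟨h | h, h'⟩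
          · exact absurd (Or.inl h) h'
          · exact ⟨h, fun hb => h' (Or.inr hb)⟩
        · rintro ⟨h, h'⟩
          refine ⟨Or.inr h, ?_⟩
          rintro (rfl | h'')
          · exact hpI h
          · exact h' h''
      rw [hsplit, ← Finset.add_sum_erase _ _ hmem, ← hs] at h1
      rw [← Finset.add_sum_erase _ _ hmem, ← hs] at h2
      simp only [Finset.sdiff_self, hx0, mul_one, insert_empty_eq] at h1 h2
      rw [h1]
      have h3 : ∑ B ∈ s, (cum (M x) (insert p B) * M x (I \ B) +
          cum (M x) B * (M x (insert p (I \ B)) - M x (I \ B) * M x {p})) =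
          ∑ B ∈ s, (cum (M x) (insert p B) * M x (I \ B) +
            cum (M x) B * M x (insert p (I \ B))) -
          (∑ B ∈ s, cum (M x) B * M x (I \ B)) * M x {p} := by
        rw [Finset.sum_mul, ← Finset.sum_sub_distrib]
        exact Finset.sum_congr rfl fun B _ => by ring
      rw [h3, h2]
      ring
    rw [hval] at hd
    refine hd.congr_of_eventuallyEq ?_
    filter_upwards [h0] with y hy
    exact cum_eq_sub (M y) hy hi

end CumulantCalculus

/-! ### Weyl's formula for Schur polynomials defined by Gelfand–Tsetlin patterns. -/

section Schur

/-- The multiset of weights of the Gelfand–Tsetlin patterns with top row `lam`. -/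
noncomputable def schurWeights : (N : ℕ) → (Fin N → ℤ) → Multiset (Fin N → ℤ)
  | 0, _ => {0}
  | N + 1, lam =>
      ∑ mu ∈ Fintype.piFinset fun i : Fin N => Finset.Icc (lam i.succ) (lam i.castSucc),
        (schurWeights N mu).map fun w =>
          (Fin.snoc w (∑ i, lam i - ∑ i, mu i) : Fin (N + 1) → ℤ)

theorem schurPoly_eq_sum_weights (N : ℕ) (lam : Fin N → ℤ) (x : Fin N → ℂ) :
    schurPoly N lam x = ((schurWeights N lam).map fun w => ∏ i, x i ^ w i).sum := by
  induction N with
  | zero => simp [schurPoly, schurWeights]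
  | succ N ih =>
    rw [schurPoly, schurWeights, ← Multiset.coe_mapAddMonoidHom, map_sum, Multiset.sum_sum]
    refine Finset.sum_congr rfl fun mu _ => ?_
    rw [Multiset.coe_mapAddMonoidHom, Multiset.map_map, ih, ← Multiset.sum_map_mul_right]
    congr 1
    refine Multiset.map_congr rfl fun w _ => ?_
    simp [Fin.prod_univ_castSucc]

/-- The alternant `det (x_i ^ a_j)`. -/
def alternant {S : Type*} [CommRing S] {N : ℕ} (x : Fin N → Sˣ) (a : Fin N → ℤ) : S :=
  Matrix.det (Matrix.of fun i j => ((x i ^ a j : Sˣ) : S))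

/-- The Schur Laurent polynomial in the units of a commutative ring. -/
noncomputable def schurUnits {S : Type*} [CommRing S] (N : ℕ) (lam : Fin N → ℤ) (x : Fin N → Sˣ) : S :=
  ((schurWeights N lam).map fun w => ((∏ i, x i ^ w i : Sˣ) : S)).sum

variable {S : Type*} [CommRing S]

theorem schurUnits_succ (N : ℕ) (lam : Fin (N + 1) → ℤ) (x : Fin (N + 1) → Sˣ) :
    schurUnits (N + 1) lam x =
      ∑ mu ∈ Fintype.piFinset fun i : Fin N => Finset.Icc (lam i.succ) (lam i.castSucc),
        schurUnits N mu (fun i => x i.castSucc) *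
          ((x (Fin.last N) ^ (∑ i, lam i - ∑ i, mu i) : Sˣ) : S) := by
  rw [schurUnits, schurWeights, ← Multiset.coe_mapAddMonoidHom, map_sum, Multiset.sum_sum]
  refine Finset.sum_congr rfl fun mu _ => ?_
  rw [Multiset.coe_mapAddMonoidHom, Multiset.map_map, schurUnits, ← Multiset.sum_map_mul_right]
  congr 1
  refine Multiset.map_congr rfl fun w _ => ?_
  simp [Fin.prod_univ_castSucc]

/-- A telescoping geometric sum. The bound a ≤ b + 1 admits the empty interval, for which both sides
vanish. -/
theorem sum_Icc_telescope (y z : Sˣ) (c : ℤ) {a b : ℤ} (hab : a ≤ b + 1) :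
    ((y : S) - z) * ∑ m ∈ Finset.Icc a b, ((y ^ (m + c) * z ^ (b - m) : Sˣ) : S) =
      ((y ^ (b + c + 1) : Sˣ) : S) - ((z ^ (b - a + 1) * y ^ (a + c) : Sˣ) : S) := by
  obtain ⟨n, hn⟩ : ∃ n : ℕ, a = b + 1 - n := ⟨(b + 1 - a).toNat, by omega⟩
  subst hn
  clear hab
  induction n with
  | zero =>
    rw [Finset.Icc_eq_empty (by simp)]
    simp [add_right_comm]
  | succ n ih =>
    have h : Finset.Icc (b + 1 - ((n + 1 : ℕ) : ℤ)) b =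
        insert (b + 1 - ((n + 1 : ℕ) : ℤ)) (Finset.Icc (b + 1 - (n : ℤ)) b) := by
      ext m
      simp only [Finset.mem_Icc, Finset.mem_insert]
      push_cast
      omega
    rw [h, Finset.sum_insert (by simp), mul_add, ih]
    have e1 : (y ^ (b + 1 - (n : ℤ) + c) : Sˣ) = y * y ^ (b + 1 - ((n + 1 : ℕ) : ℤ) + c) := by
      rw [← zpow_one_add]; congr 1; push_cast; ring
    have e2 : (z ^ (b - (b + 1 - (n : ℤ)) + 1) : Sˣ) = z ^ (b - (b + 1 - ((n + 1 : ℕ) : ℤ))) := by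
      congr 1; push_cast; ring
    have e3 : (z ^ (b - (b + 1 - ((n + 1 : ℕ) : ℤ)) + 1) : Sˣ) =
        z * z ^ (b - (b + 1 - ((n + 1 : ℕ) : ℤ))) := by
      rw [← zpow_one_add]; congr 1; ring
    rw [e1, e2, e3]
    push_cast
    ring

theorem prod_zpow_eq_zpow_sum {G ι : Type*} [CommGroup G] (s : Finset ι) (z : G) (f : ι → ℤ) :
    ∏ i ∈ s, z ^ f i = z ^ ∑ i ∈ s, f i := by
  classical
  induction s using Finset.induction_on with
  | empty => simp
  | insert i s hi ih => rw [Finset.prod_insert hi, Finset.sum_insert hi, ih, zpow_add]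

/-- The staircase exponents `N - 1, …, 1, 0`. -/
def staircase (N : ℕ) (j : Fin N) : ℤ := (j.rev : ℕ)

/-- The branching rule for alternants. Subtracting from each column a multiple of the next one
clears the last row except for its last entry; the other entries become (x_i - z) times geometric
sums over the interlacing intervals, and multilinearity in the columns expands the minor over
interlacing rows. -/
theorem alternant_succ (N : ℕ) (lam : Fin (N + 1) → ℤ) (hlam : Antitone lam)
    (x : Fin (N + 1) → Sˣ) :
    alternant x (lam + staircase (N + 1)) =
      (∏ i : Fin N, ((x i.castSucc : S) - x (Fin.last N))) *
      ∑ mu ∈ Fintype.piFinset fun i : Fin N => Finset.Icc (lam i.succ) (lam i.castSucc),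
        alternant (fun i => x i.castSucc) (mu + staircase N) *
          ((x (Fin.last N) ^ (∑ i, lam i - ∑ i, mu i) : Sˣ) : S) := by
  set z := x (Fin.last N) with hz
  set a := lam + staircase (N + 1) with ha
  set A : Matrix (Fin (N + 1)) (Fin (N + 1)) S := Matrix.of fun i j => ((x i ^ a j : Sˣ) : S) with hA
  set B : Matrix (Fin (N + 1)) (Fin (N + 1)) S := Matrix.of fun i =>
    (Fin.snoc (fun j : Fin N => A i j.castSucc -
      ((z ^ (a j.castSucc - a j.succ) : Sˣ) : S) * A i j.succ) (A i (Fin.last N)) :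
        Fin (N + 1) → S) with hB
  have hst : ∀ j : Fin N, staircase (N + 1) j.castSucc = staircase N j + 1 := by
    intro j; simp [staircase, Fin.rev_castSucc]
  have hst' : ∀ j : Fin N, staircase (N + 1) j.succ = staircase N j := by
    intro j; simp [staircase, Fin.rev_succ]
  have hdet : A.det = B.det := by
    -- The columns are reversed because the lemma on column operations uses the preceding column,
    -- while here the next column is subtracted.
    rw [← Matrix.det_submatrix_equiv_self Fin.revPerm A, ← Matrix.det_submatrix_equiv_self Fin.revPerm B]
    refine Matrix.det_eq_of_forall_col_eq_smul_add_pred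
      (fun j => ((z ^ (a j.rev.castSucc - a j.rev.succ) : Sˣ) : S)) ?_ ?_
    · intro i
      simp [hB]
    · intro i j
      simp only [Matrix.submatrix_apply, Fin.revPerm_apply, Fin.rev_succ, Fin.rev_castSucc, hB,
        Matrix.of_apply, Fin.snoc_castSucc]
      ring
  have hlast : ∀ j : Fin N, B (Fin.last N) j.castSucc = 0 := by
    intro j
    simp only [hB, hA, Matrix.of_apply, Fin.snoc_castSucc, ← hz]
    rw [← Units.val_mul, ← zpow_add, sub_add_cancel, sub_self]
  have hexp : B.det = ((z ^ a (Fin.last N) : Sˣ) : S) *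
      (B.submatrix Fin.castSucc Fin.castSucc).det := by
    rw [Matrix.det_succ_row B (Fin.last N), Fin.sum_univ_castSucc, Finset.sum_eq_zero]
    · rw [zero_add, Fin.succAbove_last]
      simp [hB, hA, ← hz, ← two_mul]
    · intro j _
      simp [hlast]
  have hsub : B.submatrix Fin.castSucc Fin.castSucc = Matrix.of fun i j =>
      ((x i.castSucc : S) - z) * ∑ m ∈ Finset.Icc (lam j.succ) (lam j.castSucc),
        ((x i.castSucc ^ (m + staircase N j) * z ^ (lam j.castSucc - m) : Sˣ) : S) := by
    ext i j
    have hle : lam j.succ ≤ lam j.castSucc + 1 :=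
      (hlam (Fin.castSucc_lt_succ (i := j)).le).trans (by omega)
    rw [Matrix.of_apply, sum_Icc_telescope _ _ _ hle]
    simp only [Matrix.submatrix_apply, hB, hA, Matrix.of_apply, Fin.snoc_castSucc, ha, Pi.add_apply,
      hst, hst', Units.val_mul]
    congr 3
    · ring
    · congr 1
      ring
  have hmul : (B.submatrix Fin.castSucc Fin.castSucc).det =
      (∏ i : Fin N, ((x i.castSucc : S) - z)) *
      ∑ mu ∈ Fintype.piFinset fun i : Fin N => Finset.Icc (lam i.succ) (lam i.castSucc),
        Matrix.det (Matrix.of fun i j : Fin N =>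
          ((x i.castSucc ^ (mu j + staircase N j) * z ^ (lam j.castSucc - mu j) : Sˣ) : S)) := by
    rw [hsub]
    refine (Matrix.det_mul_column (fun i : Fin N => ((x i.castSucc : S) - z))
      (Matrix.of fun i j => ∑ m ∈ Finset.Icc (lam j.succ) (lam j.castSucc),
        ((x i.castSucc ^ (m + staircase N j) * z ^ (lam j.castSucc - m) : Sˣ) : S))).trans ?_
    congr 1
    have h1 := (Matrix.detRowAlternating (n := Fin N) (R := S)).toMultilinearMap.map_sum_finset
      (A := fun j : Fin N => Finset.Icc (lam j.succ) (lam j.castSucc))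
      (g := fun j m i => ((x i.castSucc ^ (m + staircase N j) * z ^ (lam j.castSucc - m) : Sˣ) : S))
    rw [← Matrix.det_transpose]
    refine Eq.trans ?_ (h1.trans ?_)
    · show _ = Matrix.det _
      congr 1
      ext j i
      simp [Matrix.transpose_apply, Finset.sum_apply]
    · refine Finset.sum_congr rfl fun mu _ => ?_
      show Matrix.det _ = _
      rw [← Matrix.det_transpose]
      rfl
  show A.det = _
  rw [hdet, hexp, hmul, mul_left_comm, Finset.mul_sum]
  congr 1
  refine Finset.sum_congr rfl fun mu _ => ?_
  have h2 : Matrix.det (Matrix.of fun i j : Fin N =>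
      ((x i.castSucc ^ (mu j + staircase N j) * z ^ (lam j.castSucc - mu j) : Sˣ) : S)) =
      (∏ j : Fin N, ((z ^ (lam j.castSucc - mu j) : Sˣ) : S)) *
        alternant (fun i => x i.castSucc) (mu + staircase N) := by
    rw [alternant, ← Matrix.det_mul_row]
    congr 1
    ext i j
    simp [mul_comm]
  rw [h2, ← mul_assoc, mul_comm (alternant _ _)]
  congr 1
  rw [← Units.coe_prod, ← Units.val_mul]
  congr 1
  rw [prod_zpow_eq_zpow_sum, ← zpow_add]
  congr 1
  rw [Fin.sum_univ_castSucc, Finset.sum_sub_distrib, ha]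
  simp [staircase]
  ring

/-- Schur polynomials obey the same branching as alternants, up to the product of the x_i - z. That
product is identified by the case lam = 0 of `alternant_succ`, in which 0 is the only interlacing
row; no division is needed. -/
theorem schurUnits_mul_alternant (N : ℕ) (lam : Fin N → ℤ) (hlam : Antitone lam)
    (x : Fin N → Sˣ) :
    schurUnits N lam x * alternant x (staircase N) = alternant x (lam + staircase N) := by
  induction N with
  | zero => simp [schurUnits, schurWeights, alternant]
  | succ N ih =>
    have h0 := alternant_succ N (0 : Fin (N + 1) → ℤ) (fun _ _ _ => le_rfl) x
    rw [show Fintype.piFinset (fun i : Fin N => Finset.Icc ((0 : Fin (N + 1) → ℤ) i.succ)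
      ((0 : Fin (N + 1) → ℤ) i.castSucc)) = {0} by
        ext mu; simp [funext_iff]] at h0
    simp only [zero_add, Finset.sum_singleton, Pi.zero_apply, Finset.sum_const_zero, sub_self,
      zpow_zero, Units.val_one, mul_one] at h0
    rw [alternant_succ N lam hlam x, h0, schurUnits_succ, Finset.sum_mul, Finset.mul_sum]
    refine Finset.sum_congr rfl fun mu hmu => ?_
    rw [Fintype.mem_piFinset] at hmu
    have hmu' : Antitone mu := by
      refine antitone_iff_forall_lt.2 fun i j hij => ?_
      have h1 := (Finset.mem_Icc.1 (hmu j)).2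
      have h2 := (Finset.mem_Icc.1 (hmu i)).1
      refine h1.trans (le_trans (hlam ?_) h2)
      rw [Fin.le_def]
      simpa using hij
    rw [← ih mu hmu']
    ring

end Schur

/-! ### Taylor coefficients of Schur polynomials at (1,…,1). -/

section BinomialMoments

/-- Binomial coefficients with integer entries, zero for a negative lower entry. -/
noncomputable def intChoose (w n : ℤ) : ℤ := if n < 0 then 0 else Ring.choose w n.toNat

theorem intChoose_of_neg (w : ℤ) {n : ℤ} (hn : n < 0) : intChoose w n = 0 := if_pos hn

theorem intChoose_natCast (w : ℤ) (n : ℕ) : intChoose w n = Ring.choose w n := by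
  simp [intChoose]

theorem intChoose_pascal (w n : ℤ) :
    intChoose (w + 1) n - intChoose w n = intChoose w (n - 1) := by
  rcases lt_trichotomy n 0 with h | h | h
  · simp [intChoose, h, h.trans_le (zero_le_one)]
  · subst h; simp [intChoose]
  · obtain ⟨k, rfl⟩ : ∃ k : ℕ, n = k + 1 := ⟨(n - 1).toNat, by omega⟩
    rw [add_sub_cancel_right, intChoose_natCast,
      show ((k : ℤ) + 1) = ((k + 1 : ℕ) : ℤ) by push_cast; rfl, intChoose_natCast,
      intChoose_natCast, Ring.choose_succ_succ]
    ring

variable {N : ℕ}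

/-- The functional taking `x^w` to the coefficient of `∏ (x_i - 1)^{m_i}` in its expansion. -/
noncomputable def binFunctional (m : Fin N → ℤ) : AddMonoidAlgebra ℤ (Fin N → ℤ) →+ ℤ where
  toFun f := f.coeff.sum fun w a => a * ∏ i, intChoose (w i) (m i)
  map_zero' := by simp
  map_add' f g := by
    rw [AddMonoidAlgebra.coeff_add]
    exact Finsupp.sum_add_index' (by simp) (by intros; ring)

theorem binFunctional_single (m w : Fin N → ℤ) (a : ℤ) :
    binFunctional m (AddMonoidAlgebra.single w a) = a * ∏ i, intChoose (w i) (m i) := by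
  show ((AddMonoidAlgebra.single w a).coeff.sum fun w a => a * ∏ i, intChoose (w i) (m i)) = _
  rw [AddMonoidAlgebra.coeff_single]
  simp

/-- The variables of the ring of integral Laurent polynomials. -/
noncomputable def laurentVar (i : Fin N) : (AddMonoidAlgebra ℤ (Fin N → ℤ))ˣ where
  val := AddMonoidAlgebra.single (Pi.single i 1) 1
  inv := AddMonoidAlgebra.single (-Pi.single i 1) 1
  val_inv := by rw [AddMonoidAlgebra.single_mul_single]; simp [AddMonoidAlgebra.one_def]
  inv_val := by rw [AddMonoidAlgebra.single_mul_single]; simp [AddMonoidAlgebra.one_def]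

theorem laurentVar_zpow (i : Fin N) (k : ℤ) :
    ((laurentVar i ^ k : (AddMonoidAlgebra ℤ (Fin N → ℤ))ˣ) : AddMonoidAlgebra ℤ (Fin N → ℤ)) =
      AddMonoidAlgebra.single (Pi.single i k) 1 := by
  have hn : ∀ n : ℕ, ((laurentVar i : (AddMonoidAlgebra ℤ (Fin N → ℤ))ˣ) :
      AddMonoidAlgebra ℤ (Fin N → ℤ)) ^ n = AddMonoidAlgebra.single (Pi.single i (n : ℤ)) 1 := by
    intro n
    rw [show ((laurentVar i : (AddMonoidAlgebra ℤ (Fin N → ℤ))ˣ) :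
      AddMonoidAlgebra ℤ (Fin N → ℤ)) = AddMonoidAlgebra.single (Pi.single i 1) 1 from rfl,
      AddMonoidAlgebra.single_pow, one_pow, ← Pi.single_smul]
    simp
  obtain ⟨n, rfl | rfl⟩ := k.eq_nat_or_neg
  · rw [zpow_natCast, Units.val_pow_eq_pow_val, hn]
  · rw [zpow_neg, zpow_natCast]
    refine Units.inv_eq_of_mul_eq_one_right ?_
    rw [Units.val_pow_eq_pow_val, hn, AddMonoidAlgebra.single_mul_single, ← Pi.single_add]
    simp [AddMonoidAlgebra.one_def]

theorem laurentVar_prod (w : Fin N → ℤ) :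
    ((∏ i, laurentVar i ^ w i : (AddMonoidAlgebra ℤ (Fin N → ℤ))ˣ) :
      AddMonoidAlgebra ℤ (Fin N → ℤ)) = AddMonoidAlgebra.single w 1 := by
  rw [Units.coe_prod]
  simp_rw [laurentVar_zpow]
  have : ∀ s : Finset (Fin N), ∏ i ∈ s, (AddMonoidAlgebra.single (Pi.single i (w i)) 1 :
      AddMonoidAlgebra ℤ (Fin N → ℤ)) = AddMonoidAlgebra.single (∑ i ∈ s, Pi.single i (w i)) 1 := by
    intro s
    induction s using Finset.induction_on with
    | empty => simp [AddMonoidAlgebra.one_def]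
    | insert i s hi ih =>
      rw [Finset.prod_insert hi, Finset.sum_insert hi, ih, AddMonoidAlgebra.single_mul_single, one_mul]
  rw [this, Finset.univ_sum_single]

/-- Multiplication by y_i = x_i - 1 lowers the extracted exponent by one; on monomials this is
Pascal's rule. -/
theorem binFunctional_sub_one_mul (m : Fin N → ℤ) (i : Fin N)
    (f : AddMonoidAlgebra ℤ (Fin N → ℤ)) :
    binFunctional m (((laurentVar i : AddMonoidAlgebra ℤ (Fin N → ℤ)) - 1) * f) =
      binFunctional (m - Pi.single i 1) f := by
  induction f using AddMonoidAlgebra.induction_linear with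
  | zero => simp
  | add f g hf hg => rw [mul_add, map_add, map_add, hf, hg]
  | single w a =>
    rw [sub_mul, one_mul, map_sub, show (laurentVar i : AddMonoidAlgebra ℤ (Fin N → ℤ)) =
      AddMonoidAlgebra.single (Pi.single i 1) 1 from rfl, AddMonoidAlgebra.single_mul_single,
      binFunctional_single, binFunctional_single, binFunctional_single, one_mul, ← mul_sub]
    congr 1
    rw [← Finset.mul_prod_erase _ _ (Finset.mem_univ i), ← Finset.mul_prod_erase _ _ (Finset.mem_univ i),
      ← Finset.mul_prod_erase _ _ (Finset.mem_univ i)]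
    have h : ∀ j ∈ Finset.univ.erase i, intChoose (w j) ((m - Pi.single i 1 : Fin N → ℤ) j) =
        intChoose (w j) (m j) := by
      intro j hj
      simp [Finset.ne_of_mem_erase hj]
    have h' : ∀ j ∈ Finset.univ.erase i, intChoose ((Pi.single i 1 + w : Fin N → ℤ) j) (m j) =
        intChoose (w j) (m j) := by
      intro j hj
      simp [Finset.ne_of_mem_erase hj]
    rw [Finset.prod_congr rfl h, Finset.prod_congr rfl h', ← sub_mul]
    congr 1
    simp [add_comm (1 : ℤ), intChoose_pascal]

theorem binFunctional_sub_one_pow_mul (m : Fin N → ℤ) (i : Fin N) (k : ℕ)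
    (f : AddMonoidAlgebra ℤ (Fin N → ℤ)) :
    binFunctional m (((laurentVar i : AddMonoidAlgebra ℤ (Fin N → ℤ)) - 1) ^ k * f) =
      binFunctional (m - Pi.single i (k : ℤ)) f := by
  induction k generalizing m with
  | zero => simp
  | succ k ih =>
    rw [pow_succ', mul_assoc, binFunctional_sub_one_mul, ih, sub_sub, ← Pi.single_add]
    push_cast
    rw [add_comm (1 : ℤ)]

theorem binFunctional_prod_sub_one_pow_mul (m : Fin N → ℤ) (k : Fin N → ℕ)
    (f : AddMonoidAlgebra ℤ (Fin N → ℤ)) :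
    binFunctional m ((∏ i, ((laurentVar i : AddMonoidAlgebra ℤ (Fin N → ℤ)) - 1) ^ k i) * f) =
      binFunctional (fun i => m i - k i) f := by
  have h : ∀ (s : Finset (Fin N)) (m : Fin N → ℤ),
      binFunctional m ((∏ i ∈ s, ((laurentVar i : AddMonoidAlgebra ℤ (Fin N → ℤ)) - 1) ^ k i) * f) =
      binFunctional (m - ∑ i ∈ s, Pi.single i (k i : ℤ)) f := by
    intro s
    induction s using Finset.induction_on with
    | empty => simp
    | insert i s hi ih =>
      intro m
      rw [Finset.prod_insert hi, Finset.sum_insert hi, mul_assoc, binFunctional_sub_one_pow_mul, ih,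
        sub_sub]
  rw [h, Finset.univ_sum_single]
  rfl

/-- The coefficients of the expansion of the Schur polynomial at the point `(1,…,1)`. -/
noncomputable def schurTaylor (lam : Fin N → ℤ) (n : Fin N → ℤ) : ℤ :=
  ((schurWeights N lam).map fun w => ∏ i, intChoose (w i) (n i)).sum

theorem schurTaylor_of_neg (lam n : Fin N → ℤ) {i : Fin N} (h : n i < 0) :
    schurTaylor lam n = 0 := by
  rw [schurTaylor]
  refine Multiset.sum_eq_zero fun x hx => ?_
  obtain ⟨w, -, rfl⟩ := Multiset.mem_map.1 hx
  exact Finset.prod_eq_zero (Finset.mem_univ i) (intChoose_of_neg _ h)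

theorem binFunctional_schurUnits (lam n : Fin N → ℤ) :
    binFunctional n (schurUnits N lam laurentVar) = schurTaylor lam n := by
  rw [schurUnits, schurTaylor, map_multiset_sum, Multiset.map_map]
  congr 1
  refine Multiset.map_congr rfl fun w _ => ?_
  simp only [Function.comp_apply]
  rw [laurentVar_prod, binFunctional_single, one_mul]

/-- The alternating sum over the permutations of the staircase. -/
noncomputable def staircaseAlt {V : Type*} [AddCommGroup V] (c : (Fin N → ℤ) → V)
    (m : Fin N → ℤ) : V :=
  ∑ σ : Equiv.Perm (Fin N), ((Equiv.Perm.sign σ : ℤˣ) : ℤ) • c fun i => m i - staircase N (σ i)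

/-- The Taylor coefficient functional is applied to Weyl's formula. Vandermonde determinants are
translation invariant, so the denominator is a signed sum of monomials in the x_i - 1, which only
shift the extracted exponents; the numerator gives binomial coefficients. -/
theorem staircaseAlt_schurTaylor (lam : Fin N → ℤ) (hlam : Antitone lam) (m : Fin N → ℤ) :
    staircaseAlt (schurTaylor lam) m =
      Matrix.det (Matrix.of fun i j => intChoose (lam i + staircase N i) (m j)) := by
  have h := congrArg (binFunctional m) (schurUnits_mul_alternant N lam hlam laurentVar)
  have h1 : alternant laurentVar (staircase N) =
      Matrix.det (Matrix.of fun i j : Fin N =>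
        ((laurentVar i : AddMonoidAlgebra ℤ (Fin N → ℤ)) - 1) ^ (j.rev : ℕ)) := by
    have h2 := Matrix.det_vandermonde_sub
      (fun i : Fin N => (laurentVar i : AddMonoidAlgebra ℤ (Fin N → ℤ))) 1
    have h3 := congrArg (fun z => (((Equiv.Perm.sign (Fin.revPerm : Equiv.Perm (Fin N)) : ℤˣ) : ℤ) :
      AddMonoidAlgebra ℤ (Fin N → ℤ)) * z) h2
    simp only [← Matrix.det_permute'] at h3
    rw [alternant]
    refine Eq.trans ?_ (h3.symm.trans ?_)
    · congr 1
    · rfl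
  rw [mul_comm, h1, ← Matrix.det_transpose, Matrix.det_apply', alternant, ← Matrix.det_transpose,
    Matrix.det_apply', Finset.sum_mul, map_sum, map_sum] at h
  rw [staircaseAlt, Matrix.det_apply']
  refine Eq.trans (Finset.sum_congr rfl fun σ _ => ?_) (h.trans (Finset.sum_congr rfl fun σ _ => ?_))
  · rw [mul_assoc, ← zsmul_eq_mul, map_zsmul]
    congr 1
    simp only [Matrix.transpose_apply, Matrix.of_apply]
    rw [binFunctional_prod_sub_one_pow_mul, binFunctional_schurUnits]
    rfl
  · rw [← zsmul_eq_mul, map_zsmul, smul_eq_mul]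
    congr 1
    simp only [Matrix.transpose_apply, Matrix.of_apply]
    rw [← Units.coe_prod, laurentVar_prod, binFunctional_single, one_mul]
    rfl

theorem staircase_injective : Function.Injective (staircase N) := by
  intro i j h
  simp only [staircase, Nat.cast_inj] at h
  exact Fin.rev_injective (Fin.ext h)

/-- The strict rearrangement inequality, from the positivity of the sum of the squares of δ_{σ(i)} -
δ_i. -/
theorem sum_staircase_mul_lt {σ : Equiv.Perm (Fin N)} (hσ : σ ≠ 1) :
    ∑ i, staircase N (σ i) * staircase N i < ∑ i, staircase N i * staircase N i := by
  obtain ⟨i, hi⟩ : ∃ i, σ i ≠ i := by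
    by_contra! h
    exact hσ (Equiv.ext h)
  have h1 : 0 < ∑ i, (staircase N (σ i) - staircase N i) ^ 2 := by
    refine Finset.sum_pos' (fun j _ => sq_nonneg _) ⟨i, Finset.mem_univ i, ?_⟩
    exact sq_pos_of_ne_zero (sub_ne_zero.2 fun h => hi (staircase_injective h))
  have h2 : ∑ i, (staircase N (σ i) - staircase N i) ^ 2 =
      ∑ i, staircase N (σ i) * staircase N (σ i) + ∑ i, staircase N i * staircase N i -
        2 * ∑ i, staircase N (σ i) * staircase N i := by
    rw [Finset.mul_sum, ← Finset.sum_add_distrib, ← Finset.sum_sub_distrib]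
    exact Finset.sum_congr rfl fun i _ => by ring
  rw [Equiv.sum_comp σ fun i => staircase N i * staircase N i] at h2
  omega

/-- A function supported on the nonnegative exponents is determined by its alternating sums. -/
theorem eq_zero_of_staircaseAlt_eq_zero {V : Type*} [AddCommGroup V] {c : (Fin N → ℤ) → V}
    (hneg : ∀ n i, n i < 0 → c n = 0) (h : ∀ m, staircaseAlt c m = 0) (n : Fin N → ℤ) :
    c n = 0 := by
  -- With δ the staircase, N ∑ n_i - ∑ n_i δ_i is nonnegative on nonnegative exponents. In the
  -- alternating sum at n + δ, a permutation σ ≠ 1 gives the exponent n + δ - δ∘σ, with the same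
  -- total but a larger ∑ n_i δ_i, so the identity term is the only one not yet known to vanish.
  induction hk : (N * ∑ i, n i - ∑ i, n i * staircase N i).toNat using Nat.strong_induction_on
    generalizing n with
  | _ k ih =>
    by_cases hn : ∃ i, n i < 0
    · exact hneg n _ hn.choose_spec
    push Not at hn
    have hpos : ∀ n : Fin N → ℤ, (∀ i, 0 ≤ n i) → 0 ≤ N * ∑ i, n i - ∑ i, n i * staircase N i := by
      intro n hn
      rw [Finset.mul_sum, ← Finset.sum_sub_distrib]
      refine Finset.sum_nonneg fun i _ => ?_
      have h1 : staircase N i ≤ N := by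
        simp only [staircase]; exact_mod_cast i.rev.2.le
      nlinarith [hn i]
    have h1 := h (fun i => n i + staircase N i)
    rw [staircaseAlt, ← Finset.add_sum_erase _ _ (Finset.mem_univ 1), Finset.sum_eq_zero] at h1
    · simpa using h1
    intro σ hσ
    have hσ := Finset.ne_of_mem_erase hσ
    set n' : Fin N → ℤ := fun i => n i + staircase N i - staircase N (σ i) with hn'
    by_cases hneg' : ∃ i, n' i < 0
    · rw [hneg n' _ hneg'.choose_spec, smul_zero]
    push Not at hneg'
    have e1 : ∑ i, n' i = ∑ i, n i := by
      simp only [hn', Finset.sum_sub_distrib, Finset.sum_add_distrib]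
      rw [Equiv.sum_comp σ (staircase N)]
      ring
    have e2 : ∑ i, n i * staircase N i < ∑ i, n' i * staircase N i := by
      simp only [hn', sub_mul, add_mul, Finset.sum_sub_distrib, Finset.sum_add_distrib]
      linarith [sum_staircase_mul_lt hσ]
    have p1 := hpos n hn
    have p2 := hpos n' hneg'
    rw [ih _ ?_ n' rfl, smul_zero]
    rw [← hk, e1]
    rw [e1] at p2
    omega

theorem staircaseAlt_comp_perm {V : Type*} [AddCommGroup V] (c : (Fin N → ℤ) → V)
    (τ : Equiv.Perm (Fin N)) (m : Fin N → ℤ) :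
    staircaseAlt (fun n => c (n ∘ τ)) m =
      ((Equiv.Perm.sign τ : ℤˣ) : ℤ) • staircaseAlt c (m ∘ τ) := by
  rw [staircaseAlt, staircaseAlt, Finset.smul_sum]
  refine Fintype.sum_equiv (Equiv.mulRight τ) _ _ fun σ => ?_
  rw [smul_smul]
  simp only [Equiv.coe_mulRight, Equiv.Perm.sign_mul, Units.val_mul]
  rw [mul_left_comm, ← sq, ← Units.val_pow_eq_pow_val, Int.units_sq, Units.val_one, mul_one]
  rfl

theorem staircaseAlt_sub {V : Type*} [AddCommGroup V] (c c' : (Fin N → ℤ) → V) (m : Fin N → ℤ) :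
    staircaseAlt (fun n => c n - c' n) m = staircaseAlt c m - staircaseAlt c' m := by
  simp only [staircaseAlt, smul_sub, Finset.sum_sub_distrib]

/-- The definition by patterns does not show the symmetry. It follows because permuting the
exponents permutes the columns of the determinant of binomials, and alternating sums determine the
coefficients. -/
theorem schurTaylor_comp_perm (lam : Fin N → ℤ) (hlam : Antitone lam) (τ : Equiv.Perm (Fin N))
    (n : Fin N → ℤ) : schurTaylor lam (n ∘ τ) = schurTaylor lam n := by
  rw [← sub_eq_zero]
  refine eq_zero_of_staircaseAlt_eq_zero
    (c := fun n => schurTaylor lam (n ∘ τ) - schurTaylor lam n) ?_ ?_ n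
  · intro n i hi
    rw [schurTaylor_of_neg lam n hi, schurTaylor_of_neg lam (n ∘ τ) (i := τ.symm i) (by simpa),
      sub_zero]
  · intro m
    rw [staircaseAlt_sub, staircaseAlt_comp_perm, staircaseAlt_schurTaylor lam hlam,
      staircaseAlt_schurTaylor lam hlam, sub_eq_zero]
    have := Matrix.det_permute' τ (Matrix.of fun i j => intChoose (lam i + staircase N i) (m j))
    rw [show (Matrix.of fun i j => intChoose (lam i + staircase N i) ((m ∘ τ) j)) =
      (Matrix.of fun i j => intChoose (lam i + staircase N i) (m j)).submatrix id τ from rfl, this]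
    rw [smul_eq_mul, ← mul_assoc]
    simp [← sq, ← Units.val_pow_eq_pow_val]

end BinomialMoments

/-! ### Coefficients of formal exponentials and logarithms. -/

section ExpCoefficients

variable {R : Type*} [CommRing R] [Algebra ℚ R]

/-- The coefficients of `exp (∑_{m ≥ 1} b_m y^m)`. -/
noncomputable def expSeq (b : ℕ → R) : ℕ → R
  | 0 => 1
  | n + 1 => ((n + 1 : ℚ)⁻¹) • ∑ j : Fin (n + 1), ((j : ℕ) + 1 : R) * b (j + 1) * expSeq b (n - j)

@[simp] theorem expSeq_zero (b : ℕ → R) : expSeq b 0 = 1 := by rw [expSeq]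

theorem natCast_mul_inv_smul (n : ℕ) (x : R) : (n + 1 : R) * ((n + 1 : ℚ)⁻¹ • x) = x := by
  have : (n + 1 : R) = algebraMap ℚ R (n + 1 : ℚ) := by simp
  rw [this, ← Algebra.smul_def, smul_smul, mul_inv_cancel₀ (by positivity), one_smul]

theorem natCast_succ_mul_cancel {n : ℕ} {x y : R} (h : (n + 1 : R) * x = (n + 1 : R) * y) :
    x = y := by
  have h1 : ∀ x : R, (n + 1 : ℚ)⁻¹ • ((n + 1 : R) * x) = x := by
    intro x
    rw [← mul_smul_comm, natCast_mul_inv_smul]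
  rw [← h1 x, h, h1]

theorem expSeq_succ (b : ℕ → R) (n : ℕ) :
    (n + 1 : R) * expSeq b (n + 1) =
      ∑ j ∈ Finset.range (n + 1), (j + 1 : R) * b (j + 1) * expSeq b (n - j) := by
  rw [expSeq, natCast_mul_inv_smul,
    ← Fin.sum_univ_eq_sum_range fun j => (j + 1 : R) * b (j + 1) * expSeq b (n - j)]

/-- This is f' = b' f with f(0) = 1 in coefficients; over a ℚ-algebra it has one solution. -/
theorem expSeq_unique {b f : ℕ → R} (h0 : f 0 = 1)
    (h : ∀ n : ℕ, (n + 1 : R) * f (n + 1) =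
      ∑ j ∈ Finset.range (n + 1), (j + 1 : R) * b (j + 1) * f (n - j)) (n : ℕ) :
    f n = expSeq b n := by
  induction n using Nat.strong_induction_on with
  | _ n ih =>
    cases n with
    | zero => simp [h0]
    | succ n =>
      refine natCast_succ_mul_cancel (n := n) ?_
      rw [h, expSeq_succ]
      refine Finset.sum_congr rfl fun j _ => ?_
      rw [ih _ (by omega)]

theorem map_expSeq {R' : Type*} [CommRing R'] [Algebra ℚ R'] (φ : R →+* R') (b : ℕ → R) (n : ℕ) :
    φ (expSeq b n) = expSeq (fun m => φ (b m)) n := by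
  refine expSeq_unique (f := fun n => φ (expSeq b n)) (by simp) (fun n => ?_) n
  have := congrArg φ (expSeq_succ b n)
  simpa [map_sum] using this

/-- `exp (∑_{m ≥ 1} b_m y^m)`. -/
noncomputable def expGen (b : ℕ → R) : PowerSeries R := PowerSeries.mk (expSeq b)

/-- The derivative of `∑_{m ≥ 1} b_m y^m`. -/
noncomputable def derivGen {R : Type*} [CommRing R] (b : ℕ → R) : PowerSeries R :=
  PowerSeries.mk fun j => (j + 1 : R) * b (j + 1)

theorem derivative_eq_derivGen_mul_iff {R : Type*} [CommRing R] (b : ℕ → R) (f : PowerSeries R) :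
    PowerSeries.derivative R f = derivGen b * f ↔ ∀ n : ℕ,
      (n + 1 : R) * PowerSeries.coeff (n + 1) f =
        ∑ j ∈ Finset.range (n + 1), (j + 1 : R) * b (j + 1) * PowerSeries.coeff (n - j) f := by
  rw [PowerSeries.ext_iff]
  refine forall_congr' fun n => ?_
  rw [PowerSeries.coeff_derivative, PowerSeries.coeff_mul,
    Finset.Nat.sum_antidiagonal_eq_sum_range_succ_mk, mul_comm]
  simp [derivGen]

theorem derivative_expGen (b : ℕ → R) :
    PowerSeries.derivative R (expGen b) = derivGen b * expGen b := by
  rw [derivative_eq_derivGen_mul_iff]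
  intro n
  simpa [expGen] using expSeq_succ b n

theorem expGen_unique {b : ℕ → R} {f : PowerSeries R} (h0 : PowerSeries.constantCoeff f = 1)
    (h : PowerSeries.derivative R f = derivGen b * f) : f = expGen b := by
  ext n
  rw [derivative_eq_derivGen_mul_iff] at h
  rw [expGen, PowerSeries.coeff_mk]
  exact expSeq_unique (f := fun n => PowerSeries.coeff n f) (by simpa using h0) h n

/-- `expSeq` with integer indices. -/
noncomputable def expInt (b : ℕ → R) (n : ℤ) : R := if n < 0 then 0 else expSeq b n.toNat

theorem expInt_of_neg (b : ℕ → R) {n : ℤ} (h : n < 0) : expInt b n = 0 := if_pos h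

@[simp] theorem expInt_natCast (b : ℕ → R) (n : ℕ) : expInt b n = expSeq b n := by
  simp [expInt]

/-- The sequence `b` with `expSeq b = e`. -/
noncomputable def logSeq (e : ℕ → R) : ℕ → R
  | 0 => 0
  | n + 1 => e (n + 1) -
      ((n + 1 : ℚ)⁻¹) • ∑ j : Fin n, ((j : ℕ) + 1 : R) * logSeq e (j + 1) * e (n - j)

theorem expSeq_logSeq {e : ℕ → R} (h0 : e 0 = 1) (n : ℕ) : expSeq (logSeq e) n = e n := by
  refine (expSeq_unique h0 (fun n => ?_) n).symm
  rw [Finset.sum_range_succ, logSeq, Nat.sub_self, h0, mul_one, mul_sub, natCast_mul_inv_smul,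
    ← Fin.sum_univ_eq_sum_range fun j => (j + 1 : R) * logSeq e (j + 1) * e (n - j)]
  ring

end ExpCoefficients

/-! ### Encoding symmetric Taylor coefficients by a functional on ℝ[β₁, β₂, …]. -/

section SchurFunctional

/-- The variables of a polynomial ring, the one of index zero being replaced by `0`. -/
noncomputable def varSeq (K : Type*) [CommRing K] : ℕ → MvPolynomial ℕ+ K
  | 0 => 0
  | n + 1 => MvPolynomial.X n.succPNat

theorem varSeq_coe (K : Type*) [CommRing K] (m : ℕ+) : varSeq K m = MvPolynomial.X m := by
  obtain ⟨n, hn⟩ : ∃ n : ℕ, (m : ℕ) = n + 1 := ⟨m - 1, by have := m.pos; omega⟩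
  rw [hn, varSeq]
  congr 1
  exact PNat.eq (by simp [hn])

/-- The variables of a polynomial ring, the one of index zero being replaced by `1`. -/
noncomputable def posVar : ℕ → MvPolynomial ℕ+ ℝ
  | 0 => 1
  | n + 1 => MvPolynomial.X n.succPNat

/-- The exponent of `posVar n`. -/
noncomputable def posVarExponent : ℕ → (ℕ+ →₀ ℕ)
  | 0 => 0
  | n + 1 => Finsupp.single n.succPNat 1

theorem posVarExponent_apply (n : ℕ) (v : ℕ+) :
    posVarExponent n v = if (v : ℕ) = n then 1 else 0 := by
  cases n with
  | zero => simp [posVarExponent]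
  | succ n =>
    rw [posVarExponent, Finsupp.single_apply]
    congr 1
    rw [eq_iff_iff, ← PNat.coe_inj]
    exact eq_comm

/-- The exponent of `∏ posVar (n j)`. -/
noncomputable def posExponent {N : ℕ} (n : Fin N → ℕ) : ℕ+ →₀ ℕ :=
  ∑ j, posVarExponent (n j)

theorem prod_posVar {N : ℕ} (n : Fin N → ℕ) :
    ∏ j, posVar (n j) = MvPolynomial.monomial (posExponent n) (1 : ℝ) := by
  rw [posExponent, MvPolynomial.monomial_sum_one]
  refine Finset.prod_congr rfl fun j _ => ?_
  cases n j with
  | zero => simp [posVar, posVarExponent]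
  | succ n => simp [posVar, posVarExponent, MvPolynomial.X]

/-- The monomial forgets the zero entries, because `posVar 0 = 1`, but the number N of factors is
fixed and so their multiplicity is recovered. This makes `posFunctional` well defined on symmetric
data. -/
theorem exists_perm_of_posExponent_eq {N : ℕ} {n n' : Fin N → ℕ}
    (h : posExponent n = posExponent n') : ∃ σ : Equiv.Perm (Fin N), n = n' ∘ σ := by
  have hcount : ∀ (n : Fin N → ℕ) (v : ℕ+),
      posExponent n v = (Finset.univ.val.map n).count (v : ℕ) := by
    intro n v
    rw [posExponent, Finsupp.finsetSum_apply, Multiset.count_map, ← Finset.filter_val,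
      Finset.card_val, Finset.card_filter]
    exact Finset.sum_congr rfl fun j _ => posVarExponent_apply _ _
  have hm : Finset.univ.val.map n = Finset.univ.val.map n' := by
    have hf : (Finset.univ.val.map n).filter (fun k => k ≠ 0) =
        (Finset.univ.val.map n').filter (fun k => k ≠ 0) := by
      ext v
      by_cases hv : v = 0
      · rw [Multiset.count_filter_of_neg (by simpa using hv),
          Multiset.count_filter_of_neg (by simpa using hv)]
      · rw [Multiset.count_filter_of_pos (p := fun k => k ≠ 0) hv,
          Multiset.count_filter_of_pos (p := fun k => k ≠ 0) hv]
        have := DFunLike.congr_fun h (Nat.toPNat v (Nat.pos_of_ne_zero hv))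
        rw [hcount, hcount] at this
        exact this
    have hz : ∀ s : Multiset ℕ, s.filter (fun k => ¬ k ≠ 0) = Multiset.replicate
        (Multiset.card (s.filter (fun k => ¬ k ≠ 0))) 0 := by
      intro s
      refine Multiset.eq_replicate_card.2 fun b hb => ?_
      simpa using (Multiset.mem_filter.1 hb).2
    have hc : ∀ s : Multiset ℕ, Multiset.card (s.filter (fun k => ¬ k ≠ 0)) =
        Multiset.card s - Multiset.card (s.filter (fun k => k ≠ 0)) := by
      intro s
      have := congrArg Multiset.card (Multiset.filter_add_not (fun k => k ≠ 0) s)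
      rw [Multiset.card_add] at this
      omega
    rw [← Multiset.filter_add_not (fun k => k ≠ 0) (Finset.univ.val.map n),
      ← Multiset.filter_add_not (fun k => k ≠ 0) (Finset.univ.val.map n'), hf,
      hz (Finset.univ.val.map n), hz (Finset.univ.val.map n'), hc, hc, hf]
    simp
  obtain ⟨e, he⟩ := exists_equiv_of_map_eq hm
  let f := (Equiv.subtypeUnivEquiv fun i : Fin N => Finset.mem_univ i)
  refine ⟨(f.symm.trans e).trans f, funext fun i => ?_⟩
  exact (he (f.symm i)).symm

open Classical in
/-- The functional with the prescribed values on the products of `N` variables. -/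
noncomputable def posFunctional {N : ℕ} (T : (Fin N → ℕ) → ℝ) : MvPolynomial ℕ+ ℝ →ₗ[ℝ] ℝ :=
  (MvPolynomial.basisMonomials ℕ+ ℝ).constr ℝ fun α =>
    if h : ∃ n : Fin N → ℕ, posExponent n = α then T h.choose else 0

theorem posFunctional_prod {N : ℕ} {T : (Fin N → ℕ) → ℝ}
    (hT : ∀ (n : Fin N → ℕ) (σ : Equiv.Perm (Fin N)), T (n ∘ σ) = T n) (n : Fin N → ℕ) :
    posFunctional T (∏ j, posVar (n j)) = T n := by
  have h : ∃ n' : Fin N → ℕ, posExponent n' = posExponent n := ⟨n, rfl⟩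
  have hb : MvPolynomial.monomial (posExponent n) (1 : ℝ) =
    MvPolynomial.basisMonomials ℕ+ ℝ (posExponent n) := by rw [MvPolynomial.coe_basisMonomials]
  rw [prod_posVar, posFunctional, hb, Module.Basis.constr_basis, dif_pos h]
  obtain ⟨σ, hσ⟩ := exists_perm_of_posExponent_eq h.choose_spec
  rw [hσ, hT]

/-- The sequence of the variables `N β_m`. -/
noncomputable def scaledVar (N : ℕ) (m : ℕ) : MvPolynomial ℕ+ ℝ := (N : ℝ) • varSeq ℝ m

/-- The functional on `ℝ[β]` with prescribed values on the products of `N` of the elements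
`expSeq (scaledVar N)`. -/
noncomputable def expFunctional {N : ℕ} (T : (Fin N → ℕ) → ℝ) : MvPolynomial ℕ+ ℝ →ₗ[ℝ] ℝ :=
  posFunctional T ∘ₗ (MvPolynomial.aeval fun m : ℕ+ =>
    (N : ℝ)⁻¹ • logSeq posVar m).toLinearMap

/-- The substitution β_m ↦ N⁻¹ (log of the generating series of `posVar`)_m inverts the exponential:
it carries `expSeq (scaledVar N) n` to `posVar n`. -/
theorem expFunctional_prod {N : ℕ} {T : (Fin N → ℕ) → ℝ}
    (hT : ∀ (n : Fin N → ℕ) (σ : Equiv.Perm (Fin N)), T (n ∘ σ) = T n) (n : Fin N → ℕ) :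
    expFunctional T (∏ j, expSeq (scaledVar N) (n j)) = T n := by
  rw [← posFunctional_prod hT, expFunctional, LinearMap.comp_apply, AlgHom.toLinearMap_apply,
    map_prod]
  congr 1
  refine Finset.prod_congr rfl fun j _ => ?_
  have hN : (N : ℝ) ≠ 0 := by
    have := j.pos
    positivity
  set ψ := (MvPolynomial.aeval fun m : ℕ+ => (N : ℝ)⁻¹ • logSeq posVar m :
    MvPolynomial ℕ+ ℝ →ₐ[ℝ] MvPolynomial ℕ+ ℝ)
  have h1 := map_expSeq (ψ : MvPolynomial ℕ+ ℝ →+* MvPolynomial ℕ+ ℝ) (scaledVar N) (n j)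
  rw [RingHom.coe_coe] at h1
  rw [h1, ← expSeq_logSeq (e := posVar) (by simp [posVar])]
  congr 1
  funext m
  cases m with
  | zero => simp [scaledVar, logSeq, varSeq]
  | succ m =>
    rw [scaledVar, varSeq, map_smul, MvPolynomial.aeval_X, smul_smul, mul_inv_cancel₀ hN, one_smul,
      Nat.succPNat_coe]

end SchurFunctional

/-! ### Derivatives and base change of Laurent series. -/

section LaurentDerivative

variable {A : Type*} [CommRing A]

theorem laurent_coeff_derivative (f : LaurentSeries A) (n : ℤ) :
    (LaurentSeries.derivative A f).coeff n = (n + 1 : ℤ) • f.coeff (n + 1) := by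
  rw [LaurentSeries.derivative_apply, LaurentSeries.hasseDeriv_coeff]
  simp

theorem laurent_derivative_single_mul (a : ℤ) (g : LaurentSeries A) :
    LaurentSeries.derivative A (HahnSeries.single a 1 * g) =
      HahnSeries.single (a - 1) (a : A) * g +
        HahnSeries.single a 1 * LaurentSeries.derivative A g := by
  ext n
  rw [laurent_coeff_derivative, HahnSeries.coeff_single_mul, HahnSeries.coeff_add,
    HahnSeries.coeff_single_mul, HahnSeries.coeff_single_mul, laurent_coeff_derivative,
    show n - (a - 1) = n + 1 - a by ring, show n - a + 1 = n + 1 - a by ring]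
  simp only [zsmul_eq_mul]
  push_cast
  ring

theorem laurent_derivative_ofPowerSeries (F : PowerSeries A) :
    LaurentSeries.derivative A (HahnSeries.ofPowerSeries ℤ A F) =
      HahnSeries.ofPowerSeries ℤ A (PowerSeries.derivative A F) := by
  ext n
  rw [laurent_coeff_derivative]
  rcases lt_trichotomy n (-1) with h | rfl | h
  · rw [PowerSeries.coeff_coe, PowerSeries.coeff_coe, if_pos (by omega), if_pos (by omega),
      smul_zero]
  · rw [PowerSeries.coeff_coe (i := -1)]
    simp
  · obtain ⟨k, rfl⟩ : ∃ k : ℕ, n = k := ⟨n.toNat, by omega⟩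
    rw [show ((k : ℤ) + 1) = ((k + 1 : ℕ) : ℤ) by push_cast; rfl, LaurentSeries.coeff_coe_powerSeries,
      LaurentSeries.coeff_coe_powerSeries, PowerSeries.coeff_derivative]
    simp [mul_comm]

theorem laurent_exists_eq_single_mul (f : LaurentSeries A) :
    ∃ (a : ℤ) (F : PowerSeries A), f = HahnSeries.single a 1 * HahnSeries.ofPowerSeries ℤ A F :=
  ⟨f.order, f.powerSeriesPart, (LaurentSeries.single_order_mul_powerSeriesPart f).symm⟩

/-- Every Laurent series is a power of z times a power series, which reduces the Leibniz rule to
power series. -/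
theorem laurent_derivative_mul (f g : LaurentSeries A) :
    LaurentSeries.derivative A (f * g) =
      LaurentSeries.derivative A f * g + f * LaurentSeries.derivative A g := by
  obtain ⟨a, F, rfl⟩ := laurent_exists_eq_single_mul f
  obtain ⟨b, G, rfl⟩ := laurent_exists_eq_single_mul g
  rw [mul_mul_mul_comm, HahnSeries.single_mul_single, mul_one, ← map_mul,
    laurent_derivative_single_mul, laurent_derivative_single_mul, laurent_derivative_single_mul,
    laurent_derivative_ofPowerSeries, laurent_derivative_ofPowerSeries,
    laurent_derivative_ofPowerSeries, Derivation.leibniz, smul_eq_mul, smul_eq_mul, map_add,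
    map_mul, map_mul, map_mul]
  have h1 : (HahnSeries.single (a + b - 1) ((a + b : ℤ) : A) : LaurentSeries A) =
      HahnSeries.single (a - 1) (a : A) * HahnSeries.single b 1 +
        HahnSeries.single a 1 * HahnSeries.single (b - 1) (b : A) := by
    rw [HahnSeries.single_mul_single, HahnSeries.single_mul_single,
      show a - 1 + b = a + b - 1 by ring, show a + (b - 1) = a + b - 1 by ring,
      ← HahnSeries.single_add]
    simp
  have h2 : (HahnSeries.single (a + b) 1 : LaurentSeries A) =
      HahnSeries.single a 1 * HahnSeries.single b 1 := by
    rw [HahnSeries.single_mul_single, mul_one]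
  rw [h1, h2]
  ring

/-- The map of Laurent series induced by a ring homomorphism. -/
noncomputable def laurentMap {A' : Type*} [CommRing A'] (φ : A →+* A') :
    LaurentSeries A →+* LaurentSeries A' where
  toFun f := f.map φ
  map_zero' := by ext; simp
  map_one' := by
    ext n
    simp only [HahnSeries.map_coeff, HahnSeries.coeff_one]
    split_ifs <;> simp
  map_add' f g := by ext; simp
  map_mul' f g := HahnSeries.map_mul (φ : A →ₙ+* A')

theorem laurentMap_coeff {A' : Type*} [CommRing A'] (φ : A →+* A') (f : LaurentSeries A) (n : ℤ) :
    (laurentMap φ f).coeff n = φ (f.coeff n) := rfl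

theorem laurentMap_single {A' : Type*} [CommRing A'] (φ : A →+* A') (n : ℤ) (a : A) :
    laurentMap φ (HahnSeries.single n a) = HahnSeries.single n (φ a) := by
  ext m
  rw [laurentMap_coeff, HahnSeries.coeff_single, HahnSeries.coeff_single]
  split_ifs <;> simp

theorem laurentMap_ofPowerSeries {A' : Type*} [CommRing A'] (φ : A →+* A') (F : PowerSeries A) :
    laurentMap φ (HahnSeries.ofPowerSeries ℤ A F) =
      HahnSeries.ofPowerSeries ℤ A' (PowerSeries.map φ F) := by
  ext n
  rw [laurentMap_coeff, PowerSeries.coeff_coe, PowerSeries.coeff_coe]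
  split_ifs <;> simp

theorem laurentMap_derivative {A' : Type*} [CommRing A'] (φ : A →+* A') (f : LaurentSeries A) :
    laurentMap φ (LaurentSeries.derivative A f) =
      LaurentSeries.derivative A' (laurentMap φ f) := by
  ext n
  rw [laurentMap_coeff, laurent_coeff_derivative, laurent_coeff_derivative, laurentMap_coeff,
    map_zsmul]

end LaurentDerivative

/-! ### The iterates of ε∂ + x/z + B applied to 1. -/

section Twist

variable {A : Type*} [CommRing A] [Algebra ℚ A]

/-- `1/z`. -/
noncomputable def zInv (A : Type*) [CommRing A] : LaurentSeries A := HahnSeries.single (-1) 1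

theorem laurent_derivative_zInv_mul {A : Type*} [CommRing A] (f : LaurentSeries A) :
    LaurentSeries.derivative A (zInv A * f) =
      zInv A * LaurentSeries.derivative A f - zInv A ^ 2 * f := by
  rw [zInv, laurent_derivative_single_mul, HahnSeries.single_pow]
  have : (HahnSeries.single (-1 - 1) (((-1 : ℤ) : A)) : LaurentSeries A) =
      - HahnSeries.single (2 • (-1)) (1 ^ 2) := by
    rw [← HahnSeries.single_neg]
    simp
  rw [this]
  ring

/-- The sequence `T_0 = 1`, `(n + 1) T_{n+1} = ε T_n' + (x / z + B) T_n`. -/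
noncomputable def twist (ε x : A) (B : PowerSeries A) : ℕ → LaurentSeries A
  | 0 => 1
  | n + 1 => HahnSeries.C (algebraMap ℚ A (n + 1 : ℚ)⁻¹) * (HahnSeries.C ε * LaurentSeries.derivative A (twist ε x B n) +
      (HahnSeries.C x * zInv A + HahnSeries.ofPowerSeries ℤ A B) * twist ε x B n)

theorem natCast_mul_C_inv_mul (n : ℕ) (f : LaurentSeries A) :
    (n + 1 : LaurentSeries A) * (HahnSeries.C (algebraMap ℚ A (n + 1 : ℚ)⁻¹) * f) = f := by
  have h : (n + 1 : LaurentSeries A) = HahnSeries.C (algebraMap ℚ A (n + 1 : ℚ)) := by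
    rw [map_add, map_add, map_natCast, map_natCast, map_one, map_one]
  rw [h, ← mul_assoc, ← map_mul, ← map_mul, mul_inv_cancel₀ (by positivity), map_one, map_one,
    one_mul]

@[simp] theorem twist_zero (ε x : A) (B : PowerSeries A) : twist ε x B 0 = 1 := rfl

theorem twist_succ (ε x : A) (B : PowerSeries A) (n : ℕ) :
    (n + 1 : LaurentSeries A) * twist ε x B (n + 1) =
      HahnSeries.C ε * LaurentSeries.derivative A (twist ε x B n) +
      (HahnSeries.C x * zInv A + HahnSeries.ofPowerSeries ℤ A B) * twist ε x B n := by
  rw [twist, natCast_mul_C_inv_mul]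

/-- Formally ∑ T_n t^n = G(z+εt)/G(z) with ε G' = (x/z + B) G. Replacing x by x + ε multiplies G by
z, hence the generating series by 1 + ε t/z. The proof checks this recursively. -/
theorem twist_add (ε x : A) (B : PowerSeries A) (n : ℕ) :
    twist ε (x + ε) B (n + 1) =
      twist ε x B (n + 1) + HahnSeries.C ε * zInv A * twist ε x B n := by
  induction n with
  | zero =>
    refine natCast_succ_mul_cancel (n := 0) ?_
    rw [twist_succ, mul_add, twist_succ]
    simp only [twist_zero, map_add]
    push_cast
    ring
  | succ n ih =>
    refine natCast_succ_mul_cancel (n := n + 1) ?_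
    have h1 := twist_succ ε x B n
    have h2 : LaurentSeries.derivative A (HahnSeries.C ε * zInv A * twist ε x B n) =
        HahnSeries.C ε * (zInv A * LaurentSeries.derivative A (twist ε x B n) -
          zInv A ^ 2 * twist ε x B n) := by
      rw [mul_assoc, HahnSeries.C_mul_eq_smul, map_smul, laurent_derivative_zInv_mul,
        ← HahnSeries.C_mul_eq_smul]
    rw [twist_succ, mul_add, twist_succ, ih, map_add, map_add, h2]
    push_cast
    linear_combination -HahnSeries.C ε * zInv A * h1

theorem twist_zero_mem (ε : A) (B : PowerSeries A) (n : ℕ) :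
    ∃ F : PowerSeries A, twist ε 0 B n = HahnSeries.ofPowerSeries ℤ A F := by
  induction n with
  | zero => exact ⟨1, by simp⟩
  | succ n ih =>
    obtain ⟨F, hF⟩ := ih
    refine ⟨(n + 1 : ℚ)⁻¹ • (PowerSeries.C ε * PowerSeries.derivative A F + B * F), ?_⟩
    refine natCast_succ_mul_cancel (n := n) ?_
    rw [twist_succ, hF, laurent_derivative_ofPowerSeries]
    have := congrArg (HahnSeries.ofPowerSeries ℤ A)
      (natCast_mul_inv_smul n (PowerSeries.C ε * PowerSeries.derivative A F + B * F))
    rw [map_mul, map_add, map_add] at this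
    simp only [map_natCast, map_one] at this
    rw [this]
    simp

/-- The series G = z^i g solves ε G' = (iε/z + B) G, so conjugation by G turns ε∂ + iε/z + B into
ε∂. -/
theorem mul_twist (ε : A) (B : PowerSeries A) (i : ℕ) (g b' : PowerSeries A)
    (hg : PowerSeries.derivative A g = b' * g) (hB : PowerSeries.C ε * b' = B) (n : ℕ) :
    HahnSeries.ofPowerSeries ℤ A (PowerSeries.X ^ i * g) * twist ε (i * ε) B n * (n.factorial : LaurentSeries A) =
      HahnSeries.ofPowerSeries ℤ A
        (PowerSeries.C (ε ^ n) * (PowerSeries.derivative A)^[n] (PowerSeries.X ^ i * g)) := by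
  set G := HahnSeries.ofPowerSeries ℤ A (PowerSeries.X ^ i * g) with hG
  have hDG : HahnSeries.C ε * LaurentSeries.derivative A G =
      (HahnSeries.C (i * ε) * zInv A + HahnSeries.ofPowerSeries ℤ A B) * G := by
    have h1 : (HahnSeries.ofPowerSeries ℤ A (PowerSeries.X ^ i) : LaurentSeries A) =
        HahnSeries.single (i : ℤ) 1 := by rw [HahnSeries.ofPowerSeries_X_pow]
    rw [hG, map_mul, h1, laurent_derivative_single_mul, laurent_derivative_ofPowerSeries, hg, ← hB,
      map_mul, map_mul, map_mul (HahnSeries.ofPowerSeries ℤ A) (PowerSeries.C ε),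
      HahnSeries.ofPowerSeries_C, zInv, sub_eq_add_neg]
    have h2 : (HahnSeries.single ((i : ℤ) + -1) (((i : ℤ) : A)) : LaurentSeries A) =
        HahnSeries.C (i : A) * (HahnSeries.single (-1) 1 * HahnSeries.single (i : ℤ) 1) := by
      rw [HahnSeries.single_mul_single, HahnSeries.C_mul_eq_smul, ← HahnSeries.single_zero_mul_eq_smul,
        HahnSeries.single_mul_single]
      simp [add_comm]
    rw [h2]
    ring
  induction n with
  | zero => simp [hG]
  | succ n ih =>
    have h3 := congrArg (fun f => HahnSeries.C ε * LaurentSeries.derivative A f) ih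
    rw [laurent_derivative_ofPowerSeries, Derivation.leibniz, smul_eq_mul, smul_eq_mul,
      PowerSeries.derivative_C, mul_zero, add_zero, ← HahnSeries.ofPowerSeries_C, ← map_mul,
      ← mul_assoc, ← map_mul, ← pow_succ', ← Function.iterate_succ_apply' (PowerSeries.derivative A)] at h3
    rw [← h3, Nat.factorial_succ, HahnSeries.ofPowerSeries_C]
    have h4 : LaurentSeries.derivative A (G * twist ε (i * ε) B n * (n.factorial : LaurentSeries A)) =
        (LaurentSeries.derivative A G * twist ε (i * ε) B n +
          G * LaurentSeries.derivative A (twist ε (i * ε) B n)) * (n.factorial : LaurentSeries A) := by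
      rw [← laurent_derivative_mul, mul_comm, ← nsmul_eq_mul, map_nsmul, nsmul_eq_mul, mul_comm]
    rw [h4]
    push_cast
    linear_combination (G * (n.factorial : LaurentSeries A)) * twist_succ ε (i * ε) B n -
      (n.factorial : LaurentSeries A) * twist ε (i * ε) B n * hDG

theorem laurentMap_twist {A' : Type*} [CommRing A'] [Algebra ℚ A'] (φ : A →+* A') (ε x : A)
    (B : PowerSeries A) (n : ℕ) :
    laurentMap φ (twist ε x B n) = twist (φ ε) (φ x) (PowerSeries.map φ B) n := by
  induction n with
  | zero => simp
  | succ n ih =>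
    refine natCast_succ_mul_cancel (n := n) ?_
    have := congrArg (laurentMap φ) (twist_succ ε x B n)
    rw [twist_succ, ← ih, ← laurentMap_derivative]
    rw [map_mul, map_add, map_add, map_mul, map_mul, map_add, map_mul, laurentMap_ofPowerSeries] at this
    simp only [map_natCast, map_one, zInv, HahnSeries.C_apply, laurentMap_single] at this ⊢
    exact this

end Twist

/-! ### The effect of the vertex substitution on a formal exponential. -/

section ShiftedExponential

variable {R : Type*} [CommRing R] [Algebra ℚ R]

/-- `∑_p q^{p+1} y^p = q / (1 - q y)`. -/
noncomputable def geomGen {R : Type*} [CommRing R] (q : R) : PowerSeries R :=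
  PowerSeries.mk fun p => q ^ (p + 1)

theorem geomGen_mul {R : Type*} [CommRing R] (q : R) :
    geomGen q * (1 - PowerSeries.C q * PowerSeries.X) = PowerSeries.C q := by
  ext n
  rw [mul_sub, mul_one, ← mul_assoc, mul_comm (geomGen q), map_sub]
  cases n with
  | zero => simp [geomGen]
  | succ n =>
    rw [PowerSeries.coeff_succ_mul_X, PowerSeries.coeff_C_mul, PowerSeries.coeff_C,
      if_neg (by simp)]
    simp [geomGen, pow_succ']

theorem isUnit_one_sub_C_mul_X {R : Type*} [CommRing R] (q : R) :
    IsUnit (1 - PowerSeries.C q * PowerSeries.X : PowerSeries R) := by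
  rw [PowerSeries.isUnit_iff_constantCoeff]
  simp

theorem derivative_geomGen {R : Type*} [CommRing R] (q : R) :
    PowerSeries.derivative R (geomGen q) = geomGen q ^ 2 := by
  have h := geomGen_mul q
  have hd := congrArg (PowerSeries.derivative R) h
  rw [Derivation.leibniz, map_sub, Derivation.leibniz, PowerSeries.derivative_X,
    PowerSeries.derivative_C, Derivation.map_one_eq_zero] at hd
  simp only [smul_eq_mul, mul_one, mul_zero, add_zero, zero_sub] at hd
  refine (isUnit_one_sub_C_mul_X q).mul_right_cancel ?_
  linear_combination hd - geomGen q * h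

/-- Shifting the exponents `b_m` by `ζ^m (1 - v^m) / m` multiplies `exp (∑ b_m y^m)` by
`v (1 + τ ζ / (1 - ζ y))`. -/
theorem expGen_shift {ζ τ v : R} (hv : v * (1 + τ * ζ) = 1) {b s : ℕ → R}
    (hs : ∀ j : ℕ, (j + 1 : R) * s (j + 1) = ζ ^ (j + 1) * (1 - v ^ (j + 1))) :
    expGen (fun m => b m + s m) =
      PowerSeries.C v * (1 + PowerSeries.C τ * geomGen ζ) * expGen b := by
  symm
  refine expGen_unique ?_ ?_
  · have h1 : PowerSeries.constantCoeff (expGen b) = 1 := by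
      rw [← PowerSeries.coeff_zero_eq_constantCoeff_apply]; simp [expGen]
    have h2 : PowerSeries.constantCoeff (geomGen ζ) = ζ := by
      rw [← PowerSeries.coeff_zero_eq_constantCoeff_apply]; simp [geomGen]
    rw [map_mul, map_mul, map_add, map_mul, h1, h2, map_one, mul_one, PowerSeries.constantCoeff_C,
      PowerSeries.constantCoeff_C, hv]
  · have hd : derivGen (fun m => b m + s m) = derivGen b + (geomGen ζ - geomGen (ζ * v)) := by
      ext n
      simp only [derivGen, geomGen, PowerSeries.coeff_mk, map_add, map_sub]
      rw [mul_add, hs]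
      ring
    -- Consequently geomGen ζ - geomGen (ζ v) is the logarithmic derivative of 1 + τ geomGen ζ. The
    -- identity is checked after multiplying by the units 1 - ζy and 1 - ζvy.
    have hu : geomGen (ζ * v) * (1 + PowerSeries.C τ * geomGen ζ) = geomGen ζ := by
      refine (isUnit_one_sub_C_mul_X (ζ * v)).mul_right_cancel
        ((isUnit_one_sub_C_mul_X ζ).mul_right_cancel ?_)
      have h1 := geomGen_mul ζ
      have h2 := geomGen_mul (ζ * v)
      have h3 := congrArg (PowerSeries.C (R := R)) hv
      simp only [map_mul, map_add, map_one] at h1 h2 h3 ⊢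
      linear_combination (1 - PowerSeries.C ζ * PowerSeries.X) * (1 + PowerSeries.C τ * geomGen ζ) * h2 +
        (PowerSeries.C τ * (PowerSeries.C ζ * PowerSeries.C v) -
          (1 - PowerSeries.C ζ * PowerSeries.C v * PowerSeries.X)) * h1 +
        PowerSeries.C ζ * h3
    rw [hd, Derivation.leibniz, Derivation.leibniz, map_add, Derivation.leibniz, derivative_geomGen,
      PowerSeries.derivative_C, PowerSeries.derivative_C, Derivation.map_one_eq_zero,
      derivative_expGen]
    simp only [smul_eq_mul, mul_zero, add_zero, zero_add]
    linear_combination (PowerSeries.C v * expGen b) * hu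

theorem expSeq_shift {ζ τ v : R} (hv : v * (1 + τ * ζ) = 1) {b s : ℕ → R}
    (hs : ∀ j : ℕ, (j + 1 : R) * s (j + 1) = ζ ^ (j + 1) * (1 - v ^ (j + 1))) (n : ℕ) :
    expSeq (fun m => b m + s m) n =
      v * (expSeq b n + τ * ∑ p ∈ Finset.range (n + 1), ζ ^ (p + 1) * expSeq b (n - p)) := by
  have h := congrArg (PowerSeries.coeff n) (expGen_shift hv hs (b := b))
  rw [mul_assoc, add_mul, one_mul, PowerSeries.coeff_C_mul, map_add, mul_assoc,
    PowerSeries.coeff_C_mul, PowerSeries.coeff_mul,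
    Finset.Nat.sum_antidiagonal_eq_sum_range_succ_mk] at h
  simpa [expGen, geomGen] using h

end ShiftedExponential

/-! ### Rank-one updates and rows with infinite geometric tails. -/

section Determinants

variable {R : Type*} [CommRing R] {n : Type*} [Fintype n] [DecidableEq n]

/-- The rows are modified one at a time. Once row i is replaced by w, the earlier modifications are
multiples of that row and can be removed. -/
theorem det_add_smul_row (M : Matrix n n R) (x : n → R) (w : n → R) :
    Matrix.det (Matrix.of fun i j => M i j + x i * w j) =
      M.det + ∑ i, x i * (M.updateRow i w).det := by
  have h : ∀ s : Finset n, Matrix.det (Matrix.of fun i j => M i j + if i ∈ s then x i * w j else 0) =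
      M.det + ∑ i ∈ s, x i * (M.updateRow i w).det := by
    intro s
    induction s using Finset.induction_on with
    | empty =>
      simp only [Finset.notMem_empty, if_false, add_zero, Finset.sum_empty]
      rfl
    | insert i s hi ih =>
      rw [Finset.sum_insert hi, add_left_comm, ← ih]
      set P : Matrix n n R := Matrix.of fun i j => M i j + if i ∈ s then x i * w j else 0 with hP
      have e1 : (Matrix.of fun i' j => M i' j + if i' ∈ insert i s then x i' * w j else 0) =
          P.updateRow i (P i + x i • w) := by
        ext i' j
        rcases eq_or_ne i' i with rfl | h
        · simp [hP, hi]
        · simp [hP, h]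
      rw [e1, Matrix.det_updateRow_add, Matrix.updateRow_eq_self, Matrix.det_updateRow_smul,
        add_comm]
      congr 2
      refine Matrix.det_eq_of_forall_row_eq_smul_add_const
        (fun i' => if i' ∈ s then x i' else 0) i (by simp [hi]) ?_
      intro i' j
      rcases eq_or_ne i' i with rfl | h
      · simp [hi]
      · by_cases h' : i' ∈ s <;> simp [hP, h, h']
  simpa using h Finset.univ

/-- For each permutation both sides sum the products in which a single factor of M is replaced by
the corresponding entry of P. -/
theorem sum_det_updateRow_eq_sum_det_updateCol (M P : Matrix n n R) :
    ∑ i, (M.updateRow i (P i)).det = ∑ j, (M.updateCol j fun i => P i j).det := by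
  simp only [Matrix.det_apply]
  rw [Finset.sum_comm, Finset.sum_comm (t := Finset.univ (α := Equiv.Perm n))]
  refine Finset.sum_congr rfl fun σ _ => ?_
  rw [← Finset.smul_sum, ← Finset.smul_sum]
  congr 1
  rw [← Equiv.sum_comp σ]
  refine Finset.sum_congr rfl fun j _ => Finset.prod_congr rfl fun k _ => ?_
  rcases eq_or_ne k j with rfl | h
  · simp
  · rw [Matrix.updateRow_ne (by simpa using h), Matrix.updateCol_ne h]

theorem det_updateRow_eq_sum (M : Matrix n n R) (i : n) (w : n → R) :
    (M.updateRow i w).det = ∑ j, w j * M.adjugate j i := by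
  rw [← Matrix.cramer_transpose_apply, LinearMap.pi_apply_eq_sum_univ (Matrix.cramer M.transpose) w]
  simp only [Finset.sum_apply, Pi.smul_apply, smul_eq_mul]
  refine Finset.sum_congr rfl fun j _ => ?_
  rw [Matrix.adjugate_apply, Matrix.cramer_transpose_apply]
  congr 3
  ext k
  simp [Pi.single_apply, eq_comm]

theorem sum_geom_tail {N : ℕ} (τ ζ : R) (i : ℕ) (hi : i ≤ N) :
    (1 + τ * ζ) ^ i + τ * ζ * ∑ q ∈ Finset.Ico i N, (1 + τ * ζ) ^ q = (1 + τ * ζ) ^ N := by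
  induction N, hi using Nat.le_induction with
  | base => simp
  | succ N hN ih =>
    rw [Finset.sum_Ico_succ_top hN, mul_add, ← add_assoc, ih]
    ring

/-- Row i of Rr is the tail ∑_{q ≥ i} ζ^{q-i+1} r_q, cut off at N with remainder ζ^{N-i} Rr N. Thus
r + τ Rr is an upper triangular matrix with diagonal 1 + τζ = v⁻¹ times a rank-one perturbation of r
by Rr N. -/
theorem det_shift {N : ℕ} (r Rr : ℕ → Fin N → R) (ζ τ v : R) (hv : v * (1 + τ * ζ) = 1)
    (hR : ∀ i j, Rr i j = ζ * (r i j + Rr (i + 1) j)) :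
    v ^ N * Matrix.det (Matrix.of fun i j : Fin N => r i j + τ * Rr i j) =
      Matrix.det (Matrix.of fun i j : Fin N => r i j) +
        ∑ i : Fin N, τ * ζ ^ (N - i) * v ^ (N - i) *
          ((Matrix.of fun i j : Fin N => r i j).updateRow i (Rr N)).det := by
  set M : Matrix (Fin N) (Fin N) R := Matrix.of fun i j => r i j with hM
  set B : Matrix (Fin N) (Fin N) R := Matrix.of fun i q =>
    (if i = q then 1 else 0) + if i ≤ q then τ * ζ ^ ((q : ℕ) - i + 1) else 0 with hB
  set x : Fin N → R := fun i => τ * ζ ^ (N - i) * v ^ (N - i) with hx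
  have hRtail : ∀ d i : ℕ, i + d = N → ∀ j, Rr i j =
      ∑ q ∈ Finset.Ico i N, ζ ^ (q - i + 1) * r q j + ζ ^ (N - i) * Rr N j := by
    intro d
    induction d with
    | zero => intro i hi j; subst hi; simp
    | succ d ih =>
      intro i hi j
      rw [hR, ih (i + 1) (by omega) j, Finset.sum_eq_sum_Ico_succ_bot (by omega : i < N)]
      have : ∑ q ∈ Finset.Ico (i + 1) N, ζ ^ (q - i + 1) * r q j =
          ζ * ∑ q ∈ Finset.Ico (i + 1) N, ζ ^ (q - (i + 1) + 1) * r q j := by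
        rw [Finset.mul_sum]
        refine Finset.sum_congr rfl fun q hq => ?_
        rw [Finset.mem_Ico] at hq
        rw [show q - i = q - (i + 1) + 1 by omega]
        ring
      rw [this, show N - i = N - (i + 1) + 1 by omega]
      simp only [Nat.sub_self, zero_add, pow_one]
      ring
  have hFin : ∀ (i : Fin N) (f : ℕ → R),
      ∑ q : Fin N, (if i ≤ q then f q else 0) = ∑ q ∈ Finset.Ico (i : ℕ) N, f q := by
    intro i f
    refine (Fin.sum_univ_eq_sum_range (fun q => if (i : ℕ) ≤ q then f q else 0) N).trans ?_
    rw [← Finset.sum_filter]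
    refine Finset.sum_congr ?_ fun _ _ => rfl
    ext q
    simp [and_comm]
  have hBdet : B.det = (1 + τ * ζ) ^ N := by
    rw [Matrix.det_of_isUpperTriangular]
    · simp [hB]
    · intro i j hij
      have h1 : (j : Fin N) < i := hij
      simp [hB, h1.ne', not_le.2 h1]
  have hmul : (Matrix.of fun i j : Fin N => r i j + τ * Rr i j) =
      B * Matrix.of fun i j => M i j + x i * Rr N j := by
    ext i j
    rw [Matrix.mul_apply]
    simp only [hB, hM, Matrix.of_apply, add_mul, ite_mul, one_mul, zero_mul, Finset.sum_add_distrib,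
      Finset.sum_ite_eq, Finset.mem_univ, if_true]
    rw [hFin i fun q => τ * ζ ^ (q - i + 1) * (r q j + τ * ζ ^ (N - q) * v ^ (N - q) * Rr N j)]
    rw [hRtail (N - i) i (by omega) j]
    have key := sum_geom_tail (N := N) τ ζ i i.2.le
    have hvq : ∀ q, q ≤ N → v ^ (N - q) = v ^ N * (1 + τ * ζ) ^ q := by
      intro q hq
      conv_rhs => rw [← Nat.sub_add_cancel hq, pow_add, mul_assoc, ← mul_pow, hv, one_pow, mul_one]
    have hvN : v ^ N * (1 + τ * ζ) ^ N = 1 := by rw [← mul_pow, hv, one_pow]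
    have h2 : ∑ q ∈ Finset.Ico (i : ℕ) N, τ * ζ ^ (q - i + 1) *
        (r q j + τ * ζ ^ (N - q) * v ^ (N - q) * Rr N j) =
        τ * ∑ q ∈ Finset.Ico (i : ℕ) N, ζ ^ (q - i + 1) * r q j +
        τ * ζ ^ (N - i) * Rr N j * v ^ N * (τ * ζ * ∑ q ∈ Finset.Ico (i : ℕ) N, (1 + τ * ζ) ^ q) := by
      simp only [Finset.mul_sum]
      rw [← Finset.sum_add_distrib]
      refine Finset.sum_congr rfl fun q hq => ?_
      rw [Finset.mem_Ico] at hq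
      rw [hvq q hq.2.le, show N - (i : ℕ) = (q - i) + (N - q) by omega, pow_add ζ (q - i) (N - q)]
      ring
    rw [h2, eq_sub_of_add_eq' key]
    simp only [hx]
    rw [hvq i i.2.le]
    linear_combination (-τ * ζ ^ (N - (i : ℕ)) * Rr N j) * hvN
  rw [hmul, Matrix.det_mul, hBdet, ← mul_assoc, ← mul_pow, hv, one_pow, one_mul]
  exact det_add_smul_row M x (Rr N)

end Determinants

/-! ### The binomial identity behind the eigenvalues. -/

section Eigen

/-- `∑_q C(k,q) C(n+q,k) C(a,n+q) = C(a,k) C(a,n)`. -/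
theorem sum_choose_mul_choose_mul_choose (a : ℤ) (k n : ℕ) :
    ∑ q ∈ Finset.range (k + 1), (k.choose q : ℤ) * ((n + q).choose k : ℤ) * Ring.choose a (n + q) =
      Ring.choose a k * Ring.choose a n := by
  have h1 : ∀ q, ((n + q).choose k : ℤ) * Ring.choose a (n + q) =
      Ring.choose a k * (if k ≤ n + q then Ring.choose (a - k) (n + q - k) else 0) := by
    intro q
    split_ifs with h
    · rw [← nsmul_eq_mul, Ring.choose_smul_choose a h]
    · rw [Nat.choose_eq_zero_of_lt (not_le.1 h)]; simp
  simp_rw [mul_assoc, h1, mul_left_comm _ (Ring.choose a k), ← Finset.mul_sum]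
  congr 1
  -- After C(n+q,k) C(a,n+q) = C(a,k) C(a-k,n+q-k), the sum over q is Vandermonde's convolution for
  -- a = k + (a-k).
  have h2 := Ring.add_choose_eq (R := ℤ) (r := (k : ℤ)) (s := a - k) n (Commute.all _ _)
  rw [add_sub_cancel] at h2
  rw [h2, Finset.Nat.sum_antidiagonal_eq_sum_range_succ_mk,
    ← Finset.sum_range_reflect]
  simp only [Nat.add_sub_cancel]
  have h3 : ∀ p ∈ Finset.range (k + 1), ((k.choose (k - p) : ℕ) : ℤ) *
      (if k ≤ n + (k - p) then Ring.choose (a - k) (n + (k - p) - k) else 0) =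
      if p ≤ n then Ring.choose (k : ℤ) p * Ring.choose (a - k) (n - p) else 0 := by
    intro p hp
    have hp : p ≤ k := by simpa [Nat.lt_succ_iff] using hp
    rw [Nat.choose_symm hp, Ring.choose_natCast]
    by_cases h : p ≤ n
    · rw [if_pos (by omega), if_pos h, show n + (k - p) - k = n - p by omega]
    · rw [if_neg (by omega), if_neg h, mul_zero]
  have h4 : ∀ p ∈ Finset.range (n + 1), Ring.choose (k : ℤ) p * Ring.choose (a - k) (n - p) =
      if p ≤ k then Ring.choose (k : ℤ) p * Ring.choose (a - k) (n - p) else 0 := by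
    intro p _
    split_ifs with h
    · rfl
    · rw [Ring.choose_natCast, Nat.choose_eq_zero_of_lt (not_le.1 h)]; simp
  rw [Finset.sum_congr rfl h3, Finset.sum_congr rfl h4, ← Finset.sum_filter, ← Finset.sum_filter]
  refine Finset.sum_congr ?_ fun _ _ => rfl
  ext p
  simp [and_comm]

end Eigen

/-! ### The vertex operators and their naturality in the coefficient ring. -/

section VertexOperator

/-- Constants in the ring of power series over Laurent series. -/
noncomputable def vconst (A : Type*) [CommRing A] : A →+* PowerSeries (LaurentSeries A) :=
  (PowerSeries.C (R := LaurentSeries A)).comp HahnSeries.C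

/-- `(1 + a t / z)⁻¹`. -/
noncomputable def vfac {A : Type*} [CommRing A] (a : A) : PowerSeries (LaurentSeries A) :=
  PowerSeries.mk fun n => (- (HahnSeries.C a * zInv A)) ^ n

theorem vfac_mul {A : Type*} [CommRing A] (a : A) :
    vfac a * (1 + vconst A a * PowerSeries.X * PowerSeries.C (zInv A)) = 1 := by
  have h := PowerSeries.mk_one_mul_one_sub_eq_one (LaurentSeries A)
  have h2 : vconst A a * PowerSeries.X * PowerSeries.C (zInv A) =
      PowerSeries.C (HahnSeries.C a * zInv A) * PowerSeries.X := by
    rw [vconst, RingHom.comp_apply, map_mul]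
    ring
  rw [h2]
  ext1 n
  rw [mul_add, mul_one, ← mul_assoc, mul_comm (vfac a) (PowerSeries.C _), map_add]
  cases n with
  | zero => simp [vfac]
  | succ n =>
    rw [PowerSeries.coeff_succ_mul_X, PowerSeries.coeff_C_mul, PowerSeries.coeff_one,
      if_neg (by simp)]
    simp only [vfac, PowerSeries.coeff_mk]
    ring

section

variable {K : Type*} [CommRing K] [Algebra ℚ K]

/-- `z^{-m} (1 - v^m) / m`. -/
noncomputable def vshift (ε : K) (m : ℕ) :
    PowerSeries (LaurentSeries (MvPolynomial ℕ+ K)) :=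
  vconst _ (algebraMap ℚ _ (m : ℚ)⁻¹) * (PowerSeries.C (zInv _) ^ m *
    (1 - vfac (MvPolynomial.C ε) ^ m))

theorem succ_mul_vshift (ε : K) (j : ℕ) :
    (j + 1 : PowerSeries (LaurentSeries (MvPolynomial ℕ+ K))) * vshift ε (j + 1) =
      PowerSeries.C (zInv _) ^ (j + 1) * (1 - vfac (MvPolynomial.C ε) ^ (j + 1)) := by
  have h : (j + 1 : PowerSeries (LaurentSeries (MvPolynomial ℕ+ K))) =
      vconst _ (algebraMap ℚ _ ((j + 1 : ℕ) : ℚ)) := by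
    rw [map_natCast, map_natCast]
    push_cast
    rfl
  rw [h, vshift, ← mul_assoc, ← map_mul, ← map_mul, mul_inv_cancel₀ (by positivity), map_one,
    map_one, one_mul]

/-- The substitution `β_m ↦ β_m + ε z^{-m} (1 - v^m) / m`. -/
noncomputable def vsubst (ε : K) :
    MvPolynomial ℕ+ K →+* PowerSeries (LaurentSeries (MvPolynomial ℕ+ K)) :=
  MvPolynomial.eval₂Hom ((vconst _).comp MvPolynomial.C) fun m : ℕ+ =>
    vconst _ (MvPolynomial.X m) + vconst _ (MvPolynomial.C ε) * vshift ε m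

theorem vsubst_C (ε c : K) : vsubst ε (MvPolynomial.C c) = vconst _ (MvPolynomial.C c) := by
  simp [vsubst]

theorem vsubst_X (ε : K) (m : ℕ+) : vsubst ε (MvPolynomial.X m) =
    vconst _ (MvPolynomial.X m) + vconst _ (MvPolynomial.C ε) * vshift ε m := by
  simp [vsubst]

/-- The series `ℍ`. -/
noncomputable def vkernel (ε : K) : PowerSeries (LaurentSeries (MvPolynomial ℕ+ K)) :=
  PowerSeries.mk (twist (MvPolynomial.C ε) 1 (derivGen (varSeq K)))

/-- The coefficient of `z⁻¹ t^{k+1}` in `(1+z)^k F`. -/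
noncomputable def vres (A : Type*) [CommRing A] (k : ℕ) :
    PowerSeries (LaurentSeries A) →+ A where
  toFun F := ((1 + HahnSeries.single 1 1) ^ k * PowerSeries.coeff (k + 1) F).coeff (-1)
  map_zero' := by simp
  map_add' F G := by rw [map_add, mul_add, HahnSeries.coeff_add]

theorem vres_apply {A : Type*} [CommRing A] (k : ℕ) (F : PowerSeries (LaurentSeries A)) :
    vres A k F = ((1 + HahnSeries.single 1 1) ^ k * PowerSeries.coeff (k + 1) F).coeff (-1) := rfl

theorem vres_vconst_mul {A : Type*} [CommRing A] (k : ℕ) (a : A) (F : PowerSeries (LaurentSeries A)) :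
    vres A k (vconst A a * F) = a * vres A k F := by
  rw [vres_apply, vres_apply, vconst, RingHom.comp_apply, PowerSeries.coeff_C_mul, mul_left_comm,
    HahnSeries.C_mul_eq_smul, HahnSeries.coeff_smul, smul_eq_mul]

/-- The vertex operator. -/
noncomputable def vertex (ε : K) (k : ℕ) : MvPolynomial ℕ+ K →ₗ[K] MvPolynomial ℕ+ K where
  toFun Y := vres _ k (vkernel ε * vsubst ε Y)
  map_add' Y Z := by rw [map_add, mul_add, map_add]
  map_smul' c Y := by
    rw [MvPolynomial.smul_eq_C_mul, map_mul (vsubst ε), vsubst_C, mul_left_comm, vres_vconst_mul,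
      RingHom.id_apply, MvPolynomial.smul_eq_C_mul]

theorem vertex_apply (ε : K) (k : ℕ) (Y : MvPolynomial ℕ+ K) :
    vertex ε k Y = vres _ k (vkernel ε * vsubst ε Y) := rfl

section Naturality

variable {K' : Type*} [CommRing K'] [Algebra ℚ K'] (φ : K →+* K')

/-- The base change of power series over Laurent series. -/
noncomputable def vmap : PowerSeries (LaurentSeries (MvPolynomial ℕ+ K)) →+*
    PowerSeries (LaurentSeries (MvPolynomial ℕ+ K')) :=
  PowerSeries.map (laurentMap (MvPolynomial.map φ))

theorem vmap_vconst (a : MvPolynomial ℕ+ K) :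
    vmap φ (vconst _ a) = vconst _ (MvPolynomial.map φ a) := by
  rw [vmap, vconst, RingHom.comp_apply, PowerSeries.map_C, HahnSeries.C_apply, laurentMap_single]
  rfl

theorem laurentMap_zInv {A A' : Type*} [CommRing A] [CommRing A'] (ψ : A →+* A') :
    laurentMap ψ (zInv A) = zInv A' := by
  rw [zInv, laurentMap_single, map_one, zInv]

theorem vmap_vfac (ε : K) : vmap φ (vfac (MvPolynomial.C ε)) = vfac (MvPolynomial.C (φ ε)) := by
  ext1 n
  rw [vmap, PowerSeries.coeff_map, vfac, vfac, PowerSeries.coeff_mk, PowerSeries.coeff_mk, map_pow,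
    map_neg, map_mul, laurentMap_zInv, HahnSeries.C_apply, laurentMap_single, MvPolynomial.map_C]
  rfl

theorem vmap_vshift (ε : K) (m : ℕ) : vmap φ (vshift ε m) = vshift (φ ε) m := by
  rw [vshift, map_mul, vmap_vconst, map_mul, map_sub, map_one, map_pow, map_pow, vmap_vfac, vshift]
  congr 2
  · exact RingHom.congr_fun (Subsingleton.elim ((MvPolynomial.map φ).comp
      (algebraMap ℚ (MvPolynomial ℕ+ K))) (algebraMap ℚ (MvPolynomial ℕ+ K'))) _
  · rw [vmap, PowerSeries.map_C, laurentMap_zInv]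

theorem vmap_vsubst (ε : K) (Y : MvPolynomial ℕ+ K) :
    vmap φ (vsubst ε Y) = vsubst (φ ε) (MvPolynomial.map φ Y) := by
  have h : (vmap φ).comp (vsubst ε) = (vsubst (φ ε)).comp (MvPolynomial.map φ) := by
    refine MvPolynomial.ringHom_ext (fun c => ?_) (fun m => ?_)
    · simp only [RingHom.comp_apply, vsubst_C, vmap_vconst, MvPolynomial.map_C]
    · simp only [RingHom.comp_apply, vsubst_X, vmap_vconst, MvPolynomial.map_C, map_add, map_mul,
        MvPolynomial.map_X, vmap_vshift]
  exact RingHom.congr_fun h Y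

theorem map_varSeq (m : ℕ) : MvPolynomial.map φ (varSeq K m) = varSeq K' m := by
  cases m <;> simp [varSeq]

theorem vmap_vkernel (ε : K) : vmap φ (vkernel ε) = vkernel (φ ε) := by
  ext1 n
  rw [vmap, PowerSeries.coeff_map, vkernel, vkernel, PowerSeries.coeff_mk, PowerSeries.coeff_mk,
    laurentMap_twist, MvPolynomial.map_C, map_one]
  congr 1
  ext1 j
  simp [derivGen, map_varSeq]

theorem map_vres (k : ℕ) (F : PowerSeries (LaurentSeries (MvPolynomial ℕ+ K))) :
    MvPolynomial.map φ (vres _ k F) = vres _ k (vmap φ F) := by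
  rw [vres_apply, vres_apply, ← laurentMap_coeff, map_mul, map_pow, map_add, map_one, laurentMap_single, map_one, vmap,
    PowerSeries.coeff_map]

/-- Naturality allows ε to be an indeterminate first, so that divisibility by ε makes sense, and to
be specialized to 1/N or 0 afterwards. -/
theorem map_vertex (ε : K) (k : ℕ) (Y : MvPolynomial ℕ+ K) :
    MvPolynomial.map φ (vertex ε k Y) = vertex (φ ε) k (MvPolynomial.map φ Y) := by
  rw [vertex_apply, vertex_apply, map_vres, map_mul, vmap_vkernel, vmap_vsubst]

end Naturality

end

end VertexOperator

/-! ### The vertex substitution applied to Jacobi–Trudi determinants. -/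

section VertexDeterminant

/-- The series `∑_p z^{-p-1} e_{n-p}`. -/
noncomputable def tailSeries {A : Type*} [CommRing A] [Algebra ℚ A] (b : ℕ → A) (n : ℤ) :
    LaurentSeries A :=
  if n < 0 then 0 else
    ∑ p ∈ Finset.range (n.toNat + 1), zInv A ^ (p + 1) * HahnSeries.C (expSeq b (n.toNat - p))

theorem tailSeries_rec {A : Type*} [CommRing A] [Algebra ℚ A] (b : ℕ → A) (n : ℤ) :
    tailSeries b n = zInv A * (HahnSeries.C (expInt b n) + tailSeries b (n - 1)) := by
  rcases lt_or_ge n 0 with h | h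
  · simp [tailSeries, expInt, h, h.trans_le zero_le_one]
  obtain ⟨k, rfl⟩ : ∃ k : ℕ, n = k := ⟨n.toNat, by omega⟩
  cases k with
  | zero => simp [tailSeries, expInt]
  | succ k =>
    rw [tailSeries, if_neg (by omega), tailSeries, if_neg (by omega), Finset.sum_range_succ', mul_add,
      add_comm]
    congr 1
    · rw [expInt_natCast]
      simp
    · rw [show (((k + 1 : ℕ) : ℤ) - 1).toNat = k by omega, Finset.mul_sum]
      simp only [Int.toNat_natCast]
      refine Finset.sum_congr rfl fun p _ => ?_
      rw [show k + 1 - (p + 1) = k - p by omega]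
      ring

variable {N : ℕ}

/-- For ε = 1/N the prefactors cancel: Nβ_m moves by z^{-m}(1-v^m)/m, exactly the shift required by
`expSeq_shift` with ζ = 1/z and τ = εt. -/
theorem vsubst_scaledVar (hN : N ≠ 0) (m : ℕ) :
    vsubst (N : ℝ)⁻¹ (scaledVar N m) = vconst _ (scaledVar N m) + vshift (N : ℝ)⁻¹ m := by
  have hN' : (N : ℝ) ≠ 0 := by exact_mod_cast hN
  cases m with
  | zero => simp [scaledVar, varSeq, vshift]
  | succ m =>
    rw [scaledVar, varSeq, MvPolynomial.smul_eq_C_mul, map_mul, vsubst_C, vsubst_X, mul_add, ← map_mul,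
      ← mul_assoc, ← map_mul, ← map_mul, mul_inv_cancel₀ hN', map_one, map_one, one_mul,
      Nat.succPNat_coe]

theorem vsubst_expInt (hN : N ≠ 0) (n : ℤ) :
    vsubst (N : ℝ)⁻¹ (expInt (scaledVar N) n) = vfac (MvPolynomial.C (N : ℝ)⁻¹) *
      (vconst _ (expInt (scaledVar N) n) + vconst _ (MvPolynomial.C (N : ℝ)⁻¹) * PowerSeries.X *
        PowerSeries.C (tailSeries (scaledVar N) n)) := by
  rcases lt_or_ge n 0 with h | h
  · simp [expInt, tailSeries, h]
  obtain ⟨k, rfl⟩ : ∃ k : ℕ, n = k := ⟨n.toNat, by omega⟩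
  rw [expInt_natCast, map_expSeq, map_expSeq]
  simp_rw [vsubst_scaledVar hN]
  rw [expSeq_shift (vfac_mul _) (succ_mul_vshift _), tailSeries, if_neg (by omega), map_sum]
  congr 3
  refine Finset.sum_congr rfl fun p _ => ?_
  rw [map_mul, map_pow, ← map_expSeq, Int.toNat_natCast]
  rfl

theorem mk_twist_add {A : Type*} [CommRing A] [Algebra ℚ A] (ε x : A) (B : PowerSeries A) :
    PowerSeries.mk (twist ε (x + ε) B) =
      (1 + vconst A ε * PowerSeries.X * PowerSeries.C (zInv A)) * PowerSeries.mk (twist ε x B) := by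
  ext1 n
  rw [show (1 + vconst A ε * PowerSeries.X * PowerSeries.C (zInv A)) * PowerSeries.mk (twist ε x B) =
    PowerSeries.mk (twist ε x B) +
      vconst A ε * PowerSeries.C (zInv A) * PowerSeries.mk (twist ε x B) * PowerSeries.X by ring,
    map_add]
  cases n with
  | zero => simp
  | succ n =>
    rw [PowerSeries.coeff_succ_mul_X, vconst, RingHom.comp_apply, ← map_mul,
      PowerSeries.coeff_C_mul]
    simp only [PowerSeries.coeff_mk]
    exact twist_add ε x B n

/-- By `twist_add`, multiplying the generating series by (1 + εt/z)⁻¹ lowers the parameter x by ε.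
-/
theorem vfac_pow_mul_mk_twist {A : Type*} [CommRing A] [Algebra ℚ A] (ε x : A) (B : PowerSeries A)
    (j : ℕ) :
    vfac ε ^ j * PowerSeries.mk (twist ε (x + j * ε) B) = PowerSeries.mk (twist ε x B) := by
  induction j with
  | zero => simp
  | succ j ih =>
    rw [show x + ((j + 1 : ℕ) : A) * ε = (x + j * ε) + ε by push_cast; ring, mk_twist_add, pow_succ,
      mul_assoc, ← mul_assoc (vfac ε), vfac_mul, one_mul, ih]

theorem twist_natCast_mul {A : Type*} [CommRing A] [Algebra ℚ A] (ε : A) (B : PowerSeries A)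
    (j n : ℕ) : twist ε (j * ε) B (n + 1) = twist ε 0 B (n + 1) +
      ∑ i ∈ Finset.range j, HahnSeries.C ε * zInv A * twist ε (i * ε) B n := by
  induction j with
  | zero => simp
  | succ j ih =>
    rw [Finset.sum_range_succ, ← add_assoc, ← ih, ← twist_add]
    push_cast
    ring_nf

theorem coeff_one_add_X_pow {A : Type*} [CommRing A] (k n : ℕ) :
    PowerSeries.coeff n ((1 + PowerSeries.X : PowerSeries A) ^ k) = (k.choose n : A) := by
  have : ((1 + PowerSeries.X : PowerSeries A) ^ k) = ((1 + Polynomial.X : Polynomial A) ^ k :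
    Polynomial A) := by simp
  rw [this, Polynomial.coeff_coe, Polynomial.coeff_one_add_X_pow]

/-- The coefficients of `(1+y)^k ∂^k / k!`. -/
theorem coeff_one_add_X_pow_mul_iterate_derivative {A : Type*} [CommRing A] (f : PowerSeries A)
    (k n : ℕ) :
    PowerSeries.coeff n ((1 + PowerSeries.X) ^ k * (PowerSeries.derivative A)^[k] f) =
      (k.factorial : A) * ∑ q ∈ Finset.range (k + 1),
        (k.choose q : A) * ((n + q).choose k : A) * PowerSeries.coeff (n + q) f := by
  rw [PowerSeries.coeff_mul, Finset.Nat.sum_antidiagonal_eq_sum_range_succ_mk]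
  simp only [coeff_one_add_X_pow, PowerSeries.coeff_iterate_derivative]
  rw [← Finset.sum_range_reflect _ (k + 1), Finset.mul_sum]
  simp only [Nat.add_sub_cancel]
  have h1 : ∀ p ∈ Finset.range (k + 1), (k.factorial : A) * ((k.choose (k - p) : A) *
      ((n + (k - p)).choose k : A) * PowerSeries.coeff (n + (k - p)) f) =
      if p ≤ n then (k.choose p : A) * ((k.factorial : A) * ((n - p + k).choose k : A) *
        PowerSeries.coeff (n - p + k) f) else 0 := by
    intro p hp
    have hp : p ≤ k := by simpa [Nat.lt_succ_iff] using hp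
    rw [Nat.choose_symm hp]
    split_ifs with h
    · rw [show n + (k - p) = n - p + k by omega]
      ring
    · rw [Nat.choose_eq_zero_of_lt (show n + (k - p) < k by omega)]
      simp
  have h2 : ∀ p ∈ Finset.range (n + 1), (k.choose p : A) * ((k.factorial : A) *
      ((n - p + k).choose k : A) * PowerSeries.coeff (n - p + k) f) =
      if p ≤ k then (k.choose p : A) * ((k.factorial : A) * ((n - p + k).choose k : A) *
        PowerSeries.coeff (n - p + k) f) else 0 := by
    intro p _
    split_ifs with h
    · rfl
    · rw [Nat.choose_eq_zero_of_lt (not_le.1 h)]; simp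
  rw [Finset.sum_congr rfl h1]
  refine Eq.trans (Finset.sum_congr rfl fun p hp => ?_) ((Finset.sum_congr rfl h2).trans ?_)
  · rw [Nat.ascFactorial_eq_factorial_mul_choose]
    push_cast
    ring
  rw [← Finset.sum_filter, ← Finset.sum_filter]
  refine Finset.sum_congr ?_ fun _ _ => rfl
  ext p
  simp [and_comm]

theorem coeff_single_mul_ofPowerSeries {A : Type*} [CommRing A] (i : ℕ) (F : PowerSeries A)
    (f : LaurentSeries A) (h : HahnSeries.single (i : ℤ) 1 * f = HahnSeries.ofPowerSeries ℤ A F)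
    (n : ℕ) : f.coeff ((n : ℤ) - i) = PowerSeries.coeff n F := by
  have := congrArg (fun f => HahnSeries.coeff f (n : ℤ)) h
  simpa [HahnSeries.coeff_single_mul, LaurentSeries.coeff_coe_powerSeries] using this

theorem coeff_zInv_pow_mul {A : Type*} [CommRing A] (p : ℕ) (f : LaurentSeries A) (n : ℤ) :
    (zInv A ^ p * f).coeff n = f.coeff (n + p) := by
  rw [zInv, HahnSeries.single_pow, one_pow, HahnSeries.coeff_single_mul, one_mul]
  congr 1
  simp

/-- The Jacobi–Trudi type determinant `det (e_{m_j - i})`. -/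
noncomputable def jacobiDet {N : ℕ} (m : Fin N → ℤ) : MvPolynomial ℕ+ ℝ :=
  Matrix.det (Matrix.of fun i j : Fin N => expInt (scaledVar N) (m j - (i : ℕ)))

/-- The rows of `(1+y)^k ∂^k / k!` applied to `y^i exp(∑ b_m y^m)`. -/
noncomputable def hasseRow {N : ℕ} (k : ℕ) (m : Fin N → ℤ) (i j : Fin N) : MvPolynomial ℕ+ ℝ :=
  if m j < 0 then 0 else ∑ q ∈ Finset.range (k + 1), (k.choose q : MvPolynomial ℕ+ ℝ) *
    (((m j).toNat + q).choose k : MvPolynomial ℕ+ ℝ) * expInt (scaledVar N) (m j + q - (i : ℕ))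

theorem coeff_X_pow_mul_expGen {R : Type*} [CommRing R] [Algebra ℚ R] (b : ℕ → R) (i n : ℕ) :
    PowerSeries.coeff n (PowerSeries.X ^ i * expGen b) = expInt b (n - i) := by
  rw [PowerSeries.coeff_X_pow_mul']
  split_ifs with h
  · rw [← Nat.cast_sub h, expInt_natCast, expGen, PowerSeries.coeff_mk]
  · rw [expInt_of_neg]
    omega

/-- The power series `z^i (1+z)^k T_k`. -/
theorem exists_twist_eq (hN : N ≠ 0) (k i : ℕ) : ∃ F : PowerSeries (MvPolynomial ℕ+ ℝ),
    HahnSeries.single (i : ℤ) 1 * ((1 + HahnSeries.single 1 1) ^ k *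
      twist (MvPolynomial.C (N : ℝ)⁻¹) ((i : MvPolynomial ℕ+ ℝ) * MvPolynomial.C (N : ℝ)⁻¹) (derivGen (varSeq ℝ)) k) =
      HahnSeries.ofPowerSeries ℤ _ F ∧
    ∀ n : ℕ, PowerSeries.coeff n (F * expGen (scaledVar N)) =
      MvPolynomial.C (N : ℝ)⁻¹ ^ k * ∑ q ∈ Finset.range (k + 1), (k.choose q : MvPolynomial ℕ+ ℝ) *
        ((n + q).choose k : MvPolynomial ℕ+ ℝ) * expInt (scaledVar N) (n + q - i) := by
  have hN' : (N : ℝ) ≠ 0 := by exact_mod_cast hN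
  set ε : MvPolynomial ℕ+ ℝ := MvPolynomial.C (N : ℝ)⁻¹ with hε
  set g := expGen (scaledVar N) with hg
  have hunit : IsUnit g := by
    rw [PowerSeries.isUnit_iff_constantCoeff, ← PowerSeries.coeff_zero_eq_constantCoeff_apply]
    simp [hg, expGen]
  obtain ⟨g', hg'⟩ := hunit.exists_left_inv
  have hB : PowerSeries.C ε * derivGen (scaledVar N) = derivGen (varSeq ℝ) := by
    ext1 n
    simp only [derivGen, PowerSeries.coeff_C_mul, PowerSeries.coeff_mk, scaledVar,
      MvPolynomial.smul_eq_C_mul]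
    have : ε * MvPolynomial.C (N : ℝ) = 1 := by
      rw [hε, ← map_mul, inv_mul_cancel₀ hN', map_one]
    linear_combination ((n : MvPolynomial ℕ+ ℝ) + 1) * varSeq ℝ (n + 1) * this
  -- After division by the unit g, the series z^i (1+z)^k T_k becomes a power series whose product
  -- with g is ε^k (1+z)^k ∂^k(z^i g)/k!.
  have hT := mul_twist ε (derivGen (varSeq ℝ)) i g (derivGen (scaledVar N)) (derivative_expGen _) hB k
  set c : MvPolynomial ℕ+ ℝ := MvPolynomial.C (k.factorial : ℝ)⁻¹ with hc
  have hck : c * (k.factorial : MvPolynomial ℕ+ ℝ) = 1 := by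
    have : (k.factorial : MvPolynomial ℕ+ ℝ) = MvPolynomial.C (k.factorial : ℝ) := by simp
    rw [this, hc, ← map_mul, inv_mul_cancel₀ (by positivity), map_one]
  set D := (PowerSeries.derivative (MvPolynomial ℕ+ ℝ))^[k] (PowerSeries.X ^ i * g) with hD
  refine ⟨(1 + PowerSeries.X) ^ k * (g' * (PowerSeries.C c * (PowerSeries.C (ε ^ k) * D))), ?_, ?_⟩
  · rw [map_mul, map_mul, map_mul, ← hT, map_pow, map_add,
      map_one (HahnSeries.ofPowerSeries ℤ (MvPolynomial ℕ+ ℝ)), HahnSeries.ofPowerSeries_X,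
      map_mul, HahnSeries.ofPowerSeries_X_pow, HahnSeries.ofPowerSeries_C]
    have h1 : (HahnSeries.ofPowerSeries ℤ (MvPolynomial ℕ+ ℝ) g') * HahnSeries.ofPowerSeries ℤ _ g = 1 := by
      rw [← map_mul, hg', map_one]
    have h2 : (HahnSeries.C c : LaurentSeries (MvPolynomial ℕ+ ℝ)) * (k.factorial : _) = 1 := by
      have := congrArg (HahnSeries.C (Γ := ℤ)) hck
      rwa [map_mul, map_natCast, map_one] at this
    set T := twist ε (i * ε) (derivGen (varSeq ℝ)) k
    generalize (HahnSeries.single (i : ℤ) 1 : LaurentSeries (MvPolynomial ℕ+ ℝ)) = s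
    generalize ((1 + HahnSeries.single 1 1) ^ k : LaurentSeries (MvPolynomial ℕ+ ℝ)) = w
    linear_combination (-(s * w * T)) * h1 - (s * w * T *
      (HahnSeries.ofPowerSeries ℤ (MvPolynomial ℕ+ ℝ) g' * HahnSeries.ofPowerSeries ℤ _ g)) * h2
  · intro n
    rw [show (1 + PowerSeries.X) ^ k * (g' * (PowerSeries.C c * (PowerSeries.C (ε ^ k) * D))) * g =
      PowerSeries.C (c * ε ^ k) * ((1 + PowerSeries.X) ^ k * D) * (g' * g) by rw [map_mul]; ring, hg',
      mul_one, PowerSeries.coeff_C_mul, hD, coeff_one_add_X_pow_mul_iterate_derivative]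
    rw [show ∀ x : MvPolynomial ℕ+ ℝ, c * ε ^ k * ((k.factorial : MvPolynomial ℕ+ ℝ) * x) =
      (c * (k.factorial : MvPolynomial ℕ+ ℝ)) * (ε ^ k * x) by intro x; ring, hck, one_mul]
    refine congrArg (HMul.hMul _) ?_
    refine Finset.sum_congr rfl fun q _ => ?_
    rw [coeff_X_pow_mul_expGen]
    rw [Nat.cast_add]

/-- The substitution turns each entry e into v(e + εt · tail), and `det_shift` expands the
determinant. The factor v^{N-i} on the i-th term lowers the parameter of the kernel from 1 = Nε to
iε. -/
theorem coeff_vkernel_mul_vsubst_jacobiDet (hN : N ≠ 0) (k : ℕ) (m : Fin N → ℤ) :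
    PowerSeries.coeff (k + 1) (vkernel (N : ℝ)⁻¹ * vsubst (N : ℝ)⁻¹ (jacobiDet m)) =
      twist (MvPolynomial.C (N : ℝ)⁻¹) 1 (derivGen (varSeq ℝ)) (k + 1) *
        HahnSeries.C (jacobiDet m) +
      ∑ i : Fin N, HahnSeries.C (MvPolynomial.C (N : ℝ)⁻¹) * zInv _ ^ (N - i) *
        twist (MvPolynomial.C (N : ℝ)⁻¹) (((i : ℕ) : MvPolynomial ℕ+ ℝ) * MvPolynomial.C (N : ℝ)⁻¹)
          (derivGen (varSeq ℝ)) k *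
        ∑ j, tailSeries (scaledVar N) (m j - N) * HahnSeries.C
          ((Matrix.of fun i j : Fin N => expInt (scaledVar N) (m j - (i : ℕ))).adjugate j i) := by
  have hN' : (N : ℝ) ≠ 0 := by exact_mod_cast hN
  set ε : MvPolynomial ℕ+ ℝ := MvPolynomial.C (N : ℝ)⁻¹ with hε
  set M : Matrix (Fin N) (Fin N) (MvPolynomial ℕ+ ℝ) :=
    Matrix.of fun i j : Fin N => expInt (scaledVar N) (m j - (i : ℕ)) with hM
  have h1 : vsubst (N : ℝ)⁻¹ (jacobiDet m) = vconst _ (jacobiDet m) +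
      ∑ i : Fin N, vconst _ ε * PowerSeries.X * PowerSeries.C (zInv _) ^ (N - i) *
        vfac ε ^ (N - i) * ∑ j, PowerSeries.C (tailSeries (scaledVar N) (m j - N)) *
          vconst _ (M.adjugate j i) := by
    have h2 := det_shift (N := N) (fun i j => vconst _ (expInt (scaledVar N) (m j - (i : ℕ))))
      (fun i j => PowerSeries.C (tailSeries (scaledVar N) (m j - (i : ℕ))))
      (PowerSeries.C (zInv _)) (vconst _ ε * PowerSeries.X) (vfac ε) (vfac_mul ε) (by
        intro i j
        rw [tailSeries_rec, map_mul, map_add, vconst, RingHom.comp_apply]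
        push_cast
        rw [sub_sub])
    have h3 : (vsubst (N : ℝ)⁻¹).mapMatrix M = Matrix.of fun i j : Fin N => vfac ε *
        (vconst _ (expInt (scaledVar N) (m j - (i : ℕ))) +
          vconst _ ε * PowerSeries.X * PowerSeries.C (tailSeries (scaledVar N) (m j - (i : ℕ)))) := by
      ext1 i j
      exact vsubst_expInt hN _
    have h7 := Matrix.det_mul_column (fun _ : Fin N => vfac ε) (Matrix.of fun i j : Fin N =>
        (vconst _ (expInt (scaledVar N) (m j - (i : ℕ))) +
          vconst _ ε * PowerSeries.X * PowerSeries.C (tailSeries (scaledVar N) (m j - (i : ℕ)))))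
    rw [Finset.prod_const, Finset.card_univ, Fintype.card_fin] at h7
    rw [jacobiDet, ← hM, RingHom.map_det, h3]
    refine h7.trans ?_
    rw [RingHom.map_det]
    have h4 : (Matrix.of fun i j : Fin N => vconst _ (expInt (scaledVar N) (m j - (i : ℕ)))) =
      (vconst (MvPolynomial ℕ+ ℝ)).mapMatrix M := rfl
    refine h2.trans ?_
    rw [h4]
    refine congrArg (HAdd.hAdd _) ?_
    refine Finset.sum_congr rfl fun i _ => ?_
    rw [det_updateRow_eq_sum, ← RingHom.map_adjugate]
    rfl
  rw [h1, mul_add, map_add]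
  refine congrArg₂ HAdd.hAdd ?_ ?_
  · rw [mul_comm, vconst, RingHom.comp_apply, PowerSeries.coeff_C_mul, mul_comm, vkernel,
      PowerSeries.coeff_mk]
  · rw [Finset.mul_sum, map_sum]
    refine Finset.sum_congr rfl fun i _ => ?_
    have h5 : vfac ε ^ (N - (i : ℕ)) * vkernel (N : ℝ)⁻¹ =
        PowerSeries.mk (twist ε ((i : ℕ) * ε) (derivGen (varSeq ℝ))) := by
      rw [← vfac_pow_mul_mk_twist ε _ _ (N - i), vkernel]
      congr 3
      rw [← add_mul, Nat.cast_sub i.2.le, add_sub_cancel, hε]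
      rw [show (N : MvPolynomial ℕ+ ℝ) = MvPolynomial.C (N : ℝ) by simp, ← map_mul,
        mul_inv_cancel₀ hN', map_one]
    have h6 : ∑ j, PowerSeries.C (tailSeries (scaledVar N) (m j - N)) * vconst _ (M.adjugate j i) =
        PowerSeries.C (∑ j, tailSeries (scaledVar N) (m j - N) * HahnSeries.C (M.adjugate j i)) := by
      rw [map_sum]
      exact Finset.sum_congr rfl fun j _ => by rw [map_mul]; rfl
    rw [h6, show ∀ Z : LaurentSeries (MvPolynomial ℕ+ ℝ), vkernel (N : ℝ)⁻¹ * (vconst _ ε *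
        PowerSeries.X * PowerSeries.C (zInv _) ^ (N - (i : ℕ)) * vfac ε ^ (N - (i : ℕ)) *
          PowerSeries.C Z) = PowerSeries.C (HahnSeries.C ε * zInv _ ^ (N - (i : ℕ)) * Z) *
          (vfac ε ^ (N - (i : ℕ)) * vkernel (N : ℝ)⁻¹) * PowerSeries.X by
        intro Z; rw [map_mul, map_mul, map_pow, vconst, RingHom.comp_apply]; ring,
      PowerSeries.coeff_succ_mul_X, PowerSeries.coeff_C_mul, h5, PowerSeries.coeff_mk]
    exact mul_right_comm _ _ _

end VertexDeterminant

/-! ### The vertex operators act diagonally on Schur functionals. -/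

section VertexEigen

/-- The coefficients of F below N will multiply rows of the matrix; those from N on are what the
tail series reads off. -/
theorem coeff_mul_expGen_eq {R : Type*} [CommRing R] [Algebra ℚ R] (F : PowerSeries R) (b : ℕ → R)
    (N n : ℕ) :
    PowerSeries.coeff n (F * expGen b) =
      ∑ q ∈ Finset.range N, PowerSeries.coeff q F * expInt b (n - q) +
      if (n : ℤ) - N < 0 then 0 else ∑ p ∈ Finset.range (((n : ℤ) - N).toNat + 1),
        PowerSeries.coeff (N + p) F * expSeq b (((n : ℤ) - N).toNat - p) := by
  have h1 : PowerSeries.coeff n (F * expGen b) =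
      ∑ q ∈ Finset.range (n + 1), PowerSeries.coeff q F * expInt b (n - q) := by
    rw [PowerSeries.coeff_mul, Finset.Nat.sum_antidiagonal_eq_sum_range_succ_mk]
    refine Finset.sum_congr rfl fun q hq => ?_
    have : q ≤ n := by simpa [Nat.lt_succ_iff] using hq
    rw [← Nat.cast_sub this, expInt_natCast, expGen, PowerSeries.coeff_mk]
  rw [h1]
  split_ifs with h
  · rw [add_zero]
    refine Finset.sum_subset (fun q hq => ?_) fun q _ hq' => ?_
    · simp only [Finset.mem_range] at hq ⊢
      omega
    · rw [expInt_of_neg, mul_zero]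
      simp only [Finset.mem_range] at hq'
      omega
  · rw [show n + 1 = N + (((n : ℤ) - N).toNat + 1) by omega, Finset.sum_range_add]
    congr 1
    refine Finset.sum_congr rfl fun p hp => ?_
    have : p ≤ ((n : ℤ) - N).toNat := by simpa [Nat.lt_succ_iff] using hp
    rw [show (n : ℤ) - ((N + p : ℕ) : ℤ) = ((((n : ℤ) - N).toNat - p : ℕ) : ℤ) by omega,
      expInt_natCast]

theorem coeff_zInv_pow_mul_tailSeries {A : Type*} [CommRing A] [Algebra ℚ A] (b : ℕ → A)
    (f : LaurentSeries A) (d : ℕ) (n : ℤ) :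
    (zInv A ^ d * f * tailSeries b n).coeff (-1) =
      if n < 0 then 0 else ∑ p ∈ Finset.range (n.toNat + 1),
        f.coeff (d + p) * expSeq b (n.toNat - p) := by
  unfold tailSeries
  split_ifs with h
  · simp
  · rw [Finset.mul_sum, HahnSeries.coeff_sum]
    refine Finset.sum_congr rfl fun p _ => ?_
    rw [show ∀ e : LaurentSeries A, zInv A ^ d * f * (zInv A ^ (p + 1) * e) =
      e * (zInv A ^ (d + (p + 1)) * f) by intro e; ring, HahnSeries.C_mul_eq_smul,
      HahnSeries.coeff_smul, coeff_zInv_pow_mul, smul_eq_mul, mul_comm]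
    congr 2
    push_cast
    ring

variable {N : ℕ}

/-- T_{k+1} at parameter Nε telescopes into a pole-free part and a term (ε/z)T_k at parameter iε for
each row i. For fixed i, this term and the i-th tail term of the determinant expansion combine into
the determinant with a single replaced row, namely the coefficients of z^i(1+z)^k T_k times the
exponential series. -/
theorem vertex_jacobiDet (hN : N ≠ 0) (k : ℕ) (m : Fin N → ℤ) :
    vertex (N : ℝ)⁻¹ k (jacobiDet m) = MvPolynomial.C (N : ℝ)⁻¹ ^ (k + 1) *
      ∑ i, ((Matrix.of fun i j : Fin N => expInt (scaledVar N) (m j - (i : ℕ))).updateRow i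
        (hasseRow k m i)).det := by
  have hN' : (N : ℝ) ≠ 0 := by exact_mod_cast hN
  rw [vertex_apply, vres_apply, coeff_vkernel_mul_vsubst_jacobiDet hN]
  set ε : MvPolynomial ℕ+ ℝ := MvPolynomial.C (N : ℝ)⁻¹ with hε
  set M : Matrix (Fin N) (Fin N) (MvPolynomial ℕ+ ℝ) :=
    Matrix.of fun i j : Fin N => expInt (scaledVar N) (m j - (i : ℕ)) with hM
  set W : LaurentSeries (MvPolynomial ℕ+ ℝ) := (1 + HahnSeries.single 1 1) ^ k with hW
  have hone : (1 : MvPolynomial ℕ+ ℝ) = N * ε := by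
    rw [hε, show (N : MvPolynomial ℕ+ ℝ) = MvPolynomial.C (N : ℝ) by simp, ← map_mul,
      mul_inv_cancel₀ hN', map_one]
  set B : PowerSeries (MvPolynomial ℕ+ ℝ) := derivGen (varSeq ℝ) with hB
  have e1 : twist ε 1 B (k + 1) = twist ε 0 B (k + 1) +
      ∑ i : Fin N, HahnSeries.C ε * zInv _ * twist ε (((i : ℕ) : MvPolynomial ℕ+ ℝ) * ε) B k := by
    rw [hone, twist_natCast_mul, Fin.sum_univ_eq_sum_range
      (fun i => HahnSeries.C ε * zInv _ * twist ε ((i : MvPolynomial ℕ+ ℝ) * ε) B k)]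
  have e2 : W * (twist ε 1 B (k + 1) * HahnSeries.C (jacobiDet m) +
      ∑ i : Fin N, HahnSeries.C ε * zInv _ ^ (N - (i : ℕ)) *
        twist ε (((i : ℕ) : MvPolynomial ℕ+ ℝ) * ε) B k *
        ∑ j, tailSeries (scaledVar N) (m j - N) * HahnSeries.C (M.adjugate j i)) =
      HahnSeries.C (jacobiDet m) * (W * twist ε 0 B (k + 1)) +
      ∑ i : Fin N, HahnSeries.C ε * (HahnSeries.C (jacobiDet m) * (zInv _ ^ 1 * (W *
        twist ε (((i : ℕ) : MvPolynomial ℕ+ ℝ) * ε) B k)) +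
        ∑ j, HahnSeries.C (M.adjugate j i) * (zInv _ ^ (N - (i : ℕ)) * (W *
        twist ε (((i : ℕ) : MvPolynomial ℕ+ ℝ) * ε) B k) * tailSeries (scaledVar N) (m j - N))) := by
    rw [e1, add_mul, Finset.sum_mul, add_assoc, ← Finset.sum_add_distrib, mul_add, Finset.mul_sum]
    refine congrArg₂ HAdd.hAdd (by ring) (Finset.sum_congr rfl fun i _ => ?_)
    simp only [Finset.mul_sum, mul_add, pow_one]
    refine congrArg₂ HAdd.hAdd (by ring) (Finset.sum_congr rfl fun j _ => by ring)
  rw [e2, HahnSeries.coeff_add, HahnSeries.C_mul_eq_smul, HahnSeries.coeff_smul, HahnSeries.coeff_sum]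
  -- At parameter 0 the twist is a power series, so it has no residue.
  have e3 : (W * twist ε 0 B (k + 1)).coeff (-1) = 0 := by
    obtain ⟨F, hF⟩ := twist_zero_mem ε B (k + 1)
    have : W = HahnSeries.ofPowerSeries ℤ _ ((1 + PowerSeries.X) ^ k) := by
      rw [map_pow, map_add, map_one (HahnSeries.ofPowerSeries ℤ (MvPolynomial ℕ+ ℝ)),
        HahnSeries.ofPowerSeries_X]
    rw [hF, this, ← map_mul, PowerSeries.coeff_coe, if_pos (by norm_num)]
  rw [e3, smul_zero, zero_add, Finset.mul_sum]
  refine Finset.sum_congr rfl fun i _ => ?_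
  obtain ⟨F, hF1, hF2⟩ := exists_twist_eq hN k i
  have hF3 := coeff_single_mul_ofPowerSeries _ F _ hF1
  set Ψ := W * twist ε (((i : ℕ) : MvPolynomial ℕ+ ℝ) * ε) B k with hΨ
  -- The new row is a combination of the rows of M plus a tail. Inserted in row i, a row q ≠ i gives
  -- a repeated row, so only the coefficient of F at q = i counts; it is the constant coefficient of
  -- Ψ met in the telescoped term.
  have hw : ∀ j, ε ^ k * hasseRow k m i j =
      ∑ q : Fin N, PowerSeries.coeff (q : ℕ) F * M q j +
        (zInv _ ^ (N - (i : ℕ)) * Ψ * tailSeries (scaledVar N) (m j - N)).coeff (-1) := by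
    intro j
    rw [coeff_zInv_pow_mul_tailSeries]
    have hc : ∀ p : ℕ, Ψ.coeff (((N - (i : ℕ) : ℕ) : ℤ) + p) = PowerSeries.coeff (N + p) F := by
      intro p
      rw [← hF3]
      congr 1
      have := i.2
      omega
    simp only [hc]
    have hq : ∑ q : Fin N, PowerSeries.coeff (q : ℕ) F * M q j = ∑ q ∈ Finset.range N,
        PowerSeries.coeff q F * expInt (scaledVar N) (m j - q) :=
      Fin.sum_univ_eq_sum_range
        (fun q => PowerSeries.coeff q F * expInt (scaledVar N) (m j - q)) N
    rw [hq]
    rcases lt_or_ge (m j) 0 with h | h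
    · rw [hasseRow, if_pos h, mul_zero, if_pos (by omega), add_zero]
      symm
      refine Finset.sum_eq_zero fun q _ => ?_
      rw [expInt_of_neg _ (by omega), mul_zero]
    · obtain ⟨n, hn⟩ : ∃ n : ℕ, m j = n := ⟨(m j).toNat, by omega⟩
      rw [hasseRow, if_neg (by omega), hn, ← coeff_mul_expGen_eq, hF2]
      rfl
  rw [pow_succ' ε k, mul_assoc, ← Matrix.det_updateRow_smul, det_updateRow_eq_sum,
    HahnSeries.C_mul_eq_smul, HahnSeries.coeff_smul, smul_eq_mul, HahnSeries.coeff_add,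
    HahnSeries.C_mul_eq_smul, HahnSeries.coeff_smul, smul_eq_mul, HahnSeries.coeff_sum,
    coeff_zInv_pow_mul]
  refine congrArg (HMul.hMul ε) ?_
  have h0 : Ψ.coeff (-1 + ((1 : ℕ) : ℤ)) = PowerSeries.coeff (i : ℕ) F := by
    rw [← hF3]
    congr 1
    simp
  simp only [Pi.smul_apply, smul_eq_mul, hw, add_mul, Finset.sum_add_distrib,
    HahnSeries.C_mul_eq_smul, HahnSeries.coeff_smul, h0]
  refine congrArg₂ HAdd.hAdd ?_ (Finset.sum_congr rfl fun j _ => mul_comm _ _)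
  simp only [Finset.sum_mul]
  rw [Finset.sum_comm]
  simp only [mul_assoc, ← Finset.mul_sum]
  have hadj : ∀ q, ∑ j, M q j * M.adjugate j i = if q = i then M.det else 0 := by
    intro q
    rw [← Matrix.mul_apply, Matrix.mul_adjugate, Matrix.smul_apply, Matrix.one_apply]
    split_ifs <;> simp
  simp only [hadj]
  simp [mul_comm, jacobiDet, hM]

/-- Trading row replacement for column replacement makes each new column a combination of columns of
the same Jacobi–Trudi type. -/
theorem vertex_jacobiDet_eq_sum (hN : N ≠ 0) (k : ℕ) (m : Fin N → ℤ) :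
    vertex (N : ℝ)⁻¹ k (jacobiDet m) = ((N : ℝ)⁻¹ ^ (k + 1)) • ∑ j, if m j < 0 then 0 else
      ∑ q ∈ Finset.range (k + 1), ((k.choose q : ℝ) * (((m j).toNat + q).choose k : ℝ)) •
        jacobiDet (Function.update m j (m j + q)) := by
  rw [vertex_jacobiDet hN, ← map_pow, ← MvPolynomial.smul_eq_C_mul]
  refine congrArg _ ?_
  refine (sum_det_updateRow_eq_sum_det_updateCol _ (Matrix.of (hasseRow k m))).trans ?_
  refine Finset.sum_congr rfl fun j _ => ?_
  rw [← Matrix.cramer_apply]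
  set M : Matrix (Fin N) (Fin N) (MvPolynomial ℕ+ ℝ) :=
    Matrix.of fun i j : Fin N => expInt (scaledVar N) (m j - (i : ℕ)) with hM
  split_ifs with h
  · have : (fun i => Matrix.of (hasseRow k m) i j) = 0 := by
      funext i
      simp [hasseRow, h]
    rw [this, map_zero]
    rfl
  · have : (fun i => Matrix.of (hasseRow k m) i j) = ∑ q ∈ Finset.range (k + 1),
        (MvPolynomial.C ((k.choose q : ℝ) * (((m j).toNat + q).choose k : ℝ)) : MvPolynomial ℕ+ ℝ) •
          fun i : Fin N => expInt (scaledVar N) (m j + q - (i : ℕ)) := by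
      funext i
      simp [hasseRow, h, Finset.sum_apply]
    rw [this, map_sum, Finset.sum_apply]
    refine Finset.sum_congr rfl fun q _ => ?_
    rw [map_smul, Pi.smul_apply, Matrix.cramer_apply, MvPolynomial.smul_eq_C_mul, smul_eq_mul,
      jacobiDet]
    congr 2
    ext1 i j'
    rcases eq_or_ne j' j with rfl | hj
    · simp
    · simp [hj, hM]

/-- The products of `N` of the elements `e_n`. -/
noncomputable def prodExp (n : Fin N → ℤ) : MvPolynomial ℕ+ ℝ :=
  ∏ j, expInt (scaledVar N) (n j)

theorem prodExp_of_neg (n : Fin N → ℤ) {i : Fin N} (h : n i < 0) : prodExp n = 0 :=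
  Finset.prod_eq_zero (Finset.mem_univ i) (expInt_of_neg _ h)

/-- The alternating sum is a Leibniz expansion of the determinant with its rows in reverse order,
whence the sign of the reversal. -/
theorem staircaseAlt_prodExp (m : Fin N → ℤ) :
    staircaseAlt prodExp m =
      ((Equiv.Perm.sign (Fin.revPerm : Equiv.Perm (Fin N)) : ℤˣ) : ℤ) • jacobiDet m := by
  have h := Matrix.det_permute (Fin.revPerm : Equiv.Perm (Fin N))
    (Matrix.of fun i j : Fin N => expInt (scaledVar N) (m j - (i : ℕ)))
  rw [zsmul_eq_mul, jacobiDet, ← h, Matrix.det_apply', staircaseAlt]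
  refine Finset.sum_congr rfl fun σ _ => ?_
  rw [zsmul_eq_mul]
  rfl

theorem staircaseAlt_map {V W : Type*} [AddCommGroup V] [AddCommGroup W] (f : V →+ W)
    (c : (Fin N → ℤ) → V) (m : Fin N → ℤ) :
    staircaseAlt (fun n => f (c n)) m = f (staircaseAlt c m) := by
  simp [staircaseAlt, map_sum]

/-- A linear map that vanishes on the determinants vanishes on the products. -/
theorem eq_zero_of_jacobiDet {V : Type*} [AddCommGroup V] (f : MvPolynomial ℕ+ ℝ →+ V)
    (h : ∀ m : Fin N → ℤ, f (jacobiDet m) = 0) (n : Fin N → ℤ) : f (prodExp n) = 0 := by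
  refine eq_zero_of_staircaseAlt_eq_zero (c := fun n => f (prodExp n)) ?_ ?_ n
  · intro n i hi
    rw [prodExp_of_neg n hi, map_zero]
  · intro m
    rw [staircaseAlt_map, staircaseAlt_prodExp, map_zsmul, h, smul_zero]

/-- The span of the products of `N` of the elements `e_n`. -/
noncomputable def prodSpan (N : ℕ) : Submodule ℝ (MvPolynomial ℕ+ ℝ) :=
  Submodule.span ℝ (Set.range (prodExp (N := N)))

theorem prodExp_mem (n : Fin N → ℤ) : prodExp n ∈ prodSpan N :=
  Submodule.subset_span ⟨n, rfl⟩

theorem jacobiDet_mem (m : Fin N → ℤ) : jacobiDet m ∈ prodSpan N := by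
  rw [jacobiDet, Matrix.det_apply']
  refine Submodule.sum_mem _ fun σ _ => ?_
  rw [← zsmul_eq_mul]
  exact Submodule.smul_of_tower_mem _ _ (prodExp_mem fun j => m j - ((σ j : Fin N) : ℕ))

/-- The functional is controlled only on the span of the products, so invariance is needed in order
to iterate. Passing to the quotient, `eq_zero_of_jacobiDet` leaves the determinants, where the
explicit formula applies. -/
theorem vertex_mem_prodSpan (hN : N ≠ 0) (k : ℕ) {Y : MvPolynomial ℕ+ ℝ} (hY : Y ∈ prodSpan N) :
    vertex (N : ℝ)⁻¹ k Y ∈ prodSpan N := by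
  refine Submodule.span_induction (p := fun Y _ => vertex (N : ℝ)⁻¹ k Y ∈ prodSpan N) ?_ ?_ ?_ ?_ hY
  · rintro _ ⟨n, rfl⟩
    rw [← Submodule.Quotient.mk_eq_zero]
    refine eq_zero_of_jacobiDet (((prodSpan N).mkQ ∘ₗ vertex (N : ℝ)⁻¹ k).toAddMonoidHom) ?_ n
    intro m
    show Submodule.Quotient.mk (vertex (N : ℝ)⁻¹ k (jacobiDet m)) = 0
    rw [Submodule.Quotient.mk_eq_zero, vertex_jacobiDet_eq_sum hN]
    refine Submodule.smul_mem _ _ (Submodule.sum_mem _ fun j _ => ?_)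
    split_ifs
    · exact Submodule.zero_mem _
    · exact Submodule.sum_mem _ fun q _ => Submodule.smul_mem _ _ (jacobiDet_mem _)
  · rw [map_zero]; exact Submodule.zero_mem _
  · intro x y _ _ hx hy
    rw [map_add]; exact Submodule.add_mem _ hx hy
  · intro a x _ hx
    rw [map_smul]; exact Submodule.smul_mem _ _ hx

/-- The normalized expansion coefficients of the Schur polynomial. -/
noncomputable def schurCoeff (lam : GT N) (n : Fin N → ℤ) : ℝ :=
  (schurTaylor lam.1 n : ℝ) / (schurTaylor lam.1 0 : ℝ)

/-- The functional whose values on the products are the normalized coefficients. -/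
noncomputable def schurFunctional (lam : GT N) : MvPolynomial ℕ+ ℝ →ₗ[ℝ] ℝ :=
  expFunctional fun n => schurCoeff lam fun i => (n i : ℤ)

theorem schurFunctional_prodExp (lam : GT N) (n : Fin N → ℤ) :
    schurFunctional lam (prodExp n) = schurCoeff lam n := by
  by_cases h : ∃ i, n i < 0
  · obtain ⟨i, hi⟩ := h
    rw [prodExp_of_neg n hi, map_zero, schurCoeff, schurTaylor_of_neg _ _ hi]
    simp
  · push Not at h
    obtain ⟨n', rfl⟩ : ∃ n' : Fin N → ℕ, n = fun i => (n' i : ℤ) :=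
      ⟨fun i => (n i).toNat, funext fun i => by have := h i; simp; omega⟩
    simp only [prodExp, expInt_natCast]
    rw [schurFunctional, expFunctional_prod]
    intro n σ
    simp only [schurCoeff]
    congr 2
    exact schurTaylor_comp_perm lam.1 lam.2 σ fun i => (n i : ℤ)

/-- The sum of the binomial coefficients of the shifted entries. -/
noncomputable def binomSum (k : ℕ) (lam : GT N) : ℝ :=
  ∑ i, ((Ring.choose (lam.1 i + staircase N i) k : ℤ) : ℝ)

/-- Both families of alternating sums are determinants, and the functional carries the products of
the e_n to normalized Taylor coefficients. -/
theorem schurFunctional_jacobiDet (lam : GT N) (m : Fin N → ℤ) :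
    ((Equiv.Perm.sign (Fin.revPerm : Equiv.Perm (Fin N)) : ℤˣ) : ℤ) •
        schurFunctional lam (jacobiDet m) =
      ((Matrix.det (Matrix.of fun i j => intChoose (lam.1 i + staircase N i) (m j)) : ℤ) : ℝ) /
        (schurTaylor lam.1 0 : ℝ) := by
  rw [← map_zsmul, ← staircaseAlt_prodExp, ← staircaseAlt_schurTaylor lam.1 lam.2]
  have := staircaseAlt_map (schurFunctional lam).toAddMonoidHom prodExp m
  refine this.symm.trans ?_
  simp only [LinearMap.toAddMonoidHom_coe, schurFunctional_prodExp]
  simp only [staircaseAlt, schurCoeff]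
  push_cast
  rw [Finset.sum_div]
  refine Finset.sum_congr rfl fun σ _ => ?_
  simp [mul_div_assoc]

/-- The dual computation on binomial determinants. By the binomial identity the modified column j
equals column j with its i-th entry multiplied by C(λ_i+N-i, k); summing over rows instead of
columns pulls this factor out of row i. -/
theorem sum_det_intChoose (lam : GT N) (k : ℕ) (m : Fin N → ℤ) :
    (∑ j, if m j < 0 then 0 else ∑ q ∈ Finset.range (k + 1), ((k.choose q : ℤ) *
      (((m j).toNat + q).choose k : ℤ)) * Matrix.det (Matrix.of fun i j' =>
        intChoose (lam.1 i + staircase N i) (Function.update m j (m j + q) j'))) =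
    (∑ i, Ring.choose (lam.1 i + staircase N i) k) *
      Matrix.det (Matrix.of fun i j => intChoose (lam.1 i + staircase N i) (m j)) := by
  set M : Matrix (Fin N) (Fin N) ℤ :=
    Matrix.of fun i j => intChoose (lam.1 i + staircase N i) (m j) with hM
  have h1 : ∀ j, (if m j < 0 then 0 else ∑ q ∈ Finset.range (k + 1), ((k.choose q : ℤ) *
      (((m j).toNat + q).choose k : ℤ)) * Matrix.det (Matrix.of fun i j' =>
        intChoose (lam.1 i + staircase N i) (Function.update m j (m j + q) j'))) =
      (M.updateCol j fun i => Ring.choose (lam.1 i + staircase N i) k * M i j).det := by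
    intro j
    rw [← Matrix.cramer_apply]
    split_ifs with h
    · have : (fun i => Ring.choose (lam.1 i + staircase N i) k * M i j) = 0 := by
        funext i
        simp [hM, intChoose_of_neg _ h]
      rw [this, map_zero]
      rfl
    · obtain ⟨n, hn⟩ : ∃ n : ℕ, m j = n := ⟨(m j).toNat, by omega⟩
      have : (fun i => Ring.choose (lam.1 i + staircase N i) k * M i j) =
          ∑ q ∈ Finset.range (k + 1), ((k.choose q : ℤ) * (((m j).toNat + q).choose k : ℤ)) •
            fun i : Fin N => intChoose (lam.1 i + staircase N i) (m j + q) := by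
        funext i
        rw [Finset.sum_apply, hM, Matrix.of_apply, hn, intChoose_natCast,
          ← sum_choose_mul_choose_mul_choose]
        refine Finset.sum_congr rfl fun q _ => ?_
        rw [Pi.smul_apply, ← Nat.cast_add, intChoose_natCast, smul_eq_mul, Int.toNat_natCast]
      rw [this, map_sum, Finset.sum_apply]
      refine Finset.sum_congr rfl fun q _ => ?_
      rw [map_smul, Pi.smul_apply, Matrix.cramer_apply, smul_eq_mul]
      congr 2
      ext i j'
      rcases eq_or_ne j' j with rfl | hj
      · simp
      · simp [hj, hM]
  rw [Finset.sum_congr rfl fun j _ => h1 j]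
  refine (sum_det_updateRow_eq_sum_det_updateCol M
    (Matrix.of fun i j => Ring.choose (lam.1 i + staircase N i) k * M i j)).symm.trans ?_
  rw [Finset.sum_mul]
  refine Finset.sum_congr rfl fun i _ => ?_
  have : (Matrix.of fun i j => Ring.choose (lam.1 i + staircase N i) k * M i j) i =
      Ring.choose (lam.1 i + staircase N i) k • M i := rfl
  rw [this, Matrix.det_updateRow_smul, Matrix.updateRow_eq_self]

/-- The Schur functionals are eigenvectors of the vertex operators. -/
theorem schurFunctional_vertex (hN : N ≠ 0) (lam : GT N) (k : ℕ) {Y : MvPolynomial ℕ+ ℝ}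
    (hY : Y ∈ prodSpan N) :
    schurFunctional lam (vertex (N : ℝ)⁻¹ k Y) =
      (N : ℝ)⁻¹ ^ (k + 1) * binomSum k lam * schurFunctional lam Y := by
  refine Submodule.span_induction (p := fun Y _ => schurFunctional lam (vertex (N : ℝ)⁻¹ k Y) =
      (N : ℝ)⁻¹ ^ (k + 1) * binomSum k lam * schurFunctional lam Y) ?_ ?_ ?_ ?_ hY
  · rintro _ ⟨n, rfl⟩
    rw [← sub_eq_zero]
    refine eq_zero_of_jacobiDet ((schurFunctional lam ∘ₗ vertex (N : ℝ)⁻¹ k -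
      ((N : ℝ)⁻¹ ^ (k + 1) * binomSum k lam) • schurFunctional lam).toAddMonoidHom) ?_ n
    intro m
    set sg : ℤ := ((Equiv.Perm.sign (Fin.revPerm : Equiv.Perm (Fin N)) : ℤˣ) : ℤ) with hsg
    have hsg2 : (sg : ℝ) * sg = 1 := by
      rw [← Int.cast_mul, hsg, ← sq, ← Units.val_pow_eq_pow_val, Int.units_sq]
      simp
    have hJ : ∀ m : Fin N → ℤ, schurFunctional lam (jacobiDet m) = sg *
        (((Matrix.det (Matrix.of fun i j => intChoose (lam.1 i + staircase N i) (m j)) : ℤ) : ℝ) /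
        (schurTaylor lam.1 0 : ℝ)) := by
      intro m
      rw [← schurFunctional_jacobiDet, ← hsg, zsmul_eq_mul, ← mul_assoc, hsg2, one_mul]
    show schurFunctional lam (vertex (N : ℝ)⁻¹ k (jacobiDet m)) -
      ((N : ℝ)⁻¹ ^ (k + 1) * binomSum k lam) * schurFunctional lam (jacobiDet m) = 0
    rw [vertex_jacobiDet_eq_sum hN, map_smul, smul_eq_mul, map_sum, mul_assoc, ← mul_sub, hJ]
    have h := congrArg (fun z : ℤ => (z : ℝ)) (sum_det_intChoose lam k m)
    simp only [Int.cast_mul, Int.cast_sum] at h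
    have h2 : ∑ j, schurFunctional lam (if m j < 0 then 0 else
        ∑ q ∈ Finset.range (k + 1), ((k.choose q : ℝ) * (((m j).toNat + q).choose k : ℝ)) •
        jacobiDet (Function.update m j (m j + q))) =
        sg * ((binomSum k lam * ((Matrix.det (Matrix.of fun i j =>
          intChoose (lam.1 i + staircase N i) (m j)) : ℤ) : ℝ)) / (schurTaylor lam.1 0 : ℝ)) := by
      rw [binomSum, ← h, Finset.sum_div, Finset.mul_sum]
      refine Finset.sum_congr rfl fun j _ => ?_
      split_ifs
      · simp
      · rw [map_sum, Int.cast_sum, Finset.sum_div, Finset.mul_sum]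
        refine Finset.sum_congr rfl fun q _ => ?_
        rw [map_smul, hJ, smul_eq_mul]
        push_cast
        ring
    rw [h2]
    ring
  · simp
  · intro x y _ _ hx hy
    rw [map_add, map_add, map_add, hx, hy]
    ring
  · intro a x _ hx
    rw [map_smul, map_smul, map_smul, hx, smul_eq_mul, smul_eq_mul]
    ring

end VertexEigen

/-! ### Convergence of the generating function and its derivatives near (1,…,1). -/

section Summability

variable {N : ℕ}

/-- Interlacing bounds each row of a pattern linearly by the row above it; only the existence of a
constant depending on N matters. -/
theorem exists_sum_natAbs_schurWeights_le (N : ℕ) : ∃ C : ℕ, ∀ (lam : Fin N → ℤ),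
    ∀ w ∈ schurWeights N lam, ∑ i, (w i).natAbs ≤ C * ∑ i, (lam i).natAbs := by
  induction N with
  | zero => exact ⟨0, by simp⟩
  | succ N ih =>
    obtain ⟨C, hC⟩ := ih
    refine ⟨2 * C + 3, fun lam w hw => ?_⟩
    rw [schurWeights, Multiset.mem_sum] at hw
    obtain ⟨mu, hmu, hw⟩ := hw
    obtain ⟨w', hw', rfl⟩ := Multiset.mem_map.1 hw
    have h1 : ∑ i, (mu i).natAbs ≤ 2 * ∑ i, (lam i).natAbs := by
      have h2 : ∑ i, (mu i).natAbs ≤ ∑ i : Fin N, ((lam i.castSucc).natAbs + (lam i.succ).natAbs) := by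
        refine Finset.sum_le_sum fun i _ => ?_
        have := Finset.mem_Icc.1 (Fintype.mem_piFinset.1 hmu i)
        omega
      rw [Finset.sum_add_distrib] at h2
      have h3 := Fin.sum_univ_castSucc fun i => (lam i).natAbs
      have h4 := Fin.sum_univ_succ fun i => (lam i).natAbs
      omega
    have h5 := hC mu w' hw'
    have h6 : (∑ i, lam i - ∑ i, mu i).natAbs ≤ ∑ i, (lam i).natAbs + ∑ i, (mu i).natAbs := by
      have a1 := Int.natAbs_sum_le Finset.univ lam
      have a2 := Int.natAbs_sum_le Finset.univ mu
      omega
    rw [Fin.sum_univ_castSucc]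
    simp only [Fin.snoc_castSucc, Fin.snoc_last]
    nlinarith [Nat.mul_le_mul_left C h1]

theorem schurTaylor_zero (lam : Fin N → ℤ) :
    schurTaylor lam 0 = Multiset.card (schurWeights N lam) := by
  simp [schurTaylor, intChoose]

theorem schurWeights_ne_zero (lam : Fin N → ℤ) (hlam : Antitone lam) : schurWeights N lam ≠ 0 := by
  induction N with
  | zero => simp [schurWeights]
  | succ N ih =>
    have h := ih (fun i => lam i.castSucc) fun i j hij => hlam (by simpa using hij)
    obtain ⟨w, hw⟩ := Multiset.exists_mem_of_ne_zero h
    rw [schurWeights]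
    intro h0
    have hmem : (Fin.snoc w (∑ i, lam i - ∑ i : Fin N, lam i.castSucc) : Fin (N + 1) → ℤ) ∈
        ∑ mu ∈ Fintype.piFinset fun i : Fin N => Finset.Icc (lam i.succ) (lam i.castSucc),
        (schurWeights N mu).map fun w =>
          (Fin.snoc w (∑ i, lam i - ∑ i, mu i) : Fin (N + 1) → ℤ) := by
      rw [Multiset.mem_sum]
      refine ⟨fun i => lam i.castSucc, ?_, Multiset.mem_map_of_mem _ hw⟩
      rw [Fintype.mem_piFinset]
      exact fun i => Finset.mem_Icc.2 ⟨hlam (Fin.castSucc_lt_succ (i := i)).le, le_rfl⟩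
    rw [h0] at hmem
    exact Multiset.notMem_zero _ hmem

/-- The average over the weights. -/
noncomputable def weightAvg (lam : Fin N → ℤ) (g : (Fin N → ℤ) → ℂ) : ℂ :=
  ((schurWeights N lam).map g).sum / (Multiset.card (schurWeights N lam) : ℂ)

theorem norm_weightAvg_le (lam : GT N) {g : (Fin N → ℤ) → ℂ} {B : ℝ}
    (h : ∀ w ∈ schurWeights N lam.1, ‖g w‖ ≤ B) : ‖weightAvg lam.1 g‖ ≤ B := by
  have hpos : 0 < (Multiset.card (schurWeights N lam.1) : ℝ) := by
    exact_mod_cast Multiset.card_pos.2 (schurWeights_ne_zero lam.1 lam.2)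
  rw [weightAvg, norm_div, Complex.norm_natCast, div_le_iff₀ hpos]
  refine (norm_multiset_sum_le _).trans ?_
  refine (Multiset.sum_le_card_nsmul _ B ?_).trans ?_
  · intro x hx
    simp only [Multiset.map_map, Multiset.mem_map, Function.comp_apply] at hx
    obtain ⟨w, hw, rfl⟩ := hx
    exact h w hw
  · simp [mul_comm]

/-- `w (w - 1) ⋯ (w - n + 1)`. -/
def fallingInt (w : ℤ) (n : ℕ) : ℤ := ∏ i ∈ Finset.range n, (w - i)

theorem fallingInt_succ (w : ℤ) (n : ℕ) : fallingInt w (n + 1) = fallingInt w n * (w - n) :=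
  Finset.prod_range_succ _ _

theorem fallingInt_eq (w : ℤ) (n : ℕ) : fallingInt w n = n.factorial * Ring.choose w n := by
  rw [← nsmul_eq_mul, ← Ring.descPochhammer_eq_factorial_smul_choose, ← Polynomial.eval_eq_smeval]
  induction n with
  | zero => simp [fallingInt]
  | succ n ih => rw [fallingInt_succ, descPochhammer_succ_right, Polynomial.eval_mul, ← ih]; simp

theorem abs_fallingInt_le (w : ℤ) (n : ℕ) : |((fallingInt w n : ℤ) : ℝ)| ≤ ((w.natAbs : ℝ) + n) ^ n := by
  rw [fallingInt, Int.cast_prod, Finset.abs_prod]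
  have h : ∀ i ∈ Finset.range n, |(((w - i : ℤ)) : ℝ)| ≤ (w.natAbs : ℝ) + n := by
    intro i hi
    have hi : i < n := Finset.mem_range.1 hi
    have h1 : |((w - i : ℤ) : ℝ)| = ((w - i).natAbs : ℝ) := by
      rw [← Int.cast_abs, Int.abs_eq_natAbs, Int.cast_natCast]
    rw [h1]
    have : (w - i).natAbs ≤ w.natAbs + n := by omega
    exact_mod_cast this
  refine (Finset.prod_le_prod (fun i _ => abs_nonneg _) h).trans ?_
  simp

theorem exists_add_pow_le (n : ℕ) {ρ : ℝ} (hρ : 1 < ρ) :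
    ∃ c : ℝ, 0 ≤ c ∧ ∀ k : ℕ, ((k : ℝ) + n) ^ n ≤ c * ρ ^ k := by
  have h1 : Tendsto (fun k : ℕ => (k : ℝ) ^ n * (1 / ρ) ^ k) atTop (𝓝 0) :=
    tendsto_pow_const_mul_const_pow_of_abs_lt_one n (by
      rw [abs_of_pos (by positivity), div_lt_one (by positivity)]; exact hρ)
  obtain ⟨c, hc⟩ := h1.bddAbove_range
  have hρ0 : 0 < ρ := by linarith
  have hc' : ∀ k : ℕ, (k : ℝ) ^ n ≤ c * ρ ^ k := by
    intro k
    have := hc ⟨k, rfl⟩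
    simp only [one_div, inv_pow] at this
    rwa [← div_eq_mul_inv, div_le_iff₀ (by positivity)] at this
  have hc0 : 0 ≤ c := by
    have := hc' 0
    rw [pow_zero, mul_one] at this
    exact le_trans (by positivity) this
  refine ⟨c * ρ ^ n, by positivity, fun k => ?_⟩
  have := hc' (k + n)
  rw [pow_add] at this
  push_cast at this
  calc _ ≤ c * (ρ ^ k * ρ ^ n) := this
    _ = _ := by ring

/-- The `n`-th derivative of `x^w`. -/
noncomputable def weightDeriv (n : Fin N → ℕ) (x : Fin N → ℂ) (w : Fin N → ℤ) : ℂ :=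
  ∏ i, ((fallingInt (w i) (n i) : ℂ) * x i ^ (w i - n i))

theorem norm_zpow_le {x : ℂ} {ρ : ℝ} (hρ : 1 ≤ ρ) (h1 : ‖x‖ ≤ ρ) (h2 : ρ⁻¹ ≤ ‖x‖) (k : ℤ) :
    ‖x ^ k‖ ≤ ρ ^ k.natAbs := by
  have hx : 0 < ‖x‖ := lt_of_lt_of_le (by positivity) h2
  rw [norm_zpow]
  obtain ⟨m, rfl | rfl⟩ := k.eq_nat_or_neg
  · rw [zpow_natCast, Int.natAbs_natCast]
    exact pow_le_pow_left₀ hx.le h1 m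
  · rw [zpow_neg, zpow_natCast, Int.natAbs_neg, Int.natAbs_natCast, ← inv_pow]
    exact pow_le_pow_left₀ (by positivity) (inv_le_of_inv_le₀ (by linarith) h2) m

/-- The region of convergence. -/
def annulus (N : ℕ) (ρ : ℝ) : Set (Fin N → ℂ) := {x | ∀ i, ρ⁻¹ < ‖x i‖ ∧ ‖x i‖ < ρ}

theorem exists_weightDeriv_le (n : Fin N → ℕ) {ρ : ℝ} (hρ : 1 < ρ) : ∃ c : ℝ, 0 ≤ c ∧
    ∀ x ∈ annulus N ρ, ∀ w : Fin N → ℤ,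
      ‖weightDeriv n x w‖ ≤ c * (ρ ^ 2) ^ ∑ i, (w i).natAbs := by
  choose c hc0 hc using fun i : Fin N => exists_add_pow_le (n i) hρ
  have hρ0 : 0 < ρ := by linarith
  refine ⟨∏ i, (c i * ρ ^ n i), Finset.prod_nonneg fun i _ => mul_nonneg (hc0 i) (by positivity),
    fun x hx w => ?_⟩
  rw [weightDeriv, norm_prod, ← Finset.prod_pow_eq_pow_sum, ← Finset.prod_mul_distrib]
  refine Finset.prod_le_prod (fun i _ => norm_nonneg _) fun i _ => ?_
  rw [norm_mul]
  have h1 : ‖((fallingInt (w i) (n i) : ℤ) : ℂ)‖ ≤ c i * ρ ^ (w i).natAbs := by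
    rw [Complex.norm_intCast]
    exact (abs_fallingInt_le _ _).trans (hc i _)
  have h2 : ‖x i ^ (w i - n i)‖ ≤ ρ ^ n i * ρ ^ (w i).natAbs := by
    refine (norm_zpow_le hρ.le (hx i).2.le (hx i).1.le _).trans ?_
    rw [← pow_add]
    exact pow_le_pow_right₀ hρ.le (by omega)
  calc _ ≤ (c i * ρ ^ (w i).natAbs) * (ρ ^ n i * ρ ^ (w i).natAbs) :=
        mul_le_mul h1 h2 (norm_nonneg _) (mul_nonneg (hc0 i) (by positivity))
    _ = _ := by ring

/-- The derivatives of the Schur generating function. -/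
noncomputable def genDeriv (τ : PMF (GT N)) (n : Fin N → ℕ) (x : Fin N → ℂ) : ℂ :=
  ∑' lam : GT N, ((τ lam).toReal : ℂ) * weightAvg lam.1 (weightDeriv n x)

theorem schurGen_eq_genDeriv (τ : PMF (GT N)) (x : Fin N → ℂ) : schurGen τ x = genDeriv τ 0 x := by
  refine tsum_congr fun lam => ?_
  rw [weightAvg, schurPoly_eq_sum_weights, schurPoly_eq_sum_weights]
  congr 2
  · congr 2
    funext w
    simp [weightDeriv, fallingInt]
  · simp

/-- Uniform summable bounds for the derivatives of the Schur generating function. -/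
theorem IsSmooth.exists_bound {τ : PMF (GT N)} (h : IsSmooth τ) : ∃ ρ : ℝ, 1 < ρ ∧
    ∀ n : Fin N → ℕ, ∃ u : GT N → ℝ, Summable u ∧ ∀ lam, ∀ x ∈ annulus N ρ,
      ‖((τ lam).toReal : ℂ) * weightAvg lam.1 (weightDeriv n x)‖ ≤ u lam := by
  obtain ⟨r, hr, hs⟩ := h
  obtain ⟨C, hC⟩ := exists_sum_natAbs_schurWeights_le N
  have hr0 : 0 < r := by linarith
  obtain ⟨ρ, hρ, hρr⟩ : ∃ ρ : ℝ, 1 < ρ ∧ (ρ ^ 2) ^ C ≤ r := by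
    -- The exponent is chosen so that ρ^{2C} ≤ r. The factor 2 is there because the derivative bound
    -- spends one ρ per unit of weight on the falling factorial and one on the power of x.
    refine ⟨r ^ ((2 * C + 1 : ℝ)⁻¹), Real.one_lt_rpow hr (by positivity), ?_⟩
    rw [← pow_mul, ← Real.rpow_natCast, ← Real.rpow_mul hr0.le]
    refine (Real.rpow_le_rpow_of_exponent_le hr.le ?_).trans_eq (Real.rpow_one r)
    push_cast
    rw [inv_mul_le_iff₀ (by positivity)]
    linarith
  refine ⟨ρ, hρ, fun n => ?_⟩
  obtain ⟨c, hc0, hc⟩ := exists_weightDeriv_le n hρ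
  refine ⟨fun lam => c * ((τ lam).toReal * r ^ ∑ i, (lam.1 i).natAbs), hs.mul_left c,
    fun lam x hx => ?_⟩
  have h1 : 1 ≤ ρ ^ 2 := one_le_pow₀ hρ.le
  have h2 : ‖weightAvg lam.1 (weightDeriv n x)‖ ≤ c * r ^ ∑ i, (lam.1 i).natAbs := by
    refine norm_weightAvg_le lam fun w hw => (hc x hx w).trans ?_
    refine mul_le_mul_of_nonneg_left ?_ hc0
    calc (ρ ^ 2) ^ ∑ i, (w i).natAbs ≤ (ρ ^ 2) ^ (C * ∑ i, (lam.1 i).natAbs) :=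
          pow_le_pow_right₀ h1 (hC lam.1 w hw)
      _ = ((ρ ^ 2) ^ C) ^ ∑ i, (lam.1 i).natAbs := pow_mul _ _ _
      _ ≤ _ := pow_le_pow_left₀ (by positivity) hρr _
  rw [norm_mul, Complex.norm_real, Real.norm_of_nonneg ENNReal.toReal_nonneg]
  calc _ ≤ (τ lam).toReal * (c * r ^ ∑ i, (lam.1 i).natAbs) :=
        mul_le_mul_of_nonneg_left h2 ENNReal.toReal_nonneg
    _ = _ := by ring

theorem one_mem_annulus {ρ : ℝ} (hρ : 1 < ρ) : (1 : Fin N → ℂ) ∈ annulus N ρ := by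
  intro i
  simp only [Pi.one_apply, norm_one]
  exact ⟨inv_lt_one_of_one_lt₀ hρ, hρ⟩

/-- At the point 1 the falling factorials are factorials times binomial coefficients, so derivatives
become normalized Taylor coefficients. -/
theorem weightAvg_one (lam : GT N) (n : Fin N → ℕ) :
    weightAvg lam.1 (weightDeriv n 1) =
      (((∏ i, ((n i).factorial : ℝ)) * schurCoeff lam fun i => (n i : ℤ) : ℝ) : ℂ) := by
  have h : ((schurTaylor lam.1 (fun i => (n i : ℤ)) : ℤ) : ℂ) =
      ((schurWeights N lam.1).map fun w => ((∏ i, intChoose (w i) (n i) : ℤ) : ℂ)).sum := by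
    have := map_multiset_sum (Int.castAddHom ℂ)
      ((schurWeights N lam.1).map fun w => ∏ i, intChoose (w i) (n i))
    rw [Multiset.map_map] at this
    exact this
  rw [weightAvg, schurCoeff, schurTaylor_zero, ← mul_div_assoc, Complex.ofReal_div,
    Complex.ofReal_mul, Complex.ofReal_intCast, h, ← Multiset.sum_map_mul_left]
  congr 1
  · congr 2
    funext w
    simp only [weightDeriv, Pi.one_apply, one_zpow, mul_one, fallingInt_eq, intChoose_natCast]
    push_cast
    rw [Finset.prod_mul_distrib]

theorem IsSmooth.summable_schurCoeff {τ : PMF (GT N)} (h : IsSmooth τ) (n : Fin N → ℕ) :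
    Summable fun lam : GT N => (τ lam).toReal * schurCoeff lam fun i => (n i : ℤ) := by
  obtain ⟨ρ, hρ, hb⟩ := h.exists_bound
  obtain ⟨u, hu, hub⟩ := hb n
  have hf : (∏ i, ((n i).factorial : ℝ)) ≠ 0 := by positivity
  rw [← summable_mul_left_iff hf]
  refine Summable.of_norm_bounded hu fun lam => ?_
  have := hub lam 1 (one_mem_annulus hρ)
  rw [weightAvg_one, ← Complex.ofReal_mul, Complex.norm_real] at this
  refine le_trans (le_of_eq ?_) this
  rw [mul_left_comm]

end Summability

/-! ### Iterated derivatives of the logarithm as cumulants. -/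

section GeneratingFunction

variable {N : ℕ}

theorem hasDerivAt_weightDeriv (n : Fin N → ℕ) (x : Fin N → ℂ) (j : Fin N) (w : Fin N → ℤ) (t : ℂ)
    (hx : (x + t • Pi.single j 1 : Fin N → ℂ) j ≠ 0) :
    HasDerivAt (fun t : ℂ => weightDeriv n (x + t • Pi.single j 1) w)
      (weightDeriv (n + Pi.single j 1) (x + t • Pi.single j 1) w) t := by
  have h1 : ∀ t : ℂ, weightDeriv n (x + t • Pi.single j 1) w =
      (fallingInt (w j) (n j) : ℂ) * (x j + t) ^ (w j - n j) *
        ∏ i ∈ Finset.univ.erase j, ((fallingInt (w i) (n i) : ℂ) * x i ^ (w i - n i)) := by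
    intro t
    rw [weightDeriv, ← Finset.mul_prod_erase _ _ (Finset.mem_univ j)]
    congr 1
    · simp
    · refine Finset.prod_congr rfl fun i hi => ?_
      simp [Finset.ne_of_mem_erase hi]
  have h2 : weightDeriv (n + Pi.single j 1) (x + t • Pi.single j 1) w =
      (fallingInt (w j) (n j) : ℂ) * (((w j - n j : ℤ) : ℂ) * (x j + t) ^ (w j - n j - 1)) *
        ∏ i ∈ Finset.univ.erase j, ((fallingInt (w i) (n i) : ℂ) * x i ^ (w i - n i)) := by
    rw [weightDeriv, ← Finset.mul_prod_erase _ _ (Finset.mem_univ j)]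
    congr 1
    · simp only [Pi.add_apply, Pi.single_eq_same, Pi.smul_apply, smul_eq_mul, mul_one,
        fallingInt_succ]
      push_cast
      rw [← mul_assoc, sub_sub]
    · refine Finset.prod_congr rfl fun i hi => ?_
      simp [Finset.ne_of_mem_erase hi]
  rw [h2, funext h1]
  refine HasDerivAt.mul_const (HasDerivAt.const_mul _ ?_) _
  have h3 : x j + t ≠ 0 := by simpa using hx
  have h4 := (hasDerivAt_zpow (w j - n j) (x j + t) (Or.inl h3)).comp_const_add (x j) t
  exact h4

theorem hasDerivAt_weightAvg (lam : Fin N → ℤ) {g : ℂ → (Fin N → ℤ) → ℂ} {g' : (Fin N → ℤ) → ℂ}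
    {t : ℂ} (h : ∀ w, HasDerivAt (fun t => g t w) (g' w) t) :
    HasDerivAt (fun t => weightAvg lam (g t)) (weightAvg lam g') t := by
  classical
  unfold weightAvg
  refine HasDerivAt.div_const ?_ _
  simp only [Finset.sum_multiset_map_count, nsmul_eq_mul]
  exact HasDerivAt.fun_sum fun w _ => (h w).const_mul _

theorem continuousOn_weightAvg (lam : Fin N → ℤ) (n : Fin N → ℕ) {ρ : ℝ} (hρ : 1 < ρ) :
    ContinuousOn (fun x => weightAvg lam (weightDeriv n x)) (annulus N ρ) := by
  classical
  unfold weightAvg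
  refine ContinuousOn.div_const ?_ _
  simp only [Finset.sum_multiset_map_count, nsmul_eq_mul]
  refine continuousOn_finsetSum _ fun w _ => continuousOn_const.mul ?_
  refine continuousOn_finsetProd _ fun i _ => continuousOn_const.mul ?_
  refine ContinuousOn.zpow₀ (continuous_apply i).continuousOn _ fun x hx => Or.inl ?_
  have := (hx i).1
  exact norm_pos_iff.1 (lt_trans (inv_pos.2 (by linarith)) this)

theorem isOpen_annulus (ρ : ℝ) : IsOpen (annulus N ρ) := by
  have : annulus N ρ = ⋂ i, {x : Fin N → ℂ | ρ⁻¹ < ‖x i‖ ∧ ‖x i‖ < ρ} := by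
    ext x; simp [annulus]
  rw [this]
  refine isOpen_iInter_of_finite fun i => ?_
  exact (isOpen_lt continuous_const (continuous_apply i).norm).inter
    (isOpen_lt (continuous_apply i).norm continuous_const)

/-- A radius for which the derivatives of the generating function have summable bounds. -/
def HasBounds (τ : PMF (GT N)) (ρ : ℝ) : Prop := 1 < ρ ∧
  ∀ n : Fin N → ℕ, ∃ u : GT N → ℝ, Summable u ∧ ∀ lam, ∀ x ∈ annulus N ρ,
    ‖((τ lam).toReal : ℂ) * weightAvg lam.1 (weightDeriv n x)‖ ≤ u lam

theorem HasBounds.hasDerivAt_genDeriv {τ : PMF (GT N)} {ρ : ℝ} (h : HasBounds τ ρ)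
    (n : Fin N → ℕ) {x : Fin N → ℂ} (hx : x ∈ annulus N ρ) (j : Fin N) :
    HasDerivAt (fun t : ℂ => genDeriv τ n (x + t • Pi.single j 1))
      (genDeriv τ (n + Pi.single j 1) x) 0 := by
  have hcont : Continuous fun t : ℂ => (x + t • Pi.single j 1 : Fin N → ℂ) := by fun_prop
  have hopen : IsOpen ((fun t : ℂ => (x + t • Pi.single j 1 : Fin N → ℂ)) ⁻¹' annulus N ρ) :=
    (isOpen_annulus ρ).preimage hcont
  have h0 : (0 : ℂ) ∈ (fun t : ℂ => (x + t • Pi.single j 1 : Fin N → ℂ)) ⁻¹' annulus N ρ := by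
    simpa using hx
  obtain ⟨δ, hδ, hball⟩ := Metric.isOpen_iff.1 hopen 0 h0
  obtain ⟨u, hu, hub⟩ := h.2 (n + Pi.single j 1)
  obtain ⟨u0, hu0, hub0⟩ := h.2 n
  have key := hasDerivAt_tsum_of_isPreconnected (𝕜 := ℂ) (F := ℂ)
    (g := fun (lam : GT N) (t : ℂ) =>
      ((τ lam).toReal : ℂ) * weightAvg lam.1 (weightDeriv n (x + t • Pi.single j 1)))
    (g' := fun (lam : GT N) (t : ℂ) =>
      ((τ lam).toReal : ℂ) * weightAvg lam.1 (weightDeriv (n + Pi.single j 1) (x + t • Pi.single j 1)))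
    (t := Metric.ball 0 δ) (y₀ := 0) (y := 0) hu Metric.isOpen_ball
    (convex_ball (0 : ℂ) δ).isPreconnected
    (fun lam t ht => (hasDerivAt_weightAvg lam.1 fun w =>
      hasDerivAt_weightDeriv n x j w t (by
        have := (hball ht j).1
        exact norm_pos_iff.1 (lt_trans (inv_pos.2 (by linarith [h.1])) this))).const_mul _)
    (fun lam t ht => hub lam _ (hball ht)) (Metric.mem_ball_self hδ)
    (Summable.of_norm_bounded hu0 fun lam => hub0 lam _ h0) (Metric.mem_ball_self hδ)
  simpa [genDeriv] using key

theorem HasBounds.continuousOn_genDeriv {τ : PMF (GT N)} {ρ : ℝ} (h : HasBounds τ ρ)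
    (n : Fin N → ℕ) : ContinuousOn (genDeriv τ n) (annulus N ρ) := by
  obtain ⟨u, hu, hub⟩ := h.2 n
  exact continuousOn_tsum (fun lam => continuousOn_const.mul (continuousOn_weightAvg lam.1 n h.1)) hu hub

theorem partialD_direction (j : Fin N) :
    (fun i : Fin N => if (i : ℕ) = (j : ℕ) then (1 : ℂ) else 0) = Pi.single j 1 := by
  funext i
  simp [Pi.single_apply, Fin.ext_iff]

theorem partialD_eq_of_hasDerivAt {f : (Fin N → ℂ) → ℂ} {x : Fin N → ℂ} {j : Fin N} {c : ℂ}
    (h : HasDerivAt (fun t : ℂ => f (x + t • Pi.single j 1)) c 0) : partialD (j : ℕ) f x = c := by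
  rw [partialD, partialD_direction]
  exact HasLineDerivAt.lineDeriv h

theorem partialD_congr {f g : (Fin N → ℂ) → ℂ} {s : Set (Fin N → ℂ)} (hs : IsOpen s)
    (h : ∀ x ∈ s, f x = g x) (i : ℕ) {x : Fin N → ℂ} (hx : x ∈ s) :
    partialD i f x = partialD i g x :=
  Filter.EventuallyEq.lineDeriv_eq (Filter.eventually_of_mem (hs.mem_nhds hx) h)

/-- The number of positions of every colour. -/
def colourCount (col : ℕ → Fin N) (U : Finset ℕ) : Fin N → ℕ :=
  fun i => (U.filter fun p => col p = i).card

theorem colourCount_insert (col : ℕ → Fin N) {U : Finset ℕ} {p : ℕ} (hp : p ∉ U) :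
    colourCount col (insert p U) = colourCount col U + Pi.single (col p) 1 := by
  funext i
  rw [colourCount, Finset.filter_insert]
  by_cases h : col p = i
  · subst h
    simp [colourCount, hp]
  · simp [colourCount, h, Ne.symm h]

theorem colourCount_empty (col : ℕ → Fin N) : colourCount col ∅ = 0 := by
  funext i; simp [colourCount]

/-- The list of the colours of the positions `n - 1, …, 0`. -/
def colourList (col : ℕ → Fin N) : ℕ → List ℕ
  | 0 => []
  | n + 1 => (col n : ℕ) :: colourList col n

/-- The ratios of derivatives of S to S play the role of moments, and each further differentiation
of ln S appends an index by `hasDerivAt_cum`. Positions of differentiations serve as indices, so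
repeated variables need no special treatment. The identity is kept on an open set because the next
derivative uses nearby points. -/
theorem HasBounds.foldr_partialD_log {τ : PMF (GT N)} {ρ : ℝ} (h : HasBounds τ ρ)
    (col : ℕ → Fin N) (n : ℕ) {x : Fin N → ℂ} (hx : x ∈ annulus N ρ)
    (hx' : genDeriv τ 0 x ∈ Complex.slitPlane) :
    (colourList col (n + 1)).foldr partialD (fun x => Complex.log (schurGen τ x)) x =
      cum (fun U => genDeriv τ (colourCount col U) x / genDeriv τ 0 x) (Finset.range (n + 1)) := by
  set s : Set (Fin N → ℂ) := annulus N ρ ∩ genDeriv τ 0 ⁻¹' Complex.slitPlane with hs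
  have hopen : IsOpen s :=
    (h.continuousOn_genDeriv 0).isOpen_inter_preimage (isOpen_annulus ρ) Complex.isOpen_slitPlane
  replace hx : x ∈ s := ⟨hx, hx'⟩
  clear hx'
  have hne : ∀ x ∈ s, genDeriv τ 0 x ≠ 0 := fun x hx => Complex.slitPlane_ne_zero hx.2
  have hM0 : ∀ x ∈ s, genDeriv τ (colourCount col ∅) x / genDeriv τ 0 x = 1 := by
    intro x hx
    rw [colourCount_empty, div_self (hne x hx)]
  induction n generalizing x with
  | zero =>
    simp only [colourList, List.foldr_cons, List.foldr_nil]
    rw [show Finset.range (0 + 1) = {0} from rfl, cum_singleton _ (hM0 x hx)]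
    refine partialD_eq_of_hasDerivAt ?_
    have hd := h.hasDerivAt_genDeriv 0 hx.1 (col 0)
    have := hd.clog (by simpa using hx.2)
    simp only [zero_smul, add_zero] at this
    simp only [schurGen_eq_genDeriv]
    convert this using 3
    rw [← insert_empty_eq, colourCount_insert col (Finset.notMem_empty 0), colourCount_empty]
  | succ n ih =>
    rw [colourList, List.foldr_cons, partialD_congr hopen (fun y hy => ih hy) _ hx,
      Finset.range_add_one (n := n + 1)]
    refine partialD_eq_of_hasDerivAt ?_
    have hcont : Continuous fun t : ℂ => (x + t • Pi.single (col (n + 1)) 1 : Fin N → ℂ) := by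
      fun_prop
    have hmem : ∀ᶠ t : ℂ in 𝓝 0, (x + t • Pi.single (col (n + 1)) 1 : Fin N → ℂ) ∈ s :=
      hcont.continuousAt.eventually_mem (hopen.mem_nhds (by simpa using hx))
    have key := hasDerivAt_cum (M := fun t U =>
        genDeriv τ (colourCount col U) (x + t • Pi.single (col (n + 1)) 1) /
          genDeriv τ 0 (x + t • Pi.single (col (n + 1)) 1)) (x := 0) (p := n + 1)
      (hmem.mono fun t ht => hM0 _ ht) (I₀ := Finset.range (n + 1)) (by simp) (by
        intro U hU
        have hp : n + 1 ∉ U := fun h => by simpa using hU h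
        have hd := h.hasDerivAt_genDeriv (colourCount col U) hx.1 (col (n + 1))
        have hd0 := h.hasDerivAt_genDeriv 0 hx.1 (col (n + 1))
        have := hd.div hd0 (by simpa using hne x hx)
        refine HasDerivAt.congr_deriv this ?_
        simp only [zero_smul, add_zero]
        rw [← insert_empty_eq, colourCount_insert col hp,
          colourCount_insert col (Finset.notMem_empty _), colourCount_empty, zero_add]
        have := hne x hx
        field_simp) (Finset.range (n + 1)) subset_rfl (by simp)
    simpa using key

end GeneratingFunction

/-! ### The functional of a smooth measure as an average of Schur functionals. -/

section MeasureFunctional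

variable {N : ℕ}

/-- The mean of the normalized expansion coefficients. -/
noncomputable def meanCoeff (τ : PMF (GT N)) (n : Fin N → ℕ) : ℝ :=
  ∑' lam : GT N, (τ lam).toReal * schurCoeff lam fun i => (n i : ℤ)

/-- The functional of a measure. -/
noncomputable def measFunctional (τ : PMF (GT N)) : MvPolynomial ℕ+ ℝ →ₗ[ℝ] ℝ :=
  expFunctional (meanCoeff τ)

/-- The functional is linear in its prescribed values and each polynomial involves finitely many of
them, so it commutes with averaging. -/
theorem hasSum_posFunctional {ι : Type*} (p : ι → ℝ) (T : ι → (Fin N → ℕ) → ℝ)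
    (hs : ∀ n, Summable fun i => p i * T i n) (Y : MvPolynomial ℕ+ ℝ) :
    HasSum (fun i => p i * posFunctional (T i) Y) (posFunctional (fun n => ∑' i, p i * T i n) Y) := by
  classical
  induction Y using MvPolynomial.induction_on' with
  | monomial α a =>
    have hb : MvPolynomial.monomial α a =
        a • MvPolynomial.basisMonomials ℕ+ ℝ α := by
      rw [MvPolynomial.coe_basisMonomials, MvPolynomial.smul_monomial, smul_eq_mul, mul_one]
    simp only [hb, map_smul, posFunctional, Module.Basis.constr_basis, smul_eq_mul,
      mul_left_comm _ a]
    refine HasSum.mul_left a ?_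
    split_ifs with h
    · exact (hs _).hasSum
    · simp
  | add p q hp hq =>
    simp only [map_add, mul_add]
    exact hp.add hq

theorem IsSmooth.hasSum_schurFunctional {τ : PMF (GT N)} (h : IsSmooth τ) (Y : MvPolynomial ℕ+ ℝ) :
    HasSum (fun lam => (τ lam).toReal * schurFunctional lam Y) (measFunctional τ Y) :=
  hasSum_posFunctional _ _ h.summable_schurCoeff _

theorem schurCoeff_zero (lam : GT N) : schurCoeff lam 0 = 1 := by
  rw [schurCoeff, div_self]
  rw [schurTaylor_zero]
  simpa using schurWeights_ne_zero lam.1 lam.2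

theorem prodExp_zero : prodExp (0 : Fin N → ℤ) = 1 := by
  simp [prodExp, expInt]

theorem schurFunctional_one (lam : GT N) : schurFunctional lam 1 = 1 := by
  rw [← prodExp_zero (N := N), schurFunctional_prodExp, schurCoeff_zero]

theorem hasSum_toReal (τ : PMF (GT N)) : HasSum (fun lam => (τ lam).toReal) 1 := by
  have h := ENNReal.hasSum_toReal (f := τ) (by rw [τ.tsum_coe]; simp)
  rwa [← ENNReal.tsum_toReal_eq τ.apply_ne_top, τ.tsum_coe, ENNReal.toReal_one] at h

theorem IsSmooth.measFunctional_one {τ : PMF (GT N)} (h : IsSmooth τ) : measFunctional τ 1 = 1 := by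
  have := h.hasSum_schurFunctional 1
  simp only [schurFunctional_one, mul_one] at this
  exact this.unique (hasSum_toReal τ)

theorem IsSmooth.measFunctional_prodExp {τ : PMF (GT N)} (h : IsSmooth τ) (n : Fin N → ℕ) :
    measFunctional τ (prodExp fun i => (n i : ℤ)) = meanCoeff τ n := by
  have := h.hasSum_schurFunctional (prodExp fun i => (n i : ℤ))
  simp only [schurFunctional_prodExp] at this
  exact this.unique (h.summable_schurCoeff n).hasSum

/-- The derivatives of the logarithm of the Schur generating function are joint cumulants. -/
theorem IsSmooth.logDerivAtOne_eq {τ : PMF (GT N)} (h : IsSmooth τ) (col : ℕ → Fin N) (n : ℕ) :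
    logDerivAtOne τ (colourList col (n + 1)) =
      ((cum (fun U => (∏ i, ((colourCount col U i).factorial : ℝ)) *
        measFunctional τ (prodExp fun i => (colourCount col U i : ℤ)))
          (Finset.range (n + 1)) : ℝ) : ℂ) := by
  obtain ⟨ρ, hb⟩ := h.exists_bound
  have hb : HasBounds τ ρ := hb
  have hD : ∀ m : Fin N → ℕ, genDeriv τ m 1 =
      (((∏ i, ((m i).factorial : ℝ)) * measFunctional τ (prodExp fun i => (m i : ℤ)) : ℝ) : ℂ) := by
    intro m
    rw [genDeriv, h.measFunctional_prodExp, meanCoeff, ← tsum_mul_left, Complex.ofReal_tsum]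
    refine tsum_congr fun lam => ?_
    rw [weightAvg_one]
    push_cast
    ring
  have h0 : genDeriv τ 0 1 = 1 := by
    rw [hD]
    have : prodExp (fun i : Fin N => (((0 : Fin N → ℕ) i : ℕ) : ℤ)) = 1 := prodExp_zero
    rw [this, h.measFunctional_one]
    simp
  rw [logDerivAtOne, hb.foldr_partialD_log col n (one_mem_annulus hb.1) (by rw [h0]; simp)]
  simp only [h0, div_one, hD, cum]
  push_cast
  rfl

end MeasureFunctional

/-! ### The weight filtration, β_m having weight m. -/

section WeightFiltration

variable {K : Type*} [CommRing K]

/-- The weight of an exponent vector, the variable of index `m` having weight `m`. -/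
noncomputable def expWeight : (ℕ+ →₀ ℕ) →+ ℕ := Finsupp.weight fun m : ℕ+ => (m : ℕ)

theorem expWeight_single (m : ℕ+) (e : ℕ) : expWeight (Finsupp.single m e) = e * m := by
  simp [expWeight, Finsupp.weight_single]

/-- The polynomials of weight at most `n`. -/
def wtLE (K : Type*) [CommRing K] (n : ℤ) : AddSubgroup (MvPolynomial ℕ+ K) where
  carrier := {p | ∀ d, p.coeff d ≠ 0 → (expWeight d : ℤ) ≤ n}
  zero_mem' := by simp
  add_mem' := by
    intro p q hp hq d hd
    by_contra h
    refine hd ?_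
    rw [MvPolynomial.coeff_add]
    rw [not_imp_comm.1 (hp d) h, not_imp_comm.1 (hq d) h, add_zero]
  neg_mem' := by
    intro p hp d hd
    exact hp d (by simpa using hd)

theorem wtLE_mono {m n : ℤ} (h : m ≤ n) {p : MvPolynomial ℕ+ K} (hp : p ∈ wtLE K m) :
    p ∈ wtLE K n := fun d hd => (hp d hd).trans h

theorem monomial_mem_wtLE (d : ℕ+ →₀ ℕ) (c : K) :
    MvPolynomial.monomial d c ∈ wtLE K (expWeight d) := by
  classical
  intro d' hd'
  rw [MvPolynomial.coeff_monomial] at hd'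
  split_ifs at hd' with h
  · rw [h]
  · simp at hd'

theorem C_mem_wtLE (c : K) : MvPolynomial.C c ∈ wtLE K 0 := by
  simpa using monomial_mem_wtLE (0 : ℕ+ →₀ ℕ) c

theorem one_mem_wtLE : (1 : MvPolynomial ℕ+ K) ∈ wtLE K 0 := by
  simpa using C_mem_wtLE (1 : K)

theorem X_mem_wtLE (m : ℕ+) : (MvPolynomial.X m : MvPolynomial ℕ+ K) ∈ wtLE K m := by
  have := monomial_mem_wtLE (Finsupp.single m 1) (1 : K)
  rwa [expWeight_single, one_mul] at this

theorem mul_mem_wtLE {m n : ℤ} {p q : MvPolynomial ℕ+ K} (hp : p ∈ wtLE K m) (hq : q ∈ wtLE K n) :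
    p * q ∈ wtLE K (m + n) := by
  classical
  intro d hd
  rw [MvPolynomial.coeff_mul] at hd
  obtain ⟨x, hx, hne⟩ := Finset.exists_ne_zero_of_sum_ne_zero hd
  have h1 := hp x.1 (left_ne_zero_of_mul hne)
  have h2 := hq x.2 (right_ne_zero_of_mul hne)
  rw [← Finset.HasAntidiagonal.mem_antidiagonal.1 hx, map_add]
  push_cast
  linarith

theorem prod_mem_wtLE {ι : Type*} (s : Finset ι) (p : ι → MvPolynomial ℕ+ K) (w : ι → ℤ)
    (h : ∀ i ∈ s, p i ∈ wtLE K (w i)) : ∏ i ∈ s, p i ∈ wtLE K (∑ i ∈ s, w i) := by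
  classical
  induction s using Finset.induction_on with
  | empty => simpa using one_mem_wtLE
  | insert a s ha ih =>
    rw [Finset.prod_insert ha, Finset.sum_insert ha]
    exact mul_mem_wtLE (h a (by simp)) (ih fun i hi => h i (by simp [hi]))

theorem algebraMap_mem_wtLE [Algebra ℚ K] (q : ℚ) :
    algebraMap ℚ (MvPolynomial ℕ+ K) q ∈ wtLE K 0 := by
  rw [IsScalarTower.algebraMap_apply ℚ K, MvPolynomial.algebraMap_eq]
  exact C_mem_wtLE _

/-- Laurent series whose coefficient of `z^i` has weight at most `w + i`. -/
def laurentWtLE (K : Type*) [CommRing K] (w : ℤ) : AddSubgroup (LaurentSeries (MvPolynomial ℕ+ K)) where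
  carrier := {f | ∀ i, f.coeff i ∈ wtLE K (w + i)}
  zero_mem' := fun i => by simp [zero_mem]
  add_mem' := fun hf hg i => by rw [HahnSeries.coeff_add]; exact add_mem (hf i) (hg i)
  neg_mem' := fun hf i => by rw [HahnSeries.coeff_neg]; exact neg_mem (hf i)

theorem laurentWtLE_mono {m n : ℤ} (h : m ≤ n) {f : LaurentSeries (MvPolynomial ℕ+ K)}
    (hf : f ∈ laurentWtLE K m) : f ∈ laurentWtLE K n :=
  fun i => wtLE_mono (by linarith) (hf i)

theorem mul_mem_laurentWtLE {m n : ℤ} {f g : LaurentSeries (MvPolynomial ℕ+ K)}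
    (hf : f ∈ laurentWtLE K m) (hg : g ∈ laurentWtLE K n) : f * g ∈ laurentWtLE K (m + n) := by
  intro i
  rw [HahnSeries.coeff_mul]
  refine sum_mem fun x hx => ?_
  rw [Finset.mem_antidiagonal] at hx
  rw [← hx.2.2, show m + n + (x.1 + x.2) = m + x.1 + (n + x.2) by ring]
  exact mul_mem_wtLE (hf _) (hg _)

theorem single_mem_laurentWtLE (i w : ℤ) {a : MvPolynomial ℕ+ K} (ha : a ∈ wtLE K (w + i)) :
    HahnSeries.single i a ∈ laurentWtLE K w := by
  intro j
  by_cases h : j = i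
  · rw [h, HahnSeries.coeff_single_same]; exact ha
  · rw [HahnSeries.coeff_single_of_ne h]; exact zero_mem _

theorem C_mem_laurentWtLE {w : ℤ} {a : MvPolynomial ℕ+ K} (ha : a ∈ wtLE K w) :
    HahnSeries.C a ∈ laurentWtLE K w :=
  single_mem_laurentWtLE 0 w (by simpa using ha)

theorem one_mem_laurentWtLE : 1 ∈ laurentWtLE K 0 := by
  simpa using C_mem_laurentWtLE (one_mem_wtLE (K := K))

theorem zInv_mem_laurentWtLE : zInv (MvPolynomial ℕ+ K) ∈ laurentWtLE K 1 :=
  single_mem_laurentWtLE (-1) 1 (by simpa using one_mem_wtLE)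

theorem pow_mem_laurentWtLE {w : ℤ} {f : LaurentSeries (MvPolynomial ℕ+ K)}
    (hf : f ∈ laurentWtLE K w) (n : ℕ) : f ^ n ∈ laurentWtLE K (n * w) := by
  induction n with
  | zero => simpa using one_mem_laurentWtLE
  | succ n ih =>
    rw [pow_succ]
    exact laurentWtLE_mono (by push_cast; linarith) (mul_mem_laurentWtLE ih hf)

theorem derivative_mem_laurentWtLE {w : ℤ} {f : LaurentSeries (MvPolynomial ℕ+ K)}
    (hf : f ∈ laurentWtLE K w) : LaurentSeries.derivative (MvPolynomial ℕ+ K) f ∈ laurentWtLE K (w + 1) := by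
  intro i
  rw [laurent_coeff_derivative]
  refine zsmul_mem ?_ _
  have := hf (i + 1)
  rwa [show w + 1 + i = w + (i + 1) by ring]

theorem derivGen_mem_laurentWtLE :
    HahnSeries.ofPowerSeries ℤ _ (derivGen (varSeq K)) ∈ laurentWtLE K 1 := by
  intro i
  rw [PowerSeries.coeff_coe]
  split_ifs with h
  · exact zero_mem _
  · obtain ⟨j, rfl⟩ := Int.eq_ofNat_of_zero_le (not_lt.1 h)
    rw [derivGen, PowerSeries.coeff_mk, Int.natAbs_natCast, varSeq]
    have h1 : ((j : MvPolynomial ℕ+ K) + 1) ∈ wtLE K 0 := by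
      simpa using C_mem_wtLE ((j : K) + 1)
    refine wtLE_mono ?_ (mul_mem_wtLE h1 (X_mem_wtLE _))
    simp

variable [Algebra ℚ K]

/-- Each of ε∂, 1/z and B raises the degree by at most one when z^i is allowed the additional weight
i. -/
theorem twist_mem_laurentWtLE (ε : K) (n : ℕ) :
    twist (MvPolynomial.C ε) 1 (derivGen (varSeq K)) n ∈ laurentWtLE K n := by
  induction n with
  | zero => exact one_mem_laurentWtLE
  | succ n ih =>
    rw [twist]
    refine laurentWtLE_mono (m := 0 + (n + 1)) (by push_cast; linarith) (mul_mem_laurentWtLE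
      (C_mem_laurentWtLE (algebraMap_mem_wtLE _)) (add_mem ?_ ?_))
    · exact laurentWtLE_mono (by linarith) (mul_mem_laurentWtLE (C_mem_laurentWtLE (C_mem_wtLE ε))
        (derivative_mem_laurentWtLE ih))
    · refine laurentWtLE_mono (m := 1 + n) (by linarith) (mul_mem_laurentWtLE (add_mem ?_ ?_) ih)
      · rw [map_one, one_mul]; exact zInv_mem_laurentWtLE
      · exact derivGen_mem_laurentWtLE

/-- Series in `z` and `t` whose coefficient of `z^i t^j` has weight at most `w + i + j`. -/
def vertexWtLE (K : Type*) [CommRing K] (w : ℤ) :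
    AddSubgroup (PowerSeries (LaurentSeries (MvPolynomial ℕ+ K))) where
  carrier := {F | ∀ j : ℕ, PowerSeries.coeff j F ∈ laurentWtLE K (w + j)}
  zero_mem' := fun i => by simp [zero_mem]
  add_mem' := fun hf hg i => by rw [map_add]; exact add_mem (hf i) (hg i)
  neg_mem' := fun hf i => by rw [map_neg]; exact neg_mem (hf i)

theorem vertexWtLE_mono {m n : ℤ} (h : m ≤ n) {F : PowerSeries (LaurentSeries (MvPolynomial ℕ+ K))}
    (hF : F ∈ vertexWtLE K m) : F ∈ vertexWtLE K n :=
  fun i => laurentWtLE_mono (by linarith) (hF i)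

theorem mul_mem_vertexWtLE {m n : ℤ} {F G : PowerSeries (LaurentSeries (MvPolynomial ℕ+ K))}
    (hF : F ∈ vertexWtLE K m) (hG : G ∈ vertexWtLE K n) : F * G ∈ vertexWtLE K (m + n) := by
  intro j
  rw [PowerSeries.coeff_mul]
  refine sum_mem fun x hx => ?_
  rw [← Finset.HasAntidiagonal.mem_antidiagonal.1 hx]
  push_cast
  rw [show m + n + ((x.1 : ℤ) + x.2) = m + x.1 + (n + x.2) by ring]
  exact mul_mem_laurentWtLE (hF _) (hG _)

theorem C_mem_vertexWtLE {w : ℤ} {f : LaurentSeries (MvPolynomial ℕ+ K)}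
    (hf : f ∈ laurentWtLE K w) : PowerSeries.C f ∈ vertexWtLE K w := by
  intro j
  rw [PowerSeries.coeff_C]
  split_ifs with h
  · simpa [h] using hf
  · exact zero_mem _

theorem vconst_mem_vertexWtLE {w : ℤ} {a : MvPolynomial ℕ+ K} (ha : a ∈ wtLE K w) :
    vconst _ a ∈ vertexWtLE K w :=
  C_mem_vertexWtLE (C_mem_laurentWtLE ha)

theorem one_mem_vertexWtLE : 1 ∈ vertexWtLE K 0 := by
  simpa using vconst_mem_vertexWtLE (one_mem_wtLE (K := K))

theorem pow_mem_vertexWtLE {w : ℤ} {F : PowerSeries (LaurentSeries (MvPolynomial ℕ+ K))}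
    (hF : F ∈ vertexWtLE K w) (n : ℕ) : F ^ n ∈ vertexWtLE K (n * w) := by
  induction n with
  | zero => simpa using one_mem_vertexWtLE
  | succ n ih =>
    rw [pow_succ]
    exact vertexWtLE_mono (by push_cast; linarith) (mul_mem_vertexWtLE ih hF)

theorem prod_mem_vertexWtLE {ι : Type*} (s : Finset ι)
    (p : ι → PowerSeries (LaurentSeries (MvPolynomial ℕ+ K))) (w : ι → ℤ)
    (h : ∀ i ∈ s, p i ∈ vertexWtLE K (w i)) : ∏ i ∈ s, p i ∈ vertexWtLE K (∑ i ∈ s, w i) := by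
  classical
  induction s using Finset.induction_on with
  | empty => simpa using one_mem_vertexWtLE
  | insert a s ha ih =>
    rw [Finset.prod_insert ha, Finset.sum_insert ha]
    exact mul_mem_vertexWtLE (h a (by simp)) (ih fun i hi => h i (by simp [hi]))

theorem vfac_mem_vertexWtLE (ε : K) : vfac (MvPolynomial.C ε) ∈ vertexWtLE K 0 := by
  intro j
  rw [vfac, PowerSeries.coeff_mk]
  refine laurentWtLE_mono ?_ (pow_mem_laurentWtLE (neg_mem
    (mul_mem_laurentWtLE (C_mem_laurentWtLE (C_mem_wtLE ε)) zInv_mem_laurentWtLE)) j)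
  simp

theorem vshift_mem_vertexWtLE (ε : K) (m : ℕ) : vshift ε m ∈ vertexWtLE K m := by
  rw [vshift]
  refine vertexWtLE_mono ?_ (mul_mem_vertexWtLE (vconst_mem_vertexWtLE (algebraMap_mem_wtLE _))
    (mul_mem_vertexWtLE (pow_mem_vertexWtLE (C_mem_vertexWtLE zInv_mem_laurentWtLE) m)
      (sub_mem one_mem_vertexWtLE
        (vertexWtLE_mono (by simp) (pow_mem_vertexWtLE (vfac_mem_vertexWtLE ε) m)))))
  simp

theorem vsubst_mem_vertexWtLE (ε : K) {w : ℤ} {p : MvPolynomial ℕ+ K} (hp : p ∈ wtLE K w) :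
    vsubst ε p ∈ vertexWtLE K w := by
  rw [p.as_sum, map_sum]
  refine sum_mem fun d hd => ?_
  refine vertexWtLE_mono (hp d (MvPolynomial.mem_support_iff.1 hd)) ?_
  rw [MvPolynomial.monomial_eq, map_mul, vsubst_C, Finsupp.prod, map_prod]
  refine vertexWtLE_mono ?_ (mul_mem_vertexWtLE (vconst_mem_vertexWtLE (C_mem_wtLE _))
    (prod_mem_vertexWtLE _ _ (fun m => d m * (m : ℤ)) fun m _ => ?_))
  · rw [expWeight, Finsupp.weight_apply, Finsupp.sum]
    simp
  · rw [map_pow, vsubst_X]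
    refine pow_mem_vertexWtLE (add_mem (vconst_mem_vertexWtLE (X_mem_wtLE m)) ?_) _
    exact vertexWtLE_mono (by simp) (mul_mem_vertexWtLE (vconst_mem_vertexWtLE (C_mem_wtLE ε))
      (vshift_mem_vertexWtLE ε m))

theorem vkernel_mem_vertexWtLE (ε : K) : vkernel ε ∈ vertexWtLE K 0 := by
  intro j
  rw [vkernel, PowerSeries.coeff_mk, zero_add]
  exact twist_mem_laurentWtLE ε j

theorem vres_mem_wtLE {w : ℤ} {F : PowerSeries (LaurentSeries (MvPolynomial ℕ+ K))}
    (hF : F ∈ vertexWtLE K w) (k : ℕ) : vres _ k F ∈ wtLE K (w + k) := by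
  rw [vres_apply]
  have h1 : (1 + HahnSeries.single 1 1 : LaurentSeries (MvPolynomial ℕ+ K)) ∈ laurentWtLE K 0 :=
    add_mem one_mem_laurentWtLE (single_mem_laurentWtLE 1 0 (wtLE_mono (by simp) one_mem_wtLE))
  have := mul_mem_laurentWtLE (pow_mem_laurentWtLE h1 k) (hF (k + 1)) (-1)
  exact wtLE_mono (by push_cast; linarith) this

/-- The kernel and substitution are homogeneous up to lower weight; the coefficient of t^{k+1}
allows k + 1 and that of z⁻¹ takes one back. -/
theorem vertex_mem_wtLE (ε : K) {w : ℤ} {p : MvPolynomial ℕ+ K} (hp : p ∈ wtLE K w) (k : ℕ) :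
    vertex ε k p ∈ wtLE K (w + k) := by
  rw [vertex_apply]
  refine vres_mem_wtLE (vertexWtLE_mono (by simp)
    (mul_mem_vertexWtLE (vkernel_mem_vertexWtLE ε) (vsubst_mem_vertexWtLE ε hp))) k

end WeightFiltration

/-! ### Universal moments and cumulants as polynomials in the β_m. -/

section UniversalMoments

variable {K : Type*} [CommRing K] [Algebra ℚ K] (ε : K) (k : ℕ → ℕ)

/-- The universal joint moments: the vertex operators indexed by `U` applied to `1`. -/
noncomputable def univMoment (U : Finset ℕ) : MvPolynomial ℕ+ K :=
  (U.sort (· ≤ ·)).foldr (fun j Y => vertex ε (k j) Y) 1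

theorem univMoment_empty : univMoment ε k ∅ = 1 := by simp [univMoment]

theorem univMoment_insert {a : ℕ} {B : Finset ℕ} (h : ∀ b ∈ B, a < b) :
    univMoment ε k (insert a B) = vertex ε (k a) (univMoment ε k B) := by
  rw [univMoment, Finset.sort_insert _ (fun b hb => (h b hb).le) (fun ha => (h a ha).false),
    List.foldr_cons, univMoment]

theorem map_univMoment {K' : Type*} [CommRing K'] [Algebra ℚ K'] (φ : K →+* K') (U : Finset ℕ) :
    MvPolynomial.map φ (univMoment ε k U) = univMoment (φ ε) k U := by
  unfold univMoment
  induction U.sort (· ≤ ·) with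
  | nil => simp
  | cons a l ih => rw [List.foldr_cons, List.foldr_cons, map_vertex, ih]

theorem univMoment_mem_wtLE (U : Finset ℕ) : univMoment ε k U ∈ wtLE K (∑ j ∈ U, (k j : ℤ)) := by
  induction U using Finset.induction_on_min with
  | empty => simpa [univMoment_empty] using one_mem_wtLE
  | insert a B h ih =>
    rw [univMoment_insert ε k h, Finset.sum_insert (fun ha => (h a ha).false), add_comm]
    exact vertex_mem_wtLE ε ih _

/-- The universal joint cumulants. -/
noncomputable def univCum (U : Finset ℕ) : MvPolynomial ℕ+ K := cum (univMoment ε k) U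

/-- The variation of the universal joint cumulants under the vertex substitution. -/
noncomputable def univDiff (U : Finset ℕ) : PowerSeries (LaurentSeries (MvPolynomial ℕ+ K)) :=
  vsubst ε (univCum ε k U) - vconst _ (univCum ε k U)

theorem univCum_mem_wtLE (U : Finset ℕ) : univCum ε k U ∈ wtLE K (∑ j ∈ U, (k j : ℤ)) := by
  rw [univCum, cum]
  refine sum_mem fun π hπ => ?_
  have h1 : (-1 : MvPolynomial ℕ+ K) ^ (π.card - 1) * ((π.card - 1).factorial : MvPolynomial ℕ+ K)
      ∈ wtLE K 0 := by
    have := C_mem_wtLE ((-1 : K) ^ (π.card - 1) * ((π.card - 1).factorial : K))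
    simpa using this
  refine wtLE_mono ?_ (mul_mem_wtLE h1 (prod_mem_wtLE π _ (fun U => ∑ j ∈ U, (k j : ℤ)) fun U _ =>
    univMoment_mem_wtLE ε k U))
  rw [zero_add, sum_card_of_mem_setParts hπ]

theorem map_expMoment {R S : Type*} [CommRing R] [CommRing S] (φ : R →+* S)
    (X : Finset ℕ → R) (I : Finset ℕ) : φ (expMoment X I) = expMoment (fun U => φ (X U)) I := by
  simp only [expMoment, map_sum, map_prod]

/-- A ring homomorphism carries the moments to the exponential of the transformed cumulants, that is
of the unchanged cumulants plus their variation. By `expMoment_add` the unchanged part splits off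
and leaves the residue; the result is the cumulant recursion with the least index as pivot. -/
theorem univCum_insert {a : ℕ} {B : Finset ℕ} (h : ∀ b ∈ B, a < b) :
    univCum ε k (insert a B) = vres _ (k a) (vkernel ε * expMoment (univDiff ε k) B) := by
  set κ : Finset ℕ → MvPolynomial ℕ+ K := fun U =>
    if hU : U.Nonempty then
      vres _ (k (U.min' hU)) (vkernel ε * expMoment (univDiff ε k) (U.erase (U.min' hU))) else 0
    with hκ
  have hκ_insert : ∀ (a : ℕ) (B : Finset ℕ), (∀ b ∈ B, a < b) →
      κ (insert a B) = vres _ (k a) (vkernel ε * expMoment (univDiff ε k) B) := by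
    intro a B h
    have hm : (insert a B).min' (by simp) = a := by
      refine le_antisymm (Finset.min'_le _ _ (by simp)) ?_
      rw [Finset.le_min'_iff]
      intro b hb
      rcases Finset.mem_insert.1 hb with rfl | hb
      · exact le_rfl
      · exact (h b hb).le
    simp only [hκ]
    rw [dif_pos (by simp), hm, Finset.erase_insert fun ha => (h a ha).false]
  rw [← hκ_insert a B h, univCum]
  symm
  refine cum_unique _ κ (univMoment_empty ε k) ?_ _ (by simp)
  intro I hI
  refine ⟨I.min' hI, I.min'_mem hI, ?_⟩
  set i := I.min' hI with hi
  have hiI : i ∈ I := I.min'_mem hI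
  have hlt : ∀ b ∈ I.erase i, i < b := fun b hb => I.min'_lt_of_mem_erase_min' hI hb
  rw [sum_powerset_filter_mem hiI]
  conv_lhs => rw [← Finset.insert_erase hiI, univMoment_insert ε k hlt, vertex_apply,
    ← expMoment_cum _ (univMoment_empty ε k), map_expMoment]
  have hsplit : (fun U => vsubst ε (cum (univMoment ε k) U)) =
      univDiff ε k + fun U => vconst _ (univCum ε k U) := by
    funext U
    simp only [Pi.add_apply, univDiff, univCum, sub_add_cancel]
  rw [hsplit, expMoment_add, Finset.mul_sum, map_sum]
  refine Finset.sum_congr rfl fun B hB => ?_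
  rw [Finset.mem_powerset] at hB
  rw [hκ_insert i B fun b hb => hlt b (hB hb), ← map_expMoment]
  have : expMoment (univCum ε k) (I.erase i \ B) = univMoment ε k (I \ insert i B) := by
    have h2 : I \ insert i B = I.erase i \ B := by
      ext j; simp only [Finset.mem_sdiff, Finset.mem_insert, Finset.mem_erase]; tauto
    rw [h2]
    exact expMoment_cum _ (univMoment_empty ε k) _
  rw [this, ← mul_assoc, mul_comm _ (vconst _ _), vres_vconst_mul, mul_comm]

end UniversalMoments

/-! ### Joint moments of the normalized binomial sums. -/

section BinomialMoments

variable {N : ℕ}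

/-- The normalized binomial sum `N^{-k-1} ∑ᵢ C(lamᵢ + N - i, k)`. -/
noncomputable def scaledBinom (k : ℕ) (lam : GT N) : ℝ := (N : ℝ)⁻¹ ^ (k + 1) * binomSum k lam

theorem univMoment_mem_prodSpan (hN : N ≠ 0) (k : ℕ → ℕ) (U : Finset ℕ) :
    univMoment (N : ℝ)⁻¹ k U ∈ prodSpan N := by
  induction U using Finset.induction_on_min with
  | empty =>
    rw [univMoment_empty, ← prodExp_zero (N := N)]
    exact prodExp_mem _
  | insert a B h ih =>
    rw [univMoment_insert _ k h]
    exact vertex_mem_prodSpan hN _ ih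

/-- Every vertex operator contributes its eigenvalue, because the polynomial it acts on stays in the
span of the products. -/
theorem schurFunctional_univMoment (hN : N ≠ 0) (k : ℕ → ℕ) (lam : GT N) (U : Finset ℕ) :
    schurFunctional lam (univMoment (N : ℝ)⁻¹ k U) = ∏ j ∈ U, scaledBinom (k j) lam := by
  induction U using Finset.induction_on_min with
  | empty => rw [univMoment_empty, schurFunctional_one, Finset.prod_empty]
  | insert a B h ih =>
    rw [univMoment_insert _ k h, schurFunctional_vertex hN _ _ (univMoment_mem_prodSpan hN k B), ih,
      Finset.prod_insert fun ha => (h a ha).false, scaledBinom]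

theorem IsSmooth.hasSum_scaledBinom {τ : PMF (GT N)} (h : IsSmooth τ) (hN : N ≠ 0) (k : ℕ → ℕ)
    (U : Finset ℕ) : HasSum (fun lam => (τ lam).toReal * ∏ j ∈ U, scaledBinom (k j) lam)
      (measFunctional τ (univMoment (N : ℝ)⁻¹ k U)) := by
  simpa only [schurFunctional_univMoment hN] using
    h.hasSum_schurFunctional (univMoment (N : ℝ)⁻¹ k U)

end BinomialMoments

/-! ### Powers of ε in the universal cumulants. -/

section Divisibility

variable {K : Type*} [CommRing K] [Algebra ℚ K]

/-- The quotient of `vshift ε m` by `ε`. -/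
noncomputable def vshiftQuot (ε : K) (m : ℕ) : PowerSeries (LaurentSeries (MvPolynomial ℕ+ K)) :=
  vconst _ (algebraMap ℚ _ (m : ℚ)⁻¹) * (PowerSeries.C (zInv _) ^ m *
    (vfac (MvPolynomial.C ε) * PowerSeries.X * PowerSeries.C (zInv _) *
      ∑ i ∈ Finset.range m, vfac (MvPolynomial.C ε) ^ i))

/-- 1 - v = ε v t/z divides 1 - v^m. With the factor ε in the substitution, every variable therefore
moves by a multiple of ε². -/
theorem vshift_eq_mul (ε : K) (m : ℕ) :
    vshift ε m = vconst _ (MvPolynomial.C ε) * vshiftQuot ε m := by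
  have h1 : 1 - vfac (MvPolynomial.C ε) = vconst (MvPolynomial ℕ+ K) (MvPolynomial.C ε) *
      (vfac (MvPolynomial.C ε) * PowerSeries.X * PowerSeries.C (zInv _)) := by
    linear_combination -vfac_mul (MvPolynomial.C ε : MvPolynomial ℕ+ K)
  have h2 := mul_neg_geom_sum (vfac (MvPolynomial.C ε : MvPolynomial ℕ+ K)) m
  rw [vshift, vshiftQuot, ← h2, h1]
  ring

theorem vsubst_X_quot (ε : K) (m : ℕ+) : vsubst ε (MvPolynomial.X m) =
    vconst _ (MvPolynomial.X m) + vconst _ (MvPolynomial.C ε) ^ 2 * vshiftQuot ε m := by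
  rw [vsubst_X, vshift_eq_mul]
  ring

/-- The first order Taylor expansion of the vertex substitution. -/
theorem vsubst_taylor (ε : K) (p : MvPolynomial ℕ+ K) :
    ∀ᶠ S : Finset ℕ+ in atTop, vconst _ (MvPolynomial.C ε) ^ 4 ∣
      vsubst ε p - vconst _ p - vconst _ (MvPolynomial.C ε) ^ 2 *
        ∑ m ∈ S, vconst _ (MvPolynomial.pderiv m p) * vshiftQuot ε m := by
  set e := vconst (MvPolynomial ℕ+ K) (MvPolynomial.C ε) with he
  induction p using MvPolynomial.induction_on with
  | C c => simp [vsubst_C]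
  | add p q hp hq =>
    filter_upwards [hp, hq] with S h1 h2
    convert dvd_add h1 h2 using 1
    simp only [map_add, add_mul, Finset.sum_add_distrib]
    ring
  | mul_X p i hp =>
    filter_upwards [hp, eventually_ge_atTop {i}] with S h1 h2
    have hi : i ∈ S := by simpa using h2
    have hs : ∑ m ∈ S, vconst _ (MvPolynomial.pderiv m (p * MvPolynomial.X i)) * vshiftQuot ε m =
        vconst _ (MvPolynomial.X i) * ∑ m ∈ S, vconst _ (MvPolynomial.pderiv m p) * vshiftQuot ε m +
          vconst _ p * vshiftQuot ε i := by
      have h3 : ∀ m ∈ S, vconst _ (MvPolynomial.pderiv m (p * MvPolynomial.X i)) * vshiftQuot ε m =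
          vconst _ (MvPolynomial.X i) * (vconst _ (MvPolynomial.pderiv m p) * vshiftQuot ε m) +
            if i = m then vconst _ p * vshiftQuot ε i else 0 := by
        intro m _
        rw [Derivation.leibniz, MvPolynomial.pderiv_X, smul_eq_mul, smul_eq_mul, map_add, map_mul,
          map_mul]
        split_ifs with him
        · subst him
          rw [Pi.single_eq_same, map_one]
          ring
        · rw [Pi.single_eq_of_ne him]
          simp
          ring
      rw [Finset.sum_congr rfl h3, Finset.sum_add_distrib, ← Finset.mul_sum, Finset.sum_ite_eq,
        if_pos hi]
    obtain ⟨F, hF⟩ := h1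
    rw [hs, map_mul, map_mul, vsubst_X_quot, ← he]
    refine ⟨F * (vconst _ (MvPolynomial.X i) + e ^ 2 * vshiftQuot ε i) +
      (∑ m ∈ S, vconst _ (MvPolynomial.pderiv m p) * vshiftQuot ε m) * vshiftQuot ε i, ?_⟩
    linear_combination (vconst _ (MvPolynomial.X i) + e ^ 2 * vshiftQuot ε i) * hF

theorem dvd_vsubst_sub (ε : K) (p : MvPolynomial ℕ+ K) :
    vconst _ (MvPolynomial.C ε) ^ 2 ∣ vsubst ε p - vconst _ p := by
  obtain ⟨S, hS⟩ := (vsubst_taylor ε p).exists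
  have h1 := (pow_dvd_pow (vconst (MvPolynomial ℕ+ K) (MvPolynomial.C ε))
    (show 2 ≤ 4 by norm_num)).trans hS
  exact (dvd_sub_left (dvd_mul_right _ _)).1 h1

variable (ε : K) (k : ℕ → ℕ)

theorem dvd_univDiff {U : Finset ℕ} {n : ℕ} (h : MvPolynomial.C ε ^ n ∣ univCum ε k U) :
    vconst _ (MvPolynomial.C ε) ^ (n + 2) ∣ univDiff ε k U := by
  obtain ⟨p, hp⟩ := h
  rw [univDiff, hp, map_mul, map_mul, map_pow, map_pow, vsubst_C, ← mul_sub, pow_add]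
  exact mul_dvd_mul_left _ (dvd_vsubst_sub ε p)

/-- By induction the variation of the cumulant of a block V gains two factors and is divisible by
ε^{2|V|}. The blocks partition U without its least index, which gives the exponent 2(|U|-1). -/
theorem dvd_univCum (U : Finset ℕ) : MvPolynomial.C ε ^ (2 * (U.card - 1)) ∣ univCum ε k U := by
  induction U using Finset.strongInduction with
  | H U ih =>
    rcases U.eq_empty_or_nonempty with rfl | hU
    · simp
    set a := U.min' hU with ha
    have haU : a ∈ U := U.min'_mem hU
    have hlt : ∀ b ∈ U.erase a, a < b := fun b hb => U.min'_lt_of_mem_erase_min' hU hb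
    have hdvd : vconst _ (MvPolynomial.C ε) ^ (2 * (U.card - 1)) ∣
        expMoment (univDiff ε k) (U.erase a) := by
      rw [expMoment]
      refine Finset.dvd_sum fun π hπ => ?_
      have h1 : ∏ V ∈ π, vconst (MvPolynomial ℕ+ K) (MvPolynomial.C ε) ^ (2 * V.card) =
          vconst _ (MvPolynomial.C ε) ^ (2 * (U.card - 1)) := by
        rw [Finset.prod_pow_eq_pow_sum, ← Finset.mul_sum, ← Finset.card_erase_of_mem haU]
        have := sum_card_of_mem_setParts hπ (fun _ => 1)
        simp only [Finset.sum_const, smul_eq_mul, mul_one] at this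
        rw [this]
      rw [← h1]
      refine Finset.prod_dvd_prod_of_dvd _ _ fun V hV => ?_
      have hVU : V ⊂ U := (subset_of_mem_setParts hπ hV).trans_ssubset (Finset.erase_ssubset haU)
      have hc : 0 < V.card := Finset.card_pos.2 (nonempty_of_mem_setParts hπ hV)
      have := dvd_univDiff ε k (ih V hVU)
      rwa [show 2 * (V.card - 1) + 2 = 2 * V.card by omega] at this
    obtain ⟨F, hF⟩ := hdvd
    rw [← Finset.insert_erase haU, univCum_insert ε k hlt, hF, Finset.insert_erase haU,
      mul_left_comm, ← map_pow (vconst _), vres_vconst_mul]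
    exact dvd_mul_right _ _

end Divisibility

/-! ### The universal cumulants after division by powers of ε, and their values at ε = 0. -/

section UniversalPart

variable (k : ℕ → ℕ)

/-- The specialization of the deformation parameter. -/
noncomputable def evalEps (x : ℝ) : MvPolynomial ℕ+ (Polynomial ℝ) →+* MvPolynomial ℕ+ ℝ :=
  MvPolynomial.map (Polynomial.evalRingHom x)

/-- The universal joint cumulant divided by the power of the deformation parameter that it
contains. -/
noncomputable def univPart (U : Finset ℕ) : MvPolynomial ℕ+ (Polynomial ℝ) :=
  (dvd_univCum (Polynomial.X : Polynomial ℝ) k U).choose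

theorem univPart_spec (U : Finset ℕ) : univCum (Polynomial.X : Polynomial ℝ) k U =
    MvPolynomial.C Polynomial.X ^ (2 * (U.card - 1)) * univPart k U :=
  (dvd_univCum (Polynomial.X : Polynomial ℝ) k U).choose_spec

theorem C_X_pow_ne_zero (n : ℕ) :
    (MvPolynomial.C Polynomial.X ^ n : MvPolynomial ℕ+ (Polynomial ℝ)) ≠ 0 :=
  pow_ne_zero _ (by
    rw [Ne, MvPolynomial.C_eq_zero]
    exact Polynomial.X_ne_zero)

theorem map_univCum {K K' : Type*} [CommRing K] [Algebra ℚ K] [CommRing K'] [Algebra ℚ K'] (ε : K)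
    (φ : K →+* K') (U : Finset ℕ) :
    MvPolynomial.map φ (univCum ε k U) = univCum (φ ε) k U := by
  simp only [univCum, cum, map_sum, map_mul, map_prod, map_univMoment, map_pow, map_neg, map_one,
    map_natCast]

theorem univCum_eq_evalEps (x : ℝ) (U : Finset ℕ) :
    univCum x k U = MvPolynomial.C (x ^ (2 * (U.card - 1))) * evalEps x (univPart k U) := by
  have := congrArg (evalEps x) (univPart_spec k U)
  rw [evalEps, map_univCum, map_mul, map_pow, MvPolynomial.map_C] at this
  simpa [evalEps] using this

/-- Multiplication by a power of the indeterminate kills no coefficient, so dividing by it does not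
enlarge the support. -/
theorem univPart_mem_wtLE (U : Finset ℕ) :
    univPart k U ∈ wtLE (Polynomial ℝ) (∑ j ∈ U, (k j : ℤ)) := by
  intro d hd
  refine univCum_mem_wtLE (Polynomial.X : Polynomial ℝ) k U d ?_
  rw [univPart_spec, ← map_pow, MvPolynomial.coeff_C_mul]
  exact mul_ne_zero (pow_ne_zero _ Polynomial.X_ne_zero) hd

/-- The Laurent series `(1 + z)^l φ^n / n!`, where `φ = 1/z + ∑ m β_m z^{m-1}`. -/
noncomputable def phiPow (l n : ℕ) : LaurentSeries (MvPolynomial ℕ+ ℝ) :=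
  (1 + HahnSeries.single 1 1) ^ l * twist 0 1 (derivGen (varSeq ℝ)) n

theorem evalEps_univPart_singleton (a : ℕ) :
    evalEps 0 (univPart k {a}) = (phiPow (k a) (k a + 1)).coeff (-1) := by
  have h1 := univCum_eq_evalEps k 0 {a}
  simp only [Finset.card_singleton, Nat.sub_self, mul_zero, pow_zero, map_one, one_mul] at h1
  rw [← h1, ← insert_empty_eq, univCum_insert _ _ (by simp), expMoment_empty, mul_one, vres_apply,
    vkernel, PowerSeries.coeff_mk, map_zero, phiPow]

theorem vshiftQuot_zero (m : ℕ+) : vshiftQuot (0 : ℝ) m =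
    PowerSeries.C (zInv (MvPolynomial ℕ+ ℝ) ^ ((m : ℕ) + 1)) * PowerSeries.X := by
  have h1 : vfac (MvPolynomial.C 0 : MvPolynomial ℕ+ ℝ) = 1 := by
    have := vfac_mul (MvPolynomial.C 0 : MvPolynomial ℕ+ ℝ)
    simpa using this
  have h2 : vconst (MvPolynomial ℕ+ ℝ) (algebraMap ℚ _ ((m : ℕ) : ℚ)⁻¹) *
      ((m : ℕ) : PowerSeries (LaurentSeries (MvPolynomial ℕ+ ℝ))) = 1 := by
    have : ((m : ℕ) : PowerSeries (LaurentSeries (MvPolynomial ℕ+ ℝ))) =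
        vconst _ (algebraMap ℚ _ ((m : ℕ) : ℚ)) := by rw [map_natCast, map_natCast]
    rw [this, ← map_mul, ← map_mul, inv_mul_cancel₀ (by simp), map_one, map_one]
  rw [vshiftQuot, h1, map_pow]
  simp only [one_pow, Finset.sum_const, Finset.card_range, nsmul_eq_mul, mul_one, one_mul]
  linear_combination (PowerSeries.C (zInv (MvPolynomial ℕ+ ℝ)) ^ (m : ℕ) * PowerSeries.X *
    PowerSeries.C (zInv (MvPolynomial ℕ+ ℝ))) * h2

theorem vmap_vshiftQuot {K K' : Type*} [CommRing K] [Algebra ℚ K] [CommRing K'] [Algebra ℚ K']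
    (φ : K →+* K') (ε : K) (m : ℕ) : vmap φ (vshiftQuot ε m) = vshiftQuot (φ ε) m := by
  have h1 : vmap φ (PowerSeries.C (zInv _)) = PowerSeries.C (zInv _) := by
    rw [vmap, PowerSeries.map_C, laurentMap_zInv]
  have h2 : vmap φ PowerSeries.X = PowerSeries.X := by rw [vmap, PowerSeries.map_X]
  have h3 : MvPolynomial.map φ (algebraMap ℚ (MvPolynomial ℕ+ K) (m : ℚ)⁻¹) =
      algebraMap ℚ (MvPolynomial ℕ+ K') (m : ℚ)⁻¹ :=
    RingHom.congr_fun (Subsingleton.elim ((MvPolynomial.map φ).comp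
      (algebraMap ℚ (MvPolynomial ℕ+ K))) (algebraMap ℚ (MvPolynomial ℕ+ K'))) _
  simp only [vshiftQuot, map_mul, map_pow, map_sum, vmap_vconst, vmap_vfac, h1, h2, h3]

theorem evalEps_pderiv (x : ℝ) (m : ℕ+) (p : MvPolynomial ℕ+ (Polynomial ℝ)) :
    evalEps x (MvPolynomial.pderiv m p) = MvPolynomial.pderiv m (evalEps x p) := by
  rw [evalEps, MvPolynomial.pderiv_map]

theorem vmap_vconst_C_X : vmap (Polynomial.evalRingHom (0 : ℝ))
    (vconst _ (MvPolynomial.C Polynomial.X)) = 0 := by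
  rw [vmap_vconst, MvPolynomial.map_C]
  simp

/-- `[z⁻¹] (1 + z)^l φ^{l+1} / (l+1)!`. -/
noncomputable def limitPart (l : ℕ) : MvPolynomial ℕ+ ℝ := (phiPow l (l + 1)).coeff (-1)

theorem vres_vkernel_zero (l m : ℕ) : vres _ l (vkernel (0 : ℝ) *
    (PowerSeries.C (zInv (MvPolynomial ℕ+ ℝ) ^ (m + 1)) * PowerSeries.X)) =
      (phiPow l l).coeff m := by
  rw [vres_apply, mul_left_comm, ← mul_assoc, PowerSeries.coeff_succ_mul_X, PowerSeries.coeff_C_mul,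
    vkernel, PowerSeries.coeff_mk, mul_left_comm, coeff_zInv_pow_mul, map_zero, phiPow]
  have : (-1 : ℤ) + ((m + 1 : ℕ) : ℤ) = m := by push_cast; ring
  rw [this]

/-- Only the first-order Taylor term of the variation of the cumulant of {b} survives after ε² is
cancelled. At ε = 0 its shift is z^{-m-1} t, so the residue picks the coefficient of z^m in
(1+z)^{k_a} φ^{k_a}/k_a!. A finite set S, large enough for the Taylor expansion, replaces the formal
sum over all variables. -/
theorem evalEps_univPart_pair {a b : ℕ} (hab : a < b) :
    ∀ᶠ S : Finset ℕ+ in atTop, evalEps 0 (univPart k {a, b}) =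
      ∑ m ∈ S, MvPolynomial.pderiv m (limitPart (k b)) * (phiPow (k a) (k a)).coeff (m : ℕ) := by
  filter_upwards [vsubst_taylor Polynomial.X (univPart k {b})] with S hS
  obtain ⟨G, hG⟩ := hS
  set e := vconst (MvPolynomial ℕ+ (Polynomial ℝ)) (MvPolynomial.C Polynomial.X) with he
  have hb : univCum (Polynomial.X : Polynomial ℝ) k {b} = univPart k {b} := by
    simpa using univPart_spec k {b}
  have hd : expMoment (univDiff (Polynomial.X : Polynomial ℝ) k) {b} = e ^ 2 *
      (∑ m ∈ S, vconst _ (MvPolynomial.pderiv m (univPart k {b})) * vshiftQuot Polynomial.X m +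
        e ^ 2 * G) := by
    have h1 : expMoment (univDiff (Polynomial.X : Polynomial ℝ) k) {b} = univDiff Polynomial.X k {b} := by
      rw [expMoment_rec _ (Finset.mem_singleton_self b), sum_powerset_filter_mem
        (Finset.mem_singleton_self b)]
      simp
    rw [h1, univDiff, hb]
    linear_combination hG
  have h2 := univPart_spec k {a, b}
  rw [Finset.card_pair hab.ne, univCum_insert _ _ (by simpa using hab), hd, mul_left_comm, he,
    ← map_pow (vconst _), vres_vconst_mul] at h2
  have h3 := mul_left_cancel₀ (C_X_pow_ne_zero 2) h2
  have hX : (Polynomial.evalRingHom (0 : ℝ)) Polynomial.X = 0 := by simp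
  have hv : vmap (Polynomial.evalRingHom (0 : ℝ)) (∑ m ∈ S,
      vconst _ (MvPolynomial.pderiv m (univPart k {b})) * vshiftQuot Polynomial.X m +
        vconst _ (MvPolynomial.C Polynomial.X ^ 2) * G) =
      ∑ m ∈ S, vconst _ (MvPolynomial.pderiv m (limitPart (k b))) *
        (PowerSeries.C (zInv (MvPolynomial ℕ+ ℝ) ^ ((m : ℕ) + 1)) * PowerSeries.X) := by
    rw [map_add, map_mul, map_pow (vconst _), map_pow (vmap _), vmap_vconst_C_X,
      zero_pow two_ne_zero, zero_mul, add_zero, map_sum]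
    refine Finset.sum_congr rfl fun m _ => ?_
    rw [map_mul, vmap_vconst, vmap_vshiftQuot, hX, vshiftQuot_zero]
    have := evalEps_pderiv 0 m (univPart k {b})
    rw [evalEps_univPart_singleton] at this
    rw [← evalEps, this, limitPart]
  rw [← h3, evalEps, map_vres, map_mul (vmap _), vmap_vkernel, hv, hX, Finset.mul_sum, map_sum]
  refine Finset.sum_congr rfl fun m _ => ?_
  rw [mul_left_comm, vres_vconst_mul, vres_vkernel_zero]

section CoefficientwiseDerivation

variable {A : Type*} [CommRing A] [Algebra ℝ A] (D : Derivation ℝ A A)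

/-- The coefficientwise action of a derivation on Laurent series. -/
noncomputable def coeffDer : LaurentSeries A →+ LaurentSeries A where
  toFun f := f.map D
  map_zero' := by ext; simp
  map_add' f g := by ext; simp

theorem coeffDer_coeff (f : LaurentSeries A) (n : ℤ) : (coeffDer D f).coeff n = D (f.coeff n) := rfl

theorem coeffDer_mul (f g : LaurentSeries A) :
    coeffDer D (f * g) = coeffDer D f * g + f * coeffDer D g := by
  have hf : (coeffDer D f).support ⊆ f.support := fun n hn h => hn (by
    change D (f.coeff n) = 0
    rw [h, map_zero])
  have hg : (coeffDer D g).support ⊆ g.support := fun n hn h => hn (by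
    change D (g.coeff n) = 0
    rw [h, map_zero])
  ext n
  rw [coeffDer_coeff, HahnSeries.coeff_add, HahnSeries.coeff_mul,
    HahnSeries.coeff_mul_left' f.isPWO_support hf, HahnSeries.coeff_mul_right' g.isPWO_support hg,
    map_sum, ← Finset.sum_add_distrib]
  refine Finset.sum_congr rfl fun x _ => ?_
  rw [Derivation.leibniz, coeffDer_coeff, coeffDer_coeff, smul_eq_mul, smul_eq_mul]
  ring

theorem coeffDer_single_one (n : ℤ) : coeffDer D (HahnSeries.single n 1) = 0 := by
  ext i
  rw [coeffDer_coeff, HahnSeries.coeff_single]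
  split_ifs <;> simp

theorem coeffDer_pow_mul (f g : LaurentSeries A) (hf : coeffDer D f = 0) (l : ℕ) :
    coeffDer D (f ^ l * g) = f ^ l * coeffDer D g := by
  induction l with
  | zero => simp
  | succ l ih => rw [pow_succ', mul_assoc, coeffDer_mul, hf, ih, zero_mul, zero_add, mul_assoc]

end CoefficientwiseDerivation

theorem coeffDer_derivGen (m : ℕ+) :
    coeffDer (MvPolynomial.pderiv m) (HahnSeries.ofPowerSeries ℤ _ (derivGen (varSeq ℝ))) =
      ((m : ℕ) : LaurentSeries (MvPolynomial ℕ+ ℝ)) * HahnSeries.single ((m : ℤ) - 1) 1 := by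
  have hr : ((m : ℕ) : LaurentSeries (MvPolynomial ℕ+ ℝ)) * HahnSeries.single ((m : ℤ) - 1) 1 =
      HahnSeries.single ((m : ℤ) - 1) ((m : ℕ) : MvPolynomial ℕ+ ℝ) := by
    ext1
    funext i
    rw [← nsmul_eq_mul, HahnSeries.coeff_nsmul, Pi.smul_apply, HahnSeries.coeff_single,
      HahnSeries.coeff_single]
    split_ifs <;> simp
  rw [hr]
  ext1
  funext i
  rw [coeffDer_coeff, PowerSeries.coeff_coe, HahnSeries.coeff_single]
  have hm := m.pos
  split_ifs with h1 h2 h2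
  · omega
  · simp
  · have : i.natAbs + 1 = m := by omega
    rw [derivGen, PowerSeries.coeff_mk]
    have h3 : varSeq ℝ (i.natAbs + 1) = MvPolynomial.X m := by rw [this, varSeq_coe]
    have h4 : ((i.natAbs : MvPolynomial ℕ+ ℝ) + 1) = ((m : ℕ) : MvPolynomial ℕ+ ℝ) := by
      rw [← this]; push_cast; rfl
    rw [h3, h4, ← nsmul_eq_mul, map_nsmul, MvPolynomial.pderiv_X_self]
    simp
  · have : i.natAbs + 1 ≠ m := by omega
    rw [derivGen, PowerSeries.coeff_mk, varSeq]
    have h4 : ((i.natAbs : MvPolynomial ℕ+ ℝ) + 1) = ((i.natAbs + 1 : ℕ) : MvPolynomial ℕ+ ℝ) := by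
      push_cast; rfl
    rw [h4, ← nsmul_eq_mul, map_nsmul, MvPolynomial.pderiv_X_of_ne, smul_zero]
    intro hh
    apply this
    rw [← hh]
    simp

/-- At ε = 0 the twist is φ^n/n!, and differentiating φ = 1/z + ∑ m β_m z^{m-1} in β_m gives m
z^{m-1}. -/
theorem coeffDer_twist (m : ℕ+) (n : ℕ) :
    coeffDer (MvPolynomial.pderiv m) (twist 0 1 (derivGen (varSeq ℝ)) (n + 1)) =
      ((m : ℕ) : LaurentSeries (MvPolynomial ℕ+ ℝ)) * HahnSeries.single ((m : ℤ) - 1) 1 *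
        twist 0 1 (derivGen (varSeq ℝ)) n := by
  set B := derivGen (varSeq ℝ)
  have hφ : coeffDer (MvPolynomial.pderiv m) (zInv _ + HahnSeries.ofPowerSeries ℤ _ B) =
      ((m : ℕ) : LaurentSeries (MvPolynomial ℕ+ ℝ)) * HahnSeries.single ((m : ℤ) - 1) 1 := by
    rw [map_add, coeffDer_derivGen, zInv, coeffDer_single_one, zero_add]
  have hrec : ∀ n : ℕ, (n + 1 : LaurentSeries (MvPolynomial ℕ+ ℝ)) * twist 0 1 B (n + 1) =
      (zInv _ + HahnSeries.ofPowerSeries ℤ _ B) * twist 0 1 B n := by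
    intro n
    rw [twist_succ]
    simp
  have hnat : ∀ (n : ℕ) (f : LaurentSeries (MvPolynomial ℕ+ ℝ)),
      coeffDer (MvPolynomial.pderiv m) ((n + 1 : LaurentSeries (MvPolynomial ℕ+ ℝ)) * f) =
        (n + 1 : LaurentSeries (MvPolynomial ℕ+ ℝ)) * coeffDer (MvPolynomial.pderiv m) f := by
    intro n f
    have : (n + 1 : LaurentSeries (MvPolynomial ℕ+ ℝ)) = ((n + 1 : ℕ) : LaurentSeries _) := by
      push_cast; rfl
    rw [this, ← nsmul_eq_mul, map_nsmul, nsmul_eq_mul]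
  have hone : coeffDer (MvPolynomial.pderiv m) (1 : LaurentSeries (MvPolynomial ℕ+ ℝ)) = 0 :=
    coeffDer_single_one _ 0
  induction n with
  | zero =>
    have := hrec 0
    rw [twist_zero, mul_one] at this
    simp only [Nat.cast_zero, zero_add, one_mul] at this
    rw [zero_add, this, hφ, twist_zero, mul_one]
  | succ n ih =>
    refine natCast_succ_mul_cancel (n := n + 1) ?_
    rw [← hnat, hrec, coeffDer_mul, hφ, ih]
    push_cast
    linear_combination -(((m : ℕ) : LaurentSeries (MvPolynomial ℕ+ ℝ)) *
      HahnSeries.single ((m : ℤ) - 1) 1) * hrec n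

theorem pderiv_limitPart (m : ℕ+) (l : ℕ) :
    MvPolynomial.pderiv m (limitPart l) = ((m : ℕ) : MvPolynomial ℕ+ ℝ) *
      (phiPow l l).coeff (-(m : ℕ)) := by
  rw [limitPart, ← coeffDer_coeff, phiPow, coeffDer_pow_mul, coeffDer_twist]
  · have : (1 + HahnSeries.single 1 1) ^ l * (((m : ℕ) : LaurentSeries (MvPolynomial ℕ+ ℝ)) *
        HahnSeries.single ((m : ℤ) - 1) 1 * twist 0 1 (derivGen (varSeq ℝ)) l) =
        (m : ℕ) • (HahnSeries.single ((m : ℤ) - 1) 1 * phiPow l l) := by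
      rw [phiPow, nsmul_eq_mul]
      ring
    rw [this, HahnSeries.coeff_nsmul, Pi.smul_apply, nsmul_eq_mul]
    have h2 := HahnSeries.coeff_single_mul_add (r := (1 : MvPolynomial ℕ+ ℝ)) (x := phiPow l l)
      (a := -((m : ℕ) : ℤ)) (b := (m : ℤ) - 1)
    rw [one_mul] at h2
    rw [← h2]
    congr 3
    ring
  · rw [map_add, coeffDer_single_one, add_zero]
    exact coeffDer_single_one _ 0

end UniversalPart

/-! ### The delta method for joint cumulants. -/

section CumulantLimits

/-- The order of magnitude `N^{-scaleExp r}` of joint cumulants of `r` variables. -/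
def scaleExp (r : ℕ) : ℕ := if r = 1 then 0 else r

theorem scaleExp_one : scaleExp 1 = 0 := rfl

theorem scaleExp_of_ne_one {r : ℕ} (h : r ≠ 1) : scaleExp r = r := if_neg h

theorem scaleExp_lt_succ {r : ℕ} (h : 0 < r) : scaleExp r < scaleExp (r + 1) := by
  unfold scaleExp
  split_ifs <;> omega

theorem tendsto_natCast_inv_pow {e : ℕ} (he : e ≠ 0) :
    Tendsto (fun N : ℕ => (N : ℝ)⁻¹ ^ e) atTop (𝓝 0) := by
  have := (tendsto_inv_atTop_nhds_zero_nat (𝕜 := ℝ)).pow e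
  rwa [zero_pow he] at this

theorem tendsto_pow_mul_of_lt {u : ℕ → ℝ} {a b : ℕ} {L : ℝ} (hab : a < b)
    (h : Tendsto (fun N : ℕ => (N : ℝ) ^ b * u N) atTop (𝓝 L)) :
    Tendsto (fun N : ℕ => (N : ℝ) ^ a * u N) atTop (𝓝 0) := by
  have := (tendsto_natCast_inv_pow (e := b - a) (by omega)).mul h
  rw [zero_mul] at this
  refine this.congr' ?_
  filter_upwards [eventually_ne_atTop 0] with N hN
  have hN' : (N : ℝ) ≠ 0 := by exact_mod_cast hN
  obtain ⟨c, rfl⟩ := Nat.exists_eq_add_of_lt hab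
  rw [show a + c + 1 - a = c + 1 by omega, show a + c + 1 = (c + 1) + a by ring, pow_add _ (c + 1),
    ← mul_assoc, ← mul_assoc, ← mul_pow, inv_mul_cancel₀ hN', one_pow, one_mul]

/-- The weight of a multiset of indices. -/
def multWeight (μ : Multiset ℕ+) : ℕ := (μ.map (fun m : ℕ+ => (m : ℕ))).sum

/-- The monomial in the variables of a multiset. -/
noncomputable def multMonomial (R : Type*) [CommRing R] (μ : Multiset ℕ+) : MvPolynomial ℕ+ R :=
  (μ.map MvPolynomial.X).prod

/-- The scaled joint cumulants of the variables of weight at most `n` converge to `γ`. -/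
def CumTendsto (F : ℕ → MvPolynomial ℕ+ ℝ →ₗ[ℝ] ℝ) (n : ℕ) (γ : Multiset ℕ+ → ℝ) : Prop :=
  ∀ μ : Multiset ℕ+, μ ≠ 0 → multWeight μ ≤ n →
    Tendsto (fun N : ℕ => (N : ℝ) ^ scaleExp (Multiset.card μ) *
      kumM (F N) (μ.map MvPolynomial.X)) atTop (𝓝 (γ μ))

variable {ι : Type*} [DecidableEq ι]

/-- The evaluation at the first order limits. -/
noncomputable def evalMean (γ : Multiset ℕ+ → ℝ) : MvPolynomial ℕ+ ℝ →ₐ[ℝ] ℝ :=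
  MvPolynomial.aeval fun m => γ {m}

/-- The limit of scaled joint cumulants of polynomials, by the delta method. -/
noncomputable def slotLimit (γ : Multiset ℕ+ → ℝ) (n : ℕ) (J : Finset ι)
    (x : ι → MvPolynomial ℕ+ ℝ) : ℝ :=
  if J.card = 1 then ∏ j ∈ J, evalMean γ (x j) else
    ∑ m ∈ Fintype.piFinset fun _ : J => Finset.Icc 1 n.succPNat,
      (∏ j : J, evalMean γ (MvPolynomial.pderiv (m j) (x j))) * γ (Finset.univ.val.map m)

theorem slotLimit_congr {γ : Multiset ℕ+ → ℝ} {n : ℕ} {J : Finset ι} {x y : ι → MvPolynomial ℕ+ ℝ}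
    (h : ∀ j ∈ J, x j = y j) : slotLimit γ n J x = slotLimit γ n J y := by
  have h1 : ∏ j ∈ J, evalMean γ (x j) = ∏ j ∈ J, evalMean γ (y j) :=
    Finset.prod_congr rfl fun j hj => by rw [h j hj]
  have h2 : ∀ m : J → ℕ+, ∏ j : J, evalMean γ (MvPolynomial.pderiv (m j) (x j)) =
      ∏ j : J, evalMean γ (MvPolynomial.pderiv (m j) (y j)) := fun m =>
    Finset.prod_congr rfl fun j _ => by rw [h j j.2]
  simp only [slotLimit, h1, h2]

theorem slotLimit_singleton (γ : Multiset ℕ+ → ℝ) (n : ℕ) (i : ι) (x : ι → MvPolynomial ℕ+ ℝ) :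
    slotLimit γ n {i} x = evalMean γ (x i) := by
  simp [slotLimit]

/-- As a function of a single slot the limit is a fixed combination of the values at the limiting
means of its partial derivatives, which yields both linearity and the product rule. -/
theorem exists_slotLimit_update (γ : Multiset ℕ+ → ℝ) (n : ℕ) {J : Finset ι} {i : ι} (hi : i ∈ J)
    (hJ : J.card ≠ 1) (x : ι → MvPolynomial ℕ+ ℝ) : ∃ R : (J → ℕ+) → ℝ, ∀ w,
      slotLimit γ n J (Function.update x i w) =
        ∑ m ∈ Fintype.piFinset fun _ : J => Finset.Icc 1 n.succPNat,
          evalMean γ (MvPolynomial.pderiv (m ⟨i, hi⟩) w) * R m := by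
  refine ⟨fun m => (∏ j ∈ Finset.univ \ {⟨i, hi⟩},
    evalMean γ (MvPolynomial.pderiv (m j) (x j))) * γ (Finset.univ.val.map m), fun w => ?_⟩
  rw [slotLimit, if_neg hJ]
  refine Finset.sum_congr rfl fun m _ => ?_
  rw [← mul_assoc, ← Finset.mul_prod_erase _ _ (Finset.mem_univ ⟨i, hi⟩),
    Finset.sdiff_singleton_eq_erase, Function.update_self]
  congr 2
  refine Finset.prod_congr rfl fun j hj => ?_
  rw [Function.update_of_ne]
  exact fun h => (Finset.mem_erase.1 hj).1 (Subtype.ext h)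

theorem slotLimit_update_sum (γ : Multiset ℕ+ → ℝ) (n : ℕ) {J : Finset ι} {i : ι} (hi : i ∈ J)
    (x : ι → MvPolynomial ℕ+ ℝ) {σ : Type*} (s : Finset σ) (c : σ → ℝ)
    (a : σ → MvPolynomial ℕ+ ℝ) :
    slotLimit γ n J (Function.update x i (∑ t ∈ s, c t • a t)) =
      ∑ t ∈ s, c t * slotLimit γ n J (Function.update x i (a t)) := by
  by_cases hJ : J.card = 1
  · obtain ⟨j, rfl⟩ := Finset.card_eq_one.1 hJ
    obtain rfl := Finset.mem_singleton.1 hi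
    simp [slotLimit_singleton]
  · obtain ⟨R, hR⟩ := exists_slotLimit_update γ n hi hJ x
    simp only [hR, map_sum, Finset.sum_mul, Finset.mul_sum]
    rw [Finset.sum_comm]
    exact Finset.sum_congr rfl fun t _ => Finset.sum_congr rfl fun m _ => by
      rw [Derivation.map_smul, map_smul, smul_eq_mul]; ring

theorem slotLimit_update_mul (γ : Multiset ℕ+ → ℝ) (n : ℕ) {J : Finset ι} {i : ι} (hi : i ∈ J)
    (hJ : J.card ≠ 1) (x : ι → MvPolynomial ℕ+ ℝ) (a b : MvPolynomial ℕ+ ℝ) :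
    slotLimit γ n J (Function.update x i (a * b)) =
      evalMean γ a * slotLimit γ n J (Function.update x i b) +
        slotLimit γ n J (Function.update x i a) * evalMean γ b := by
  obtain ⟨R, hR⟩ := exists_slotLimit_update γ n hi hJ x
  simp only [hR, Finset.sum_mul, Finset.mul_sum, Derivation.leibniz, smul_eq_mul, map_add, map_mul]
  rw [← Finset.sum_add_distrib]
  exact Finset.sum_congr rfl fun m _ => by ring

theorem slotLimit_one (γ : Multiset ℕ+ → ℝ) (n : ℕ) {J : Finset ι} {i : ι} (hi : i ∈ J)
    (hJ : J.card ≠ 1) (x : ι → MvPolynomial ℕ+ ℝ) (hx : x i = 1) : slotLimit γ n J x = 0 := by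
  obtain ⟨R, hR⟩ := exists_slotLimit_update γ n hi hJ x
  rw [← Function.update_eq_self i x, hR, hx]
  simp

/-- For variables only the assignment m itself has nonzero gradients. The summation range, which
ends at n + 1, must contain it. -/
theorem slotLimit_X (γ : Multiset ℕ+ → ℝ) (n : ℕ) {J : Finset ι} (m : ι → ℕ+)
    (hm : ∀ j ∈ J, m j ≤ n.succPNat) (hJ : J.Nonempty) :
    slotLimit γ n J (fun j => MvPolynomial.X (m j)) = γ (J.val.map m) := by
  by_cases h1 : J.card = 1
  · obtain ⟨j, rfl⟩ := Finset.card_eq_one.1 h1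
    simp [slotLimit_singleton, evalMean]
  · rw [slotLimit, if_neg h1, Finset.sum_eq_single (fun j : J => m j)]
    · simp only [MvPolynomial.pderiv_X_self, map_one, Finset.prod_const_one, one_mul]
      congr 1
      rw [← Multiset.attach_map_val' J.val m]
      rfl
    · intro m' _ hne
      obtain ⟨j, hj⟩ := Function.ne_iff.1 hne
      rw [Finset.prod_eq_zero (Finset.mem_univ j), zero_mul]
      rw [MvPolynomial.pderiv_X_of_ne (Ne.symm hj), map_zero]
    · intro h
      refine absurd ?_ h
      rw [Fintype.mem_piFinset]
      exact fun j => Finset.mem_Icc.2 ⟨one_le, hm j j.2⟩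

theorem multMonomial_cons (R : Type*) [CommRing R] (m : ℕ+) (μ : Multiset ℕ+) :
    multMonomial R (m ::ₘ μ) = MvPolynomial.X m * multMonomial R μ := by
  simp [multMonomial]

theorem multMonomial_singleton (R : Type*) [CommRing R] (m : ℕ+) :
    multMonomial R {m} = MvPolynomial.X m := by
  simp [multMonomial]

variable [Infinite ι] {F : ℕ → MvPolynomial ℕ+ ℝ →ₗ[ℝ] ℝ} {n : ℕ} {γ : Multiset ℕ+ → ℝ}

theorem CumTendsto.generators (hγ : CumTendsto F n γ) (hF : ∀ N, F N 1 = 1) {J : Finset ι}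
    (hJ : J.Nonempty) (m : ι → ℕ+) (hw : ∑ j ∈ J, (m j : ℕ) ≤ n) :
    Tendsto (fun N : ℕ => (N : ℝ) ^ scaleExp J.card *
      kum (F N) (fun j => MvPolynomial.X (m j)) J) atTop
        (𝓝 (slotLimit γ n J fun j => MvPolynomial.X (m j))) := by
  have hm : ∀ j ∈ J, m j ≤ n.succPNat := by
    intro j hj
    have := (Finset.single_le_sum (f := fun j => (m j : ℕ)) (fun _ _ => Nat.zero_le _) hj).trans hw
    rw [← PNat.coe_le_coe, Nat.succPNat_coe]
    exact Nat.le_succ_of_le this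
  rw [slotLimit_X γ n m hm hJ]
  have := hγ (J.val.map m) (by
    intro h
    rw [Multiset.map_eq_zero] at h
    exact hJ.ne_empty (Finset.val_eq_zero.1 h)) (by
    rw [multWeight, Multiset.map_map]
    exact hw)
  rw [Multiset.card_map] at this
  refine this.congr fun N => ?_
  rw [kum_eq_kumM (hF N) _ hJ, Multiset.map_map]
  rfl

/-- The delta method for monomials. -/
theorem CumTendsto.monomials (hγ : CumTendsto F n γ) (hF : ∀ N, F N 1 = 1) (k : ℕ) :
    ∀ (J : Finset ι) (d : ι → Multiset ℕ+), J.Nonempty →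
      ∑ j ∈ J, (Multiset.card (d j) - 1) = k → ∑ j ∈ J, multWeight (d j) ≤ n →
      Tendsto (fun N : ℕ => (N : ℝ) ^ scaleExp J.card *
        kum (F N) (fun j => multMonomial ℝ (d j)) J) atTop
          (𝓝 (slotLimit γ n J fun j => multMonomial ℝ (d j))) := by
  induction k using Nat.strong_induction_on with
  | _ k ih =>
  intro J d hJ hk hw
  by_cases h0 : ∃ i ∈ J, d i = 0
  · obtain ⟨i, hi, hdi⟩ := h0
    have h1 : multMonomial ℝ (d i) = 1 := by simp [hdi, multMonomial]
    by_cases hc : J.card = 1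
    · obtain ⟨j, rfl⟩ := Finset.card_eq_one.1 hc
      obtain rfl := Finset.mem_singleton.1 hi
      simp only [slotLimit_singleton, h1, map_one, kum_singleton (hF _), hF, hc, scaleExp_one,
        pow_zero, one_mul]
      exact tendsto_const_nhds
    · rw [slotLimit_one γ n hi hc _ h1]
      have hc' : 1 < J.card := by
        have := Finset.card_pos.2 hJ
        omega
      simp only [fun N => kum_scalar (hF N) (fun j => multMonomial ℝ (d j)) 1
        (by simp [h1]) J hi hc', mul_zero]
      exact tendsto_const_nhds
  push Not at h0
  by_cases h2 : ∀ i ∈ J, Multiset.card (d i) = 1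
  · have h3 : ∀ i : ι, ∃ m : ℕ+, i ∈ J → d i = {m} := by
      intro i
      by_cases hi : i ∈ J
      · obtain ⟨m, hm⟩ := Multiset.card_eq_one.1 (h2 i hi)
        exact ⟨m, fun _ => hm⟩
      · exact ⟨1, fun h => absurd h hi⟩
    choose m hm using h3
    have h4 : ∀ j ∈ J, multMonomial ℝ (d j) = MvPolynomial.X (m j) := fun j hj => by
      rw [hm j hj, multMonomial_singleton]
    rw [slotLimit_congr h4]
    simp only [fun N => kum_congr (E := F N) h4]
    refine hγ.generators hF hJ m ?_
    rw [Finset.sum_congr rfl fun j hj => by rw [hm j hj]] at hw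
    simpa [multWeight] using hw
  push Not at h2
  obtain ⟨i, hi, hci⟩ := h2
  obtain ⟨m, s, hs⟩ : ∃ m s, d i = m ::ₘ s := by
    obtain ⟨m, hm⟩ := Multiset.exists_mem_of_ne_zero (h0 i hi)
    obtain ⟨s, hs⟩ := Multiset.exists_cons_of_mem hm
    exact ⟨m, s, hs⟩
  have hs0 : 0 < Multiset.card s := by
    rw [hs, Multiset.card_cons] at hci
    omega
  -- A fresh index j holds the variable split off from the monomial in slot i. The formula for a
  -- product entry then expresses the cumulant through families with smaller total excess degree ∑
  -- (card - 1).
  obtain ⟨j, hj⟩ := Infinite.exists_notMem_finset J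
  have hij : i ≠ j := fun h => hj (h ▸ hi)
  set d' : ι → Multiset ℕ+ := Function.update (Function.update d i s) j {m} with hd'
  have hd'i : d' i = s := by rw [hd', Function.update_of_ne hij, Function.update_self]
  have hd'j : d' j = {m} := by rw [hd', Function.update_self]
  have hd'o : ∀ l ∈ J.erase i, d' l = d l := by
    intro l hl
    rw [Finset.mem_erase] at hl
    have hlj : l ≠ j := fun h => hj (h ▸ hl.2)
    rw [hd', Function.update_of_ne hlj, Function.update_of_ne hl.1]
  set x : ι → MvPolynomial ℕ+ ℝ := fun l => multMonomial ℝ (d' l) with hx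
  -- bookkeeping of degrees and weights
  have hkJ : Multiset.card s + ∑ l ∈ J.erase i, (Multiset.card (d' l) - 1) = k := by
    rw [← hk, ← Finset.add_sum_erase _ _ hi, hs, Multiset.card_cons,
      Finset.sum_congr rfl fun l hl => by rw [hd'o l hl]]
    simp
  have hwJ : (m : ℕ) + multWeight s + ∑ l ∈ J.erase i, multWeight (d' l) ≤ n := by
    refine le_trans (le_of_eq ?_) hw
    rw [← Finset.add_sum_erase _ _ hi, hs, Finset.sum_congr rfl fun l hl => by rw [hd'o l hl]]
    simp [multWeight]
  have hsub : ∀ {B C : Finset ι} (f : ι → ℕ), B ⊆ C → ∑ l ∈ B, f l ≤ ∑ l ∈ C, f l :=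
    fun f h => Finset.sum_le_sum_of_subset h
  have hje : j ∉ J.erase i := fun h => hj (Finset.mem_of_mem_erase h)
  have hie : i ∉ J.erase i := Finset.notMem_erase i J
  have hI : ∀ B ⊆ J.erase i, Tendsto (fun N : ℕ => (N : ℝ) ^ scaleExp (insert i B).card *
      kum (F N) x (insert i B)) atTop (𝓝 (slotLimit γ n (insert i B) x)) := by
    intro B hB
    refine ih _ ?_ (insert i B) d' (by simp) rfl ?_
    · rw [Finset.sum_insert fun h => hie (hB h), hd'i]
      have := hsub (fun l => Multiset.card (d' l) - 1) hB
      omega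
    · rw [Finset.sum_insert fun h => hie (hB h), hd'i]
      have := hsub (fun l => multWeight (d' l)) hB
      omega
  have hII : ∀ B ⊆ J.erase i, Tendsto (fun N : ℕ => (N : ℝ) ^ scaleExp (insert j B).card *
      kum (F N) x (insert j B)) atTop (𝓝 (slotLimit γ n (insert j B) x)) := by
    intro B hB
    refine ih _ ?_ (insert j B) d' (by simp) rfl ?_
    · rw [Finset.sum_insert fun h => hje (hB h), hd'j]
      have := hsub (fun l => Multiset.card (d' l) - 1) hB
      simp only [Multiset.card_singleton]
      omega
    · rw [Finset.sum_insert fun h => hje (hB h), hd'j]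
      have := hsub (fun l => multWeight (d' l)) hB
      have h3 : multWeight {m} = m := by simp [multWeight]
      omega
  have hIII : Tendsto (fun N : ℕ => (N : ℝ) ^ scaleExp (insert j J).card *
      kum (F N) x (insert j J)) atTop (𝓝 (slotLimit γ n (insert j J) x)) := by
    refine ih _ ?_ (insert j J) d' (by simp) rfl ?_
    · rw [Finset.sum_insert hj, hd'j, ← Finset.add_sum_erase _ _ hi, hd'i]
      simp only [Multiset.card_singleton]
      omega
    · rw [Finset.sum_insert hj, hd'j, ← Finset.add_sum_erase _ _ hi, hd'i]
      have h3 : multWeight {m} = m := by simp [multWeight]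
      omega
  have hupd : ∀ l ∈ J, multMonomial ℝ (d l) = Function.update x i (x i * x j) l := by
    intro l hl
    by_cases hli : l = i
    · subst hli
      rw [Function.update_self, hx]
      simp only [hd'i, hd'j]
      rw [hs, multMonomial_cons, multMonomial_singleton, mul_comm]
    · rw [Function.update_of_ne hli, hx]
      simp only [hd'o l (Finset.mem_erase.2 ⟨hli, hl⟩)]
  rw [slotLimit_congr hupd]
  simp only [fun N => kum_congr (E := F N) hupd, fun N => kum_update_mul (hF N) x hi hj, mul_add,
    Finset.mul_sum]
  have hJpos := Finset.card_pos.2 hJ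
  have hcard : (J.erase i).card + 1 = J.card := Finset.card_erase_add_one hi
  -- The cumulant over J ∪ {j} has one more argument and is of strictly smaller order than the scale
  -- for J.
  have hfirst := tendsto_pow_mul_of_lt (a := scaleExp J.card) (by
    rw [Finset.card_insert_of_notMem hj]
    exact scaleExp_lt_succ hJpos) hIII
  -- the other terms
  set y := Function.update x i (x j) with hy
  have hswap : ∀ N, kum (F N) x (insert j (J.erase i)) = kum (F N) y J := by
    intro N
    refine kum_eq_of_map_eq (hF N) ?_ (by simp)
    conv_rhs => rw [← Finset.insert_erase hi]
    rw [Finset.insert_val_of_notMem hje, Finset.insert_val_of_notMem hie, Multiset.map_cons,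
      Multiset.map_cons, hy, Function.update_self]
    congr 1
    refine Multiset.map_congr rfl fun l hl => ?_
    rw [Function.update_of_ne]
    rintro rfl
    exact hie hl
  have hIV : Tendsto (fun N : ℕ => (N : ℝ) ^ scaleExp J.card * kum (F N) y J) atTop
      (𝓝 (slotLimit γ n J y)) := by
    have hy' : y = fun l => multMonomial ℝ (Function.update d' i {m} l) := by
      funext l
      by_cases hli : l = i
      · subst hli
        rw [hy, Function.update_self, Function.update_self, hx]
        simp only [hd'j]
      · rw [hy, Function.update_of_ne hli, Function.update_of_ne hli]
    rw [hy']
    have ho : ∀ l ∈ J.erase i, Function.update d' i {m} l = d' l := fun l hl =>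
      Function.update_of_ne (Finset.mem_erase.1 hl).1 _ _
    refine ih _ ?_ J (Function.update d' i {m}) hJ rfl ?_
    · rw [← Finset.add_sum_erase _ _ hi, Function.update_self,
        Finset.sum_congr rfl fun l hl => by rw [ho l hl]]
      simp only [Multiset.card_singleton]
      omega
    · rw [← Finset.add_sum_erase _ _ hi, Function.update_self,
        Finset.sum_congr rfl fun l hl => by rw [ho l hl]]
      have h3 : multWeight {m} = m := by simp [multWeight]
      omega
  have hsingle_i := hI ∅ (by simp)
  have hsingle_j := hII ∅ (by simp)
  simp only [insert_empty_eq, Finset.card_singleton, scaleExp_one, pow_zero, one_mul,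
    slotLimit_singleton] at hsingle_i hsingle_j
  have hempty : Tendsto (fun N : ℕ => (N : ℝ) ^ scaleExp J.card * (kum (F N) x (insert i ∅) *
      kum (F N) x (insert j (J.erase i \ ∅)))) atTop
        (𝓝 (evalMean γ (x i) * slotLimit γ n J y)) := by
    refine (hsingle_i.mul hIV).congr fun N => ?_
    rw [Finset.sdiff_empty, hswap, insert_empty_eq]
    ring
  by_cases hc : J.card = 1
  · obtain ⟨i', rfl⟩ := Finset.card_eq_one.1 hc
    obtain rfl := Finset.mem_singleton.1 hi
    rw [Finset.erase_singleton, Finset.powerset_empty] at *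
    simp only [Finset.sum_singleton]
    have := hfirst.add hempty
    rw [zero_add, slotLimit_singleton, hy, Function.update_self] at this
    rwa [slotLimit_singleton, Function.update_self, map_mul]
  · have hx_self : Function.update x i (x i) = x := Function.update_eq_self i x
    rw [slotLimit_update_mul γ n hi hc x (x i) (x j), hx_self, ← hy, ← zero_add (_ + _)]
    refine hfirst.add ?_
    have hne : (J.erase i) ≠ ∅ := by
      rw [← Finset.card_pos.trans Finset.nonempty_iff_ne_empty]
      omega
    have hfull : Tendsto (fun N : ℕ => (N : ℝ) ^ scaleExp J.card *
        (kum (F N) x (insert i (J.erase i)) * kum (F N) x (insert j (J.erase i \ J.erase i)))) atTop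
        (𝓝 (slotLimit γ n J x * evalMean γ (x j))) := by
      have h1 := hI (J.erase i) subset_rfl
      rw [Finset.insert_erase hi] at h1
      refine (h1.mul hsingle_j).congr fun N => ?_
      rw [Finset.sdiff_self, Finset.insert_erase hi, insert_empty_eq]
      ring
    -- Among the products over B, only B = ∅ and B = `J.erase i` survive: there one factor is a
    -- mean. They are the two terms of the Leibniz rule.
    have hsum : evalMean γ (x i) * slotLimit γ n J y + slotLimit γ n J x * evalMean γ (x j) =
        ∑ B ∈ (J.erase i).powerset, ((if B = ∅ then evalMean γ (x i) * slotLimit γ n J y else 0) +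
          if B = J.erase i then slotLimit γ n J x * evalMean γ (x j) else 0) := by
      rw [Finset.sum_add_distrib, Finset.sum_ite_eq', Finset.sum_ite_eq', if_pos (by simp),
        if_pos (by simp)]
    rw [hsum]
    refine tendsto_finsetSum _ fun B hB => ?_
    rw [Finset.mem_powerset] at hB
    by_cases hB0 : B = ∅
    · subst hB0
      rw [if_pos rfl, if_neg (Ne.symm hne), add_zero]
      exact hempty
    by_cases hB1 : B = J.erase i
    · rw [if_neg hB0, if_pos hB1, zero_add, hB1]
      exact hfull
    rw [if_neg hB0, if_neg hB1, add_zero]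
    have h1 := hI B hB
    have h2 := hII (J.erase i \ B) Finset.sdiff_subset
    rw [Finset.card_insert_of_notMem fun h => hie (hB h)] at h1
    rw [Finset.card_insert_of_notMem fun h => hje (Finset.sdiff_subset h),
      Finset.card_sdiff_of_subset hB] at h2
    have hBc : 0 < B.card := Finset.card_pos.2 (Finset.nonempty_iff_ne_empty.2 hB0)
    have hBc' : B.card < (J.erase i).card :=
      Finset.card_lt_card (Finset.ssubset_iff_subset_ne.2 ⟨hB, hB1⟩)
    rw [scaleExp_of_ne_one (by omega)] at h1 h2
    -- Both factors have at least two arguments, (|B|+1) + (|J|-|B|) = |J| + 1 in all, so the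
    -- product is smaller than the scale by a factor N⁻¹.
    refine tendsto_pow_mul_of_lt (b := J.card + 1) ?_ ((h1.mul h2).congr fun N => ?_)
    · rw [scaleExp_of_ne_one hc]
      exact Nat.lt_succ_self _
    · rw [show J.card + 1 = (B.card + 1) + ((J.erase i).card - B.card + 1) by omega, pow_add]
      ring

theorem monomial_toFinsupp (R : Type*) [CommRing R] (μ : Multiset ℕ+) :
    MvPolynomial.monomial (Multiset.toFinsupp μ) (1 : R) = multMonomial R μ := by
  induction μ using Multiset.induction_on with
  | empty => simp [multMonomial]
  | cons m μ ih =>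
    rw [multMonomial_cons, ← ih, ← Multiset.singleton_add, map_add, Multiset.toFinsupp_singleton,
      MvPolynomial.X, MvPolynomial.monomial_mul, one_mul]

theorem expWeight_toFinsupp (μ : Multiset ℕ+) : expWeight (Multiset.toFinsupp μ) = multWeight μ := by
  induction μ using Multiset.induction_on with
  | empty => simp [multWeight]
  | cons m μ ih =>
    rw [← Multiset.singleton_add, map_add, map_add, ih, Multiset.toFinsupp_singleton,
      expWeight_single, one_mul]
    simp [multWeight]

theorem monomial_one_eq (R : Type*) [CommRing R] (d : ℕ+ →₀ ℕ) :
    MvPolynomial.monomial d (1 : R) = multMonomial R (Finsupp.toMultiset d) := by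
  rw [← monomial_toFinsupp, Finsupp.toMultiset_toFinsupp]

theorem multWeight_toMultiset (d : ℕ+ →₀ ℕ) : multWeight (Finsupp.toMultiset d) = expWeight d := by
  rw [← expWeight_toFinsupp, Finsupp.toMultiset_toFinsupp]

theorem evalEps_multMonomial (x : ℝ) (μ : Multiset ℕ+) :
    evalEps x (multMonomial _ μ) = multMonomial ℝ μ := by
  rw [multMonomial, map_multiset_prod, Multiset.map_map, multMonomial]
  congr 1
  exact Multiset.map_congr rfl fun m _ => by simp [evalEps]

theorem evalEps_eq_sum (x : ℝ) (p : MvPolynomial ℕ+ (Polynomial ℝ)) :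
    evalEps x p = ∑ d ∈ p.support, (p.coeff d).eval x • multMonomial ℝ (Finsupp.toMultiset d) := by
  conv_lhs => rw [p.as_sum]
  rw [map_sum]
  refine Finset.sum_congr rfl fun d _ => ?_
  rw [evalEps, MvPolynomial.map_monomial, ← monomial_one_eq, MvPolynomial.smul_monomial, smul_eq_mul,
    mul_one, Polynomial.coe_evalRingHom]

/-- The delta method for polynomials depending polynomially on `1/N`. -/
theorem CumTendsto.delta (hγ : CumTendsto F n γ) (hF : ∀ N, F N 1 = 1) {J : Finset ι}
    (hJ : J.Nonempty) (w : ι → ℕ) (hw : ∑ j ∈ J, w j ≤ n)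
    (x : ι → MvPolynomial ℕ+ (Polynomial ℝ)) (hx : ∀ j ∈ J, x j ∈ wtLE _ (w j)) :
    Tendsto (fun N : ℕ => (N : ℝ) ^ scaleExp J.card *
      kum (F N) (fun j => evalEps (N : ℝ)⁻¹ (x j)) J) atTop
        (𝓝 (slotLimit γ n J fun j => evalEps 0 (x j))) := by
  -- T contains the slots that may still hold general polynomials; the other slots of J hold
  -- monomials. Each induction step expands one slot, and its coefficients, polynomials in 1/N,
  -- converge to their values at 0.
  suffices H : ∀ T : Finset ι, ∀ x : ι → MvPolynomial ℕ+ (Polynomial ℝ),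
      (∀ j ∈ J, x j ∈ wtLE _ (w j)) →
      (∀ j ∈ J, j ∉ T → ∃ μ, x j = multMonomial _ μ ∧ multWeight μ ≤ w j) →
      Tendsto (fun N : ℕ => (N : ℝ) ^ scaleExp J.card *
        kum (F N) (fun j => evalEps (N : ℝ)⁻¹ (x j)) J) atTop
          (𝓝 (slotLimit γ n J fun j => evalEps 0 (x j))) from
    H J x hx fun j hj hj' => absurd hj hj'
  intro T
  induction T using Finset.induction_on with
  | empty =>
    intro x hx hμ
    have h1 : ∀ j, ∃ μ, j ∈ J → x j = multMonomial _ μ ∧ multWeight μ ≤ w j := by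
      intro j
      by_cases hj : j ∈ J
      · obtain ⟨μ, hμ⟩ := hμ j hj (by simp)
        exact ⟨μ, fun _ => hμ⟩
      · exact ⟨0, fun h => absurd h hj⟩
    choose d hd using h1
    have h2 : ∀ (y : ℝ), ∀ j ∈ J, evalEps y (x j) = multMonomial ℝ (d j) := fun y j hj => by
      rw [(hd j hj).1, evalEps_multMonomial]
    rw [slotLimit_congr (h2 0)]
    simp only [fun N : ℕ => kum_congr (E := F N) (h2 (N : ℝ)⁻¹)]
    exact hγ.monomials hF _ J d hJ rfl
      ((Finset.sum_le_sum fun j hj => (hd j hj).2).trans hw)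
  | insert i T hi ih =>
    intro x hx hμ
    by_cases hiJ : i ∈ J
    swap
    · exact ih x hx fun j hj hjT => hμ j hj (by
        rw [Finset.mem_insert]
        rintro (rfl | h)
        · exact hiJ hj
        · exact hjT h)
    have h1 : ∀ y : ℝ, (fun j => evalEps y (x j)) = Function.update (fun j => evalEps y (x j)) i
        (∑ d ∈ (x i).support, ((x i).coeff d).eval y • multMonomial ℝ (Finsupp.toMultiset d)) := by
      intro y
      rw [← evalEps_eq_sum, Function.update_eq_self_iff.2 rfl]
    rw [h1 0, slotLimit_update_sum γ n hiJ]
    have h2 : ∀ N : ℕ, (N : ℝ) ^ scaleExp J.card * kum (F N) (fun j => evalEps (N : ℝ)⁻¹ (x j)) J =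
        ∑ d ∈ (x i).support, ((x i).coeff d).eval (N : ℝ)⁻¹ * ((N : ℝ) ^ scaleExp J.card *
          kum (F N) (fun j => evalEps (N : ℝ)⁻¹ (Function.update x i
            (multMonomial _ (Finsupp.toMultiset d)) j)) J) := by
      intro N
      rw [h1, kum_update_sum (hF N) _ _ _ hiJ, Finset.mul_sum]
      refine Finset.sum_congr rfl fun d _ => ?_
      rw [kum_update_smul (hF N) _ _ _ hiJ]
      have h3 : (fun j => evalEps (N : ℝ)⁻¹ (Function.update x i
          (multMonomial _ (Finsupp.toMultiset d)) j)) = Function.update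
            (fun j => evalEps (N : ℝ)⁻¹ (x j)) i (multMonomial ℝ (Finsupp.toMultiset d)) := by
        funext j
        by_cases hji : j = i
        · subst hji
          rw [Function.update_self, Function.update_self, evalEps_multMonomial]
        · rw [Function.update_of_ne hji, Function.update_of_ne hji]
      rw [h3]
      ring
    simp only [h2]
    refine tendsto_finsetSum _ fun d hd => Tendsto.mul ?_ ?_
    · have := ((x i).coeff d).continuous.continuousAt (x := 0)
      exact this.tendsto.comp tendsto_inv_atTop_nhds_zero_nat
    · have hwd : expWeight d ≤ w i := by
        exact_mod_cast hx i hiJ d (MvPolynomial.mem_support_iff.1 hd)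
      have := ih (Function.update x i (multMonomial _ (Finsupp.toMultiset d))) ?_ ?_
      · convert this using 2
        refine slotLimit_congr fun j _ => ?_
        by_cases hji : j = i
        · subst hji
          rw [Function.update_self, Function.update_self, evalEps_multMonomial]
        · rw [Function.update_of_ne hji, Function.update_of_ne hji]
      · intro j hj
        by_cases hji : j = i
        · subst hji
          rw [Function.update_self, ← monomial_one_eq]
          exact wtLE_mono (by exact_mod_cast hwd) (monomial_mem_wtLE d 1)
        · rw [Function.update_of_ne hji]
          exact hx j hj
      · intro j hj hjT
        by_cases hji : j = i
        · subst hji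
          exact ⟨_, Function.update_self .., by rwa [multWeight_toMultiset]⟩
        · rw [Function.update_of_ne hji]
          exact hμ j hj (by simp [hji, hjT])

end CumulantLimits

/-! ### Limits of the joint cumulants of the binomial sums. -/

section BinomialLimits

theorem tendsto_pow_mul_inv_pow {u : ℕ → ℝ} {a b c : ℕ} {L : ℝ} (habc : a = b + c)
    (h : Tendsto (fun N : ℕ => (N : ℝ) ^ c * u N) atTop (𝓝 L)) :
    Tendsto (fun N : ℕ => (N : ℝ) ^ a * ((N : ℝ)⁻¹ ^ b * u N)) atTop (𝓝 L) := by
  refine h.congr' ?_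
  filter_upwards [eventually_ne_atTop 0] with N hN
  have hN' : (N : ℝ) ≠ 0 := by exact_mod_cast hN
  rw [habc, pow_add, mul_mul_mul_comm, ← mul_pow, mul_inv_cancel₀ hN', one_pow, one_mul]

theorem tendsto_pow_mul_inv_pow_of_lt {u : ℕ → ℝ} {a b c : ℕ} {L : ℝ} (habc : a < b + c)
    (h : Tendsto (fun N : ℕ => (N : ℝ) ^ c * u N) atTop (𝓝 L)) :
    Tendsto (fun N : ℕ => (N : ℝ) ^ a * ((N : ℝ)⁻¹ ^ b * u N)) atTop (𝓝 0) :=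
  tendsto_pow_mul_of_lt habc (tendsto_pow_mul_inv_pow rfl h)

theorem card_le_of_mem_setParts {I : Finset ℕ} {π : Finset (Finset ℕ)} (h : π ∈ setParts I) :
    π.card ≤ I.card := by
  have h1 := sum_card_of_mem_setParts h (fun _ => 1)
  simp only [Finset.sum_const, smul_eq_mul, mul_one] at h1
  rw [← h1, Finset.card_eq_sum_ones]
  exact Finset.sum_le_sum fun U hU => Finset.card_pos.2 (nonempty_of_mem_setParts h hU)

theorem sum_card_sub_one_of_mem_setParts {I : Finset ℕ} {π : Finset (Finset ℕ)}
    (h : π ∈ setParts I) : ∑ U ∈ π, (U.card - 1) = I.card - π.card := by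
  have h1 := sum_card_of_mem_setParts h (fun _ => 1)
  simp only [Finset.sum_const, smul_eq_mul, mul_one] at h1
  have h2 : ∑ U ∈ π, (U.card - 1) + π.card = I.card := by
    rw [← h1, Finset.card_eq_sum_ones π, ← Finset.sum_add_distrib]
    refine Finset.sum_congr rfl fun U hU => ?_
    have := Finset.card_pos.2 (nonempty_of_mem_setParts h hU)
    omega
  omega

/-- The embedding of points as singletons. -/
def singletonEmb : ℕ ↪ Finset ℕ := ⟨fun i => {i}, Finset.singleton_injective⟩

theorem map_singletonEmb_mem_setParts (I : Finset ℕ) : I.map singletonEmb ∈ setParts I := by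
  rw [mem_setParts]
  refine ⟨?_, ?_, ?_⟩
  · simp [singletonEmb]
  · intro U hU V hV hne
    simp only [Finset.mem_map, singletonEmb, Function.Embedding.coeFn_mk] at hU hV
    obtain ⟨i, -, rfl⟩ := hU
    obtain ⟨j, -, rfl⟩ := hV
    rw [Finset.disjoint_singleton]
    rintro rfl
    exact hne rfl
  · ext i
    simp [singletonEmb]

theorem eq_map_singletonEmb {I : Finset ℕ} {π : Finset (Finset ℕ)} (h : π ∈ setParts I)
    (hc : π.card = I.card) : π = I.map singletonEmb := by
  have h1 := sum_card_sub_one_of_mem_setParts h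
  rw [hc, Nat.sub_self, Finset.sum_eq_zero_iff] at h1
  refine Finset.eq_of_subset_of_card_le (fun U hU => ?_) (by rw [Finset.card_map, hc])
  have h2 := h1 U hU
  have h3 := Finset.card_pos.2 (nonempty_of_mem_setParts h hU)
  obtain ⟨i, rfl⟩ := Finset.card_eq_one.1 (by omega : U.card = 1)
  exact Finset.mem_map.2 ⟨i, subset_of_mem_setParts h hU (by simp), rfl⟩

variable {F : ℕ → MvPolynomial ℕ+ ℝ →ₗ[ℝ] ℝ} {n : ℕ} {γ : Multiset ℕ+ → ℝ}

/-- The limit of the scaled joint cumulants of the normalized binomial sums. -/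
noncomputable def binomLimit (γ : Multiset ℕ+ → ℝ) (n : ℕ) (k : ℕ → ℕ) (J : Finset ℕ) : ℝ :=
  slotLimit γ n J (fun j => limitPart (k j)) +
    if J.card = 2 then evalMean γ (evalEps 0 (univPart k J)) else 0

/-- Total cumulance with the universal cumulants as conditional cumulants; the blocks of π carry the
powers of x, of total exponent 2(|J|-|π|). -/
theorem cum_univMoment (E : MvPolynomial ℕ+ ℝ →ₗ[ℝ] ℝ) (hE : E 1 = 1) (x : ℝ) (k : ℕ → ℕ)
    {J : Finset ℕ} (hJ : J.Nonempty) :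
    cum (fun U => E (univMoment x k U)) J = ∑ π ∈ setParts J,
      x ^ (2 * (J.card - π.card)) * kum E (fun U => evalEps x (univPart k U)) π := by
  have h1 : (fun U => E (univMoment x k U)) =
      fun U => E.toAddMonoidHom (expMoment (univCum x k) U) := by
    funext U
    have : expMoment (univCum x k) U = univMoment x k U := expMoment_cum _ (univMoment_empty x k) U
    rw [this]
    rfl
  rw [h1, cum_total E.toAddMonoidHom hE _ hJ]
  refine Finset.sum_congr rfl fun π hπ => ?_
  have h2 : (univCum x k) = fun U => x ^ (2 * (U.card - 1)) • evalEps x (univPart k U) := by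
    funext U
    rw [univCum_eq_evalEps, MvPolynomial.smul_eq_C_mul]
  change kum E (univCum x k) π = _
  rw [h2, kum_smul, Finset.prod_pow_eq_pow_sum, ← Finset.mul_sum,
    sum_card_sub_one_of_mem_setParts hπ]

/-- A partition π of J contributes at order N^{-2(|J|-|π|)-`scaleExp`(|π|)}. Against `scaleExp`(|J|)
there survive the partition into singletons, which is the delta method, and, when |J| = 2, the
single block. For |J| = 1 the two partitions coincide. -/
theorem CumTendsto.binom (hγ : CumTendsto F n γ) (hF : ∀ N, F N 1 = 1) (k : ℕ → ℕ) {J : Finset ℕ}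
    (hJ : J.Nonempty) (hk : ∑ j ∈ J, k j ≤ n) :
    Tendsto (fun N : ℕ => (N : ℝ) ^ scaleExp J.card *
      cum (fun U => F N (univMoment (N : ℝ)⁻¹ k U)) J) atTop (𝓝 (binomLimit γ n k J)) := by
  simp only [fun N => cum_univMoment (F N) (hF N) (N : ℝ)⁻¹ k hJ, Finset.mul_sum]
  have hJpos := Finset.card_pos.2 hJ
  have hdelta : ∀ π ∈ setParts J, Tendsto (fun N : ℕ => (N : ℝ) ^ scaleExp π.card *
      kum (F N) (fun U => evalEps (N : ℝ)⁻¹ (univPart k U)) π) atTop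
        (𝓝 (slotLimit γ n π fun U => evalEps 0 (univPart k U))) := by
    intro π hπ
    refine hγ.delta hF (Finset.card_pos.1 (card_pos_of_mem_setParts hπ hJ))
      (fun U => ∑ j ∈ U, k j) ?_ _ fun U _ => ?_
    · rwa [sum_card_of_mem_setParts hπ]
    · have := univPart_mem_wtLE k U
      exact_mod_cast this
  have hsing : Tendsto (fun N : ℕ => (N : ℝ) ^ scaleExp J.card *
      ((N : ℝ)⁻¹ ^ (2 * (J.card - (J.map singletonEmb).card)) *
        kum (F N) (fun U => evalEps (N : ℝ)⁻¹ (univPart k U)) (J.map singletonEmb))) atTop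
        (𝓝 (slotLimit γ n J (fun j => limitPart (k j)))) := by
    have h1 := hγ.delta hF hJ k hk (fun j => univPart k {j}) (fun j _ => by
      simpa using univPart_mem_wtLE k {j})
    simp only [evalEps_univPart_singleton] at h1
    refine h1.congr fun N => ?_
    rw [Finset.card_map, Nat.sub_self, mul_zero, pow_zero, one_mul]
    congr 1
    refine kum_eq_of_map_eq (hF N) ?_ hJ
    rw [Finset.map_val, Multiset.map_map]
    rfl
  have hlim : binomLimit γ n k J = ∑ π ∈ setParts J,
      ((if π = J.map singletonEmb then slotLimit γ n J (fun j => limitPart (k j)) else 0) +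
        if π = {J} then (if J.card = 2 then evalMean γ (evalEps 0 (univPart k J)) else 0) else 0) := by
    rw [Finset.sum_add_distrib, Finset.sum_ite_eq', Finset.sum_ite_eq',
      if_pos (map_singletonEmb_mem_setParts J), if_pos (singleton_mem_setParts hJ), binomLimit]
  rw [hlim]
  refine tendsto_finsetSum _ fun π hπ => ?_
  by_cases h1 : π = J.map singletonEmb
  · rw [if_pos h1]
    have h2 : (if π = {J} then (if J.card = 2 then evalMean γ (evalEps 0 (univPart k J)) else 0)
        else 0) = 0 := by
      split_ifs with h3 h4
      · have := congrArg Finset.card h3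
        rw [h1, Finset.card_map, h4] at this
        simp at this
      · rfl
      · rfl
    rw [h2, add_zero, h1]
    exact hsing
  rw [if_neg h1, zero_add]
  have hlt : π.card < J.card := lt_of_le_of_ne (card_le_of_mem_setParts hπ)
    fun h => h1 (eq_map_singletonEmb hπ h)
  by_cases h2 : π = {J}
  · rw [if_pos h2]
    have h3 := hdelta π hπ
    have hc : π.card = 1 := by rw [h2, Finset.card_singleton]
    split_ifs with h4
    · have := tendsto_pow_mul_inv_pow (a := scaleExp J.card) (b := 2 * (J.card - π.card)) (by
        rw [hc, h4]; rfl) h3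
      rwa [h2, slotLimit_singleton, ← h2] at this
    · refine tendsto_pow_mul_inv_pow_of_lt ?_ h3
      rw [hc, scaleExp_one, scaleExp_of_ne_one (by omega)]
      omega
  · rw [if_neg h2]
    -- For 1 < |π| < |J| the exponent 2(|J|-|π|) + |π| exceeds |J|.
    refine tendsto_pow_mul_inv_pow_of_lt ?_ (hdelta π hπ)
    have hc : 1 < π.card := by
      by_contra h
      exact h2 (eq_singleton_of_mem_setParts hπ hJ (not_lt.1 h))
    rw [scaleExp_of_ne_one (by omega), scaleExp_of_ne_one (by omega)]
    omega

end BinomialLimits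

/-! ### Solving linear systems whose matrices converge. -/

section MatrixLimit

/-- By Cramer's rule α = det(L)⁻¹ adj(L) (Lα) as soon as det L ≠ 0, and the right-hand side is
continuous at the limit. -/
theorem tendsto_of_mulVec {S : Type*} [Fintype S] [DecidableEq S] {L : ℕ → Matrix S S ℝ}
    {L' : Matrix S S ℝ} (hL : ∀ i j, Tendsto (fun N => L N i j) atTop (𝓝 (L' i j)))
    (hdet : L'.det ≠ 0) {α : ℕ → S → ℝ} {b : S → ℝ}
    (h : ∀ i, Tendsto (fun N => (L N).mulVec (α N) i) atTop (𝓝 (b i))) :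
    ∃ β : S → ℝ, L'.mulVec β = b ∧ ∀ i, Tendsto (fun N => α N i) atTop (𝓝 (β i)) := by
  have hLt : Tendsto L atTop (𝓝 L') :=
    tendsto_pi_nhds.2 fun i => tendsto_pi_nhds.2 fun j => hL i j
  have hd : Tendsto (fun N => (L N).det) atTop (𝓝 L'.det) :=
    (Continuous.matrix_det continuous_id).continuousAt.tendsto.comp hLt
  have ha : Tendsto (fun N => (L N).adjugate) atTop (𝓝 L'.adjugate) :=
    (Continuous.matrix_adjugate continuous_id).continuousAt.tendsto.comp hLt
  refine ⟨L'.det⁻¹ • L'.adjugate.mulVec b, ?_, fun i => ?_⟩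
  · rw [Matrix.mulVec_smul, Matrix.mulVec_mulVec, Matrix.mul_adjugate, Matrix.smul_mulVec,
      Matrix.one_mulVec, smul_smul, inv_mul_cancel₀ hdet, one_smul]
  · have h1 : Tendsto (fun N => (L N).det⁻¹ * (L N).adjugate.mulVec ((L N).mulVec (α N)) i) atTop
        (𝓝 (L'.det⁻¹ * L'.adjugate.mulVec b i)) := by
      refine (hd.inv₀ hdet).mul ?_
      simp only [Matrix.mulVec, dotProduct] at h ⊢
      refine tendsto_finsetSum _ fun j _ => Tendsto.mul ?_ (h j)
      exact (tendsto_pi_nhds.1 ((tendsto_pi_nhds.1 ha) i)) j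
    refine h1.congr' ?_
    filter_upwards [hd.eventually_ne hdet] with N hN
    rw [Matrix.mulVec_mulVec, Matrix.adjugate_mul, Matrix.smul_mulVec, Matrix.one_mulVec,
      Pi.smul_apply, smul_eq_mul, ← mul_assoc, inv_mul_cancel₀ hN, one_mul]

end MatrixLimit

/-! ### Changing a functional in top weight only. -/

section Perturbation

theorem multWeight_cons (m : ℕ+) (μ : Multiset ℕ+) : multWeight (m ::ₘ μ) = m + multWeight μ := by
  simp [multWeight]

theorem multWeight_eq_zero {μ : Multiset ℕ+} (h : multWeight μ = 0) : μ = 0 := by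
  induction μ using Multiset.induction_on with
  | empty => rfl
  | cons m μ _ =>
    rw [multWeight_cons] at h
    have := m.pos
    omega

instance finite_multWeight (n : ℕ) : Finite {μ : Multiset ℕ+ // multWeight μ = n} := by
  refine Finite.of_injective (β := Nat.Partition n)
    (fun μ => ⟨μ.1.map fun m : ℕ+ => (m : ℕ), ?_, μ.2⟩) ?_
  · intro i hi
    obtain ⟨m, -, rfl⟩ := Multiset.mem_map.1 hi
    exact m.pos
  · intro μ ν h
    have := congrArg Nat.Partition.parts h
    exact Subtype.ext (Multiset.map_injective PNat.coe_injective this)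

noncomputable instance fintype_multWeight (n : ℕ) : Fintype {μ : Multiset ℕ+ // multWeight μ = n} :=
  Fintype.ofFinite _

/-- An enumeration of a multiset. -/
noncomputable def multEnum (μ : Multiset ℕ+) (j : ℕ) : ℕ+ := μ.toList.getD j 1

theorem map_multEnum (μ : Multiset ℕ+) :
    (Finset.range (Multiset.card μ)).val.map (multEnum μ) = μ := by
  conv_rhs => rw [← Multiset.coe_toList μ]
  rw [Finset.range_val, ← Multiset.coe_range, Multiset.map_coe]
  congr 1
  rw [← Multiset.length_toList]
  apply List.ext_getElem
  · simp
  · intro n h1 h2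
    rw [List.getElem_map, List.getElem_range, multEnum, List.getD_eq_getElem]

theorem sum_multEnum (μ : Multiset ℕ+) :
    ∑ j ∈ Finset.range (Multiset.card μ), (multEnum μ j : ℕ) = multWeight μ := by
  conv_rhs => rw [← map_multEnum μ]
  rw [multWeight, Multiset.map_map]
  rfl

theorem prod_X_multEnum (μ : Multiset ℕ+) :
    ∏ j ∈ Finset.range (Multiset.card μ), (MvPolynomial.X (multEnum μ j) : MvPolynomial ℕ+ ℝ) =
      multMonomial ℝ μ := by
  conv_rhs => rw [← map_multEnum μ]
  rw [multMonomial, Multiset.map_map]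
  rfl

theorem kumM_map_X {E : MvPolynomial ℕ+ ℝ →ₗ[ℝ] ℝ} (hE : E 1 = 1) {μ : Multiset ℕ+} (hμ : μ ≠ 0) :
    kumM E (μ.map MvPolynomial.X) =
      kum E (fun j => MvPolynomial.X (multEnum μ j)) (Finset.range (Multiset.card μ)) := by
  rw [kum_eq_kumM hE]
  · conv_lhs => rw [← map_multEnum μ, Multiset.map_map]
    rfl
  · simpa using hμ

variable {E E' : MvPolynomial ℕ+ ℝ →ₗ[ℝ] ℝ} {n : ℕ}

theorem sum_lt_sum_of_ssubset {k : ℕ → ℕ} {U J : Finset ℕ} (hk : ∀ j ∈ J, 0 < k j) (h : U ⊂ J) :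
    ∑ j ∈ U, k j < ∑ j ∈ J, k j := by
  obtain ⟨i, hi, hiU⟩ := Finset.exists_of_ssubset h
  exact Finset.sum_lt_sum_of_subset h.1 hi hiU (hk i hi) fun _ _ _ => Nat.zero_le _

theorem prod_X_mem_wtLE (m : ℕ → ℕ+) (U : Finset ℕ) :
    ∏ j ∈ U, (MvPolynomial.X (m j) : MvPolynomial ℕ+ ℝ) ∈ wtLE ℝ (∑ j ∈ U, (m j : ℕ) : ℕ) := by
  have := prod_mem_wtLE U (fun j => (MvPolynomial.X (m j) : MvPolynomial ℕ+ ℝ))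
    (fun j => ((m j : ℕ) : ℤ)) fun j _ => X_mem_wtLE (m j)
  exact_mod_cast this

theorem kumM_eq_of_lt (hE : E 1 = 1) (hE' : E' 1 = 1)
    (h : ∀ p ∈ wtLE ℝ ((n : ℤ) - 1), E p = E' p) {μ : Multiset ℕ+} (hμ : μ ≠ 0)
    (hw : multWeight μ < n) :
    kumM E (μ.map MvPolynomial.X) = kumM E' (μ.map MvPolynomial.X) := by
  rw [kumM_map_X hE hμ, kumM_map_X hE' hμ]
  refine cum_congr fun U hU => h _ (wtLE_mono ?_ (prod_X_mem_wtLE _ U))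
  have := Finset.sum_le_sum_of_subset (f := fun j => (multEnum μ j : ℕ)) hU
  rw [sum_multEnum] at this
  omega

/-- All moments of proper subfamilies have smaller weight and agree, so the cumulants differ exactly
as the top moments do. -/
theorem kumM_sub_kumM (hE : E 1 = 1) (hE' : E' 1 = 1)
    (h : ∀ p ∈ wtLE ℝ ((n : ℤ) - 1), E p = E' p) {μ : Multiset ℕ+} (hμ : μ ≠ 0)
    (hw : multWeight μ = n) :
    kumM E (μ.map MvPolynomial.X) - kumM E' (μ.map MvPolynomial.X) =
      E (multMonomial ℝ μ) - E' (multMonomial ℝ μ) := by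
  rw [kumM_map_X hE hμ, kumM_map_X hE' hμ, kum, kum, cum_sub_cum, prod_X_multEnum]
  · simpa using hE
  · simpa using hμ
  · intro U hU
    refine h _ (wtLE_mono ?_ (prod_X_mem_wtLE _ U))
    have := sum_lt_sum_of_ssubset (k := fun j => (multEnum μ j : ℕ)) (fun j _ => (multEnum μ j).pos) hU
    rw [sum_multEnum] at this
    omega

/-- The same principle for the binomial sums. Positivity of the indices makes proper subfamilies
have smaller weight. -/
theorem cum_univMoment_sub (hE : E 1 = 1) (h : ∀ p ∈ wtLE ℝ ((n : ℤ) - 1), E p = E' p) (x : ℝ)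
    {k : ℕ → ℕ} {J : Finset ℕ} (hJ : J.Nonempty) (hk : ∀ j ∈ J, 0 < k j)
    (hn : ∑ j ∈ J, k j = n) :
    cum (fun U => E (univMoment x k U)) J - cum (fun U => E' (univMoment x k U)) J =
      E (univMoment x k J) - E' (univMoment x k J) := by
  refine cum_sub_cum ?_ hJ fun U hU => h _ (wtLE_mono ?_ (univMoment_mem_wtLE x k U))
  · simpa [univMoment_empty] using hE
  · have := sum_lt_sum_of_ssubset hk hU
    rw [hn] at this
    push_cast [← Nat.cast_sum]
    omega

/-- The coefficient functional of a monomial. -/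
noncomputable def multCoeff (μ : Multiset ℕ+) : MvPolynomial ℕ+ ℝ →ₗ[ℝ] ℝ :=
  MvPolynomial.lcoeff ℝ (Multiset.toFinsupp μ)

theorem multCoeff_multMonomial (μ ν : Multiset ℕ+) :
    multCoeff μ (multMonomial ℝ ν) = if ν = μ then 1 else 0 := by
  classical
  rw [multCoeff, MvPolynomial.lcoeff_apply, ← monomial_toFinsupp, MvPolynomial.coeff_monomial]
  simp

theorem multCoeff_of_mem_wtLE {μ : Multiset ℕ+} {p : MvPolynomial ℕ+ ℝ}
    (hp : p ∈ wtLE ℝ ((multWeight μ : ℤ) - 1)) : multCoeff μ p = 0 := by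
  by_contra h
  have := hp _ h
  rw [expWeight_toFinsupp] at this
  omega

theorem multCoeff_one {μ : Multiset ℕ+} (hμ : μ ≠ 0) : multCoeff μ 1 = 0 := by
  have := multCoeff_multMonomial μ 0
  rw [if_neg (Ne.symm hμ)] at this
  simpa [multMonomial] using this

theorem multCoeff_zero_one : multCoeff 0 1 = 1 := by
  have := multCoeff_multMonomial 0 0
  rw [if_pos rfl] at this
  simpa [multMonomial] using this

theorem multCoeff_zero_prod_X (m : ℕ → ℕ+) {U : Finset ℕ} (hU : U.Nonempty) :
    multCoeff 0 (∏ j ∈ U, MvPolynomial.X (m j)) = 0 := by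
  have h : ∏ j ∈ U, (MvPolynomial.X (m j) : MvPolynomial ℕ+ ℝ) = multMonomial ℝ (U.val.map m) := by
    rw [multMonomial, Multiset.map_map]
    rfl
  rw [h, multCoeff_multMonomial, if_neg]
  rw [Multiset.map_eq_zero, Finset.val_eq_zero]
  exact hU.ne_empty

theorem kumM_multCoeff_zero {μ : Multiset ℕ+} (hμ : μ ≠ 0) :
    kumM (multCoeff 0) (μ.map MvPolynomial.X) = 0 := by
  rw [kumM_map_X multCoeff_zero_one hμ, kum, cum]
  refine Finset.sum_eq_zero fun π hπ => ?_
  have hne : (Finset.range (Multiset.card μ)).Nonempty := by simpa using hμ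
  obtain ⟨U, hU⟩ := Finset.card_pos.1 (card_pos_of_mem_setParts hπ hne)
  rw [Finset.prod_eq_zero hU, mul_zero]
  exact multCoeff_zero_prod_X _ (nonempty_of_mem_setParts hπ hU)

/-- The functional with the cumulants of weight `n` removed. -/
noncomputable def dropTop (E : MvPolynomial ℕ+ ℝ →ₗ[ℝ] ℝ) (n : ℕ) : MvPolynomial ℕ+ ℝ →ₗ[ℝ] ℝ :=
  E - ∑ μ : {μ : Multiset ℕ+ // multWeight μ = n},
    kumM E (μ.1.map MvPolynomial.X) • multCoeff μ.1

theorem dropTop_apply (p : MvPolynomial ℕ+ ℝ) : dropTop E n p =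
    E p - ∑ μ : {μ : Multiset ℕ+ // multWeight μ = n},
      kumM E (μ.1.map MvPolynomial.X) * multCoeff μ.1 p := by
  simp [dropTop]

theorem ne_zero_of_multWeight {μ : Multiset ℕ+} (h : multWeight μ = n) (hn : 0 < n) : μ ≠ 0 := by
  rintro rfl
  simp [multWeight] at h
  omega

theorem dropTop_of_mem_wtLE {p : MvPolynomial ℕ+ ℝ} (hp : p ∈ wtLE ℝ ((n : ℤ) - 1)) :
    dropTop E n p = E p := by
  rw [dropTop_apply, Finset.sum_eq_zero, sub_zero]
  intro μ _
  rw [multCoeff_of_mem_wtLE (by rwa [μ.2]), mul_zero]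

theorem dropTop_one (hE : E 1 = 1) (hn : 0 < n) : dropTop E n 1 = 1 := by
  rw [dropTop_of_mem_wtLE, hE]
  exact wtLE_mono (by omega) one_mem_wtLE

/-- Subtracting kumM E times the coefficient functional of a monomial of weight n affects only that
top moment, and a top cumulant depends on its moment with slope one. -/
theorem kumM_dropTop (hE : E 1 = 1) (hn : 0 < n) {μ : Multiset ℕ+} (hw : multWeight μ = n) :
    kumM (dropTop E n) (μ.map MvPolynomial.X) = 0 := by
  have hμ := ne_zero_of_multWeight hw hn
  have h := kumM_sub_kumM hE (dropTop_one hE hn) (fun p hp => (dropTop_of_mem_wtLE hp).symm) hμ hw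
  rw [dropTop_apply, Finset.sum_eq_single ⟨μ, hw⟩, multCoeff_multMonomial, if_pos rfl] at h
  · linarith
  · intro ν _ hne
    rw [multCoeff_multMonomial, if_neg, mul_zero]
    exact fun h => hne (Subtype.ext h.symm)
  · simp

end Perturbation

/-! ### Derivatives of the limiting means at β = 0. -/

section ConstantTerms

theorem twist_map_zero (n : ℕ) : (n.factorial : LaurentSeries ℝ) *
    laurentMap (MvPolynomial.aeval (0 : ℕ+ → ℝ) : MvPolynomial ℕ+ ℝ →ₐ[ℝ] ℝ).toRingHom
      (twist 0 1 (derivGen (varSeq ℝ)) n) = zInv ℝ ^ n := by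
  rw [laurentMap_twist]
  have hB : PowerSeries.map (MvPolynomial.aeval (0 : ℕ+ → ℝ) : MvPolynomial ℕ+ ℝ →ₐ[ℝ] ℝ).toRingHom
      (derivGen (varSeq ℝ)) = 0 := by
    ext j
    simp [derivGen, varSeq]
  rw [hB, map_zero, map_one]
  induction n with
  | zero => simp
  | succ n ih =>
    rw [Nat.factorial_succ, pow_succ, ← ih]
    push_cast
    have := twist_succ (0 : ℝ) 1 0 n
    simp only [map_zero, zero_mul, map_one, one_mul, zero_add, add_zero] at this
    linear_combination (n.factorial : LaurentSeries ℝ) * this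

theorem coeff_phiPow_zero (l : ℕ) (i : ℤ) :
    (l.factorial : ℝ) * MvPolynomial.aeval (0 : ℕ+ → ℝ) ((phiPow l l).coeff i) =
      ((1 + HahnSeries.single 1 1 : LaurentSeries ℝ) ^ l).coeff (i + l) := by
  have h1 := laurentMap_coeff (MvPolynomial.aeval (0 : ℕ+ → ℝ) : MvPolynomial ℕ+ ℝ →ₐ[ℝ] ℝ).toRingHom
    (phiPow l l) i
  have h2 : (MvPolynomial.aeval (0 : ℕ+ → ℝ) : MvPolynomial ℕ+ ℝ →ₐ[ℝ] ℝ).toRingHom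
      ((phiPow l l).coeff i) = MvPolynomial.aeval (0 : ℕ+ → ℝ) ((phiPow l l).coeff i) := rfl
  rw [← h2, ← h1, ← nsmul_eq_mul, ← Pi.smul_apply, ← HahnSeries.coeff_nsmul, nsmul_eq_mul, phiPow,
    map_mul, mul_left_comm, twist_map_zero, map_pow, map_add, map_one, laurentMap_single, map_one,
    mul_comm, coeff_zInv_pow_mul]

theorem coeff_one_add_single_pow_of_neg (l : ℕ) {i : ℤ} (hi : i < 0) :
    ((1 + HahnSeries.single 1 1 : LaurentSeries ℝ) ^ l).coeff i = 0 := by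
  have : (1 + HahnSeries.single 1 1 : LaurentSeries ℝ) ^ l =
      HahnSeries.ofPowerSeries ℤ ℝ ((1 + PowerSeries.X) ^ l) := by
    rw [map_pow, map_add, HahnSeries.ofPowerSeries_X, map_one (HahnSeries.ofPowerSeries ℤ ℝ)]
  rw [this, PowerSeries.coeff_coe, if_pos hi]

theorem coeff_one_add_single_pow_zero (l : ℕ) :
    ((1 + HahnSeries.single 1 1 : LaurentSeries ℝ) ^ l).coeff 0 = 1 := by
  have : (1 + HahnSeries.single 1 1 : LaurentSeries ℝ) ^ l =
      HahnSeries.ofPowerSeries ℤ ℝ ((1 + PowerSeries.X) ^ l) := by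
    rw [map_pow, map_add, HahnSeries.ofPowerSeries_X, map_one (HahnSeries.ofPowerSeries ℤ ℝ)]
  rw [this, PowerSeries.coeff_coe, if_neg (lt_irrefl _)]
  simp

/-- At β = 0 the series φ is 1/z, so only coefficients of (1+z)^l remain: zero for l < m, and the
constant term 1 for l = m. -/
theorem aeval_zero_pderiv_limitPart (m : ℕ+) (l : ℕ) : (l.factorial : ℝ) *
    MvPolynomial.aeval (0 : ℕ+ → ℝ) (MvPolynomial.pderiv m (limitPart l)) =
      m * ((1 + HahnSeries.single 1 1 : LaurentSeries ℝ) ^ l).coeff (-(m : ℕ) + l) := by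
  rw [pderiv_limitPart, map_mul, map_natCast, mul_left_comm, coeff_phiPow_zero]

theorem aeval_zero_pderiv_limitPart_of_lt {m : ℕ+} {l : ℕ} (h : l < m) :
    MvPolynomial.aeval (0 : ℕ+ → ℝ) (MvPolynomial.pderiv m (limitPart l)) = 0 := by
  have := aeval_zero_pderiv_limitPart m l
  rw [coeff_one_add_single_pow_of_neg _ (by omega), mul_zero] at this
  exact (mul_eq_zero.1 this).resolve_left (by positivity)

theorem aeval_zero_pderiv_limitPart_self (m : ℕ+) :
    MvPolynomial.aeval (0 : ℕ+ → ℝ) (MvPolynomial.pderiv m (limitPart m)) ≠ 0 := by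
  intro h
  have := aeval_zero_pderiv_limitPart m m
  rw [neg_add_cancel, coeff_one_add_single_pow_zero, h] at this
  have hm := m.pos
  simp at this
  have : (m : ℕ) = 0 := by exact_mod_cast this.symm
  omega

/-- In weight at most m the variable β_m occurs only as a monomial by itself, so along the axis of
β_m the polynomial is affine. -/
theorem aeval_single_sub {m : ℕ+} {p : MvPolynomial ℕ+ ℝ} (hp : p ∈ wtLE ℝ m) :
    MvPolynomial.aeval (Pi.single m 1 : ℕ+ → ℝ) p - MvPolynomial.aeval (0 : ℕ+ → ℝ) p =
      MvPolynomial.aeval (0 : ℕ+ → ℝ) (MvPolynomial.pderiv m p) := by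
  have key : ∀ μ : Multiset ℕ+, multWeight μ ≤ m →
      MvPolynomial.aeval (Pi.single m 1 : ℕ+ → ℝ) (multMonomial ℝ μ) -
        MvPolynomial.aeval (0 : ℕ+ → ℝ) (multMonomial ℝ μ) =
      MvPolynomial.aeval (0 : ℕ+ → ℝ) (MvPolynomial.pderiv m (multMonomial ℝ μ)) := by
    intro μ hμ
    by_cases hm : m ∈ μ
    · obtain ⟨ν, rfl⟩ := Multiset.exists_cons_of_mem hm
      rw [multWeight_cons] at hμ
      obtain rfl := multWeight_eq_zero (μ := ν) (by omega)
      simp [multMonomial]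
    · induction μ using Multiset.induction_on with
      | empty => simp [multMonomial]
      | cons j ν _ =>
        have hj : j ≠ m := fun h => hm (by simp [h])
        rw [multMonomial_cons, Derivation.leibniz, MvPolynomial.pderiv_X_of_ne hj]
        simp [hj]
  rw [p.as_sum]
  simp only [map_sum, ← Finset.sum_sub_distrib]
  refine Finset.sum_congr rfl fun d hd => ?_
  have h1 : MvPolynomial.monomial d (p.coeff d) =
      p.coeff d • multMonomial ℝ (Finsupp.toMultiset d) := by
    rw [← monomial_one_eq, MvPolynomial.smul_monomial, smul_eq_mul, mul_one]
  have h2 := key (Finsupp.toMultiset d) (by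
    rw [multWeight_toMultiset]
    exact_mod_cast hp d (MvPolynomial.mem_support_iff.1 hd))
  rw [h1, Derivation.map_smul, map_smul, map_smul, map_smul, ← smul_sub, h2]

theorem limitPart_mem_wtLE (l : ℕ) : limitPart l ∈ wtLE ℝ l := by
  have h := univCum_mem_wtLE (0 : ℝ) (fun _ => l) {0}
  rw [← insert_empty_eq, univCum_insert _ _ (by simp), expMoment_empty, mul_one, vres_apply,
    vkernel, PowerSeries.coeff_mk, map_zero, ← phiPow] at h
  rw [limitPart]
  simpa using h

end ConstantTerms

/-! ### Invertibility of the limiting dependence in a fixed weight. -/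

section TransferMatrix

/-- The indicator of a multiset. -/
def multIndicator (μ : Multiset ℕ+) (ν : Multiset ℕ+) : ℝ := if ν = μ then 1 else 0

theorem evalMean_multIndicator {μ : Multiset ℕ+} (hμ : Multiset.card μ ≠ 1) :
    evalMean (multIndicator μ) = evalMean 0 := by
  unfold evalMean
  congr 1
  funext m
  rw [multIndicator, if_neg]
  · rfl
  · rintro rfl
    simp at hμ

theorem evalMean_zero : evalMean 0 = MvPolynomial.aeval (0 : ℕ+ → ℝ) := rfl

theorem evalMean_multIndicator_singleton (m : ℕ+) :
    evalMean (multIndicator {m}) = MvPolynomial.aeval (Pi.single m 1 : ℕ+ → ℝ) := by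
  unfold evalMean
  congr 1
  funext j
  rw [multIndicator, Pi.single_apply]
  simp

/-- The limiting dependence of the binomial cumulant indexed by `κ` on the variable cumulant
indexed by `μ` of the same weight. -/
noncomputable def transferLimit (n : ℕ) (κ μ : Multiset ℕ+) : ℝ :=
  binomLimit (multIndicator μ) n (fun j => (multEnum κ j : ℕ)) (Finset.range (Multiset.card κ)) -
    binomLimit 0 n (fun j => (multEnum κ j : ℕ)) (Finset.range (Multiset.card κ))

variable {n : ℕ}

theorem multEnum_singleton (m : ℕ+) : multEnum {m} 0 = m := by simp [multEnum]

theorem transferLimit_singleton (m : ℕ+) (μ : Multiset ℕ+) : transferLimit n {m} μ =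
    evalMean (multIndicator μ) (limitPart m) - evalMean 0 (limitPart m) := by
  simp only [transferLimit, binomLimit, Multiset.card_singleton, Finset.range_one,
    slotLimit_singleton, multEnum_singleton, Finset.card_singleton]
  simp

theorem transferLimit_singleton_of_ne {m : ℕ+} {μ : Multiset ℕ+} (hμ : Multiset.card μ ≠ 1) :
    transferLimit n {m} μ = 0 := by
  rw [transferLimit_singleton, evalMean_multIndicator hμ, sub_self]

theorem transferLimit_singleton_self (m : ℕ+) : transferLimit n {m} {m} ≠ 0 := by
  rw [transferLimit_singleton, evalMean_multIndicator_singleton, evalMean_zero,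
    aeval_single_sub (by exact_mod_cast limitPart_mem_wtLE m)]
  exact aeval_zero_pderiv_limitPart_self m

theorem slotLimit_zero {J : Finset ℕ} (hJ : J.card ≠ 1) (x : ℕ → MvPolynomial ℕ+ ℝ) :
    slotLimit 0 n J x = 0 := by
  rw [slotLimit, if_neg hJ]
  simp

/-- A nonzero product of gradients at 0 forces m_j ≤ κ_j for every slot j; as κ and μ have the same
weight, this gives m = κ, and the indicator then requires μ = κ. -/
theorem transferLimit_of_card_ne_one {κ μ : Multiset ℕ+} (hκ : Multiset.card κ ≠ 1)
    (hμ : Multiset.card μ ≠ 1) (hκn : multWeight κ = n) (hμn : multWeight μ = n) :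
    transferLimit n κ μ = if κ = μ then ∏ j : Finset.range (Multiset.card κ),
      evalMean 0 (MvPolynomial.pderiv (multEnum κ j) (limitPart (multEnum κ j))) else 0 := by
  have hc : (Finset.range (Multiset.card κ)).card ≠ 1 := by simpa using hκ
  rw [transferLimit, binomLimit, binomLimit, slotLimit_zero hc, evalMean_multIndicator hμ, zero_add,
    add_sub_cancel_right, slotLimit, if_neg hc, evalMean_multIndicator hμ,
    Finset.sum_eq_single fun j : Finset.range (Multiset.card κ) => multEnum κ j]
  · have : Finset.univ.val.map (fun j : Finset.range (Multiset.card κ) => multEnum κ j) = κ := by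
      conv_rhs => rw [← map_multEnum κ]
      rw [← Multiset.attach_map_val' (Finset.range (Multiset.card κ)).val (multEnum κ)]
      rfl
    rw [this, multIndicator]
    split_ifs <;> simp
  · intro m _ hne
    by_cases h : Finset.univ.val.map m = μ
    swap
    · rw [multIndicator, if_neg h, mul_zero]
    have hsum : ∑ j : Finset.range (Multiset.card κ), (m j : ℕ) =
        ∑ j : Finset.range (Multiset.card κ), (multEnum κ j : ℕ) := by
      rw [Finset.sum_coe_sort (Finset.range (Multiset.card κ)) (fun j => (multEnum κ j : ℕ)),
        sum_multEnum, hκn, ← hμn, ← h, multWeight, Multiset.map_map]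
      rfl
    obtain ⟨j, hj⟩ : ∃ j : Finset.range (Multiset.card κ), (multEnum κ j : ℕ) < m j := by
      by_contra hcon
      push Not at hcon
      refine hne (funext fun j => PNat.coe_injective ?_)
      exact (Finset.sum_eq_sum_iff_of_le fun j _ => hcon j).1 hsum j (Finset.mem_univ j)
    rw [Finset.prod_eq_zero (Finset.mem_univ j), zero_mul]
    exact aeval_zero_pderiv_limitPart_of_lt hj
  · intro h
    refine absurd ?_ h
    rw [Fintype.mem_piFinset]
    intro j
    refine Finset.mem_Icc.2 ⟨one_le, ?_⟩
    have h1 := Finset.single_le_sum (f := fun j => (multEnum κ j : ℕ)) (fun _ _ => Nat.zero_le _) j.2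
    rw [sum_multEnum, hκn] at h1
    rw [← PNat.coe_le_coe, Nat.succPNat_coe]
    exact Nat.le_succ_of_le h1

theorem transferLimit_self_ne_zero {κ : Multiset ℕ+} (hκ : Multiset.card κ ≠ 1)
    (hκn : multWeight κ = n) : transferLimit n κ κ ≠ 0 := by
  rw [transferLimit_of_card_ne_one hκ hκ hκn hκn, if_pos rfl]
  exact Finset.prod_ne_zero_iff.2 fun j _ => aeval_zero_pderiv_limitPart_self _

theorem transferLimit_of_three_le {κ μ : Multiset ℕ+} (hκ : 3 ≤ Multiset.card κ)
    (hμ : Multiset.card μ = 1) : transferLimit n κ μ = 0 := by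
  have hc : (Finset.range (Multiset.card κ)).card ≠ 1 := by simp; omega
  have hc2 : (Finset.range (Multiset.card κ)).card ≠ 2 := by simp; omega
  rw [transferLimit, binomLimit, binomLimit, slotLimit_zero hc, if_neg hc2, if_neg hc2, slotLimit,
    if_neg hc, add_zero, add_zero, sub_zero]
  refine Finset.sum_eq_zero fun m _ => ?_
  rw [multIndicator, if_neg, mul_zero]
  rintro rfl
  rw [Multiset.card_map, Finset.card_val, Finset.card_univ, Fintype.card_coe, Finset.card_range] at hμ
  omega

/-- The singleton row is zero off its diagonal, and the rows and columns of other cardinality form a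
diagonal block. A kernel vector therefore vanishes first at the singleton and then everywhere; the
singleton column may still meet rows of cardinality two. -/
theorem det_transferLimit_ne_zero (n : ℕ) :
    (Matrix.of fun κ μ : {μ : Multiset ℕ+ // multWeight μ = n} =>
      transferLimit n κ.1 μ.1).det ≠ 0 := by
  intro h
  obtain ⟨v, hv, hL⟩ := Matrix.exists_mulVec_eq_zero_iff.2 h
  have hrow : ∀ κ : {μ : Multiset ℕ+ // multWeight μ = n},
      ∑ μ : {μ : Multiset ℕ+ // multWeight μ = n}, transferLimit n κ.1 μ.1 * v μ = 0 := fun κ => congrFun hL κ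
  have h1 : ∀ κ : {μ : Multiset ℕ+ // multWeight μ = n}, Multiset.card κ.1 = 1 → v κ = 0 := by
    intro κ hκ
    obtain ⟨m, hm⟩ := Multiset.card_eq_one.1 hκ
    have h2 := hrow κ
    rw [Finset.sum_eq_single κ] at h2
    · rw [hm] at h2
      exact (mul_eq_zero.1 h2).resolve_left (transferLimit_singleton_self m)
    · intro μ _ hne
      have hc : Multiset.card μ.1 ≠ 1 := by
        intro hc
        obtain ⟨m', hm'⟩ := Multiset.card_eq_one.1 hc
        have e1 := κ.2
        have e2 := μ.2
        rw [hm] at e1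
        rw [hm'] at e2
        simp only [multWeight, Multiset.map_singleton, Multiset.sum_singleton] at e1 e2
        exact hne (Subtype.ext (by rw [hm, hm', PNat.coe_injective (e2.trans e1.symm)]))
      rw [hm, transferLimit_singleton_of_ne hc, zero_mul]
    · simp
  refine hv (funext fun κ => ?_)
  by_cases hκ : Multiset.card κ.1 = 1
  · exact h1 κ hκ
  have h2 := hrow κ
  rw [Finset.sum_eq_single κ] at h2
  · exact (mul_eq_zero.1 h2).resolve_left (transferLimit_self_ne_zero hκ κ.2)
  · intro μ _ hne
    by_cases hμ : Multiset.card μ.1 = 1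
    · rw [h1 μ hμ, mul_zero]
    · rw [transferLimit_of_card_ne_one hκ hμ κ.2 μ.2, if_neg, zero_mul]
      exact fun h => hne (Subtype.ext h.symm)
  · simp

end TransferMatrix

/-! ### Recovering the cumulants of the β_m from those of the binomial sums. -/

section Inversion

/-- The joint cumulant of the normalized binomial sums indexed by a multiset. -/
noncomputable def binomCum (E : MvPolynomial ℕ+ ℝ →ₗ[ℝ] ℝ) (x : ℝ) (κ : Multiset ℕ+) : ℝ :=
  cum (fun U => E (univMoment x (fun j => (multEnum κ j : ℕ)) U)) (Finset.range (Multiset.card κ))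

/-- The joint moment of the normalized binomial sums indexed by a multiset. -/
noncomputable def binomMoment (x : ℝ) (κ : Multiset ℕ+) : MvPolynomial ℕ+ ℝ :=
  univMoment x (fun j => (multEnum κ j : ℕ)) (Finset.range (Multiset.card κ))

variable {n : ℕ}

theorem binomCum_sub {E E' : MvPolynomial ℕ+ ℝ →ₗ[ℝ] ℝ} (hE : E 1 = 1)
    (h : ∀ p ∈ wtLE ℝ ((n : ℤ) - 1), E p = E' p) (x : ℝ) {κ : Multiset ℕ+} (hκ : κ ≠ 0)
    (hw : multWeight κ = n) :
    binomCum E x κ - binomCum E' x κ = E (binomMoment x κ) - E' (binomMoment x κ) :=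
  cum_univMoment_sub hE h x (by simpa using hκ) (fun j _ => (multEnum κ j).pos)
    (by rw [sum_multEnum, hw])

theorem cumTendsto_multCoeff_zero (n : ℕ) : CumTendsto (fun _ => multCoeff 0) n 0 := by
  intro μ hμ _
  simp only [kumM_multCoeff_zero hμ, mul_zero]
  exact tendsto_const_nhds

/-- A functional whose only nonzero cumulant of weight at most that of `μ` is the one of `μ`. -/
noncomputable def probeFunctional (μ : Multiset ℕ+) (N : ℕ) : MvPolynomial ℕ+ ℝ →ₗ[ℝ] ℝ :=
  multCoeff 0 + (N : ℝ)⁻¹ ^ scaleExp (Multiset.card μ) • multCoeff μ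

theorem probeFunctional_one {μ : Multiset ℕ+} (hμ : μ ≠ 0) (N : ℕ) : probeFunctional μ N 1 = 1 := by
  simp [probeFunctional, multCoeff_zero_one, multCoeff_one hμ]

theorem probeFunctional_of_mem_wtLE {μ : Multiset ℕ+} (N : ℕ) {p : MvPolynomial ℕ+ ℝ}
    (hp : p ∈ wtLE ℝ ((multWeight μ : ℤ) - 1)) : probeFunctional μ N p = multCoeff 0 p := by
  simp [probeFunctional, multCoeff_of_mem_wtLE hp]

theorem tendsto_pow_mul_inv_pow_self (e : ℕ) :
    Tendsto (fun N : ℕ => (N : ℝ) ^ e * (N : ℝ)⁻¹ ^ e) atTop (𝓝 1) := by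
  have := tendsto_pow_mul_inv_pow (u := fun _ => 1) (a := e) (b := e) (c := 0) (L := 1) rfl (by simp)
  simpa using this

/-- The probe differs from evaluation at β = 0 by one rescaled monomial coefficient in weight n, so
precisely one limiting cumulant is nonzero. -/
theorem cumTendsto_probeFunctional {μ : Multiset ℕ+} (hμ : μ ≠ 0) (hw : multWeight μ = n) :
    CumTendsto (probeFunctional μ) n (multIndicator μ) := by
  intro ν hν hνn
  have hagree : ∀ N, ∀ p ∈ wtLE ℝ ((n : ℤ) - 1), probeFunctional μ N p = multCoeff 0 p :=
    fun N p hp => probeFunctional_of_mem_wtLE N (by rwa [hw])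
  rcases hνn.lt_or_eq with hlt | heq
  · have h1 : ν ≠ μ := by
      rintro rfl
      omega
    simp only [fun N => kumM_eq_of_lt (probeFunctional_one hμ N) multCoeff_zero_one (hagree N) hν hlt,
      kumM_multCoeff_zero hν, mul_zero, multIndicator, if_neg h1]
    exact tendsto_const_nhds
  · have h2 : ∀ N, kumM (probeFunctional μ N) (ν.map MvPolynomial.X) =
        (N : ℝ)⁻¹ ^ scaleExp (Multiset.card μ) * if ν = μ then 1 else 0 := by
      intro N
      have := kumM_sub_kumM (probeFunctional_one hμ N) multCoeff_zero_one (hagree N) hν heq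
      rw [kumM_multCoeff_zero hν, sub_zero] at this
      rw [this]
      simp [probeFunctional, multCoeff_multMonomial]
    simp only [h2, multIndicator]
    split_ifs with h3
    · subst h3
      simpa using tendsto_pow_mul_inv_pow_self (scaleExp (Multiset.card ν))
    · simp

/-- The matrix entry is the difference of the responses to the probe and to evaluation at β = 0, and
the forward limit theorem applies to both. -/
theorem tendsto_transferLimit {κ μ : Multiset ℕ+} (hn : 0 < n) (hκ : multWeight κ = n)
    (hμ : multWeight μ = n) :
    Tendsto (fun N : ℕ => (N : ℝ) ^ scaleExp (Multiset.card κ) *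
      ((N : ℝ)⁻¹ ^ scaleExp (Multiset.card μ) * multCoeff μ (binomMoment (N : ℝ)⁻¹ κ))) atTop
      (𝓝 (transferLimit n κ μ)) := by
  have hκ0 := ne_zero_of_multWeight hκ hn
  have hμ0 := ne_zero_of_multWeight hμ hn
  have hne : (Finset.range (Multiset.card κ)).Nonempty := by simpa using hκ0
  have hsum : ∑ j ∈ Finset.range (Multiset.card κ), (multEnum κ j : ℕ) ≤ n := by
    rw [sum_multEnum, hκ]
  have h1 := (cumTendsto_probeFunctional hμ0 hμ).binom (probeFunctional_one hμ0) _ hne hsum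
  have h2 := (cumTendsto_multCoeff_zero n).binom (fun _ => multCoeff_zero_one) _ hne hsum
  refine (h1.sub h2).congr fun N => ?_
  rw [← mul_sub, Finset.card_range]
  congr 1
  have h3 := binomCum_sub (n := n) (probeFunctional_one hμ0 N) (E' := multCoeff 0)
    (fun p hp => probeFunctional_of_mem_wtLE N (by rwa [hμ])) (N : ℝ)⁻¹ hκ0 hκ
  refine h3.trans ?_
  simp [probeFunctional]

variable {F : ℕ → MvPolynomial ℕ+ ℝ →ₗ[ℝ] ℝ}

theorem cumTendsto_dropTop (hF : ∀ N, F N 1 = 1) (hn : 0 < n) {γ : Multiset ℕ+ → ℝ}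
    (h : CumTendsto F (n - 1) γ) :
    CumTendsto (fun N => dropTop (F N) n) n (fun μ => if multWeight μ < n then γ μ else 0) := by
  intro μ hμ hw
  rcases hw.lt_or_eq with hlt | heq
  · simp only [if_pos hlt, fun N => kumM_eq_of_lt (dropTop_one (hF N) hn) (hF N)
      (fun p hp => dropTop_of_mem_wtLE hp) hμ hlt]
    exact h μ hμ (by omega)
  · simp only [if_neg heq.not_lt, fun N => kumM_dropTop (hF N) hn heq, mul_zero]
    exact tendsto_const_nhds

theorem binomLimit_of_three_le {γ : Multiset ℕ+ → ℝ} (k : ℕ → ℕ) {J : Finset ℕ} (hJ : 3 ≤ J.card)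
    (hγ : ∀ μ, 3 ≤ Multiset.card μ → γ μ = 0) : binomLimit γ n k J = 0 := by
  rw [binomLimit, if_neg (by omega), slotLimit, if_neg (by omega), add_zero]
  refine Finset.sum_eq_zero fun m _ => ?_
  rw [hγ, mul_zero]
  rwa [Multiset.card_map, Finset.card_val, Finset.card_univ, Fintype.card_coe]

/-- Subtracting the binomial cumulants of `dropTop`, whose limits are governed by lower weights,
leaves an expression linear in the β-cumulants of weight n. Its coefficient matrix converges to an
invertible matrix, so the rescaled cumulants converge. -/
theorem exists_cum_limit_of_binomCum (hF : ∀ N, F N 1 = 1) (hn : 0 < n) {γ : Multiset ℕ+ → ℝ}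
    (h : CumTendsto F (n - 1) γ) (hγ : ∀ μ, multWeight μ < n → 3 ≤ Multiset.card μ → γ μ = 0)
    {y : Multiset ℕ+ → ℝ} (hy3 : ∀ κ, 3 ≤ Multiset.card κ → y κ = 0)
    (hy : ∀ κ : Multiset ℕ+, κ ≠ 0 → Tendsto (fun N : ℕ => (N : ℝ) ^ scaleExp (Multiset.card κ) *
      binomCum (F N) (N : ℝ)⁻¹ κ) atTop (𝓝 (y κ))) :
    ∀ μ : Multiset ℕ+, multWeight μ = n → ∃ L : ℝ, Tendsto (fun N : ℕ =>
      (N : ℝ) ^ scaleExp (Multiset.card μ) * kumM (F N) (μ.map MvPolynomial.X)) atTop (𝓝 L) ∧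
        (3 ≤ Multiset.card μ → L = 0) := by
  set γ₀ : Multiset ℕ+ → ℝ := fun μ => if multWeight μ < n then γ μ else 0 with hγ₀
  have hdrop := cumTendsto_dropTop hF hn h
  set b : {μ : Multiset ℕ+ // multWeight μ = n} → ℝ := fun κ => y κ.1 -
    binomLimit γ₀ n (fun j => (multEnum κ.1 j : ℕ)) (Finset.range (Multiset.card κ.1)) with hb
  obtain ⟨β, hβ, hlim⟩ := tendsto_of_mulVec
    (L := fun N : ℕ => Matrix.of fun κ μ : {μ : Multiset ℕ+ // multWeight μ = n} =>
      (N : ℝ) ^ scaleExp (Multiset.card κ.1) * ((N : ℝ)⁻¹ ^ scaleExp (Multiset.card μ.1) *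
        multCoeff μ.1 (binomMoment (N : ℝ)⁻¹ κ.1)))
    (L' := Matrix.of fun κ μ : {μ : Multiset ℕ+ // multWeight μ = n} => transferLimit n κ.1 μ.1)
    (fun κ μ => tendsto_transferLimit hn κ.2 μ.2) (det_transferLimit_ne_zero n)
    (α := fun N μ => (N : ℝ) ^ scaleExp (Multiset.card μ.1) *
      kumM (F N) (μ.1.map MvPolynomial.X)) (b := b) (by
    intro κ
    have hκ0 := ne_zero_of_multWeight κ.2 hn
    have h1 := hy κ.1 hκ0
    have h2 := hdrop.binom (fun N => dropTop_one (hF N) hn) (fun j => (multEnum κ.1 j : ℕ))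
      (J := Finset.range (Multiset.card κ.1)) (by simpa using hκ0) (by rw [sum_multEnum, κ.2])
    refine (h1.sub h2).congr' ?_
    filter_upwards [eventually_ne_atTop 0] with N hN
    have hN' : (N : ℝ) ≠ 0 := by exact_mod_cast hN
    have h3 := binomCum_sub (n := n) (hF N) (E' := dropTop (F N) n)
      (fun p hp => (dropTop_of_mem_wtLE hp).symm) (N : ℝ)⁻¹ hκ0 κ.2
    rw [dropTop_apply, sub_sub_cancel] at h3
    rw [Finset.card_range, ← mul_sub]
    refine (congrArg (fun t => (N : ℝ) ^ scaleExp (Multiset.card κ.1) * t) h3).trans ?_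
    simp only [Matrix.mulVec, dotProduct, Matrix.of_apply]
    rw [Finset.mul_sum]
    refine Finset.sum_congr rfl fun μ _ => ?_
    have h4 : (N : ℝ)⁻¹ ^ scaleExp (Multiset.card μ.1) * (N : ℝ) ^ scaleExp (Multiset.card μ.1) = 1 := by
      rw [← mul_pow, inv_mul_cancel₀ hN', one_pow]
    linear_combination (-(N : ℝ) ^ scaleExp (Multiset.card κ.1) *
      kumM (F N) (μ.1.map MvPolynomial.X) * multCoeff μ.1 (binomMoment (N : ℝ)⁻¹ κ.1)) * h4)
  intro μ hμ
  refine ⟨β ⟨μ, hμ⟩, hlim ⟨μ, hμ⟩, fun h3 => ?_⟩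
  have h4 := congrFun hβ ⟨μ, hμ⟩
  simp only [Matrix.mulVec, dotProduct, Matrix.of_apply] at h4
  -- For at least three variables the row of μ in the limiting system is diagonal and its right-hand
  -- side is zero.
  rw [Finset.sum_eq_single ⟨μ, hμ⟩, hb] at h4
  · simp only [hy3 μ h3] at h4
    rw [binomLimit_of_three_le _ (by simpa using h3), sub_zero] at h4
    · exact (mul_eq_zero.1 h4).resolve_left (transferLimit_self_ne_zero (by omega) hμ)
    · intro ν hν
      simp only [hγ₀]
      split_ifs with hlt
      · exact hγ ν hlt hν
      · rfl
  · intro ν _ hne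
    by_cases hν : Multiset.card ν.1 = 1
    · rw [transferLimit_of_three_le h3 hν, zero_mul]
    · rw [transferLimit_of_card_ne_one (by omega) hν hμ ν.2, if_neg, zero_mul]
      exact fun h => hne (Subtype.ext h.symm)
  · simp

/-- The limit of a scaled joint cumulant of variables. -/
noncomputable def cumLim (F : ℕ → MvPolynomial ℕ+ ℝ →ₗ[ℝ] ℝ) (μ : Multiset ℕ+) : ℝ :=
  limUnder atTop fun N : ℕ => (N : ℝ) ^ scaleExp (Multiset.card μ) *
    kumM (F N) (μ.map MvPolynomial.X)

/-- The limits of the joint cumulants of the binomial sums determine those of the variables. -/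
theorem cumTendsto_of_binomCum (hF : ∀ N, F N 1 = 1)
    {y : Multiset ℕ+ → ℝ} (hy3 : ∀ κ, 3 ≤ Multiset.card κ → y κ = 0)
    (hy : ∀ κ : Multiset ℕ+, κ ≠ 0 → Tendsto (fun N : ℕ => (N : ℝ) ^ scaleExp (Multiset.card κ) *
      binomCum (F N) (N : ℝ)⁻¹ κ) atTop (𝓝 (y κ))) (n : ℕ) :
    CumTendsto F n (cumLim F) ∧
      ∀ μ, multWeight μ ≤ n → 3 ≤ Multiset.card μ → cumLim F μ = 0 := by
  induction n with
  | zero =>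
    refine ⟨fun μ hμ hw => absurd (multWeight_eq_zero (by omega)) hμ, fun μ hw h3 => ?_⟩
    rw [multWeight_eq_zero (μ := μ) (by omega)] at h3
    simp at h3
  | succ n ih =>
    have key := exists_cum_limit_of_binomCum (n := n + 1) hF (by omega) ih.1
      (fun μ hμ => ih.2 μ (by omega)) hy3 hy
    refine ⟨fun μ hμ hw => ?_, fun μ hw h3 => ?_⟩
    · rcases hw.lt_or_eq with hlt | heq
      · exact ih.1 μ hμ (by omega)
      · obtain ⟨L, hL, -⟩ := key μ heq
        rwa [cumLim, hL.limUnder_eq]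
    · rcases hw.lt_or_eq with hlt | heq
      · exact ih.2 μ (by omega) h3
      · obtain ⟨L, hL, h0⟩ := key μ heq
        rw [cumLim, hL.limUnder_eq, h0 h3]

end Inversion

/-! ### Log-derivatives as sums over one-coloured set partitions. -/

section ColouredBlocks

variable {N : ℕ} {R : Type*} [CommRing R] [Algebra ℚ R]

/-- The contribution `|B|! b_{|B|}` of a one-coloured block. -/
def blockVar {κ : Type*} [DecidableEq κ] (col : ℕ → κ) (b : ℕ → R) (B : Finset ℕ) : R :=
  if ∀ p ∈ B, ∀ q ∈ B, col p = col q then (B.card.factorial : R) * b B.card else 0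

/-- The exponential formula, one colour at a time. With pivot p only blocks inside the colour class
of p contribute; counting them by size reproduces the recursion for n e_n, and the other colours
factor out. -/
theorem expMoment_blockVar (col : ℕ → Fin N) (b : ℕ → R) (U : Finset ℕ) :
    expMoment (blockVar col b) U =
      ∏ i, ((colourCount col U i).factorial : R) * expSeq b (colourCount col U i) := by
  induction U using Finset.strongInduction with
  | H U ih =>
  rcases U.eq_empty_or_nonempty with rfl | ⟨p, hp⟩
  · simp [colourCount_empty]
  set c := col p with hc
  set V := U.filter (fun q => col q = c) with hV
  have hVU : V ⊆ U := Finset.filter_subset _ _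
  have hpV : p ∈ V := Finset.mem_filter.2 ⟨hp, rfl⟩
  obtain ⟨n, hn⟩ : ∃ n, V.card = n + 1 :=
    ⟨V.card - 1, by have := Finset.card_pos.2 ⟨p, hpV⟩; omega⟩
  set P : R := ∏ i ∈ Finset.univ.erase c,
    ((colourCount col U i).factorial : R) * expSeq b (colourCount col U i) with hP
  have hcU : colourCount col U c = n + 1 := hn
  have hterm : ∀ B ∈ (V.erase p).powerset, blockVar col b (insert p B) * expMoment (blockVar col b)
      (U \ insert p B) = ((B.card + 1).factorial : R) * b (B.card + 1) *
        (((n - B.card).factorial : R) * expSeq b (n - B.card)) * P := by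
    intro B hB
    rw [Finset.mem_powerset] at hB
    have hpB : p ∉ B := fun h => Finset.notMem_erase p V (hB h)
    have hBV : insert p B ⊆ V :=
      Finset.insert_subset hpV (hB.trans (Finset.erase_subset _ _))
    have hcol : ∀ q ∈ insert p B, col q = c := fun q hq => (Finset.mem_filter.1 (hBV hq)).2
    rw [ih _ (Finset.sdiff_ssubset (hBV.trans hVU) ⟨p, by simp⟩), blockVar,
      if_pos fun q hq r hr => (hcol q hq).trans (hcol r hr).symm, Finset.card_insert_of_notMem hpB,
      ← Finset.mul_prod_erase _ _ (Finset.mem_univ c)]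
    have h1 : colourCount col (U \ insert p B) c = n - B.card := by
      have : (U \ insert p B).filter (fun q => col q = c) = V \ insert p B := by
        ext q; simp only [Finset.mem_filter, Finset.mem_sdiff, hV]; tauto
      rw [colourCount, this, Finset.card_sdiff_of_subset hBV, Finset.card_insert_of_notMem hpB, hn]
      omega
    have h2 : ∀ i ∈ Finset.univ.erase c, colourCount col (U \ insert p B) i = colourCount col U i := by
      intro i hi
      have hic := (Finset.mem_erase.1 hi).1
      have : (U \ insert p B).filter (fun q => col q = i) = U.filter (fun q => col q = i) := by
        ext q
        simp only [Finset.mem_filter, Finset.mem_sdiff]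
        refine ⟨fun h => ⟨h.1.1, h.2⟩, fun h => ⟨⟨h.1, fun hq => hic ?_⟩, h.2⟩⟩
        rw [← h.2, hcol q hq]
      rw [colourCount, this, colourCount]
    rw [h1, Finset.prod_congr rfl fun i hi => by rw [h2 i hi], ← hP]
    ring
  have hsub : (V.powerset.filter (p ∈ ·)) ⊆ U.powerset.filter (p ∈ ·) :=
    Finset.filter_subset_filter _ (Finset.powerset_mono.2 hVU)
  rw [expMoment_rec _ hp, ← Finset.sum_subset hsub, sum_powerset_filter_mem hpV,
    Finset.sum_congr rfl hterm]
  · rw [Finset.sum_powerset_apply_card (fun s => ((s + 1).factorial : R) * b (s + 1) *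
      (((n - s).factorial : R) * expSeq b (n - s)) * P), Finset.card_erase_of_mem hpV, hn,
      Nat.add_sub_cancel, ← Finset.mul_prod_erase _ _ (Finset.mem_univ c), ← hP, hcU]
    have hs : ∀ s ∈ Finset.range (n + 1), n.choose s • (((s + 1).factorial : R) * b (s + 1) *
        (((n - s).factorial : R) * expSeq b (n - s)) * P) =
        (n.factorial : R) * P * ((s + 1 : R) * b (s + 1) * expSeq b (n - s)) := by
      intro s hs
      have h3 := Nat.choose_mul_factorial_mul_factorial (Nat.lt_succ_iff.1 (Finset.mem_range.1 hs))
      have h4 : (n.choose s : R) * s.factorial * (n - s).factorial = n.factorial := by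
        exact_mod_cast congrArg (Nat.cast : ℕ → R) h3
      rw [nsmul_eq_mul, Nat.factorial_succ, ← h4]
      push_cast
      ring
    rw [Finset.sum_congr rfl hs, ← Finset.mul_sum, ← expSeq_succ, Nat.factorial_succ]
    push_cast
    ring
  · intro B hB hB'
    simp only [Finset.mem_filter, Finset.mem_powerset] at hB hB'
    rw [blockVar, if_neg, zero_mul]
    intro h
    refine hB' ⟨fun q hq => Finset.mem_filter.2 ⟨hB.1 hq, h q hq p hB.2⟩, hB.2⟩

theorem kum_eq_zero_of_mem {ι A : Type*} [DecidableEq ι] [CommRing A] [Algebra ℝ A]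
    {E : A →ₗ[ℝ] ℝ} (hE : E 1 = 1) (x : ι → A) {I : Finset ι} {i : ι} (hi : i ∈ I) (hx : x i = 0) :
    kum E x I = 0 := by
  have := kum_update_zero hE x hi
  rwa [← hx, Function.update_eq_self] at this

/-- The partitions of `{0, …, n - 1}` into one-coloured blocks. -/
def monoParts (col : ℕ → ℕ) (n : ℕ) : Finset (Finset (Finset ℕ)) :=
  (setParts (Finset.range n)).filter fun π => ∀ B ∈ π, ∀ p ∈ B, ∀ q ∈ B, col p = col q

/-- The multiset of the block sizes. -/
def blockSizes (π : Finset (Finset ℕ)) : Multiset ℕ+ := π.val.map fun B => B.card.toPNat'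

/-- The product of the factorials of the block sizes. -/
def blockWeight (π : Finset (Finset ℕ)) : ℝ := ∏ B ∈ π, (B.card.factorial : ℝ)

/-- The moments in the cumulant expression for the log-derivative are E of sums over one-coloured
partitions, so total cumulance applies. Its conditional cumulant of a block is |B|! N β_|B|, or zero
if the block has two colours. -/
theorem IsSmooth.logDerivAtOne_colourList {τ : PMF (GT N)} (h : IsSmooth τ) (col : ℕ → Fin N)
    (n : ℕ) : logDerivAtOne τ (colourList col (n + 1)) =
      ((∑ π ∈ monoParts (fun j => col j) (n + 1), blockWeight π * (N : ℝ) ^ π.card *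
        kumM (measFunctional τ) ((blockSizes π).map MvPolynomial.X) : ℝ) : ℂ) := by
  rw [h.logDerivAtOne_eq]
  congr 1
  have hE := h.measFunctional_one
  have h1 : (fun U => (∏ i, ((colourCount col U i).factorial : ℝ)) *
      measFunctional τ (prodExp fun i => (colourCount col U i : ℤ))) =
      fun U => (measFunctional τ).toAddMonoidHom (expMoment (blockVar col (scaledVar N)) U) := by
    funext U
    rw [expMoment_blockVar, Finset.prod_mul_distrib]
    have h2 : (∏ i, ((colourCount col U i).factorial : MvPolynomial ℕ+ ℝ)) =
        MvPolynomial.C (∏ i, ((colourCount col U i).factorial : ℝ)) := by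
      rw [map_prod]
      simp
    have h3 : ∏ i, expSeq (scaledVar N) (colourCount col U i) =
        prodExp fun i => (colourCount col U i : ℤ) := by
      simp [prodExp]
    rw [h2, h3, ← MvPolynomial.smul_eq_C_mul]
    change _ = measFunctional τ _
    rw [map_smul, smul_eq_mul]
  rw [h1, cum_total _ hE _ (by simp), monoParts, Finset.sum_filter]
  refine Finset.sum_congr rfl fun π hπ => ?_
  change kum (measFunctional τ) (blockVar col (scaledVar N)) π = _
  split_ifs with hm
  · have h2 : ∀ B ∈ π, blockVar col (scaledVar N) B =
        ((B.card.factorial : ℝ) * N) • MvPolynomial.X B.card.toPNat' := by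
      intro B hB
      have hc : (B.card.toPNat' : ℕ) = B.card := by
        rw [Nat.toPNat'_coe, if_pos (Finset.card_pos.2 (nonempty_of_mem_setParts hπ hB))]
      rw [blockVar, if_pos fun p hp q hq => Fin.ext (hm B hB p hp q hq), scaledVar, ← hc, varSeq_coe,
        hc, mul_smul, ← nsmul_eq_mul, ← Nat.cast_smul_eq_nsmul ℝ]
    rw [kum_congr h2, kum_smul, Finset.prod_mul_distrib, Finset.prod_const, blockWeight,
      kum_eq_kumM hE _ (Finset.card_pos.1 (card_pos_of_mem_setParts hπ (by simp))), blockSizes,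
      Multiset.map_map]
    rfl
  · push Not at hm
    obtain ⟨B, hB, p, hp, q, hq, hne⟩ := hm
    refine kum_eq_zero_of_mem hE _ hB ?_
    rw [blockVar, if_neg]
    exact fun hh => hne (congrArg Fin.val (hh p hp q hq))

end ColouredBlocks

/-! ### One-coloured partitions for a given list of differentiations. -/

section ListColours

/-- The colouring of positions, counted from the end, by the entries of a list. -/
def listCol (L : List ℕ) (j : ℕ) : ℕ := L.reverse.getD j 0

/-- The head of a colour list is its highest position, which is why `listCol` reads the list
backwards. -/
theorem colourList_length {N : ℕ} (col : ℕ → Fin N) (L : List ℕ)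
    (h : ∀ j < L.length, (col j : ℕ) = listCol L j) : colourList col L.length = L := by
  induction L with
  | nil => rfl
  | cons a l ih =>
    rw [List.length_cons, colourList, ih, h l.length (by simp)]
    · simp [listCol]
    · intro j hj
      rw [h j (by simp; omega), listCol, listCol, List.reverse_cons, List.getD_append]
      simpa using hj

theorem map_listCol (L : List ℕ) : (Finset.range L.length).val.map (listCol L) = (L : Multiset ℕ) := by
  rw [← Multiset.coe_reverse, Finset.range_val, ← Multiset.coe_range, Multiset.map_coe]
  congr 1
  apply List.ext_getElem
  · simp
  · intro n h1 h2
    rw [List.getElem_map, List.getElem_range, listCol, List.getD_eq_getElem]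

theorem image_listCol (L : List ℕ) : (Finset.range L.length).image (listCol L) = L.toFinset := by
  rw [Finset.image, map_listCol]
  rfl

theorem card_filter_listCol (L : List ℕ) (c : ℕ) :
    ((Finset.range L.length).filter fun j => listCol L j = c).card = L.count c := by
  rw [← Multiset.coe_count, ← map_listCol, Multiset.count_map, Finset.card_def, Finset.filter_val]
  congr 1
  exact Multiset.filter_congr fun j _ => eq_comm

/-- The positions of a colour. -/
def colourClass (L : List ℕ) (c : ℕ) : Finset ℕ :=
  (Finset.range L.length).filter fun j => listCol L j = c

/-- The partition of the positions into colour classes. -/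
def colourPart (L : List ℕ) : Finset (Finset ℕ) := L.toFinset.image (colourClass L)

theorem exists_of_mem_toFinset {L : List ℕ} {c : ℕ} (hc : c ∈ L.toFinset) :
    ∃ j ∈ Finset.range L.length, listCol L j = c := by
  rwa [← image_listCol, Finset.mem_image] at hc

theorem listCol_mem_toFinset {L : List ℕ} {j : ℕ} (hj : j ∈ Finset.range L.length) :
    listCol L j ∈ L.toFinset := by
  rw [← image_listCol]
  exact Finset.mem_image_of_mem _ hj

theorem injOn_colourClass (L : List ℕ) : Set.InjOn (colourClass L) L.toFinset := by
  intro c hc c' _ h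
  obtain ⟨j, hj, hjc⟩ := exists_of_mem_toFinset hc
  have : j ∈ colourClass L c' := h ▸ Finset.mem_filter.2 ⟨hj, hjc⟩
  rw [← hjc, (Finset.mem_filter.1 this).2]

theorem card_colourPart (L : List ℕ) : (colourPart L).card = L.toFinset.card :=
  Finset.card_image_of_injOn (injOn_colourClass L)

theorem blockSizes_colourPart (L : List ℕ) :
    blockSizes (colourPart L) = L.toFinset.val.map fun c => (L.count c).toPNat' := by
  rw [blockSizes, colourPart, Finset.image_val_of_injOn (injOn_colourClass L), Multiset.map_map]
  refine Multiset.map_congr rfl fun c _ => ?_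
  rw [Function.comp_apply, colourClass, card_filter_listCol]

theorem blockWeight_colourPart (L : List ℕ) :
    blockWeight (colourPart L) = ∏ c ∈ L.toFinset, ((L.count c).factorial : ℝ) := by
  rw [blockWeight, colourPart, Finset.prod_image (injOn_colourClass L)]
  refine Finset.prod_congr rfl fun c _ => ?_
  rw [colourClass, card_filter_listCol]

theorem colourPart_mem_monoParts (L : List ℕ) : colourPart L ∈ monoParts (listCol L) L.length := by
  rw [monoParts, Finset.mem_filter, mem_setParts]
  refine ⟨⟨?_, ?_, ?_⟩, ?_⟩
  · intro h
    obtain ⟨c, hc, h0⟩ := Finset.mem_image.1 h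
    obtain ⟨j, hj, hjc⟩ := exists_of_mem_toFinset hc
    have : j ∈ colourClass L c := Finset.mem_filter.2 ⟨hj, hjc⟩
    simp [h0] at this
  · intro U hU V hV hne
    obtain ⟨c, -, rfl⟩ := Finset.mem_image.1 hU
    obtain ⟨c', -, rfl⟩ := Finset.mem_image.1 hV
    rw [Finset.disjoint_left]
    intro j hj hj'
    apply hne
    rw [← (Finset.mem_filter.1 hj).2, (Finset.mem_filter.1 hj').2]
  · ext j
    simp only [Finset.mem_biUnion, id]
    constructor
    · rintro ⟨U, hU, hj⟩
      obtain ⟨c, -, rfl⟩ := Finset.mem_image.1 hU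
      exact (Finset.mem_filter.1 hj).1
    · intro hj
      exact ⟨colourClass L (listCol L j), Finset.mem_image_of_mem _ (listCol_mem_toFinset hj),
        Finset.mem_filter.2 ⟨hj, rfl⟩⟩
  · intro B hB p hp q hq
    obtain ⟨c, -, rfl⟩ := Finset.mem_image.1 hB
    rw [(Finset.mem_filter.1 hp).2, (Finset.mem_filter.1 hq).2]

/-- Choosing a block for each colour is injective, so there are at least as many blocks as colours.
With equally many, each colour has one block and the blocks are the colour classes. -/
theorem card_lt_of_mem_monoParts {L : List ℕ} {π : Finset (Finset ℕ)}
    (hπ : π ∈ monoParts (listCol L) L.length) (hne : π ≠ colourPart L) :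
    L.toFinset.card < π.card := by
  rw [monoParts, Finset.mem_filter] at hπ
  obtain ⟨hπ, hm⟩ := hπ
  by_contra hcard
  push Not at hcard
  apply hne
  have hex : ∀ c : ℕ, ∃ B, c ∈ L.toFinset → B ∈ π ∧ ∃ j ∈ B, listCol L j = c := by
    intro c
    by_cases hc : c ∈ L.toFinset
    · obtain ⟨j, hj, hjc⟩ := exists_of_mem_toFinset hc
      obtain ⟨B, hB, hjB⟩ := exists_mem_setParts hπ hj
      exact ⟨B, fun _ => ⟨hB, j, hjB, hjc⟩⟩
    · exact ⟨∅, fun h => absurd h hc⟩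
  choose g hg using hex
  have hinj : Set.InjOn g L.toFinset := by
    intro c hc c' hc' h
    obtain ⟨hB, j, hj, rfl⟩ := hg c hc
    obtain ⟨hB', j', hj', rfl⟩ := hg c' hc'
    exact hm _ hB j hj j' (h ▸ hj')
  have himg : L.toFinset.image g = π := by
    refine Finset.eq_of_subset_of_card_le (fun B hB => ?_) ?_
    · obtain ⟨c, hc, rfl⟩ := Finset.mem_image.1 hB
      exact (hg c hc).1
    · rwa [Finset.card_image_of_injOn hinj]
  rw [← himg, colourPart]
  refine Finset.image_congr fun c hc => ?_
  obtain ⟨hB, j, hj, hjc⟩ := hg c hc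
  ext q
  rw [colourClass, Finset.mem_filter]
  constructor
  · intro hq
    exact ⟨subset_of_mem_setParts hπ hB hq, (hm _ hB q hq j hj).trans hjc⟩
  · rintro ⟨hq, hqc⟩
    obtain ⟨B', hB', hqB'⟩ := exists_mem_setParts hπ hq
    rw [← himg] at hB'
    obtain ⟨c', hc', rfl⟩ := Finset.mem_image.1 hB'
    obtain ⟨hB'', j', hj', hjc'⟩ := hg c' hc'
    have : c' = c := by rw [← hjc', ← hqc, hm _ hB'' j' hj' q hqB']
    rwa [← this]

theorem multWeight_blockSizes {n : ℕ} {π : Finset (Finset ℕ)} (hπ : π ∈ setParts (Finset.range n)) :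
    multWeight (blockSizes π) = n := by
  have h1 := sum_card_of_mem_setParts hπ (fun _ => 1)
  simp only [Finset.sum_const, smul_eq_mul, mul_one, Finset.card_range] at h1
  rw [multWeight, blockSizes, Multiset.map_map, ← h1]
  change ∑ B ∈ π, (B.card.toPNat' : ℕ) = _
  refine Finset.sum_congr rfl fun B hB => ?_
  rw [Nat.toPNat'_coe, if_pos (Finset.card_pos.2 (nonempty_of_mem_setParts hπ hB))]

theorem card_blockSizes (π : Finset (Finset ℕ)) : Multiset.card (blockSizes π) = π.card := by
  rw [blockSizes, Multiset.card_map]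
  rfl

theorem blockWeight_pos (π : Finset (Finset ℕ)) : 0 < blockWeight π :=
  Finset.prod_pos fun B _ => by positivity

theorem IsSmooth.logDerivAtOne_list {N : ℕ} {τ : PMF (GT N)} (h : IsSmooth τ) {L : List ℕ}
    (hL : L ≠ []) (hN : ∀ c ∈ L, c < N) : logDerivAtOne τ L =
      ((∑ π ∈ monoParts (listCol L) L.length, blockWeight π * (N : ℝ) ^ π.card *
        kumM (measFunctional τ) ((blockSizes π).map MvPolynomial.X) : ℝ) : ℂ) := by
  have hlt : ∀ j, listCol L j < N := by
    intro j
    rw [listCol]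
    by_cases hj : j < L.reverse.length
    · rw [List.getD_eq_getElem _ _ hj]
      exact hN _ (List.mem_reverse.1 (List.getElem_mem hj))
    -- Positions beyond the list receive the default colour 0, which is below N because the list has
    -- an entry.
    · rw [List.getD_eq_default _ _ (not_lt.1 hj)]
      obtain ⟨c, hc⟩ := List.exists_mem_of_ne_nil L hL
      exact (Nat.zero_le c).trans_lt (hN c hc)
  obtain ⟨n, hn⟩ : ∃ n, L.length = n + 1 :=
    ⟨L.length - 1, by have := List.length_pos_iff.2 hL; omega⟩
  have := h.logDerivAtOne_colourList (fun j => ⟨listCol L j, hlt j⟩) n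
  rw [← hn, colourList_length _ L fun j _ => rfl] at this
  exact this

end ListColours

/-! ### Asymptotics of the derivatives of ln S. -/

section LogDerivativeLimits

variable {ρ : (N : ℕ) → PMF (GT N)}

/-- The normalization of the derivatives of the logarithm with respect to `s` variables. -/
noncomputable def logScale (s N : ℕ) : ℝ := if s = 1 then 1 / (N : ℝ) else 1

/-- Other partitions have more blocks than there are colours. Their terms converge by hypothesis;
with one colour the normalization 1/N kills them, and with two or more colours they have at least
three blocks and limit zero. -/
theorem tendsto_logDeriv_sub (hρ : ∀ N, IsSmooth (ρ N)) {L : List ℕ} (hL : L ≠ [])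
    (h : ∀ π ∈ monoParts (listCol L) L.length, π ≠ colourPart L →
      ∃ l : ℝ, Tendsto (fun N : ℕ => (N : ℝ) ^ scaleExp π.card *
        kumM (measFunctional (ρ N)) ((blockSizes π).map MvPolynomial.X)) atTop (𝓝 l) ∧
          (3 ≤ π.card → l = 0)) :
    Tendsto (fun N : ℕ => (logScale L.toFinset.card N : ℂ) * logDerivAtOne (ρ N) L -
      ((blockWeight (colourPart L) * ((N : ℝ) ^ scaleExp L.toFinset.card *
        kumM (measFunctional (ρ N)) ((blockSizes (colourPart L)).map MvPolynomial.X)) : ℝ) : ℂ))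
      atTop (𝓝 0) := by
  set s := L.toFinset.card with hs
  have hspos : 0 < s := by
    rw [hs, Finset.card_pos]
    obtain ⟨c, hc⟩ := List.exists_mem_of_ne_nil L hL
    exact ⟨c, List.mem_toFinset.2 hc⟩
  have hreal : Tendsto (fun N : ℕ => ∑ π ∈ (monoParts (listCol L) L.length).erase (colourPart L),
      blockWeight π * (logScale s N * ((N : ℝ) ^ π.card *
        kumM (measFunctional (ρ N)) ((blockSizes π).map MvPolynomial.X)))) atTop (𝓝 0) := by
    rw [← Finset.sum_const_zero (s := (monoParts (listCol L) L.length).erase (colourPart L))]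
    refine tendsto_finsetSum _ fun π hπ => ?_
    obtain ⟨hne, hπ⟩ := Finset.mem_erase.1 hπ
    have hcard := card_lt_of_mem_monoParts hπ hne
    rw [← hs] at hcard
    obtain ⟨l, hl, hl0⟩ := h π hπ hne
    rw [scaleExp_of_ne_one (by omega)] at hl
    rw [← mul_zero (blockWeight π)]
    refine Tendsto.const_mul _ ?_
    by_cases h1 : s = 1
    · simp only [logScale, if_pos h1]
      have := (tendsto_one_div_atTop_nhds_zero_nat (𝕜 := ℝ)).mul hl
      rwa [zero_mul] at this
    · simp only [logScale, if_neg h1, one_mul]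
      rwa [hl0 (by omega)] at hl
  have hC := (Complex.continuous_ofReal.tendsto 0).comp hreal
  rw [Complex.ofReal_zero] at hC
  refine hC.congr' ?_
  have hbig : ∀ᶠ N : ℕ in atTop, ∀ c ∈ L, c < N := by
    filter_upwards [eventually_gt_atTop L.sum] with N hN c hc
    exact (List.single_le_sum (fun _ _ => Nat.zero_le _) c hc).trans_lt hN
  filter_upwards [hbig, eventually_ne_atTop 0] with N hN hN0
  have hN' : (N : ℝ) ≠ 0 := by exact_mod_cast hN0
  rw [(hρ N).logDerivAtOne_list hL hN, Function.comp_apply, ← Complex.ofReal_mul,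
    ← Complex.ofReal_sub]
  congr 1
  rw [← Finset.add_sum_erase _ _ (colourPart_mem_monoParts L), card_colourPart, ← hs, mul_add,
    Finset.mul_sum]
  have h2 : logScale s N * (N : ℝ) ^ s = (N : ℝ) ^ scaleExp s := by
    rw [logScale, scaleExp]
    split_ifs with h1
    · rw [h1]
      field_simp
    · rw [one_mul]
  rw [← h2]
  rw [show ∀ a b w X S : ℝ, (a * (w * b * X) + S) - w * (a * b * X) = S by intros; ring]
  exact Finset.sum_congr rfl fun π _ => by ring

theorem tendsto_re_of_sub {u : ℕ → ℂ} {v : ℕ → ℝ} {l : ℝ}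
    (h : Tendsto (fun N => u N - (v N : ℂ)) atTop (𝓝 0)) (hu : Tendsto u atTop (𝓝 (l : ℂ))) :
    Tendsto v atTop (𝓝 l) := by
  have h1 : Tendsto (fun N => (v N : ℂ)) atTop (𝓝 (l : ℂ)) := by
    have := hu.sub h
    rw [sub_zero] at this
    exact this.congr fun N => by ring
  exact (Complex.continuous_re.tendsto _).comp h1

theorem tendsto_of_sub_ofReal {u : ℕ → ℂ} {v : ℕ → ℝ} {l : ℝ}
    (h : Tendsto (fun N => u N - (v N : ℂ)) atTop (𝓝 0)) (hv : Tendsto v atTop (𝓝 l)) :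
    Tendsto u atTop (𝓝 (l : ℂ)) := by
  have := h.add ((Complex.continuous_ofReal.tendsto l).comp hv)
  rw [zero_add] at this
  exact this.congr fun N => by simp

/-- The variables satisfy a central limit theorem with limits `γ`. -/
def VarCLT (F : ℕ → MvPolynomial ℕ+ ℝ →ₗ[ℝ] ℝ) (γ : Multiset ℕ+ → ℝ) : Prop :=
  (∀ n, CumTendsto F n γ) ∧ ∀ μ, 3 ≤ Multiset.card μ → γ μ = 0

theorem VarCLT.tendsto_logDeriv (hρ : ∀ N, IsSmooth (ρ N)) {γ : Multiset ℕ+ → ℝ}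
    (h : VarCLT (fun N => measFunctional (ρ N)) γ) {L : List ℕ} (hL : L ≠ []) :
    Tendsto (fun N : ℕ => (logScale L.toFinset.card N : ℂ) * logDerivAtOne (ρ N) L) atTop
      (𝓝 ((blockWeight (colourPart L) * γ (blockSizes (colourPart L)) : ℝ) : ℂ)) := by
  have hlim : ∀ π ∈ monoParts (listCol L) L.length, Tendsto (fun N : ℕ => (N : ℝ) ^ scaleExp π.card *
        kumM (measFunctional (ρ N)) ((blockSizes π).map MvPolynomial.X)) atTop
          (𝓝 (γ (blockSizes π))) := by
    intro π hπ
    rw [monoParts, Finset.mem_filter] at hπ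
    have hpos := card_pos_of_mem_setParts hπ.1 (by simpa using hL)
    have := h.1 L.length (blockSizes π) (by
      rw [← Multiset.card_pos, card_blockSizes]
      exact hpos) (multWeight_blockSizes hπ.1).le
    rwa [card_blockSizes] at this
  refine tendsto_of_sub_ofReal (tendsto_logDeriv_sub hρ hL fun π hπ _ =>
    ⟨_, hlim π hπ, fun h3 => h.2 _ (by rwa [card_blockSizes])⟩) (Tendsto.const_mul _ ?_)
  have := hlim _ (colourPart_mem_monoParts L)
  rwa [card_colourPart] at this

end LogDerivativeLimits

/-! ### CLT-appropriateness in terms of the cumulants of the β_m. -/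

section Appropriate

variable {ρ : (N : ℕ) → PMF (GT N)}

theorem toPNat'_coe (m : ℕ+) : (m : ℕ).toPNat' = m :=
  PNat.coe_injective (by rw [Nat.toPNat'_coe, if_pos m.pos])

theorem toFinset_replicate_append {i j : ℕ} (k m : ℕ+) :
    (List.replicate k i ++ List.replicate m j).toFinset = {i, j} := by
  ext a
  simp

theorem toFinset_replicate_pnat {i : ℕ} (k : ℕ+) : (List.replicate k i).toFinset = {i} := by
  ext a
  simp

theorem count_replicate_append_left {i j : ℕ} (h : i ≠ j) (k m : ℕ) :
    (List.replicate k i ++ List.replicate m j).count i = k := by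
  simp [List.count_replicate, h.symm]

theorem count_replicate_append_right {i j : ℕ} (h : i ≠ j) (k m : ℕ) :
    (List.replicate k i ++ List.replicate m j).count j = m := by
  simp [List.count_replicate, h]

theorem pnat_replicate_ne_nil (k : ℕ+) (i : ℕ) : List.replicate (k : ℕ) i ≠ [] := by simp

theorem pnat_replicate_append_ne_nil (k : ℕ+) (i : ℕ) (l : List ℕ) :
    List.replicate (k : ℕ) i ++ l ≠ [] := by simp

theorem VarCLT.cltAppropriateWith (hρ : ∀ N, IsSmooth (ρ N)) {γ : Multiset ℕ+ → ℝ}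
    (h : VarCLT (fun N => measFunctional (ρ N)) γ) :
    CLTAppropriateWith ρ (fun m => (m : ℕ).factorial * γ {m})
      (fun k m => (k : ℕ).factorial * (m : ℕ).factorial * γ {k, m}) where
  one i k := by
    have h1 := h.tendsto_logDeriv hρ (pnat_replicate_ne_nil k i)
    rw [blockWeight_colourPart, blockSizes_colourPart, toFinset_replicate_pnat] at h1
    simpa [logScale, toPNat'_coe] using h1
  two i j hij k m := by
    have h1 := h.tendsto_logDeriv hρ (pnat_replicate_append_ne_nil k i (List.replicate m j))
    rw [blockWeight_colourPart, blockSizes_colourPart, toFinset_replicate_append,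
      Finset.card_pair hij, Finset.prod_pair hij, Finset.insert_val_of_notMem (by simpa using hij),
      Finset.singleton_val, Multiset.map_cons, Multiset.map_singleton,
      count_replicate_append_left hij, count_replicate_append_right hij, toPNat'_coe,
      toPNat'_coe] at h1
    simpa [logScale] using h1
  three L hL := by
    have hne : L ≠ [] := by
      rintro rfl
      simp at hL
    have h1 := h.tendsto_logDeriv hρ hne
    rw [h.2 _ (by rwa [card_blockSizes, card_colourPart]), mul_zero] at h1
    simpa [logScale, show L.toFinset.card ≠ 1 by omega] using h1

/-- A list of colours `0, 1, …` with multiplicities given by a multiset. -/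
noncomputable def multList (μ : Multiset ℕ+) : List ℕ :=
  (List.range (Multiset.card μ)).flatMap fun j => List.replicate (multEnum μ j) j

theorem toFinset_multList (μ : Multiset ℕ+) :
    (multList μ).toFinset = Finset.range (Multiset.card μ) := by
  ext a
  simp [multList]

theorem count_flatMap_replicate (m : ℕ → ℕ) (s j : ℕ) :
    ((List.range s).flatMap fun j => List.replicate (m j) j).count j = if j < s then m j else 0 := by
  induction s with
  | zero => simp
  | succ s ih =>
    rw [List.range_succ, List.flatMap_append, List.count_append, ih]
    simp only [List.flatMap_cons, List.flatMap_nil, List.append_nil, List.count_replicate, beq_iff_eq]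
    split_ifs <;> first | omega | simp_all

theorem blockSizes_multList (μ : Multiset ℕ+) : blockSizes (colourPart (multList μ)) = μ := by
  rw [blockSizes_colourPart, toFinset_multList]
  conv_rhs => rw [← map_multEnum μ]
  refine Multiset.map_congr rfl fun j hj => ?_
  rw [multList, count_flatMap_replicate, if_pos (by simpa using hj), toPNat'_coe]

theorem multList_ne_nil {μ : Multiset ℕ+} (hμ : μ ≠ 0) : multList μ ≠ [] := by
  intro h
  have := toFinset_multList μ
  rw [h, List.toFinset_nil, eq_comm, Finset.range_eq_empty_iff, Multiset.card_eq_zero] at this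
  exact hμ this

theorem card_le_multWeight (μ : Multiset ℕ+) : Multiset.card μ ≤ multWeight μ := by
  induction μ using Multiset.induction_on with
  | empty => simp
  | cons m μ ih =>
    rw [multWeight_cons, Multiset.card_cons]
    have := m.pos
    omega

theorem CLTAppropriateWith.tendsto_multList {c : ℕ+ → ℝ} {d : ℕ+ → ℕ+ → ℝ}
    (h : CLTAppropriateWith ρ c d) {μ : Multiset ℕ+} (hμ : μ ≠ 0) :
    ∃ l : ℝ, Tendsto (fun N : ℕ => (logScale (Multiset.card μ) N : ℂ) *
      logDerivAtOne (ρ N) (multList μ)) atTop (𝓝 (l : ℂ)) ∧ (3 ≤ Multiset.card μ → l = 0) := by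
  have hpos := Multiset.card_pos.2 hμ
  by_cases h1 : Multiset.card μ = 1
  · refine ⟨c (multEnum μ 0), ?_, fun h => by omega⟩
    have hl : multList μ = List.replicate (multEnum μ 0) 0 := by
      rw [multList, h1]
      simp
    rw [hl, h1]
    simpa [logScale] using h.one 0 (multEnum μ 0)
  by_cases h2 : Multiset.card μ = 2
  · refine ⟨d (multEnum μ 0) (multEnum μ 1), ?_, fun h => by omega⟩
    have hl : multList μ = List.replicate (multEnum μ 0) 0 ++ List.replicate (multEnum μ 1) 1 := by
      rw [multList, h2]
      simp [List.range_succ]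
    rw [hl, h2]
    simpa [logScale] using h.two 0 1 (by norm_num) (multEnum μ 0) (multEnum μ 1)
  · refine ⟨0, ?_, fun _ => rfl⟩
    have h3 := h.three (multList μ) (by rw [toFinset_multList, Finset.card_range]; omega)
    simpa [logScale, h1] using h3

/-- Induction on weight minus number of variables. The list of differentiations encoding μ has μ as
its coarsest block type; finer partitions have the same weight but more blocks, hence are already
known, and the leading term can be solved for. -/
theorem CLTAppropriateWith.varCLT (hρ : ∀ N, IsSmooth (ρ N)) {c : ℕ+ → ℝ} {d : ℕ+ → ℕ+ → ℝ}
    (h : CLTAppropriateWith ρ c d) :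
    VarCLT (fun N => measFunctional (ρ N)) (cumLim fun N => measFunctional (ρ N)) := by
  set F : ℕ → MvPolynomial ℕ+ ℝ →ₗ[ℝ] ℝ := fun N => measFunctional (ρ N) with hF
  have key : ∀ (e : ℕ) (μ : Multiset ℕ+), μ ≠ 0 → multWeight μ - Multiset.card μ = e →
      ∃ l : ℝ, Tendsto (fun N : ℕ => (N : ℝ) ^ scaleExp (Multiset.card μ) *
        kumM (F N) (μ.map MvPolynomial.X)) atTop (𝓝 l) ∧ (3 ≤ Multiset.card μ → l = 0) := by
    intro e
    induction e using Nat.strong_induction_on with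
    | _ e ih =>
    intro μ hμ he
    obtain ⟨l, hl, hl0⟩ := h.tendsto_multList hμ
    have hcol := colourPart_mem_monoParts (multList μ)
    have hlen : (multList μ).length = multWeight μ := by
      rw [monoParts, Finset.mem_filter] at hcol
      rw [← multWeight_blockSizes hcol.1, blockSizes_multList]
    have hcard : (multList μ).toFinset.card = Multiset.card μ := by
      rw [toFinset_multList, Finset.card_range]
    have h1 := tendsto_logDeriv_sub hρ (multList_ne_nil hμ) (fun π hπ hne => by
      have hlt := card_lt_of_mem_monoParts hπ hne
      rw [hcard] at hlt
      rw [monoParts, Finset.mem_filter] at hπ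
      have hw := multWeight_blockSizes hπ.1
      rw [hlen] at hw
      have hle := card_le_multWeight (blockSizes π)
      rw [card_blockSizes] at hle
      obtain ⟨l', hl', hl0'⟩ := ih (multWeight (blockSizes π) - Multiset.card (blockSizes π)) (by
        rw [card_blockSizes]
        omega) (blockSizes π) (by
        rw [← Multiset.card_pos, card_blockSizes]
        omega) rfl
      rw [card_blockSizes] at hl' hl0'
      exact ⟨l', hl', hl0'⟩)
    rw [hcard, blockSizes_multList] at h1
    have h2 := tendsto_re_of_sub h1 hl
    have hw := blockWeight_pos (colourPart (multList μ))
    refine ⟨(blockWeight (colourPart (multList μ)))⁻¹ * l, ?_, fun h3 => by rw [hl0 h3, mul_zero]⟩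
    refine (h2.const_mul (blockWeight (colourPart (multList μ)))⁻¹).congr fun N => ?_
    rw [← mul_assoc, inv_mul_cancel₀ hw.ne', one_mul]
  refine ⟨fun n μ hμ _ => ?_, fun μ h3 => ?_⟩
  · obtain ⟨l, hl, -⟩ := key _ μ hμ rfl
    rwa [cumLim, hl.limUnder_eq]
  · obtain ⟨l, hl, hl0⟩ := key _ μ (by rintro rfl; simp at h3) rfl
    rw [cumLim, hl.limUnder_eq, hl0 h3]

theorem CLTAppropriateWith.unique {c c' : ℕ+ → ℝ} {d d' : ℕ+ → ℕ+ → ℝ}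
    (h : CLTAppropriateWith ρ c d) (h' : CLTAppropriateWith ρ c' d') : c = c' ∧ d = d' := by
  refine ⟨funext fun k => ?_, funext fun k => funext fun m => ?_⟩
  · exact Complex.ofReal_injective (tendsto_nhds_unique (h.one 0 k) (h'.one 0 k))
  · exact Complex.ofReal_injective
      (tendsto_nhds_unique (h.two 0 1 zero_ne_one k m) (h'.two 0 1 zero_ne_one k m))

end Appropriate

/-! ### Expectation as a linear functional on random variables. -/

section ExpectationFunctional

variable {N : ℕ} {τ : PMF (GT N)}

/-- The algebra of random variables generated by the `scaledBinom k`. -/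
noncomputable def binomAlgebra (N : ℕ) : Subalgebra ℝ (GT N → ℝ) :=
  Algebra.adjoin ℝ (Set.range fun k : ℕ+ => scaledBinom (k : ℕ))

theorem scaledBinom_mem_binomAlgebra (k : ℕ+) : scaledBinom (k : ℕ) ∈ binomAlgebra N :=
  Algebra.subset_adjoin ⟨k, rfl⟩

/-- The random variables with finite expectation. -/
def summableSubmodule (τ : PMF (GT N)) : Submodule ℝ (GT N → ℝ) where
  carrier := {f | Summable fun lam => (τ lam).toReal * f lam}
  zero_mem' := by simp
  add_mem' := fun ha hb => by simpa [mul_add] using ha.add hb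
  smul_mem' := fun c f hf => by
    have := Summable.mul_left c hf
    simpa [mul_left_comm] using this

/-- The algebra is spanned by products of normalized binomial sums, whose expectations converge
because they are values of the measure functional. -/
theorem IsSmooth.binomAlgebra_le (h : IsSmooth τ) (hN : N ≠ 0) :
    Subalgebra.toSubmodule (binomAlgebra N) ≤ summableSubmodule τ := by
  rw [binomAlgebra, Algebra.adjoin_eq_span, Submodule.span_le]
  intro f hf
  obtain ⟨l, hl, rfl⟩ := Submonoid.exists_multiset_of_mem_closure hf
  obtain ⟨μ, rfl⟩ : ∃ μ : Multiset ℕ+, l = μ.map fun k : ℕ+ => scaledBinom (k : ℕ) := by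
    choose! g hg using hl
    exact ⟨l.map g, by
      rw [Multiset.map_map]
      exact (Multiset.map_id l).symm.trans (Multiset.map_congr rfl fun y hy => (hg y hy).symm)⟩
  have := (h.hasSum_scaledBinom hN (fun j => (multEnum μ j : ℕ)) (Finset.range (Multiset.card μ))).summable
  refine this.congr fun lam => ?_
  conv_rhs => rw [← map_multEnum μ, Multiset.map_map]
  rw [← Finset.prod_apply]
  rfl

/-- A `tsum` is additive only on summable families, so the expectation is taken there and extended
linearly to obtain a functional on the whole algebra of functions. -/
theorem IsSmooth.exists_expectFunctional (h : IsSmooth τ) (hN : N ≠ 0) :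
    ∃ E : (GT N → ℝ) →ₗ[ℝ] ℝ, ∀ f ∈ binomAlgebra N, E f = expect τ f := by
  let g : summableSubmodule τ →ₗ[ℝ] ℝ :=
    { toFun := fun f => expect τ f.1
      map_add' := fun a b => by
        simp only [expect, Submodule.coe_add, Pi.add_apply, mul_add]
        exact a.2.tsum_add b.2
      map_smul' := fun c a => by
        simp only [expect, Submodule.coe_smul, Pi.smul_apply, smul_eq_mul, RingHom.id_apply]
        rw [← tsum_mul_left]
        exact tsum_congr fun _ => mul_left_comm _ _ _ }
  obtain ⟨E, hE⟩ := g.exists_extend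
  refine ⟨E, fun f hf => ?_⟩
  exact LinearMap.congr_fun hE ⟨f, h.binomAlgebra_le hN hf⟩

/-- A linear extension of the expectation from the algebra generated by the `scaledBinom k`. -/
noncomputable def expectFunctional (τ : PMF (GT N)) : (GT N → ℝ) →ₗ[ℝ] ℝ :=
  open Classical in
  if h : ∃ E : (GT N → ℝ) →ₗ[ℝ] ℝ, ∀ f ∈ binomAlgebra N, E f = expect τ f then h.choose else 0

theorem IsSmooth.expectFunctional_eq (h : IsSmooth τ) (hN : N ≠ 0) {f : GT N → ℝ}
    (hf : f ∈ binomAlgebra N) : expectFunctional τ f = expect τ f := by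
  have h' := h.exists_expectFunctional hN
  rw [expectFunctional, dif_pos h']
  exact h'.choose_spec f hf

theorem IsSmooth.expectFunctional_one (h : IsSmooth τ) (hN : N ≠ 0) :
    expectFunctional τ 1 = 1 := by
  rw [h.expectFunctional_eq hN (one_mem _), expect]
  simpa using (hasSum_toReal τ).tsum_eq

theorem IsSmooth.expectFunctional_prod (h : IsSmooth τ) (hN : N ≠ 0) (k : ℕ → ℕ+) (U : Finset ℕ) :
    expectFunctional τ (∏ j ∈ U, scaledBinom (k j : ℕ)) =
      measFunctional τ (univMoment (N : ℝ)⁻¹ (fun j => (k j : ℕ)) U) := by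
  rw [h.expectFunctional_eq hN (prod_mem fun j _ => scaledBinom_mem_binomAlgebra _),
    ← (h.hasSum_scaledBinom hN (fun j => (k j : ℕ)) U).tsum_eq, expect]
  simp only [Finset.prod_apply]

theorem IsSmooth.cum_univMoment (h : IsSmooth τ) (hN : N ≠ 0) (k : ℕ → ℕ+) {J : Finset ℕ}
    (hJ : J.Nonempty) :
    cum (fun U => measFunctional τ (univMoment (N : ℝ)⁻¹ (fun j => (k j : ℕ)) U)) J =
      kumM (expectFunctional τ) ((J.val.map k).map fun m : ℕ+ => scaledBinom (m : ℕ)) := by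
  rw [Multiset.map_map]
  refine Eq.trans ?_ (kum_eq_kumM (h.expectFunctional_one hN) (fun j => scaledBinom (k j : ℕ)) hJ)
  exact cum_congr fun U _ => (h.expectFunctional_prod hN k U).symm

theorem IsSmooth.binomCum_eq (h : IsSmooth τ) (hN : N ≠ 0) {κ : Multiset ℕ+} (hκ : κ ≠ 0) :
    binomCum (measFunctional τ) (N : ℝ)⁻¹ κ =
      kumM (expectFunctional τ) (κ.map fun m : ℕ+ => scaledBinom (m : ℕ)) := by
  rw [binomCum, h.cum_univMoment hN (multEnum κ), map_multEnum]
  simpa using hκ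

end ExpectationFunctional

/-! ### Triangular changes of variables that are asymptotically diagonal. -/

section Triangular

theorem map_univ_multEnum (μ : Multiset ℕ+) :
    (Finset.univ : Finset (Fin (Multiset.card μ))).val.map
      (fun i : Fin (Multiset.card μ) => multEnum μ i) = μ := by
  have h1 : (Finset.univ : Finset (Fin (Multiset.card μ))).val.map
      (fun i : Fin (Multiset.card μ) => (i : ℕ)) = (Finset.range (Multiset.card μ)).val := by
    change (Finset.univ.map Fin.valEmbedding).val = _
    rw [Fin.map_valEmbedding_univ, Nat.Iio_eq_range]
  conv_rhs => rw [← map_multEnum μ, ← h1, Multiset.map_map]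
  rfl

/-- By multilinearity the cumulant of the y's is a finite combination of cumulants of the x's with
the same number of arguments, hence the same scale; in the limit only the diagonal choice keeps a
nonzero coefficient. -/
theorem tendsto_kumM_triangular {A : ℕ → Type} [∀ N, CommRing (A N)] [∀ N, Algebra ℝ (A N)]
    {E : ∀ N, A N →ₗ[ℝ] ℝ} (hE : ∀ᶠ N in atTop, E N 1 = 1) {x y : ∀ N, ℕ+ → A N}
    {a : ℕ → ℕ+ → ℕ+ → ℝ} {b : ℕ+ → ℝ}
    (hy : ∀ᶠ N in atTop, ∀ k, y N k = ∑ j ∈ Finset.Icc 1 k, a N k j • x N j)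
    (ha : ∀ k, ∀ j ∈ Finset.Icc 1 k, Tendsto (fun N => a N k j) atTop (𝓝 (if j = k then b k else 0)))
    {l : Multiset ℕ+ → ℝ} (hl : ∀ μ, μ ≠ 0 → Tendsto (fun N : ℕ => (N : ℝ) ^ scaleExp (Multiset.card μ) *
      kumM (E N) (μ.map (x N))) atTop (𝓝 (l μ))) {μ : Multiset ℕ+} (hμ : μ ≠ 0) :
    Tendsto (fun N : ℕ => (N : ℝ) ^ scaleExp (Multiset.card μ) * kumM (E N) (μ.map (y N))) atTop
      (𝓝 ((μ.map b).prod * l μ)) := by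
  set r := Multiset.card μ with hr
  have hr0 : r ≠ 0 := by simpa [hr] using hμ
  have : NeZero r := ⟨hr0⟩
  let k : Fin r → ℕ+ := fun i => multEnum μ i
  have hk : (Finset.univ : Finset (Fin r)).val.map k = μ := map_univ_multEnum μ
  have hJ : (Finset.univ : Finset (Fin r)).Nonempty := Finset.univ_nonempty
  have hcard (m : Fin r → ℕ+) : Multiset.card ((Finset.univ : Finset (Fin r)).val.map m) = r := by simp
  have key : ∀ᶠ N in atTop, ∑ m ∈ Fintype.piFinset (fun i => Finset.Icc 1 (k i)),
      (∏ i, a N (k i) (m i)) * ((N : ℝ) ^ scaleExp r *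
        kumM (E N) (((Finset.univ : Finset (Fin r)).val.map m).map (x N))) =
      (N : ℝ) ^ scaleExp r * kumM (E N) (μ.map (y N)) := by
    filter_upwards [hE, hy] with N hN hyN
    rw [← hk, Multiset.map_map, ← kum_eq_kumM hN (y N ∘ k) hJ]
    have e1 : kum (E N) (y N ∘ k) Finset.univ =
        kumMultilinear (E := E N) hN (fun i => ∑ j ∈ Finset.Icc 1 (k i), a N (k i) j • x N j) := by
      exact kum_congr fun i _ => hyN (k i)
    rw [e1, MultilinearMap.map_sum_finset, Finset.mul_sum]
    refine Finset.sum_congr rfl fun m _ => ?_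
    have e2 : kumMultilinear (E := E N) hN (fun i => a N (k i) (m i) • x N (m i)) =
        (∏ i, a N (k i) (m i)) * kum (E N) (fun i => x N (m i)) Finset.univ :=
      kum_smul (fun i => x N (m i)) (fun i => a N (k i) (m i)) Finset.univ
    rw [e2, Multiset.map_map, ← kum_eq_kumM hN (x N ∘ m) hJ]
    simp only [Function.comp_def]
    ring
  refine Tendsto.congr' key ?_
  have hlim : (μ.map b).prod * l μ = ∑ m ∈ Fintype.piFinset (fun i => Finset.Icc 1 (k i)),
      (∏ i, if m i = k i then b (k i) else 0) * l ((Finset.univ : Finset (Fin r)).val.map m) := by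
    rw [Finset.sum_eq_single k]
    · simp only [if_true, hk]
      rw [← hk, Multiset.map_map]
      rfl
    · intro m _ hm
      obtain ⟨i, hi⟩ := Function.ne_iff.1 hm
      rw [Finset.prod_eq_zero (Finset.mem_univ i) (by rw [if_neg hi]), zero_mul]
    · intro hk'
      exact absurd (Fintype.mem_piFinset.2 fun i => Finset.mem_Icc.2 ⟨one_le, le_rfl⟩) hk'
  rw [hlim]
  refine tendsto_finsetSum _ fun m hm => ?_
  refine (tendsto_finsetProd _ fun i _ => ha (k i) (m i) (Fintype.mem_piFinset.1 hm i)).mul ?_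
  have := hl ((Finset.univ : Finset (Fin r)).val.map m) (by
    intro h0
    have := hcard m
    rw [h0] at this
    exact hr0 (by simpa using this.symm))
  rwa [hcard m] at this

end Triangular

/-! ### Power sums against binomial sums, by Stirling coefficients. -/

section PowerSums

theorem pow_eq_sum_fallingInt (w : ℤ) (k : ℕ) :
    w ^ k = ∑ j ∈ Finset.range (k + 1), (Nat.stirlingSecond k j : ℤ) * fallingInt w j := by
  induction k with
  | zero => simp [fallingInt]
  | succ k ih =>
    rw [pow_succ, ih, Finset.sum_mul, Finset.sum_range_succ' _ (k + 1)]
    simp only [Nat.stirlingSecond_succ_zero, Nat.cast_zero, zero_mul, add_zero,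
      Nat.stirlingSecond_succ_succ, fallingInt_succ]
    have h1 : ∑ j ∈ Finset.range (k + 1), ((j : ℤ) + 1) * (Nat.stirlingSecond k (j + 1) : ℤ) *
        (fallingInt w j * (w - j)) =
        ∑ j ∈ Finset.range (k + 1), (j : ℤ) * (Nat.stirlingSecond k j : ℤ) * fallingInt w j := by
      rw [Finset.sum_range_succ, Nat.stirlingSecond_eq_zero_of_lt (Nat.lt_succ_self k),
        Finset.sum_range_succ' _ k]
      simp [fallingInt_succ]
    push_cast
    simp only [add_mul _ _ (fallingInt w _ * (w - _)), Finset.sum_add_distrib]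
    rw [h1, ← Finset.sum_add_distrib]
    exact Finset.sum_congr rfl fun j _ => by ring

theorem fallingInt_eq_sum_pow (w : ℤ) (k : ℕ) :
    fallingInt w k = ∑ j ∈ Finset.range (k + 1), (descPochhammer ℤ k).coeff j * w ^ j := by
  rw [fallingInt_eq, ← nsmul_eq_mul, ← Ring.descPochhammer_eq_factorial_smul_choose,
    ← Polynomial.eval_eq_smeval, Polynomial.eval_eq_sum_range, descPochhammer_natDegree]

theorem sum_Icc_pnat (k : ℕ+) (g : ℕ → ℝ) (h0 : g 0 = 0) :
    ∑ j ∈ Finset.Icc 1 k, g (j : ℕ) = ∑ j ∈ Finset.range ((k : ℕ) + 1), g j := by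
  rw [Finset.sum_range_succ', h0, add_zero]
  refine Finset.sum_bij' (fun j _ => (j : ℕ) - 1) (fun j _ => j.succPNat) ?_ ?_ ?_ ?_ ?_
  · intro j hj
    have h1 : (j : ℕ) ≤ k := PNat.coe_le_coe _ _ |>.2 (Finset.mem_Icc.1 hj).2
    have := j.pos
    exact Finset.mem_range.2 (by omega)
  · intro j hj
    rw [Finset.mem_Icc]
    exact ⟨one_le, PNat.coe_le_coe _ _ |>.1 (Finset.mem_range.1 hj)⟩
  · intro j _
    exact PNat.eq (by simp [Nat.sub_add_cancel j.pos])
  · intro j _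
    simp
  · intro j _
    rw [Nat.sub_add_cancel j.pos]

variable {N : ℕ}

/-- The power sum `p_k` divided by `N`. -/
noncomputable def meanPower (N : ℕ) (k : ℕ+) (lam : GT N) : ℝ := (N : ℝ)⁻¹ * powerSum N k lam

theorem meanPower_eq (k : ℕ+) (lam : GT N) : meanPower N k lam =
    (N : ℝ)⁻¹ ^ ((k : ℕ) + 1) * ∑ i, (((lam.1 i + staircase N i) ^ (k : ℕ) : ℤ) : ℝ) := by
  rw [meanPower, powerSum, pow_succ', mul_assoc, Finset.mul_sum Finset.univ _ ((N : ℝ)⁻¹ ^ (k : ℕ))]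
  congr 1
  refine Finset.sum_congr rfl fun i _ => ?_
  have h : (((lam.1 i + staircase N i : ℤ)) : ℝ) = (lam.1 i : ℝ) + N - 1 - (i : ℕ) := by
    have : ((i.rev : ℕ) : ℝ) = N - 1 - (i : ℕ) := by
      rw [Fin.val_rev, Nat.cast_sub i.2]
      push_cast
      ring
    rw [staircase, Int.cast_add, Int.cast_natCast, this]
    ring
  rw [Int.cast_pow, h, div_eq_mul_inv, mul_pow, mul_comm]

theorem scaledBinom_eq (k : ℕ) (lam : GT N) : scaledBinom k lam =
    (N : ℝ)⁻¹ ^ (k + 1) * (((k.factorial : ℝ)⁻¹) *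
      ∑ i, ((fallingInt (lam.1 i + staircase N i) k : ℤ) : ℝ)) := by
  rw [scaledBinom, binomSum]
  congr 1
  rw [Finset.mul_sum]
  refine Finset.sum_congr rfl fun i _ => ?_
  rw [fallingInt_eq, Int.cast_mul, Int.cast_natCast,
    inv_mul_cancel_left₀ (Nat.cast_ne_zero.2 (Nat.factorial_ne_zero k))]

/-- Splitting k + 1 as (k-j) + (j+1) shows that lower-order terms of the change of basis carry
x^{k-j}, here a positive power of 1/N. -/
theorem sum_triangular (x : ℝ) (k : ℕ+) {ι : Type*} (s : Finset ι) (Y : ι → ℤ) (X : ℕ → ι → ℤ)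
    (t : ℕ → ℤ) (ht : t 0 = 0) (h : ∀ i, Y i = ∑ j ∈ Finset.range ((k : ℕ) + 1), t j * X j i) :
    x ^ ((k : ℕ) + 1) * ∑ i ∈ s, (Y i : ℝ) = ∑ j ∈ Finset.Icc 1 k,
      (t j : ℝ) * x ^ ((k : ℕ) - j) * (x ^ ((j : ℕ) + 1) * ∑ i ∈ s, (X j i : ℝ)) := by
  rw [sum_Icc_pnat k (fun j => (t j : ℝ) * x ^ ((k : ℕ) - j) * (x ^ (j + 1) * ∑ i ∈ s, (X j i : ℝ)))
    (by simp [ht])]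
  simp only [h, Int.cast_sum, Int.cast_mul]
  rw [Finset.sum_comm, Finset.mul_sum]
  refine Finset.sum_congr rfl fun j hj => ?_
  rw [← Finset.mul_sum, show (k : ℕ) + 1 = ((k : ℕ) - j) + (j + 1) by
    have := Finset.mem_range.1 hj
    omega, pow_add]
  ring

theorem meanPower_eq_sum (k : ℕ+) : meanPower N k = ∑ j ∈ Finset.Icc 1 k,
    ((Nat.stirlingSecond k j : ℝ) * ((j : ℕ).factorial : ℝ) * (N : ℝ)⁻¹ ^ ((k : ℕ) - j)) •
      scaledBinom (N := N) (j : ℕ) := by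
  funext lam
  rw [meanPower_eq, sum_triangular _ k Finset.univ _ (fun j i => fallingInt (lam.1 i + staircase N i) j)
    (fun j => (Nat.stirlingSecond k j : ℤ)) (by
      obtain ⟨n, hn⟩ := Nat.exists_eq_succ_of_ne_zero k.ne_zero
      simp [hn]) (fun i => pow_eq_sum_fallingInt _ _), Finset.sum_apply]
  refine Finset.sum_congr rfl fun j _ => ?_
  have := Nat.factorial_ne_zero (j : ℕ)
  rw [Pi.smul_apply, smul_eq_mul, scaledBinom_eq]
  push_cast
  field_simp

theorem scaledBinom_eq_sum (k : ℕ+) : scaledBinom (N := N) (k : ℕ) = ∑ j ∈ Finset.Icc 1 k,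
    (((k : ℕ).factorial : ℝ)⁻¹ * ((descPochhammer ℤ k).coeff j : ℝ) * (N : ℝ)⁻¹ ^ ((k : ℕ) - j)) •
      meanPower N j := by
  funext lam
  rw [scaledBinom_eq, mul_left_comm, sum_triangular _ k Finset.univ _
    (fun j i => (lam.1 i + staircase N i) ^ j) (fun j => (descPochhammer ℤ k).coeff j) (by
      rw [Polynomial.coeff_zero_eq_eval_zero, descPochhammer_eval_zero, if_neg k.ne_zero])
    (fun i => fallingInt_eq_sum_pow _ _), Finset.sum_apply, Finset.mul_sum]
  refine Finset.sum_congr rfl fun j _ => ?_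
  rw [Pi.smul_apply, smul_eq_mul, meanPower_eq]
  push_cast
  ring

theorem tendsto_triangular_coeff (t : ℝ) {j k : ℕ+} (hj : j ∈ Finset.Icc 1 k) :
    Tendsto (fun N : ℕ => t * (N : ℝ)⁻¹ ^ ((k : ℕ) - j)) atTop (𝓝 (if j = k then t else 0)) := by
  split_ifs with h
  · simp [h]
  · have hlt : (j : ℕ) < k := PNat.coe_lt_coe _ _ |>.2 (lt_of_le_of_ne (Finset.mem_Icc.1 hj).2 h)
    have h0 : (k : ℕ) - j ≠ 0 := by omega
    simpa [zero_pow h0] using ((tendsto_inv_atTop_nhds_zero_nat (𝕜 := ℝ)).pow ((k : ℕ) - j)).const_mul t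

variable {ρ : (N : ℕ) → PMF (GT N)}

/-- Convergence of the rescaled joint cumulants of the random variables `x N k`. -/
def RVTendsto (ρ : (N : ℕ) → PMF (GT N)) (x : ∀ N, ℕ+ → GT N → ℝ) (l : Multiset ℕ+ → ℝ) : Prop :=
  ∀ μ, μ ≠ 0 → Tendsto (fun N : ℕ => (N : ℝ) ^ scaleExp (Multiset.card μ) *
    kumM (expectFunctional (ρ N)) (μ.map (x N))) atTop (𝓝 (l μ))

theorem eventually_expectFunctional_one (hρ : ∀ N, IsSmooth (ρ N)) :
    ∀ᶠ N in atTop, expectFunctional (ρ N) 1 = 1 :=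
  (eventually_ne_atTop 0).mono fun N hN => (hρ N).expectFunctional_one hN

theorem RVTendsto.toMeanPower (hρ : ∀ N, IsSmooth (ρ N)) {l : Multiset ℕ+ → ℝ}
    (h : RVTendsto ρ (fun _ k => scaledBinom (k : ℕ)) l) :
    RVTendsto ρ meanPower fun μ => (μ.map fun k : ℕ+ => ((k : ℕ).factorial : ℝ)).prod * l μ := by
  intro μ hμ
  refine tendsto_kumM_triangular (eventually_expectFunctional_one hρ)
    (Eventually.of_forall fun N k => meanPower_eq_sum k) (fun k j hj => ?_) h hμ
  convert tendsto_triangular_coeff _ hj using 2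
  split_ifs with hjk
  · rw [hjk, Nat.stirlingSecond_self, Nat.cast_one, one_mul]
  · rfl

theorem RVTendsto.toScaledBinom (hρ : ∀ N, IsSmooth (ρ N)) {l : Multiset ℕ+ → ℝ}
    (h : RVTendsto ρ meanPower l) : RVTendsto ρ (fun _ k => scaledBinom (k : ℕ)) fun μ =>
      (μ.map fun k : ℕ+ => ((k : ℕ).factorial : ℝ)⁻¹).prod * l μ := by
  intro μ hμ
  refine tendsto_kumM_triangular (eventually_expectFunctional_one hρ)
    (Eventually.of_forall fun N k => scaledBinom_eq_sum k) (fun k j hj => ?_) h hμ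
  convert tendsto_triangular_coeff _ hj using 2
  split_ifs with hjk
  · have : (descPochhammer ℤ (k : ℕ)).coeff k = 1 := by
      have := monic_descPochhammer ℤ (k : ℕ)
      rwa [Polynomial.Monic, Polynomial.leadingCoeff, descPochhammer_natDegree] at this
    rw [hjk, this, Int.cast_one, mul_one]
  · rfl

end PowerSums

/-! ### The central limit theorem in terms of rescaled cumulants. -/

section CLT

theorem kumM_singleton {A : Type*} [CommRing A] [Algebra ℝ A] {E : A →ₗ[ℝ] ℝ} (hE : E 1 = 1)
    (a : A) : kumM E {a} = E a := by
  rw [← kum_singleton hE (fun _ : ℕ => a) 0, kum_eq_kumM hE _ (Finset.singleton_nonempty 0)]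
  rfl

theorem kumM_pair {A : Type*} [CommRing A] [Algebra ℝ A] {E : A →ₗ[ℝ] ℝ} (hE : E 1 = 1)
    (a b : A) : kumM E {a, b} = E (a * b) - E a * E b := by
  let x : Bool → A := fun j => cond j a b
  have h := kum_rec hE x (I := {true, false}) (i := true) (by simp)
  have h2 : kum E x {true, false} = kumM E {a, b} := kum_eq_kumM hE x (by simp)
  have e1 : ({true, false} : Finset Bool).erase true = {false} := by decide
  have e2 : ({false} : Finset Bool).powerset = {∅, {false}} := by decide
  rw [e1, e2, Finset.sum_pair (by decide), insert_empty_eq, kum_singleton hE, h2,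
    Finset.prod_pair (by decide)] at h
  simp only [Finset.sdiff_empty, Finset.prod_singleton, sdiff_self, Finset.bot_eq_empty,
    Finset.prod_empty, hE, mul_one, x, cond_true, cond_false] at h
  linarith

variable {N : ℕ} {τ : PMF (GT N)}

theorem powerSum_eq_smul (hN : N ≠ 0) (k : ℕ+) : powerSum N k = (N : ℝ) • meanPower N k := by
  funext lam
  rw [Pi.smul_apply, smul_eq_mul, meanPower, mul_inv_cancel_left₀ (Nat.cast_ne_zero.2 hN)]

theorem powerSum_mem_binomAlgebra (hN : N ≠ 0) (k : ℕ+) : powerSum N k ∈ binomAlgebra N := by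
  rw [powerSum_eq_smul hN, meanPower_eq_sum]
  exact Subalgebra.smul_mem _ (sum_mem fun j _ => Subalgebra.smul_mem _ (scaledBinom_mem_binomAlgebra j) _) _

/-- `Finpartition` and `setParts` describe the same partitions: the empty block is excluded and the
blocks are disjoint with union the whole set. -/
theorem cumulant_eq_cum (ξ : ℕ+ → GT N → ℝ) {r : ℕ} (k : Fin r → ℕ+) :
    cumulant τ ξ k = cum (fun U => expect τ (∏ j ∈ U, ξ (k j))) Finset.univ := by
  rw [cumulant, cum]
  refine Finset.sum_bij (fun π _ => π.parts) (fun π _ => ?_) (fun π _ π' _ h => Finpartition.ext h)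
    (fun s hs => ?_) (fun π _ => ?_)
  · exact mem_setParts.2 ⟨π.bot_notMem, fun U hU V hV h => π.disjoint hU hV h,
      Finset.sup_eq_biUnion π.parts id ▸ π.sup_parts⟩
  · obtain ⟨h1, h2, h3⟩ := mem_setParts.1 hs
    exact ⟨⟨s, Finset.supIndep_iff_pairwiseDisjoint.2 fun U hU V hV h => h2 U hU V hV h,
      (Finset.sup_eq_biUnion s id).trans h3, h1⟩, Finset.mem_univ _, rfl⟩
  · simp only [Finset.prod_fn]

theorem IsSmooth.cumulant_eq (h : IsSmooth τ) (hN : N ≠ 0) {r : ℕ} (hr : r ≠ 0) (k : Fin r → ℕ+) :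
    cumulant τ (powerSum N) k = (N : ℝ) ^ r *
      kumM (expectFunctional τ) ((Finset.univ.val.map k).map (meanPower N)) := by
  have : NeZero r := ⟨hr⟩
  have h1 : cumulant τ (powerSum N) k = kum (expectFunctional τ) (fun j => powerSum N (k j)) Finset.univ := by
    rw [cumulant_eq_cum]
    exact cum_congr fun U _ => (h.expectFunctional_eq hN
      (prod_mem fun j _ => powerSum_mem_binomAlgebra hN (k j))).symm
  have h2 : kum (expectFunctional τ) (fun j => powerSum N (k j)) Finset.univ =
      kum (expectFunctional τ) (fun j => (N : ℝ) • meanPower N (k j)) Finset.univ :=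
    kum_congr fun j _ => powerSum_eq_smul hN _
  rw [h1, h2, kum_smul, Finset.prod_const, Finset.card_univ, Fintype.card_fin,
    kum_eq_kumM (h.expectFunctional_one hN) _ Finset.univ_nonempty, Multiset.map_map]
  rfl

/-- This first-order identity explains the scale N^0 for means: p_k/N is already the variable used
in the rescaled cumulants. -/
theorem IsSmooth.mean_eq (h : IsSmooth τ) (hN : N ≠ 0) (k : ℕ+) :
    1 / (N : ℝ) * expect τ (powerSum N k) = kumM (expectFunctional τ) {meanPower N k} := by
  rw [← h.expectFunctional_eq hN (powerSum_mem_binomAlgebra hN k), powerSum_eq_smul hN, map_smul,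
    smul_eq_mul, one_div, inv_mul_cancel_left₀ (Nat.cast_ne_zero.2 hN),
    kumM_singleton (h.expectFunctional_one hN)]

theorem IsSmooth.covariance_eq (h : IsSmooth τ) (hN : N ≠ 0) (k m : ℕ+) :
    expect τ (fun lam => powerSum N k lam * powerSum N m lam) -
      expect τ (powerSum N k) * expect τ (powerSum N m) =
    (N : ℝ) ^ 2 * kumM (expectFunctional τ) {meanPower N k, meanPower N m} := by
  have hk := powerSum_mem_binomAlgebra hN k
  have hm := powerSum_mem_binomAlgebra hN m
  have e : (fun lam => powerSum N k lam * powerSum N m lam) = powerSum N k * powerSum N m := rfl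
  rw [e, ← h.expectFunctional_eq hN hk, ← h.expectFunctional_eq hN hm,
    ← h.expectFunctional_eq hN (mul_mem hk hm), powerSum_eq_smul hN, powerSum_eq_smul hN,
    smul_mul_smul_comm, map_smul, map_smul, map_smul, kumM_pair (h.expectFunctional_one hN)]
  simp only [smul_eq_mul]
  ring

variable {ρ : (N : ℕ) → PMF (GT N)}

theorem RVTendsto.satisfiesCLTWith (hρ : ∀ N, IsSmooth (ρ N)) {l : Multiset ℕ+ → ℝ}
    (h : RVTendsto ρ meanPower l) (hl : ∀ μ, 3 ≤ Multiset.card μ → l μ = 0) :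
    SatisfiesCLTWith ρ (fun k => l {k}) (fun k m => l {k, m}) where
  mean k := by
    refine (h {k} (by simp)).congr' ((eventually_ne_atTop 0).mono fun N hN => ?_)
    beta_reduce
    rw [(hρ N).mean_eq hN, Multiset.card_singleton, scaleExp_one, pow_zero, one_mul,
      Multiset.map_singleton]
  covariance k m := by
    refine (h {k, m} (by simp)).congr' ((eventually_ne_atTop 0).mono fun N hN => ?_)
    beta_reduce
    rw [(hρ N).covariance_eq hN, Multiset.card_pair, scaleExp_of_ne_one (by norm_num)]
    rfl
  higher r hr k := by
    have hc : Multiset.card ((Finset.univ : Finset (Fin r)).val.map k) = r := by simp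
    rw [← hl _ (hc.symm ▸ hr)]
    refine (h ((Finset.univ : Finset (Fin r)).val.map k) (fun h0 => ?_)).congr'
      ((eventually_ne_atTop 0).mono fun N hN => ?_)
    · rw [h0, Multiset.card_zero] at hc
      omega
    · beta_reduce
      rw [(hρ N).cumulant_eq hN (by omega), hc, scaleExp_of_ne_one (by omega)]

/-- The limits of the rescaled joint cumulants when a CLT holds. -/
noncomputable def cltLimit (p : ℕ+ → ℝ) (cov : ℕ+ → ℕ+ → ℝ) (μ : Multiset ℕ+) : ℝ :=
  if Multiset.card μ = 1 then p (multEnum μ 0)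
  else if Multiset.card μ = 2 then cov (multEnum μ 0) (multEnum μ 1) else 0

theorem SatisfiesCLTWith.rvTendsto (hρ : ∀ N, IsSmooth (ρ N)) {p : ℕ+ → ℝ} {cov : ℕ+ → ℕ+ → ℝ}
    (h : SatisfiesCLTWith ρ p cov) : RVTendsto ρ meanPower (cltLimit p cov) := by
  intro μ hμ
  rw [cltLimit]
  split_ifs with h1 h2
  · refine (h.mean (multEnum μ 0)).congr' ((eventually_ne_atTop 0).mono fun N hN => ?_)
    beta_reduce
    rw [(hρ N).mean_eq hN, h1, scaleExp_one, pow_zero, one_mul]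
    have e : ∀ f : ℕ → ℕ+, (Finset.range 1).val.map f = {f 0} := fun f => rfl
    conv_rhs => rw [← map_multEnum μ, h1, e]
    rw [Multiset.map_singleton]
  · refine (h.covariance (multEnum μ 0) (multEnum μ 1)).congr'
      ((eventually_ne_atTop 0).mono fun N hN => ?_)
    beta_reduce
    rw [(hρ N).covariance_eq hN, h2, scaleExp_of_ne_one (by norm_num)]
    have e : ∀ f : ℕ → ℕ+, (Finset.range 2).val.map f = {f 0, f 1} := fun f => rfl
    conv_rhs => rw [← map_multEnum μ, h2, e]
    simp only [Multiset.insert_eq_cons, Multiset.map_cons, Multiset.map_singleton]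
  · have h0 : Multiset.card μ ≠ 0 := by simpa using hμ
    refine (h.higher (Multiset.card μ) (by omega) (fun i => multEnum μ i)).congr'
      ((eventually_ne_atTop 0).mono fun N hN => ?_)
    beta_reduce
    rw [(hρ N).cumulant_eq hN h0, map_univ_multEnum, scaleExp_of_ne_one h1]

end CLT

/-! ### Equivalence of the two notions. -/

section Equivalence

variable {ρ : (N : ℕ) → PMF (GT N)}

/-- The triangular change of basis turns the CLT for power sums into limits for binomial sums, and
the inversion by weight does the rest. -/
theorem SatisfiesCLTWith.varCLT (hρ : ∀ N, IsSmooth (ρ N)) {p : ℕ+ → ℝ} {cov : ℕ+ → ℕ+ → ℝ}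
    (h : SatisfiesCLTWith ρ p cov) :
    VarCLT (fun N => measFunctional (ρ N)) (cumLim fun N => measFunctional (ρ N)) := by
  have h1 := (h.rvTendsto hρ).toScaledBinom hρ
  have key := cumTendsto_of_binomCum (F := fun N => measFunctional (ρ N))
    (fun N => (hρ N).measFunctional_one) (y := fun μ =>
      (μ.map fun k : ℕ+ => ((k : ℕ).factorial : ℝ)⁻¹).prod * cltLimit p cov μ)
    (fun κ hκ => by
      rw [cltLimit, if_neg (by omega), if_neg (by omega), mul_zero])
    (fun κ hκ => (h1 κ hκ).congr' ((eventually_ne_atTop 0).mono fun N hN => by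
      beta_reduce
      rw [(hρ N).binomCum_eq hN hκ]))
  exact ⟨fun n => (key n).1, fun μ hμ => (key (multWeight μ)).2 μ le_rfl hμ⟩

theorem VarCLT.tendsto_scaledBinom (hρ : ∀ N, IsSmooth (ρ N)) {γ : Multiset ℕ+ → ℝ}
    (h : VarCLT (fun N => measFunctional (ρ N)) γ) (k : ℕ → ℕ+) {J : Finset ℕ} (hJ : J.Nonempty) :
    Tendsto (fun N : ℕ => (N : ℝ) ^ scaleExp J.card * kumM (expectFunctional (ρ N))
      ((J.val.map k).map fun m : ℕ+ => scaledBinom (m : ℕ))) atTop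
      (𝓝 (binomLimit γ (∑ j ∈ J, (k j : ℕ)) (fun j => (k j : ℕ)) J)) :=
  ((h.1 _).binom (fun N => (hρ N).measFunctional_one) (fun j => (k j : ℕ)) hJ le_rfl).congr'
    ((eventually_ne_atTop 0).mono fun N hN => by
      beta_reduce
      rw [(hρ N).cum_univMoment hN k hJ])

/-- The limit of the joint cumulant of the random variables `scaledBinom k`, `k ∈ μ`. -/
noncomputable def multLimit (γ : Multiset ℕ+ → ℝ) (μ : Multiset ℕ+) : ℝ :=
  binomLimit γ (∑ j ∈ Finset.range (Multiset.card μ), (multEnum μ j : ℕ))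
    (fun j => (multEnum μ j : ℕ)) (Finset.range (Multiset.card μ))

theorem VarCLT.rvTendsto (hρ : ∀ N, IsSmooth (ρ N)) {γ : Multiset ℕ+ → ℝ}
    (h : VarCLT (fun N => measFunctional (ρ N)) γ) :
    RVTendsto ρ (fun _ k => scaledBinom (k : ℕ)) (multLimit γ) := by
  intro μ hμ
  have := h.tendsto_scaledBinom hρ (multEnum μ) (J := Finset.range (Multiset.card μ)) (by simpa using hμ)
  rwa [map_multEnum, Finset.card_range] at this

/-- The limit does not depend on the enumeration of the multiset, since both expressions are limits
of the same sequence. -/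
theorem VarCLT.multLimit_map (hρ : ∀ N, IsSmooth (ρ N)) {γ : Multiset ℕ+ → ℝ}
    (h : VarCLT (fun N => measFunctional (ρ N)) γ) (k : ℕ → ℕ+) {J : Finset ℕ} (hJ : J.Nonempty) :
    multLimit γ (J.val.map k) = binomLimit γ (∑ j ∈ J, (k j : ℕ)) (fun j => (k j : ℕ)) J := by
  have h1 := h.rvTendsto hρ (J.val.map k) (by simpa using hJ.ne_empty)
  rw [Multiset.card_map, Finset.card_val] at h1
  exact tendsto_nhds_unique h1 (h.tendsto_scaledBinom hρ k hJ)

theorem VarCLT.satisfiesCLTWith (hρ : ∀ N, IsSmooth (ρ N)) {γ : Multiset ℕ+ → ℝ}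
    (h : VarCLT (fun N => measFunctional (ρ N)) γ) :
    SatisfiesCLTWith ρ (fun k => ((k : ℕ).factorial : ℝ) * multLimit γ {k})
      (fun k m => ((k : ℕ).factorial : ℝ) * ((m : ℕ).factorial : ℝ) * multLimit γ {k, m}) := by
  have := ((h.rvTendsto hρ).toMeanPower hρ).satisfiesCLTWith hρ (fun μ hμ => by
    rw [multLimit, binomLimit_of_three_le _ (by rwa [Finset.card_range]) h.2, mul_zero])
  simpa using this

theorem SatisfiesCLTWith.unique {p p' : ℕ+ → ℝ} {cov cov' : ℕ+ → ℕ+ → ℝ}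
    (h : SatisfiesCLTWith ρ p cov) (h' : SatisfiesCLTWith ρ p' cov') : p = p' ∧ cov = cov' :=
  ⟨funext fun k => tendsto_nhds_unique (h.mean k) (h'.mean k), funext fun k => funext fun m =>
    tendsto_nhds_unique (h.covariance k m) (h'.covariance k m)⟩

theorem satisfiesCLT_iff_cltAppropriate (hρ : ∀ N, IsSmooth (ρ N)) :
    SatisfiesCLT ρ ↔ CLTAppropriate ρ :=
  ⟨fun ⟨_, _, h⟩ => ⟨_, _, (h.varCLT hρ).cltAppropriateWith hρ⟩,
    fun ⟨_, _, h⟩ => ⟨_, _, (h.varCLT hρ).satisfiesCLTWith hρ⟩⟩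

end Equivalence

/-! ### Coefficient formulas for the limiting means. -/

section LimitFormulas

variable {R : Type*} [CommRing R] [Algebra ℚ R]

/-- `1 + ∑_{a ≥ 1} c_a z^a / (a-1)!`. -/
noncomputable def genSeries (c : ℕ+ → R) : PowerSeries R :=
  1 + PowerSeries.X * PowerSeries.mk fun a => algebraMap ℚ R (a.factorial : ℚ)⁻¹ * c a.succPNat

theorem map_genSeries {S : Type*} [CommRing S] [Algebra ℚ S] (φ : R →+* S) (c : ℕ+ → R) :
    PowerSeries.map φ (genSeries c) = genSeries fun a => φ (c a) := by
  rw [genSeries, genSeries, map_add, map_mul, map_one, PowerSeries.map_X]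
  have h : PowerSeries.map φ (PowerSeries.mk fun a => algebraMap ℚ R (a.factorial : ℚ)⁻¹ * c a.succPNat) =
      PowerSeries.mk fun a => algebraMap ℚ S (a.factorial : ℚ)⁻¹ * φ (c a.succPNat) := by
    ext a
    rw [PowerSeries.coeff_map, PowerSeries.coeff_mk, PowerSeries.coeff_mk, map_mul]
    congr 1
    exact RingHom.congr_fun (Subsingleton.elim (φ.comp (algebraMap ℚ R)) (algebraMap ℚ S)) _
  rw [h]

/-- The coefficient of `z^n` in `(1+z)^l (1/z + ∑_{a ≥ 1} c_a z^{a-1} / (a-1)!)^q`, shifted by `q`. -/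
noncomputable def genCoeff (c : ℕ+ → R) (l q n : ℕ) : R :=
  PowerSeries.coeff n ((1 + PowerSeries.X) ^ l * genSeries c ^ q)

theorem map_genCoeff {S : Type*} [CommRing S] [Algebra ℚ S] (φ : R →+* S) (c : ℕ+ → R) (l q n : ℕ) :
    φ (genCoeff c l q n) = genCoeff (fun a => φ (c a)) l q n := by
  rw [genCoeff, genCoeff, ← map_genSeries, ← PowerSeries.coeff_map]
  simp only [map_mul, map_pow, map_add, map_one, PowerSeries.map_X]

/-- The coefficient is formed once with indeterminates over ℚ and then specialized, which is what
polynomial dependence with rational coefficients means. -/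
theorem exists_genCoeff (l q n : ℕ) : ∃ P : MvPolynomial ℕ+ ℚ, ∀ c : ℕ+ → ℝ,
    genCoeff c l q n = MvPolynomial.aeval c P := by
  refine ⟨genCoeff MvPolynomial.X l q n, fun c => ?_⟩
  have := map_genCoeff (MvPolynomial.aeval c : MvPolynomial ℕ+ ℚ →ₐ[ℚ] ℝ).toRingHom MvPolynomial.X l q n
  refine Eq.trans ?_ this.symm
  congr
  funext a
  exact (MvPolynomial.aeval_X c a).symm

variable {K : Type*} [Field K] [Algebra ℚ K]

theorem fSeries_eq (c : ℕ+ → K) : fSeries c = zInv K *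
    HahnSeries.ofPowerSeries ℤ K ((1 + PowerSeries.X) * genSeries c) := by
  have hz : zInv K * HahnSeries.ofPowerSeries ℤ K PowerSeries.X = 1 := by
    rw [HahnSeries.ofPowerSeries_X, zInv, HahnSeries.single_mul_single]
    simp
  have hz' : (zVar K)⁻¹ = zInv K := by
    rw [zVar, HahnSeries.inv_single, inv_one, zInv]
  rw [fSeries, hz', genSeries, map_mul, map_add, map_add, map_mul, map_one,
    HahnSeries.ofPowerSeries_X]
  have hm : (PowerSeries.mk fun a : ℕ => c a.succPNat / (a.factorial : K)) =
      PowerSeries.mk fun a => algebraMap ℚ K (a.factorial : ℚ)⁻¹ * c a.succPNat := by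
    ext a
    rw [PowerSeries.coeff_mk, PowerSeries.coeff_mk, map_inv₀, map_natCast, div_eq_inv_mul]
  rw [HahnSeries.ofPowerSeries_X] at hz
  rw [hm, zVar]
  linear_combination (-(1 + HahnSeries.single 1 1) * HahnSeries.ofPowerSeries ℤ K
    (PowerSeries.mk fun a => algebraMap ℚ K (a.factorial : ℚ)⁻¹ * c a.succPNat)) * hz

theorem coeff_zInv_pow_mul_ofPowerSeries {A : Type*} [CommRing A] (q : ℕ) (f : PowerSeries A) (i : ℤ) :
    (zInv A ^ q * HahnSeries.ofPowerSeries ℤ A f).coeff i =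
      if i + q < 0 then 0 else PowerSeries.coeff (i + q).toNat f := by
  rw [coeff_zInv_pow_mul, PowerSeries.coeff_coe]
  split_ifs with h
  · rfl
  · rw [show (i + q).natAbs = (i + q).toNat by omega]

theorem coeff_fSeries_pow (c : ℕ+ → K) (k : ℕ) (i : ℤ) :
    (fSeries c ^ k).coeff i = if i + k < 0 then 0 else genCoeff c k k (i + k).toNat := by
  rw [fSeries_eq, mul_pow, ← map_pow, coeff_zInv_pow_mul_ofPowerSeries, mul_pow, genCoeff]

theorem limitMean_eq (c : ℕ+ → ℝ) (k : ℕ+) :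
    limitMean c k = ((k : ℕ) + 1 : ℝ)⁻¹ * genCoeff c k (k + 1) k := by
  have hu : HahnSeries.ofPowerSeries ℤ ℝ (1 + PowerSeries.X) = 1 + zVar ℝ := by
    rw [map_add, map_one, HahnSeries.ofPowerSeries_X, zVar]
  have hu0 : (1 + zVar ℝ) ≠ 0 := by
    intro h
    have := congrArg (fun f : LaurentSeries ℝ => f.coeff 0) h
    simp [zVar] at this
  have hk : ((k : ℕ) + 1 : LaurentSeries ℝ) = HahnSeries.C ((k : ℕ) + 1 : ℝ) := by
    rw [map_add, map_natCast, map_one]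
  have hk0 : ((k : ℕ) + 1 : ℝ) ≠ 0 := by positivity
  have key : (((k : ℕ) + 1 : LaurentSeries ℝ) * (1 + zVar ℝ))⁻¹ * fSeries c ^ ((k : ℕ) + 1) =
      HahnSeries.C ((k : ℕ) + 1 : ℝ)⁻¹ * (zInv ℝ ^ ((k : ℕ) + 1) * HahnSeries.ofPowerSeries ℤ ℝ
        ((1 + PowerSeries.X) ^ (k : ℕ) * genSeries c ^ ((k : ℕ) + 1))) := by
    rw [mul_inv, hk, ← map_inv₀, fSeries_eq, mul_pow, mul_assoc]
    congr 1
    rw [map_mul, map_mul, map_pow, mul_pow, hu, map_pow, pow_succ (1 + zVar ℝ)]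
    field_simp
  rw [limitMean, key, HahnSeries.C_apply, HahnSeries.coeff_single_zero_mul,
    coeff_zInv_pow_mul_ofPowerSeries, if_neg (by push_cast; omega), genCoeff]
  congr 3
  push_cast
  omega

end LimitFormulas

/-! ### Coefficient formulas for the limiting covariances. -/

section CovarianceFormula

theorem coeff_neg_one_mul_ofPowerSeries {A : Type*} [CommRing A] {k : ℕ} (hk : k ≠ 0)
    (g p : PowerSeries A) :
    (zInv A ^ k * HahnSeries.ofPowerSeries ℤ A g * HahnSeries.ofPowerSeries ℤ A p).coeff (-1) =
      ∑ n ∈ Finset.range k, PowerSeries.coeff (k - 1 - n) g * PowerSeries.coeff n p := by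
  obtain ⟨k, rfl⟩ := Nat.exists_eq_succ_of_ne_zero hk
  rw [mul_assoc, ← map_mul, coeff_zInv_pow_mul_ofPowerSeries, if_neg (by push_cast; omega),
    show (-1 + ((k.succ : ℕ) : ℤ)).toNat = k by push_cast; omega, mul_comm g, PowerSeries.coeff_mul,
    Finset.Nat.sum_antidiagonal_eq_sum_range_succ_mk]
  exact Finset.sum_congr rfl fun n _ => mul_comm _ _

/-- All n + 1 ways of writing n = a + b give the same monomial w^{-2-n}. -/
theorem coeff_geom_sq (n : ℕ) : PowerSeries.coeff n
    ((PowerSeries.mk fun a : ℕ => (HahnSeries.single (-(1 + (a : ℤ))) (1 : ℝ) : LaurentSeries ℝ)) ^ 2) =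
      HahnSeries.single (-(2 + (n : ℤ))) ((n : ℝ) + 1) := by
  rw [sq, PowerSeries.coeff_mul, Finset.sum_congr rfl (g := fun _ =>
    (HahnSeries.single (-(2 + (n : ℤ))) (1 : ℝ) : LaurentSeries ℝ)) (fun x hx => ?_)]
  · rw [Finset.sum_const, Finset.Nat.card_antidiagonal]
    ext i
    rw [HahnSeries.coeff_nsmul, Pi.smul_apply, HahnSeries.coeff_single, HahnSeries.coeff_single]
    split_ifs <;> simp
  · rw [PowerSeries.coeff_mk, PowerSeries.coeff_mk, HahnSeries.single_mul_single, one_mul]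
    rw [Finset.HasAntidiagonal.mem_antidiagonal] at hx
    rw [← hx, show -(1 + (x.1 : ℤ)) + -(1 + (x.2 : ℤ)) = -(2 + ((x.1 + x.2 : ℕ) : ℤ)) by push_cast; ring]

/-- Since f(z)^k has a pole of order at most k, only z-exponents n < k matter. The geometric square
then asks for the coefficient of w^{n+1} in f(w)^m with multiplicity n + 1, and the d-part for a
residue in w. -/
theorem limitCov_eq (c : ℕ+ → ℝ) (d : ℕ+ → ℕ+ → ℝ) (k m : ℕ+) :
    limitCov c d k m = ∑ n ∈ Finset.range k, genCoeff c k k (k - 1 - n) *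
      (((n : ℝ) + 1) * genCoeff c m m (n + 1 + m) + ∑ b ∈ Finset.range m,
        genCoeff c m m (m - 1 - b) * (d n.succPNat b.succPNat / (n.factorial * b.factorial : ℝ))) := by
  set g : PowerSeries (LaurentSeries ℝ) :=
    PowerSeries.mk fun a : ℕ => HahnSeries.single (-(1 + (a : ℤ))) (1 : ℝ) with hg
  set q : ℕ → PowerSeries ℝ := fun a => PowerSeries.mk fun b : ℕ =>
    d a.succPNat b.succPNat / ((a.factorial : ℝ) * (b.factorial : ℝ)) with hq
  set A : PowerSeries (LaurentSeries ℝ) := ((1 + PowerSeries.X) *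
    genSeries (fun a => (HahnSeries.C (c a) : LaurentSeries ℝ))) ^ (k : ℕ) with hA
  have e1 : (HahnSeries.C (fSeries c) : LaurentSeries (LaurentSeries ℝ)) ^ (m : ℕ) =
      HahnSeries.ofPowerSeries ℤ (LaurentSeries ℝ) (PowerSeries.C (fSeries c ^ (m : ℕ))) := by
    rw [HahnSeries.ofPowerSeries_C, map_pow]
  have e2 : fSeries (fun a => (HahnSeries.C (c a) : LaurentSeries ℝ)) ^ (k : ℕ) *
      HahnSeries.C (fSeries c) ^ (m : ℕ) * (geomSeries ^ 2 + dSeries d) =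
      zInv (LaurentSeries ℝ) ^ (k : ℕ) * HahnSeries.ofPowerSeries ℤ (LaurentSeries ℝ) A *
        HahnSeries.ofPowerSeries ℤ (LaurentSeries ℝ) (PowerSeries.C (fSeries c ^ (m : ℕ)) *
          (g ^ 2 + PowerSeries.mk fun a => HahnSeries.ofPowerSeries ℤ ℝ (q a))) := by
    rw [e1, fSeries_eq (K := LaurentSeries ℝ), mul_pow, ← map_pow, map_mul _ (PowerSeries.C _), map_add, map_pow _ g,
      mul_assoc _ (HahnSeries.ofPowerSeries ℤ (LaurentSeries ℝ) (PowerSeries.C _))]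
    rfl
  have hcoeff : ∀ j, PowerSeries.coeff j A = HahnSeries.C (genCoeff c k k j) := fun j => by
    rw [map_genCoeff, genCoeff, hA, mul_pow]
  rw [limitCov, e2, coeff_neg_one_mul_ofPowerSeries k.ne_zero, HahnSeries.coeff_sum]
  refine Finset.sum_congr rfl fun n _ => ?_
  rw [hcoeff, HahnSeries.C_apply, HahnSeries.coeff_single_zero_mul, PowerSeries.coeff_C_mul, map_add,
    coeff_geom_sq, PowerSeries.coeff_mk, mul_add, HahnSeries.coeff_add, HahnSeries.coeff_mul_single]
  congr 2
  · rw [coeff_fSeries_pow, if_neg (by omega), mul_comm]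
    congr 2
    omega
  · rw [fSeries_eq, mul_pow, ← map_pow, coeff_neg_one_mul_ofPowerSeries m.ne_zero]
    refine Finset.sum_congr rfl fun b _ => ?_
    rw [hq, PowerSeries.coeff_mk, mul_pow, genCoeff]

theorem exists_limitMean_polynomial (k : ℕ+) : ∃ P : MvPolynomial ℕ+ ℚ, ∀ c : ℕ+ → ℝ,
    limitMean c k = MvPolynomial.aeval c P := by
  obtain ⟨P, hP⟩ := exists_genCoeff k (k + 1) k
  refine ⟨MvPolynomial.C ((k : ℕ) + 1 : ℚ)⁻¹ * P, fun c => ?_⟩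
  rw [limitMean_eq, hP, map_mul, MvPolynomial.aeval_C]
  simp

theorem exists_limitCov_polynomial (k m : ℕ+) : ∃ Q : MvPolynomial (ℕ+ ⊕ ℕ+ × ℕ+) ℚ,
    ∀ (c : ℕ+ → ℝ) (d : ℕ+ → ℕ+ → ℝ),
      limitCov c d k m = MvPolynomial.aeval (Sum.elim c fun ab => d ab.1 ab.2) Q := by
  choose P hP using exists_genCoeff
  refine ⟨∑ n ∈ Finset.range k, MvPolynomial.rename Sum.inl (P k k (k - 1 - n)) *
    (((n : MvPolynomial (ℕ+ ⊕ ℕ+ × ℕ+) ℚ) + 1) * MvPolynomial.rename Sum.inl (P m m (n + 1 + m)) +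
      ∑ b ∈ Finset.range m, MvPolynomial.rename Sum.inl (P m m (m - 1 - b)) *
        (MvPolynomial.X (Sum.inr (n.succPNat, b.succPNat)) *
          MvPolynomial.C ((n.factorial * b.factorial : ℚ)⁻¹))), fun c d => ?_⟩
  rw [limitCov_eq]
  simp only [map_sum, map_mul, map_add, map_natCast, map_one, MvPolynomial.aeval_X,
    MvPolynomial.aeval_rename, Sum.elim_comp_inl, ← hP, MvPolynomial.aeval_C, Sum.elim_inr, map_inv₀,
    div_eq_mul_inv]

theorem factorial_mul_twist_zero {A : Type*} [CommRing A] [Algebra ℚ A] (B : PowerSeries A) (n : ℕ) :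
    (n.factorial : LaurentSeries A) * twist 0 1 B n =
      (zInv A + HahnSeries.ofPowerSeries ℤ A B) ^ n := by
  induction n with
  | zero => simp [twist]
  | succ n ih =>
    rw [Nat.factorial_succ, pow_succ, ← ih]
    push_cast
    have := twist_succ (0 : A) 1 B n
    simp only [map_zero, zero_mul, map_one, one_mul, zero_add] at this
    linear_combination (n.factorial : LaurentSeries A) * this

/-- With c_m = m! γ{m} the coefficient m β_m becomes c_m/(m-1)! at the limiting means, so φ turns
into f(z)/(1+z). -/
theorem evalMean_phiPow (γ : Multiset ℕ+ → ℝ) (l q : ℕ) (i : ℤ) :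
    (q.factorial : ℝ) * evalMean γ ((phiPow l q).coeff i) =
      if i + q < 0 then 0 else genCoeff (fun m => (m : ℕ).factorial * γ {m}) l q (i + q).toNat := by
  have hB : PowerSeries.map (evalMean γ).toRingHom (derivGen (varSeq ℝ)) =
      PowerSeries.mk fun a => algebraMap ℚ ℝ (a.factorial : ℚ)⁻¹ *
        (((a.succPNat : ℕ).factorial : ℝ) * γ {a.succPNat}) := by
    ext a
    rw [PowerSeries.coeff_map, derivGen, PowerSeries.coeff_mk, PowerSeries.coeff_mk, varSeq]
    have h1 : (evalMean γ).toRingHom (((a : MvPolynomial ℕ+ ℝ) + 1) * MvPolynomial.X a.succPNat) =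
        (a + 1) * γ {a.succPNat} := by
      change evalMean γ _ = _
      rw [map_mul, map_add, map_natCast, map_one, evalMean, MvPolynomial.aeval_X]
    have := Nat.cast_ne_zero (R := ℝ) |>.2 (Nat.factorial_ne_zero a)
    rw [h1, map_inv₀, map_natCast, Nat.succPNat_coe, Nat.succ_eq_add_one, Nat.factorial_succ]
    push_cast
    field_simp
  have hz : zInv ℝ * HahnSeries.ofPowerSeries ℤ ℝ PowerSeries.X = 1 := by
    rw [HahnSeries.ofPowerSeries_X, zInv, HahnSeries.single_mul_single]
    simp
  have h1 := laurentMap_coeff (evalMean γ).toRingHom (phiPow l q) i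
  have h2 : (evalMean γ).toRingHom ((phiPow l q).coeff i) = evalMean γ ((phiPow l q).coeff i) := rfl
  have h3 : zInv ℝ + HahnSeries.ofPowerSeries ℤ ℝ (PowerSeries.map (evalMean γ).toRingHom
      (derivGen (varSeq ℝ))) = zInv ℝ * HahnSeries.ofPowerSeries ℤ ℝ
        (genSeries fun m => (m : ℕ).factorial * γ {m}) := by
    rw [hB, genSeries, map_add, map_mul, map_one (HahnSeries.ofPowerSeries ℤ ℝ), mul_add, mul_one,
      ← mul_assoc, hz, one_mul]
  rw [← h2, ← h1, ← nsmul_eq_mul, ← Pi.smul_apply, ← HahnSeries.coeff_nsmul, nsmul_eq_mul, phiPow,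
    map_mul, mul_left_comm, laurentMap_twist, map_pow, map_add, map_one (laurentMap _),
    laurentMap_single, map_zero, map_one (evalMean γ).toRingHom, factorial_mul_twist_zero, h3, mul_pow,
    mul_left_comm, genCoeff, ← map_pow (HahnSeries.ofPowerSeries ℤ ℝ) (genSeries _),
    ← coeff_zInv_pow_mul_ofPowerSeries, map_mul, map_pow _ (1 + PowerSeries.X), map_add,
    HahnSeries.ofPowerSeries_X, map_one (HahnSeries.ofPowerSeries ℤ ℝ)]

end CovarianceFormula

/-! ### Identification of the limits and the theorem. -/

section Main

theorem factorial_mul_evalMean_limitPart (γ : Multiset ℕ+ → ℝ) (k : ℕ+) :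
    ((k : ℕ).factorial : ℝ) * evalMean γ (limitPart k) =
      limitMean (fun m => (m : ℕ).factorial * γ {m}) k := by
  have h := evalMean_phiPow γ k (k + 1) (-1)
  rw [if_neg (by push_cast; omega), show (-1 + (((k : ℕ) + 1 : ℕ) : ℤ)).toNat = k by omega,
    Nat.factorial_succ] at h
  have h0 : ((k : ℕ) + 1 : ℝ) ≠ 0 := by positivity
  rw [limitMean_eq, ← h, limitPart]
  push_cast
  field_simp

theorem factorial_mul_evalMean_pderiv (γ : Multiset ℕ+ → ℝ) (k m : ℕ+) :
    ((k : ℕ).factorial : ℝ) * evalMean γ (MvPolynomial.pderiv m (limitPart k)) =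
      if k < m then 0 else (m : ℕ) * genCoeff (fun m => (m : ℕ).factorial * γ {m}) k k (k - m) := by
  have h := evalMean_phiPow γ k k (-(m : ℕ))
  rw [pderiv_limitPart, map_mul, map_natCast, mul_left_comm, h]
  simp only [← PNat.coe_lt_coe k m]
  split_ifs with h1 h2 h2
  · rw [mul_zero]
  · omega
  · omega
  · rw [show (-((m : ℕ) : ℤ) + (k : ℕ)).toNat = k - m by omega]

theorem sum_eq_sum_range {M : Type*} [AddCommMonoid M] (k : ℕ+) (S : Finset ℕ+) (hS : Finset.Icc 1 k ≤ S)
    (g : ℕ+ → M) (h0 : ∀ m, k < m → g m = 0) :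
    ∑ m ∈ S, g m = ∑ n ∈ Finset.range k, g n.succPNat := by
  rw [← Finset.sum_subset hS fun m _ hm => h0 m (by
    by_contra hlt
    exact hm (Finset.mem_Icc.2 ⟨one_le, not_lt.1 hlt⟩))]
  symm
  refine Finset.sum_bij (fun n _ => n.succPNat) (fun n hn => ?_) (fun a _ b _ h => ?_) (fun m hm => ?_)
    (fun _ _ => rfl)
  · exact Finset.mem_Icc.2 ⟨one_le, PNat.coe_le_coe _ _ |>.1 (Finset.mem_range.1 hn)⟩
  · exact Nat.succPNat_injective h
  · have h1 : (m : ℕ) ≤ k := PNat.coe_le_coe _ _ |>.2 (Finset.mem_Icc.1 hm).2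
    have := m.pos
    exact ⟨m - 1, Finset.mem_range.2 (by omega), PNat.eq (by simp [Nat.sub_add_cancel m.pos])⟩

theorem slotLimit_pair (γ : Multiset ℕ+ → ℝ) (n : ℕ) (x : ℕ → MvPolynomial ℕ+ ℝ) :
    slotLimit γ n {0, 1} x = ∑ a ∈ Finset.Icc 1 n.succPNat, ∑ b ∈ Finset.Icc 1 n.succPNat,
      evalMean γ (MvPolynomial.pderiv a (x 1)) * evalMean γ (MvPolynomial.pderiv b (x 0)) * γ {a, b} := by
  have h0 : (0 : ℕ) ∈ ({0, 1} : Finset ℕ) := by simp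
  have h1 : (1 : ℕ) ∈ ({0, 1} : Finset ℕ) := by simp
  have hu : (Finset.univ : Finset ({0, 1} : Finset ℕ)) = {⟨1, h1⟩, ⟨0, h0⟩} := by
    decide +revert
  have hv (m : ({0, 1} : Finset ℕ) → ℕ+) :
      (Finset.univ : Finset ({0, 1} : Finset ℕ)).val.map m = {m ⟨1, h1⟩, m ⟨0, h0⟩} := by
    rw [hu]
    rfl
  rw [slotLimit, if_neg (by decide), ← Finset.sum_product']
  refine Finset.sum_bij' (fun m _ => (m ⟨1, h1⟩, m ⟨0, h0⟩))
    (fun ab _ j => if (j : ℕ) = 1 then ab.1 else ab.2) ?_ ?_ ?_ ?_ ?_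
  · intro m hm
    exact Finset.mem_product.2 ⟨Fintype.mem_piFinset.1 hm _, Fintype.mem_piFinset.1 hm _⟩
  · intro ab hab
    rw [Fintype.mem_piFinset]
    intro j
    rw [Finset.mem_product] at hab
    split_ifs
    exacts [hab.1, hab.2]
  · intro m _
    funext ⟨j, hj⟩
    simp only [Finset.mem_insert, Finset.mem_singleton] at hj
    rcases hj with rfl | rfl <;> simp
  · intro ab _
    simp
  · intro m _
    rw [hv, hu, Finset.prod_pair (by simp)]

/-- The gradient terms give the d-part, since ∂/∂β_a of a limiting mean is a[z^{-a}] of a power of f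
up to factorials. The universal part gives ∑_a a [z^{-a}]f^k [w^a]f^m, the geometric square. Index 1
carries k because the second index is the differentiated one in `evalEps_univPart_pair`. -/
theorem factorial_mul_binomLimit_pair (γ : Multiset ℕ+ → ℝ) (k m : ℕ+) (κ : ℕ → ℕ) (h0 : κ 0 = m)
    (h1 : κ 1 = k) {n : ℕ} (hk : (k : ℕ) ≤ n) (hm : (m : ℕ) ≤ n) :
    ((k : ℕ).factorial : ℝ) * ((m : ℕ).factorial : ℝ) * binomLimit γ n κ {0, 1} =
      limitCov (fun m => (m : ℕ).factorial * γ {m})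
        (fun k m => (k : ℕ).factorial * (m : ℕ).factorial * γ {k, m}) k m := by
  obtain ⟨S, hS, hkS⟩ := ((evalEps_univPart_pair κ zero_lt_one).and
    (eventually_ge_atTop (Finset.Icc 1 k))).exists
  have hIcc : ∀ l : ℕ+, (l : ℕ) ≤ n → Finset.Icc 1 l ≤ Finset.Icc 1 n.succPNat := fun l hl =>
    Finset.Icc_subset_Icc_right (PNat.coe_le_coe _ _ |>.1 (hl.trans (Nat.le_succ n)))
  have hP := factorial_mul_evalMean_pderiv γ
  have hz : ∀ l a : ℕ+, l < a → evalMean γ (MvPolynomial.pderiv a (limitPart l)) = 0 := fun l a hla => by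
    have := hP l a
    rw [if_pos hla] at this
    exact (mul_eq_zero.1 this).resolve_left (Nat.cast_ne_zero.2 (Nat.factorial_ne_zero _))
  have hP' : ∀ (l : ℕ+) (a : ℕ), a ∈ Finset.range l → ((l : ℕ).factorial : ℝ) *
      evalMean γ (MvPolynomial.pderiv a.succPNat (limitPart l)) =
        (a + 1 : ℝ) * genCoeff (fun m => (m : ℕ).factorial * γ {m}) l l (l - 1 - a) := fun l a ha => by
    have hlt : ¬ l < a.succPNat := fun h => by
      have := PNat.coe_lt_coe _ _ |>.2 h
      rw [Nat.succPNat_coe] at this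
      have := Finset.mem_range.1 ha
      omega
    rw [hP, if_neg hlt, Nat.succPNat_coe, Nat.sub_sub, Nat.add_comm 1 a]
    push_cast
    rfl
  rw [binomLimit, if_pos (by decide), slotLimit_pair, hS, h0, h1, map_sum, limitCov_eq,
    sum_eq_sum_range k _ (hIcc k hk) _ (fun a ha => by simp [hz k a ha]),
    sum_eq_sum_range k S hkS _ (fun a ha => by rw [map_mul, hz k a ha, zero_mul]), ← Finset.sum_add_distrib,
    Finset.mul_sum]
  refine Finset.sum_congr rfl fun a ha => ?_
  have h3 := evalMean_phiPow γ m m (a.succPNat : ℕ)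
  rw [if_neg (by omega), show (((a.succPNat : ℕ) : ℤ) + (m : ℕ)).toNat = a + 1 + m by
    rw [Nat.succPNat_coe]; omega] at h3
  rw [sum_eq_sum_range m _ (hIcc m hm) _ (fun b hb => by simp [hz m b hb]), map_mul, mul_add, add_comm, mul_add]
  congr 1
  · rw [← h3]
    linear_combination ((m : ℕ).factorial : ℝ) *
      evalMean γ ((phiPow m m).coeff (a.succPNat : ℕ)) * hP' k a ha
  · rw [Finset.mul_sum, Finset.mul_sum]
    refine Finset.sum_congr rfl fun b hb => ?_
    have ha0 := Nat.cast_ne_zero (R := ℝ) |>.2 (Nat.factorial_ne_zero a)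
    have hb0 := Nat.cast_ne_zero (R := ℝ) |>.2 (Nat.factorial_ne_zero b)
    have e : ((a.succPNat : ℕ).factorial * (b.succPNat : ℕ).factorial * γ {a.succPNat, b.succPNat} : ℝ) /
        (a.factorial * b.factorial) = (a + 1) * (b + 1) * γ {a.succPNat, b.succPNat} := by
      rw [Nat.succPNat_coe, Nat.succPNat_coe, Nat.succ_eq_add_one, Nat.succ_eq_add_one,
        Nat.factorial_succ, Nat.factorial_succ]
      push_cast
      field_simp
    rw [e]
    linear_combination ((m : ℕ).factorial : ℝ) * evalMean γ (MvPolynomial.pderiv b.succPNat (limitPart m)) *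
      γ {a.succPNat, b.succPNat} * hP' k a ha + (a + 1 : ℝ) *
        genCoeff (fun m => (m : ℕ).factorial * γ {m}) k k (k - 1 - a) * γ {a.succPNat, b.succPNat} * hP' m b hb

variable {ρ : (N : ℕ) → PMF (GT N)}

/-- Limits are unique, so the given constants may be replaced by the ones computed from γ. -/
theorem VarCLT.limits_eq (hρ : ∀ N, IsSmooth (ρ N)) {γ : Multiset ℕ+ → ℝ}
    (h : VarCLT (fun N => measFunctional (ρ N)) γ) {p : ℕ+ → ℝ} {cov : ℕ+ → ℕ+ → ℝ} {c : ℕ+ → ℝ}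
    {d : ℕ+ → ℕ+ → ℝ} (h1 : SatisfiesCLTWith ρ p cov) (h2 : CLTAppropriateWith ρ c d) :
    (∀ k, p k = limitMean c k) ∧ ∀ k m, cov k m = limitCov c d k m := by
  obtain ⟨rfl, rfl⟩ := h1.unique (h.satisfiesCLTWith hρ)
  obtain ⟨rfl, rfl⟩ := h2.unique (h.cltAppropriateWith hρ)
  refine ⟨fun k => ?_, fun k m => ?_⟩
  · have e := h.multLimit_map hρ (fun _ => k) (Finset.singleton_nonempty 0)
    rw [Finset.singleton_val, Multiset.map_singleton, binomLimit, slotLimit_singleton,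
      if_neg (by decide), add_zero] at e
    beta_reduce
    rw [e, factorial_mul_evalMean_limitPart]
  · have e := h.multLimit_map hρ (fun j => if j = 0 then m else k) (J := {0, 1}) (by simp)
    have e' : ({0, 1} : Finset ℕ).val.map (fun j => if j = 0 then m else k) = {k, m} := by
      rw [Multiset.pair_comm]
      rfl
    rw [e'] at e
    beta_reduce
    rw [e, factorial_mul_binomLimit_pair γ k m _ (by simp) (by simp) (by simp) (by simp)]

end Main

theorem theorem2p4 :
    (∀ ρ : (N : ℕ) → PMF (GT N), (∀ N, IsSmooth (ρ N)) →
      (SatisfiesCLT ρ ↔ CLTAppropriate ρ) ∧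
      ∀ (p : ℕ+ → ℝ) (cov : ℕ+ → ℕ+ → ℝ) (c : ℕ+ → ℝ) (d : ℕ+ → ℕ+ → ℝ),
        SatisfiesCLTWith ρ p cov → CLTAppropriateWith ρ c d →
          (∀ k, p k = limitMean c k) ∧ (∀ k m, cov k m = limitCov c d k m)) ∧
    (∀ k : ℕ+, ∃ P : MvPolynomial ℕ+ ℚ, ∀ c : ℕ+ → ℝ,
      limitMean c k = MvPolynomial.aeval c P) ∧
    (∀ k m : ℕ+, ∃ Q : MvPolynomial (ℕ+ ⊕ ℕ+ × ℕ+) ℚ, ∀ (c : ℕ+ → ℝ) (d : ℕ+ → ℕ+ → ℝ),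
      limitCov c d k m = MvPolynomial.aeval (Sum.elim c fun ab => d ab.1 ab.2) Q) := by
  refine ⟨fun ρ hρ => ⟨satisfiesCLT_iff_cltAppropriate hρ, fun p cov c d h1 h2 =>
    (h2.varCLT hρ).limits_eq hρ h1 h2⟩, exists_limitMean_polynomial, exists_limitCov_polynomial⟩
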